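/- **Setting.** Let $R=\mathbb{C}[u_1,\dots,u_m\,|\,\upsilon_1,\dots,\upsilon_n]$ be a free supercommutative algebra with even generators $u_i$ and odd generators $\upsilon_i$, with even part $R^0$ and odd part $R^1$. Let $A$ consist of even linear coordinates $x^k$ ($k\ge 1$) and odd linear coordinates $\theta^k$ ($k\ge 0$) on a free $R$-supermodule $V$. Let $\mathcal{D}$ be the completed super Weyl algebra of operators $\sum_{r\le M}\sum_{a_1,\dots,a_r}p^{a_1,\dots,a_r}(A)\,\partial_{a_1}\cdots\partial_{a_r}$ (possibly infinite sums over $a_1,\dots,a_r$, with $p^{a_1,\dots,a_r}$ polynomials over $R$), let $F_d\mathcal{D}$ be the operators of degree $\le d$, where all coordinates and derivatives have degree one, and let $\widehat{\mathcal{D}}^\hbar=\prod_{d\ge0}\hbar^dF_d\mathcal{D}$. All brackets are supercommutators. A family of elements $H_j=\sum_d\hbar^d\sum p_{j,d}^{a_1,\dots,a_r}(A)\partial_{a_1}\cdots\partial_{a_r}$ is *bounded* if for all $d,a_1,\dots,a_r$ only finitely many $p_{j,d}^{a_1,\dots,a_r}$ are non-zero; the left ideal it generates is the set of all, possibly infinite,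 sums $\sum_j c_jH_j$ with $c_j\in\widehat{\mathcal{D}}^\hbar$. A *super Airy structure* on $V$, with respect to a system $A'$ of linear coordinates of $V$ and an odd coordinate $\hat\theta\in A'$, is a left ideal $\mathcal{I}\subseteq\widehat{\mathcal{D}}^\hbar$ generated by a bounded family of elements $H_j$, $j\in A'\setminus\{\hat\theta\}$, homogeneous in parity, with $H_j=\hbar\partial_j+\hbar p_j(A')+O(\hbar^2)$, where $p_j$ is a polynomial of degree $\leq 1$ and $\partial_j$ is the partial derivative in the system $A'$, and such that $[\mathcal{I},\mathcal{I}]\subseteq\hbar^2\mathcal{I}$. **Modes.** Set $J_k=\hbar\partial_{x^k}$ for $k>0$, $J_0=0$, $J_{k}=-k\hbar x^{-k}$ for $k<0$; $\Gamma_k=\hbar\partial_{\theta^k}$ for $k>0$, $\Gamma_0=\hbar(\tfrac12\theta^0+\partial_{\theta^0})$, $\Gamma_k=\hbar\theta^{-k}$ for $k<0$; ${:}XY{:}=XY-(XY\cdot1)|_{A=0}$; and, for $q\in\mathbb{Z}$, $$L_{2q}=\tfrac12\sum_{j\in\mathbb{Z}}(-1)^{j-1}{:}J_{-j}J_{2q+j}{:}+\tfrac12\sum_{j\in\mathbb{Z}}(-1)^j(j+q){:}\Gamma_{-j}\Gamma_{2q+j}{:}+\tfrac{\hbar^2}{4}\delta_{q,0},\qquad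 G_{2q+1}=\sum_{j\in\mathbb{Z}}(-1)^{j-1}J_{-j}\Gamma_{2q+1+j}.$$ **Data.** Let $t_k\in R^0$, $\tau_k\in R^1$ ($k\in\mathbb{Z}$) vanish for $k\ll0$, with $t_0=0$, and let $B_{kl},V_{kl}\in R^0$, $\phi_{kl}\in R^1$ ($k,l\ge0$) satisfy $B_{k0}=B_{0k}=\phi_{0k}=V_{00}=0$, $B_{kl}=B_{lk}$, $V_{kl}=-V_{lk}$. Put $$T=\exp\Big(\hbar^{-2}\sum_{k}\big(J_k\tfrac{t_k}{k}-\Gamma_k\tau_k\big)\Big),\qquad \Phi=\exp\Big(\tfrac{1}{2\hbar^2}\sum_{k,l\ge0}\big(\tfrac{J_kJ_l}{kl}B_{kl}-2\tfrac{J_k\Gamma_l}{k}\phi_{kl}+\Gamma_k\Gamma_lV_{kl}\big)\Big),$$ where the terms divided by a zero index are read as $0$, and where conjugation by $\exp X$ means $\sum_{r\ge0}\frac1{r!}\mathrm{ad}_X^r$. On the formal punctured super disc with Ramond coordinates $\mathbf{z}=(z\,|\,\theta)$ let $D_\theta^*=\partial_\theta+\theta z\partial_z$, $\sigma(z\,|\,\theta)=(-z\,|-\theta)$,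 $[dz]=[d\theta]\theta z$, and $$\omega_{0,1}(\mathbf{z})=\sum_{k\in\mathbb{Z}}\big([dz]\,t_kz^{k-1}+[d\theta]\,\tau_kz^k\big).$$ For a symmetric bidifferential $\omega=[d\theta_1][d\theta_2]\,g(\mathbf{z}_1,\mathbf{z}_2)$ let $$\mathcal{C}^\sigma(\omega)(\mathbf{z})=\tfrac12[d\theta]^3\Big(D^*_{\theta_1}g\big|_{\mathbf{z}_1=\mathbf{z},\,\mathbf{z}_2=\sigma(\mathbf{z})}-D^*_{\theta_1}g\big|_{\mathbf{z}_1=\sigma(\mathbf{z}),\,\mathbf{z}_2=\mathbf{z}}\Big).$$ **Proposition.** Let $s=\min\{k\in\mathbb{Z}\mid k\text{ odd and }t_k\text{ invertible in }R\}$ (assumed to exist) and assume $s\in\{1,3\}$. Assume that $$\omega_{0,1}(\mathbf{z})+\omega_{0,1}(\sigma(\mathbf{z}))=[d\theta]\,\mathcal{O}(z)\qquad\text{and}\qquad\mathcal{C}^\sigma(\omega_{0,1}\boxtimes\omega_{0,1})(\mathbf{z})=[d\theta]^3\,\mathcal{O}(z^s).$$ Then the collection $$\big\{J_{2j},\ \Gamma_{2j-1},\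 \Phi TL_{2j-s-1}T^{-1}\Phi^{-1},\ \Phi TG_{2j-s}T^{-1}\Phi^{-1}\ \big|\ j\ge1\big\}$$ is bounded and generates a super Airy structure on $V$ for a suitable choice of the distinguished odd coordinate. More precisely, there are finitely many nilpotent $c_a\in R$, indexed by coordinates $a\in A\setminus\{\theta^0\}$ and of parity opposite to that of $a$, such that the left ideal it generates is a super Airy structure on $V$ with respect to the linear coordinates $\{x^k,\theta^k\}_{k\ge1}\cup\{\hat\theta^0\}$ and $\hat\theta^0$, where $\hat\theta^0=\theta^0-\sum_{a}c_a\,a$. -/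

import Mathlib

open scoped TensorProduct

noncomputable section

namespace SuperAiry

/-! ### Supercommutative polynomial algebras -/

/-- The free supercommutative `ℂ`-algebra on even generators `E` and odd generators `O`:
polynomials in the even generators tensor the exterior algebra on the odd ones. -/
def SuperPoly (E O : Type) : Type :=
  MvPolynomial E ℂ ⊗[ℂ] ExteriorAlgebra ℂ (O →₀ ℂ)

instance (E O : Type) : Ring (SuperPoly E O) :=
  inferInstanceAs (Ring (MvPolynomial E ℂ ⊗[ℂ] ExteriorAlgebra ℂ (O →₀ ℂ)))

instance (E O : Type) : Algebra ℂ (SuperPoly E O) :=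
  inferInstanceAs (Algebra ℂ (MvPolynomial E ℂ ⊗[ℂ] ExteriorAlgebra ℂ (O →₀ ℂ)))

/-- The algebra map induced by a map on the polynomial factor and a map on the exterior
factor. -/
def SuperPoly.map {E O E' O' : Type} (f : MvPolynomial E ℂ →ₐ[ℂ] MvPolynomial E' ℂ)
    (g : ExteriorAlgebra ℂ (O →₀ ℂ) →ₐ[ℂ] ExteriorAlgebra ℂ (O' →₀ ℂ)) :
    SuperPoly E O →ₐ[ℂ] SuperPoly E' O' :=
  Algebra.TensorProduct.map f g

/-- A linear map of the polynomial factor, as an operator. -/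
def SuperPoly.evenOp {E O : Type} (D : MvPolynomial E ℂ →ₗ[ℂ] MvPolynomial E ℂ) :
    SuperPoly E O →ₗ[ℂ] SuperPoly E O :=
  LinearMap.rTensor (ExteriorAlgebra ℂ (O →₀ ℂ)) D

/-- A linear map of the exterior factor, as an operator. -/
def SuperPoly.oddOp {E O : Type}
    (D : ExteriorAlgebra ℂ (O →₀ ℂ) →ₗ[ℂ] ExteriorAlgebra ℂ (O →₀ ℂ)) :
    SuperPoly E O →ₗ[ℂ] SuperPoly E O :=
  LinearMap.lTensor (MvPolynomial E ℂ) D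

/-- The even generator with label `e`. -/
def evenGen {E O : Type} (e : E) : SuperPoly E O :=
  (MvPolynomial.X e ⊗ₜ[ℂ] 1 : MvPolynomial E ℂ ⊗[ℂ] ExteriorAlgebra ℂ (O →₀ ℂ))

/-- The odd generator with label `o`. -/
def oddGen {E O : Type} (o : O) : SuperPoly E O :=
  (1 ⊗ₜ[ℂ] ExteriorAlgebra.ι ℂ (Finsupp.single o 1) :
    MvPolynomial E ℂ ⊗[ℂ] ExteriorAlgebra ℂ (O →₀ ℂ))

/-- The parity involution: `+1` on even elements, `-1` on odd elements. -/
def parity {E O : Type} : SuperPoly E O →ₐ[ℂ] SuperPoly E O :=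
  SuperPoly.map (AlgHom.id ℂ _) CliffordAlgebra.involute

/-- `p` lies in the even part. -/
def IsEven {E O : Type} (p : SuperPoly E O) : Prop := parity p = p

/-- `p` lies in the odd part. -/
def IsOdd {E O : Type} (p : SuperPoly E O) : Prop := parity p = -p

/-- The base ring `R = ℂ[u₁, …, u_m | υ₁, …, υ_n]`. -/
abbrev Base (m n : ℕ) : Type := SuperPoly (Fin m) (Fin n)

/-- The index set `A` of the linear coordinates: `Sum.inl k` labels the even coordinate
`x^k` (`k ≥ 1`), `Sum.inr k` labels the odd coordinate `θ^k` (`k ≥ 0`). -/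
abbrev Idx : Type := ℕ+ ⊕ ℕ

/-- The label of the distinguished odd coordinate `θ⁰`. -/
def theta0 : Idx := Sum.inr 0

/-- The polynomial superalgebra `R[A]`, with `R = Base m n`. -/
abbrev Pol (m n : ℕ) : Type := SuperPoly (Fin m ⊕ ℕ+) (Fin n ⊕ ℕ)

variable {m n : ℕ}

/-- The inclusion `R → R[A]`. -/
def ofBase : Base m n →ₐ[ℂ] Pol m n :=
  SuperPoly.map (MvPolynomial.rename Sum.inl)
    (ExteriorAlgebra.map (Finsupp.lmapDomain ℂ ℂ Sum.inl))

/-- Evaluation at `A = 0` (all `x^k` and `θ^k` are sent to `0`), with values in `R ⊆ R[A]`. -/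
def evalZero : Pol m n →ₐ[ℂ] Pol m n :=
  SuperPoly.map
    (MvPolynomial.aeval (Sum.elim (fun i => MvPolynomial.X (Sum.inl i)) (fun _ => 0)))
    (ExteriorAlgebra.map (Finsupp.linearCombination ℂ
      (Sum.elim (fun i => Finsupp.single (Sum.inl i) 1) (fun _ => 0))))

/-- The linear coordinates `x^k`, `θ^k`, as elements of `R[A]`. -/
def coord : Idx → Pol m n
  | Sum.inl k => evenGen (Sum.inr k)
  | Sum.inr k => oddGen (Sum.inr k)

/-- The polynomials of degree at most `d` in the coordinates `A`, with coefficients in `R`. -/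
def degLE (d : ℕ) : Submodule ℂ (Pol m n) :=
  Submodule.span ℂ {q | ∃ (r : Base m n) (a : List Idx), a.length ≤ d ∧
    q = ofBase r * (a.map coord).prod}

/-! ### Operators, the completed Weyl algebra and its Rees algebra -/

/-- All `ℂ`-linear operators on `R[A]`. -/
abbrev Op (m n : ℕ) : Type := Module.End ℂ (Pol m n)

/-- The partial derivatives, acting from the left: `∂/∂x^k` is the derivative of the
polynomial factor, `∂/∂θ^k` is the contraction of the exterior factor. -/
def pd : Idx → Op m n
  | Sum.inl k => SuperPoly.evenOp (MvPolynomial.pderiv (R := ℂ) (Sum.inr k)).toLinearMap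
  | Sum.inr k => SuperPoly.oddOp
      (CliffordAlgebra.contractLeft (Q := (0 : QuadraticForm ℂ ((Fin n ⊕ ℕ) →₀ ℂ)))
        (Finsupp.lapply (Sum.inr k)))

/-- The parity-conjugate of an operator: `D` if `D` is even and `-D` if `D` is odd. -/
def parityOp : Op m n →ₗ[ℂ] Op m n :=
  (LinearMap.mulLeft ℂ (parity.toLinearMap : Op m n)).comp
    (LinearMap.mulRight ℂ (parity.toLinearMap : Op m n))

/-- `D = ∑ p^{a₁,…,aᵣ}(A) ∂_{a₁} ⋯ ∂_{aᵣ}`, a possibly infinite sum over tuples of length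
`r ≤ d`, with `p^{a₁,…,aᵣ}` a polynomial of degree at most `d - r`. Here `δ a` stands for
`∂_a`. On a given polynomial only finitely many terms of the sum are nonzero. -/
def IsExpansion (δ : Idx → Op m n) (d : ℕ) (p : List Idx → Pol m n) (D : Op m n) : Prop :=
  (∀ a, d < a.length → p a = 0) ∧ (∀ a, p a ∈ degLE (d - a.length)) ∧
    ∀ f, D f = ∑ᶠ a : List Idx, p a * (a.map δ).prod f

/-- The step `F_d` of the degree filtration of the completed super Weyl algebra, all the
generators having degree one. -/
def weylFiltration (m n d : ℕ) : Set (Op m n) := {D | ∃ p, IsExpansion pd d p D}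

/-- Formal Laurent series in `ħ` with coefficients in the operators on `R[A]`. -/
abbrev HOp (m n : ℕ) : Type := LaurentSeries (Op m n)

/-- The power `ħ^k`, for `k ∈ ℤ`. -/
def hbar (k : ℤ) : HOp m n := HahnSeries.single k 1

/-- An operator, as a series in `ħ` that is constant in `ħ`. -/
def ofOp (D : Op m n) : HOp m n := HahnSeries.single 0 D

/-- The operator of left multiplication by a polynomial. -/
def mulOp (p : Pol m n) : Op m n := LinearMap.mulLeft ℂ p

/-- An element of `R`, as a multiplication operator. -/
def scalar (r : Base m n) : HOp m n := ofOp (mulOp (ofBase r))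

/-- The completed super Rees Weyl algebra `∏_{d ≥ 0} ħ^d F_d`. -/
def reesWeyl (m n : ℕ) : Set (HOp m n) :=
  {S | (∀ k < 0, S.coeff k = 0) ∧ ∀ d : ℕ, S.coeff (d : ℤ) ∈ weylFiltration m n d}

/-- `S` is the (possibly infinite) sum of the family `T`: at each order in `ħ` and on each
polynomial only finitely many members are nonzero, and they add up to `S`. -/
def IsSum {ι : Type} (T : ι → HOp m n) (S : HOp m n) : Prop :=
  ∀ (k : ℤ) (f : Pol m n), (Function.support fun i => (T i).coeff k f).Finite ∧
    S.coeff k f = ∑ᶠ i, (T i).coeff k f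

open Classical in
/-- The sum of a family of operators in the sense of `IsSum`. -/
def opSum {ι : Type} (T : ι → HOp m n) : HOp m n :=
  if h : ∃ S, IsSum T S then h.choose else 0

/-- The parity-conjugate of a series of operators. -/
def parityH (S : HOp m n) : HOp m n := HahnSeries.map S (parityOp (m := m) (n := n))

/-- `S` is homogeneous with respect to parity. -/
def IsHomogeneous (S : HOp m n) : Prop := parityH S = S ∨ parityH S = -S

/-- The supercommutator: on homogeneous elements it is `X * Y - (-1)^(|X||Y|) Y * X`. -/
def superComm (X Y : HOp m n) : HOp m n :=
  X * Y - Y * ((1 / 2 : ℂ) • (X + parityH X)) - parityH Y * ((1 / 2 : ℂ) • (X - parityH X))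

/-! ### Super Airy structures -/

/-- A family `H` of elements of the completed Rees Weyl algebra is bounded: in
`H_j = ∑_d ħ^d ∑ p_{j,d}^{a₁,…,aᵣ}(A) ∂_{a₁} ⋯ ∂_{aᵣ}`, for each `d` and `a₁, …, aᵣ` only
finitely many of the polynomials `p_{j,d}^{a₁,…,aᵣ}` are nonzero. -/
def IsBounded {ι : Type} (δ : Idx → Op m n) (H : ι → HOp m n) : Prop :=
  (∀ j, ∀ k < 0, (H j).coeff k = 0) ∧
    ∃ p : ι → ℕ → List Idx → Pol m n,
      (∀ j (d : ℕ), IsExpansion δ d (p j d) ((H j).coeff (d : ℤ))) ∧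
      ∀ d a, {j | p j d a ≠ 0}.Finite

/-- The set of all sums `∑ c_j H_j`, possibly infinite, with `c_j` in the completed
Rees Weyl algebra. -/
def leftSpan {ι : Type} (H : ι → HOp m n) : Set (HOp m n) :=
  {S | ∃ c : ι → HOp m n, (∀ j, c j ∈ reesWeyl m n) ∧ IsSum (fun j => c j * H j) S}

/-- `I` is a super Airy structure on `(V, θ⁰)`, for a system of linear coordinates on `V`
that is labelled by `A` and has partial derivatives `δ`, and where `θ⁰` is the coordinate
with label `a₀`. -/
structure IsSuperAiryStructure (δ : Idx → Op m n) (a₀ : Idx) (I : Set (HOp m n)) : Prop where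
  subset : I ⊆ reesWeyl m n
  zero_mem : (0 : HOp m n) ∈ I
  sum_mem : ∀ X ∈ I, ∀ Y ∈ I, X + Y ∈ I
  mul_mem : ∀ c ∈ reesWeyl m n, ∀ X ∈ I, c * X ∈ I
  exists_generators : ∃ H : {j : Idx // j ≠ a₀} → HOp m n,
    (∀ j, IsHomogeneous (H j)) ∧
    IsBounded δ H ∧
    I = leftSpan H ∧
    ∀ j, (H j).coeff 0 = 0 ∧ ∃ p ∈ degLE (m := m) (n := n) 1, (H j).coeff 1 = δ j + mulOp p
  comm_mem : ∀ X ∈ I, ∀ Y ∈ I, ∃ Z ∈ I, superComm X Y = hbar 2 * Z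

/-- The partial derivatives of the linear coordinates `x^k` (`k ≥ 1`), `θ^k` (`k ≥ 1`) and
`θ⁰ - ∑ c_a x^a`, the sum over all labels `a ≠ θ⁰`: they are `∂_a + c_a ∂_{θ⁰}` for `a ≠ θ⁰`,
and `∂_{θ⁰}`. It is used for finitely supported `c` with `c_a` of the parity opposite to
that of `x^a`. -/
def shiftedPd (c : Idx →₀ Base m n) (a : Idx) : Op m n :=
  if a = theta0 then pd theta0 else pd a + mulOp (ofBase (c a)) * pd theta0

/-! ### Heisenberg, Clifford and super Virasoro modes -/

/-- The Heisenberg mode `J_k`. -/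
def J (k : ℤ) : HOp m n :=
  if 0 < k then hbar 1 * ofOp (pd (Sum.inl k.toNat.toPNat'))
  else if k = 0 then 0
  else hbar 1 * ofOp ((-k : ℂ) • mulOp (coord (Sum.inl (-k).toNat.toPNat')))

/-- The Clifford mode `Γ_k`. -/
def Gam (k : ℤ) : HOp m n :=
  if 0 < k then hbar 1 * ofOp (pd (Sum.inr k.toNat))
  else if k = 0 then hbar 1 * ofOp ((1 / 2 : ℂ) • mulOp (coord theta0) + pd theta0)
  else hbar 1 * ofOp (mulOp (coord (Sum.inr (-k).toNat)))

/-- The vacuum expectation value `⟨0| D |0⟩ = (D 1)(0)`, as a multiplication operator. -/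
def vacuumOp : Op m n →ₗ[ℂ] Op m n :=
  (LinearMap.mul ℂ (Pol m n)).comp (evalZero.toLinearMap.comp (LinearMap.applyₗ 1))

/-- The normal ordering of a product of two modes, `:XY: = XY - ⟨0| XY |0⟩`. -/
def normOrd (X Y : HOp m n) : HOp m n :=
  X * Y - HahnSeries.map (X * Y) (vacuumOp (m := m) (n := n))

/-- The operator `L_k`; it is used for even `k`. -/
def Lvir (k : ℤ) : HOp m n :=
  (1 / 2 : ℂ) • opSum (fun j : ℤ => (-1 : ℂ) ^ (j - 1) • normOrd (J (-j)) (J (k + j)))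
  + (1 / 2 : ℂ) • opSum (fun j : ℤ =>
      ((-1 : ℂ) ^ j * ((j : ℂ) + (k : ℂ) / 2)) • normOrd (Gam (-j)) (Gam (k + j)))
  + if k = 0 then (1 / 4 : ℂ) • hbar 2 else 0

/-- The operator `G_k`; it is used for odd `k`. -/
def Gvir (k : ℤ) : HOp m n :=
  opSum (fun j : ℤ => (-1 : ℂ) ^ (j - 1) • (J (-j) * Gam (k + j)))

/-! ### Dilaton shift and change of polarisation -/

/-- The logarithm of the dilaton shift `T`. -/
def logT (t τ : ℤ → Base m n) : HOp m n :=
  hbar (-2) * opSum (fun k : ℤ =>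
    ((k : ℂ)⁻¹) • (J k * scalar (t k)) - Gam k * scalar (τ k))

/-- The logarithm of the change of polarisation `Φ`. -/
def logPhi (B V φ : ℕ → ℕ → Base m n) : HOp m n :=
  (1 / 2 : ℂ) • (hbar (-2) * opSum (fun kl : ℕ × ℕ =>
    (((kl.1 : ℂ) * (kl.2 : ℂ))⁻¹) • (J kl.1 * J kl.2 * scalar (B kl.1 kl.2))
    - (2 * (kl.1 : ℂ)⁻¹) • (J kl.1 * Gam kl.2 * scalar (φ kl.1 kl.2))
    + Gam kl.1 * Gam kl.2 * scalar (V kl.1 kl.2)))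

/-- The conjugate `exp(X) Y exp(-X) = ∑ (1/r!) (ad X)^r Y`, for even `X`. -/
def expConj (X Y : HOp m n) : HOp m n :=
  opSum (fun r : ℕ => ((r.factorial : ℂ)⁻¹) • (fun Z => X * Z - Z * X)^[r] Y)

/-- The collection `J_{2j}`, `Γ_{2j-1}`, `Φ T L_{2j-s-1} T⁻¹ Φ⁻¹`, `Φ T G_{2j-s} T⁻¹ Φ⁻¹`,
for `j ≥ 1`. -/
def generators (t τ : ℤ → Base m n) (B V φ : ℕ → ℕ → Base m n) (s : ℤ) :
    Fin 4 × ℕ+ → HOp m n := fun i =>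
  ![J (2 * (i.2 : ℤ)),
    Gam (2 * (i.2 : ℤ) - 1),
    expConj (logPhi B V φ) (expConj (logT t τ) (Lvir (2 * (i.2 : ℤ) - s - 1))),
    expConj (logPhi B V φ) (expConj (logT t τ) (Gvir (2 * (i.2 : ℤ) - s)))] i.1

/-! ### Differentials on the formal punctured super disc, in Ramond coordinates `(z | θ)` -/

/-- The expression `∑_k z^k c0_k + θ ∑_k z^k c1_k` with coefficients in `R`, used as the
coefficient of `[dθ]` or of `[dθ]³`. -/
@[ext] structure DiscSection (m n : ℕ) where
  c0 : ℤ → Base m n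
  c1 : ℤ → Base m n

/-- The form `[dz] ∑_k f_k z^k`, through `[dz] = [dθ] θ z`. -/
def dzForm (f : ℤ → Base m n) : DiscSection m n := ⟨fun _ => 0, fun k => f (k - 1)⟩

/-- The form `[dθ] ∑_k f_k z^k`. -/
def dthetaForm (f : ℤ → Base m n) : DiscSection m n := ⟨f, fun _ => 0⟩

/-- Addition of sections. -/
def DiscSection.plus (ω η : DiscSection m n) : DiscSection m n :=
  ⟨fun k => ω.c0 k + η.c0 k, fun k => ω.c1 k + η.c1 k⟩

/-- `ω_{0,1} = ∑_k [dz] t_k z^{k-1} + [dθ] τ_k z^k`. -/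
def omega01 (t τ : ℤ → Base m n) : DiscSection m n :=
  (dzForm fun k => t (k + 1)).plus (dthetaForm τ)

/-- The pullback of a section `[dθ] g` along `σ : (z | θ) ↦ (-z | -θ)`; here
`[dθ] ↦ -[dθ]`. -/
def DiscSection.pullSigma (ω : DiscSection m n) : DiscSection m n :=
  ⟨fun k => -((-1 : ℂ) ^ k • ω.c0 k), fun k => -((-1 : ℂ) ^ k • -ω.c1 k)⟩

/-- The coefficient function is `O(z^r)`. -/
def DiscSection.IsBigO (ω : DiscSection m n) (r : ℤ) : Prop :=
  ∀ k < r, ω.c0 k = 0 ∧ ω.c1 k = 0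

/-- A bidifferential `[dθ₁][dθ₂] g`, with `g` equal to
`∑_{k,l} z₁^k z₂^l (g00_{kl} + θ₁ g10_{kl} + θ₂ g01_{kl} + θ₁ θ₂ g11_{kl})`. -/
structure BiSection (m n : ℕ) where
  g00 : ℤ → ℤ → Base m n
  g10 : ℤ → ℤ → Base m n
  g01 : ℤ → ℤ → Base m n
  g11 : ℤ → ℤ → Base m n

/-- `ω ⊠ η = [dθ₁][dθ₂] g(z₁ | θ₁) h(z₂ | θ₂)` for `ω = [dθ] g`, `η = [dθ] h`; elements of `R`
are moved past `θ₂` by the sign rule. -/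
def boxTimes (ω η : DiscSection m n) : BiSection m n where
  g00 k l := ω.c0 k * η.c0 l
  g10 k l := ω.c1 k * η.c0 l
  g01 k l := parity (ω.c0 k) * η.c1 l
  g11 k l := parity (ω.c1 k) * η.c1 l

/-- The action of `D*_{θ₁} = ∂_{θ₁} + θ₁ z₁ ∂_{z₁}` on the coefficient `g`. -/
def BiSection.dStar (g : BiSection m n) : BiSection m n where
  g00 k l := g.g10 k l
  g10 k l := (k : ℂ) • g.g00 k l
  g01 k l := g.g11 k l
  g11 k l := (k : ℂ) • g.g01 k l

/-- Specialisation of the coefficient `g` to `(z₁ | θ₁) = (z | θ)`, `(z₂ | θ₂) = (-z | -θ)`. -/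
def BiSection.specRight (g : BiSection m n) : DiscSection m n where
  c0 r := ∑ᶠ k : ℤ, (-1 : ℂ) ^ (r - k) • g.g00 k (r - k)
  c1 r := ∑ᶠ k : ℤ, (-1 : ℂ) ^ (r - k) • (g.g10 k (r - k) - g.g01 k (r - k))

/-- Specialisation of the coefficient `g` to `(z₁ | θ₁) = (-z | -θ)`, `(z₂ | θ₂) = (z | θ)`. -/
def BiSection.specLeft (g : BiSection m n) : DiscSection m n where
  c0 r := ∑ᶠ k : ℤ, (-1 : ℂ) ^ k • g.g00 k (r - k)
  c1 r := ∑ᶠ k : ℤ, (-1 : ℂ) ^ k • (g.g01 k (r - k) - g.g10 k (r - k))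

/-- The twisted super quadratic Casimir operator in Ramond coordinates, with values in
`[dθ]³ g`. -/
def twistedCasimir (g : BiSection m n) : DiscSection m n where
  c0 r := (1 / 2 : ℂ) • (g.dStar.specRight.c0 r - g.dStar.specLeft.c0 r)
  c1 r := (1 / 2 : ℂ) • (g.dStar.specRight.c1 r - g.dStar.specLeft.c1 r)

end SuperAiry

end

noncomputable section
namespace SuperAiry

/-! ### Supercommutative polynomial algebras: generators and parity -/

section SuperPolyBasics

variable {E O E' O' : Type}

/-! The generators come from a super Virasoro algebra. The sums `L_k` and `G_k` are first corrected
by left multiples of the modes `J_{2j}`, `Γ_{2j-1}` of positive index, which amounts to cancelling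
the part of the quadratic sums that involves these modes or their partners. The corrected operators
`mOp k` (k even) and `nOp k` (k odd) supercommute with all `J_{2j}`, `Γ_{2j-1}`. The change of
family is `1 - A`, where `A` only uses members that do not change, so its inverse is `1 + A` and the
left ideal stays the same (`IsReesFamily.of_triangular`).

Under the adjoint action `mOp k` and `nOp k` send each mode to a multiple of a mode with index
raised by `k`. Such an operator is determined by this action and by its vacuum expectation value
(`IsShift.ext`). This yields `[M_k, M_l] = (k - l) M_{k+l}`, `[M_k, N_l] = (k/2 - l) N_{k+l}`,
`[N_k, N_l] = 2 M_{k+l}` in the range that is used, where the constant `ħ²/4` in `L_0` accounts for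
the vacuum terms.

The logarithm of `T` is `ħ⁻¹ Q` with `Q` linear in the modes, so the double commutator of `Q` with a
corrected operator of index `k` is a scalar. The linear condition and antisymmetry of products of
odd elements identify this scalar, up to sign, with a multiple of the coefficient of `z^{-k}` in the
twisted Casimir; hence it vanishes for `k > -s` (`IsDilation.finsum_rowSq`). Conjugation by `T`
therefore turns `ħ² D` into `ħ² D + ħ [Q, D]`. The linear condition also says that `T` fixes the
modes of the family. The logarithm of `Φ` only contains modes of index `≥ 0`, so it is locally
nilpotent and `Φ` fixes all modes of positive index. The conjugated family `hatGen` thus closes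
under `ħ⁻²[-,-]` with constant coefficients; for `s ∈ {1, 3}` the structure constants vanish
whenever the index would leave the family (`IsAiryData.vConst_eq_zero`). The Leibniz rule extends
closure to the left ideal, where infinite sums have to be rearranged and brackets with arbitrary
coefficients have to be divided by `ħ²`. For the latter, `F_d` is described intrinsically: an
operator has degree `≤ d` iff it is linear over `R` and its `(d+1)`-fold supercommutators with
coordinates and derivatives vanish. One direction is Taylor expansion. In this form it is clear that
degrees add under products and drop by two under brackets (`mul_mem_fil`, `bracket_mem_fil`).

It remains to bring the terms of order `ħ` into normal form. The row of a corrected operator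
labelled by the parity `c` and the index `a` has derivative part `∑ t_i ∂_{a-s+i}` with `i` odd,
plus terms with coefficients `τ_i` and the effect of `Φ` on modes of index `≤ 0`. Elements `τ_i` are
odd, hence nilpotent, and so is `t_i` for odd `i < s`, by induction from the vanishing of the
Casimir at `z^{2i}`. Modulo nilpotents the matrix is thus triangular with diagonal entries `1` or
`t_s`. After normalisation it differs from the identity by a locally nilpotent map and is invertible
with finite columns (`IsUnitriangular.exists_inverse`). The inverse leads to generators `ħ(∂_a + c_a
∂_{θ⁰}) + …` with `c_a` nilpotent, and `∂_a + c_a ∂_{θ⁰}` are the derivatives dual to the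
coordinates in which `θ⁰` is replaced by `θ⁰ - ∑ c_a a`. -/

theorem SuperPoly.map_evenGen (f : MvPolynomial E ℂ →ₐ[ℂ] MvPolynomial E' ℂ)
    (g : ExteriorAlgebra ℂ (O →₀ ℂ) →ₐ[ℂ] ExteriorAlgebra ℂ (O' →₀ ℂ)) (e : E) :
    SuperPoly.map f g (evenGen e) =
      (f (MvPolynomial.X e) ⊗ₜ[ℂ] 1 : MvPolynomial E' ℂ ⊗[ℂ] ExteriorAlgebra ℂ (O' →₀ ℂ)) := by
  show Algebra.TensorProduct.map f g _ = _
  rw [evenGen, Algebra.TensorProduct.map_tmul, map_one]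

theorem SuperPoly.map_oddGen (f : MvPolynomial E ℂ →ₐ[ℂ] MvPolynomial E' ℂ)
    (g : ExteriorAlgebra ℂ (O →₀ ℂ) →ₐ[ℂ] ExteriorAlgebra ℂ (O' →₀ ℂ)) (o : O) :
    SuperPoly.map f g (oddGen o) =
      (1 ⊗ₜ[ℂ] g (ExteriorAlgebra.ι ℂ (Finsupp.single o 1)) :
        MvPolynomial E' ℂ ⊗[ℂ] ExteriorAlgebra ℂ (O' →₀ ℂ)) := by
  show Algebra.TensorProduct.map f g _ = _
  rw [oddGen, Algebra.TensorProduct.map_tmul, map_one]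

/-- The elementary tensor `p ⊗ q` as an element of `SuperPoly`. -/
def SuperPoly.tmul (p : MvPolynomial E ℂ) (q : ExteriorAlgebra ℂ (O →₀ ℂ)) : SuperPoly E O :=
  (p ⊗ₜ[ℂ] q : MvPolynomial E ℂ ⊗[ℂ] ExteriorAlgebra ℂ (O →₀ ℂ))

theorem SuperPoly.tmul_mul_tmul (p p' : MvPolynomial E ℂ) (q q' : ExteriorAlgebra ℂ (O →₀ ℂ)) :
    SuperPoly.tmul p q * SuperPoly.tmul p' q' = SuperPoly.tmul (p * p') (q * q') :=
  Algebra.TensorProduct.tmul_mul_tmul p p' q q'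

theorem SuperPoly.one_eq : (1 : SuperPoly E O) = SuperPoly.tmul 1 1 := rfl

theorem SuperPoly.induction_tmul {motive : SuperPoly E O → Prop}
    (zero : motive 0) (add : ∀ x y, motive x → motive y → motive (x + y))
    (tmul : ∀ p q, motive (SuperPoly.tmul p q)) (x : SuperPoly E O) : motive x := by
  refine TensorProduct.induction_on (R := ℂ) (M := MvPolynomial E ℂ)
    (N := ExteriorAlgebra ℂ (O →₀ ℂ)) (motive := fun z => motive z) x zero tmul add

theorem SuperPoly.tmul_add (p : MvPolynomial E ℂ) (q q' : ExteriorAlgebra ℂ (O →₀ ℂ)) :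
    SuperPoly.tmul p (q + q') = SuperPoly.tmul p q + SuperPoly.tmul p q' :=
  TensorProduct.tmul_add p q q'

theorem SuperPoly.add_tmul (p p' : MvPolynomial E ℂ) (q : ExteriorAlgebra ℂ (O →₀ ℂ)) :
    SuperPoly.tmul (p + p') q = SuperPoly.tmul p q + SuperPoly.tmul p' q :=
  TensorProduct.add_tmul p p' q

theorem SuperPoly.tmul_smul (c : ℂ) (p : MvPolynomial E ℂ) (q : ExteriorAlgebra ℂ (O →₀ ℂ)) :
    SuperPoly.tmul p (c • q) = c • SuperPoly.tmul p q :=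
  TensorProduct.tmul_smul c p q

theorem SuperPoly.smul_tmul (c : ℂ) (p : MvPolynomial E ℂ) (q : ExteriorAlgebra ℂ (O →₀ ℂ)) :
    SuperPoly.tmul (c • p) q = c • SuperPoly.tmul p q :=
  TensorProduct.smul_tmul' c p q

theorem SuperPoly.tmul_neg (p : MvPolynomial E ℂ) (q : ExteriorAlgebra ℂ (O →₀ ℂ)) :
    SuperPoly.tmul p (-q) = -SuperPoly.tmul p q :=
  TensorProduct.tmul_neg p q

theorem SuperPoly.tmul_sub (p : MvPolynomial E ℂ) (q q' : ExteriorAlgebra ℂ (O →₀ ℂ)) :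
    SuperPoly.tmul p (q - q') = SuperPoly.tmul p q - SuperPoly.tmul p q' :=
  TensorProduct.tmul_sub p q q'

theorem SuperPoly.zero_tmul (q : ExteriorAlgebra ℂ (O →₀ ℂ)) :
    SuperPoly.tmul (0 : MvPolynomial E ℂ) q = 0 :=
  TensorProduct.zero_tmul _ q

theorem SuperPoly.tmul_zero (p : MvPolynomial E ℂ) :
    SuperPoly.tmul p (0 : ExteriorAlgebra ℂ (O →₀ ℂ)) = 0 :=
  TensorProduct.tmul_zero _ p

theorem evenGen_eq (e : E) : (evenGen e : SuperPoly E O) = SuperPoly.tmul (MvPolynomial.X e) 1 :=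
  rfl

theorem oddGen_eq (o : O) : (oddGen o : SuperPoly E O) =
    SuperPoly.tmul 1 (ExteriorAlgebra.ι ℂ (Finsupp.single o 1)) :=
  rfl

theorem SuperPoly.evenOp_tmul (D : MvPolynomial E ℂ →ₗ[ℂ] MvPolynomial E ℂ)
    (p : MvPolynomial E ℂ) (q : ExteriorAlgebra ℂ (O →₀ ℂ)) :
    SuperPoly.evenOp D (SuperPoly.tmul p q) = SuperPoly.tmul (D p) q :=
  LinearMap.rTensor_tmul _ D q p

theorem SuperPoly.oddOp_tmul
    (D : ExteriorAlgebra ℂ (O →₀ ℂ) →ₗ[ℂ] ExteriorAlgebra ℂ (O →₀ ℂ))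
    (p : MvPolynomial E ℂ) (q : ExteriorAlgebra ℂ (O →₀ ℂ)) :
    SuperPoly.oddOp D (SuperPoly.tmul p q) = SuperPoly.tmul p (D q) :=
  LinearMap.lTensor_tmul _ D p q

/-- A subspace containing `1` and stable under left multiplication by the generators is
everything. -/
theorem SuperPoly.eq_top_of_gen (W : Submodule ℂ (SuperPoly E O)) (h1 : 1 ∈ W)
    (he : ∀ e, ∀ f ∈ W, evenGen e * f ∈ W) (ho : ∀ o, ∀ f ∈ W, oddGen o * f ∈ W) : W = ⊤ := by
  -- Stability propagates from the generators to `p ⊗ 1`, then to `1 ⊗ v` for vectors `v`, then to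
  -- `1 ⊗ q`; finally `p ⊗ q = (p ⊗ 1)(1 ⊗ q)`.
  have hp : ∀ p : MvPolynomial E ℂ, ∀ f ∈ W, SuperPoly.tmul p 1 * f ∈ W := by
    intro p
    induction p using MvPolynomial.induction_on with
    | C a =>
      intro f hf
      have : SuperPoly.tmul (MvPolynomial.C a : MvPolynomial E ℂ)
          (1 : ExteriorAlgebra ℂ (O →₀ ℂ)) = a • (1 : SuperPoly E O) := by
        rw [SuperPoly.one_eq, ← SuperPoly.smul_tmul, MvPolynomial.C_eq_smul_one]
      rw [this, smul_mul_assoc, one_mul]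
      exact W.smul_mem _ hf
    | add p q hp hq =>
      intro f hf
      rw [SuperPoly.add_tmul, add_mul]
      exact W.add_mem (hp f hf) (hq f hf)
    | mul_X p e hp =>
      intro f hf
      have : SuperPoly.tmul (p * MvPolynomial.X e) (1 : ExteriorAlgebra ℂ (O →₀ ℂ)) =
          SuperPoly.tmul p 1 * evenGen e := by
        rw [evenGen_eq, SuperPoly.tmul_mul_tmul, one_mul]
      rw [this, mul_assoc]
      exact hp _ (he e f hf)
  have hv : ∀ v : O →₀ ℂ, ∀ f ∈ W,
      SuperPoly.tmul (1 : MvPolynomial E ℂ) (ExteriorAlgebra.ι ℂ v) * f ∈ W := by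
    intro v
    induction v using Finsupp.induction_linear with
    | zero =>
      intro f _
      rw [map_zero, SuperPoly.tmul_zero, zero_mul]
      exact W.zero_mem
    | add u v hu hv =>
      intro f hf
      rw [map_add, SuperPoly.tmul_add, add_mul]
      exact W.add_mem (hu f hf) (hv f hf)
    | single o c =>
      intro f hf
      have : Finsupp.single o c = c • Finsupp.single o (1 : ℂ) := by simp
      rw [this, map_smul, SuperPoly.tmul_smul, smul_mul_assoc]
      exact W.smul_mem _ (ho o f hf)
  have hq : ∀ q : ExteriorAlgebra ℂ (O →₀ ℂ), ∀ f ∈ W,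
      SuperPoly.tmul (1 : MvPolynomial E ℂ) q * f ∈ W := by
    intro q
    induction q using ExteriorAlgebra.induction with
    | algebraMap r =>
      intro f hf
      rw [Algebra.algebraMap_eq_smul_one, SuperPoly.tmul_smul, ← SuperPoly.one_eq,
        smul_mul_assoc, one_mul]
      exact W.smul_mem _ hf
    | ι v => exact hv v
    | mul a b ha hb =>
      intro f hf
      have : SuperPoly.tmul (1 : MvPolynomial E ℂ) (a * b) =
          SuperPoly.tmul 1 a * SuperPoly.tmul 1 b := by
        rw [SuperPoly.tmul_mul_tmul, one_mul]
      rw [this, mul_assoc]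
      exact ha _ (hb f hf)
    | add a b ha hb =>
      intro f hf
      rw [SuperPoly.tmul_add, add_mul]
      exact W.add_mem (ha f hf) (hb f hf)
  rw [eq_top_iff]
  intro x _
  induction x using SuperPoly.induction_tmul with
  | zero => exact W.zero_mem
  | add x y hx hy => exact W.add_mem (hx trivial) (hy trivial)
  | tmul p q =>
    have : SuperPoly.tmul p q = SuperPoly.tmul p 1 * (SuperPoly.tmul 1 q * 1) := by
      rw [mul_one, SuperPoly.tmul_mul_tmul, mul_one, one_mul]
    rw [this]
    exact hp p _ (hq q 1 h1)

theorem SuperPoly.algHom_ext {B : Type*} [Semiring B] [Algebra ℂ B]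
    {f g : SuperPoly E O →ₐ[ℂ] B} (he : ∀ e, f (evenGen e) = g (evenGen e))
    (ho : ∀ o, f (oddGen o) = g (oddGen o)) : f = g := by
  have h : LinearMap.eqLocus f.toLinearMap g.toLinearMap = ⊤ := by
    refine SuperPoly.eq_top_of_gen _ ?_ ?_ ?_
    · simp [LinearMap.mem_eqLocus]
    · intro e p hp
      simp only [LinearMap.mem_eqLocus, AlgHom.toLinearMap_apply, map_mul] at hp ⊢
      rw [hp, he]
    · intro e p hp
      simp only [LinearMap.mem_eqLocus, AlgHom.toLinearMap_apply, map_mul] at hp ⊢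
      rw [hp, ho]
  ext x
  have hx : x ∈ LinearMap.eqLocus f.toLinearMap g.toLinearMap := h ▸ Submodule.mem_top
  exact hx

/-- Extensionality for maps that are not multiplicative, such as multiplications and derivatives:
the subspace where two maps agree has only to be stable under left multiplication by generators. -/
theorem SuperPoly.linearMap_ext_gen {B : Type*} [AddCommGroup B] [Module ℂ B]
    {f g : SuperPoly E O →ₗ[ℂ] B} (h1 : f 1 = g 1)
    (he : ∀ e p, f p = g p → f (evenGen e * p) = g (evenGen e * p))
    (ho : ∀ o p, f p = g p → f (oddGen o * p) = g (oddGen o * p)) : f = g := by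
  have h : LinearMap.eqLocus f g = ⊤ :=
    SuperPoly.eq_top_of_gen _ h1 (fun e p hp => he e p hp) (fun o p hp => ho o p hp)
  ext x
  have hx : x ∈ LinearMap.eqLocus f g := h ▸ Submodule.mem_top
  exact hx

@[simp] theorem parity_evenGen (e : E) : parity (evenGen e : SuperPoly E O) = evenGen e := by
  rw [parity, SuperPoly.map_evenGen]; rfl

@[simp] theorem parity_oddGen (o : O) : parity (oddGen o : SuperPoly E O) = -oddGen o := by
  rw [parity, SuperPoly.map_oddGen]
  have : CliffordAlgebra.involute (ExteriorAlgebra.ι ℂ (Finsupp.single o (1 : ℂ))) =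
    -(ExteriorAlgebra.ι ℂ (Finsupp.single o (1 : ℂ))) := CliffordAlgebra.involute_ι _
  rw [this]
  exact SuperPoly.tmul_neg _ _

@[simp] theorem parity_parity (p : SuperPoly E O) : parity (parity p) = p := by
  have h : (parity (E := E) (O := O)).comp parity = AlgHom.id ℂ _ := by
    refine SuperPoly.algHom_ext ?_ ?_ <;> intro e <;> simp
  exact DFunLike.congr_fun h p

theorem evenGen_mul_comm (e : E) (q : SuperPoly E O) : evenGen e * q = q * evenGen e := by
  induction q using SuperPoly.induction_tmul with
  | zero => simp
  | add x y hx hy => rw [mul_add, add_mul, hx, hy]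
  | tmul p q => rw [evenGen_eq, SuperPoly.tmul_mul_tmul, SuperPoly.tmul_mul_tmul, mul_comm]; simp

theorem oddGen_mul_comm (o : O) (q : SuperPoly E O) : oddGen o * q = parity q * oddGen o := by
  have h : LinearMap.mulLeft ℂ (oddGen o : SuperPoly E O) =
      (LinearMap.mulRight ℂ (oddGen o : SuperPoly E O)).comp parity.toLinearMap := by
    refine SuperPoly.linearMap_ext_gen ?_ ?_ ?_
    · simp
    · intro e p hp
      simp only [LinearMap.mulLeft_apply, LinearMap.comp_apply, AlgHom.toLinearMap_apply,
        LinearMap.mulRight_apply, map_mul, parity_evenGen] at hp ⊢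
      rw [← mul_assoc, ← evenGen_mul_comm, mul_assoc, hp, mul_assoc]
    · intro o' p hp
      simp only [LinearMap.mulLeft_apply, LinearMap.comp_apply, AlgHom.toLinearMap_apply,
        LinearMap.mulRight_apply, map_mul, parity_oddGen] at hp ⊢
      have : oddGen o * oddGen o' = -(oddGen o' * oddGen o : SuperPoly E O) := by
        rw [oddGen_eq, oddGen_eq, SuperPoly.tmul_mul_tmul, SuperPoly.tmul_mul_tmul,
          ← SuperPoly.tmul_neg]
        congr 1
        rw [eq_neg_iff_add_eq_zero]
        exact ExteriorAlgebra.ι_add_mul_swap _ _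
      rw [← mul_assoc, this, neg_mul, mul_assoc, hp]
      simp [mul_assoc]
  exact DFunLike.congr_fun h q

/-- Supercommutativity without homogeneity assumptions: the even part of `p` commutes with `q`, the
odd part passes `q` at the cost of its parity involution. As an identity of bilinear maps it can be
verified by induction on `p` along the generators. -/
theorem mul_superComm (p q : SuperPoly E O) :
    p * q = q * ((1 / 2 : ℂ) • (p + parity p)) + parity q * ((1 / 2 : ℂ) • (p - parity p)) := by
  have h : LinearMap.mul ℂ (SuperPoly E O) =
      (LinearMap.mul ℂ (SuperPoly E O)).flip.comp
        ((1 / 2 : ℂ) • (LinearMap.id + parity.toLinearMap)) +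
      ((LinearMap.mul ℂ (SuperPoly E O)).comp parity.toLinearMap).flip.comp
        ((1 / 2 : ℂ) • (LinearMap.id - parity.toLinearMap)) := by
    refine SuperPoly.linearMap_ext_gen ?_ ?_ ?_
    · ext q
      simp [← two_smul ℂ, smul_smul]
    · intro e p hp
      ext q
      have hq := DFunLike.congr_fun hp q
      simp only [LinearMap.mul_apply', LinearMap.comp_apply, AlgHom.toLinearMap_apply, map_mul,
        parity_evenGen, LinearMap.add_apply, LinearMap.smul_apply, LinearMap.flip_apply,
        LinearMap.sub_apply, LinearMap.id_apply] at hq ⊢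
      rw [mul_assoc, hq, ← mul_add, ← mul_sub]
      simp only [mul_add, mul_sub, mul_smul_comm, smul_add, smul_sub]
      simp only [← mul_assoc, evenGen_mul_comm e q, evenGen_mul_comm e (parity q)]
    · intro o p hp
      ext q
      have hq := DFunLike.congr_fun hp q
      simp only [LinearMap.mul_apply', LinearMap.comp_apply, AlgHom.toLinearMap_apply, map_mul,
        parity_oddGen, LinearMap.add_apply, LinearMap.smul_apply, LinearMap.flip_apply,
        LinearMap.sub_apply, LinearMap.id_apply] at hq ⊢
      rw [mul_assoc, hq]
      simp only [mul_add, mul_sub, mul_smul_comm, smul_add, smul_sub]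
      simp only [← mul_assoc, oddGen_mul_comm o q, oddGen_mul_comm o (parity q), parity_parity]
      simp only [mul_assoc, neg_mul, mul_neg]
      module
  exact DFunLike.congr_fun (DFunLike.congr_fun h p) q

theorem IsEven.mul_comm {p : SuperPoly E O} (hp : IsEven p) (q : SuperPoly E O) :
    p * q = q * p := by
  rw [mul_superComm p q, show parity p = p from hp, sub_self, ← two_smul ℂ p, smul_smul]
  norm_num

theorem IsOdd.mul_comm {p : SuperPoly E O} (hp : IsOdd p) (q : SuperPoly E O) :
    p * q = parity q * p := by
  rw [mul_superComm p q, show parity p = -p from hp, add_neg_cancel, sub_neg_eq_add,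
    ← two_smul ℂ p, smul_smul]
  norm_num

end SuperPolyBasics
end SuperAiry
end

noncomputable section
namespace SuperAiry

/-! ### Coordinates and partial derivatives -/

section PolBasics

variable {m n : ℕ}

theorem ofBase_evenGen (i : Fin m) :
    (ofBase (evenGen i) : Pol m n) = evenGen (Sum.inl i) := by
  rw [ofBase, SuperPoly.map_evenGen, MvPolynomial.rename_X]; rfl

theorem ofBase_oddGen (i : Fin n) :
    (ofBase (oddGen i) : Pol m n) = oddGen (Sum.inl i) := by
  rw [ofBase, SuperPoly.map_oddGen, ExteriorAlgebra.map_apply_ι, Finsupp.lmapDomain_apply,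
    Finsupp.mapDomain_single]
  rfl

theorem parity_ofBase (r : Base m n) : parity (ofBase r : Pol m n) = ofBase (parity r) := by
  have h : (parity.comp ofBase : Base m n →ₐ[ℂ] Pol m n) = ofBase.comp parity := by
    refine SuperPoly.algHom_ext ?_ ?_ <;> intro e <;> simp [ofBase_evenGen, ofBase_oddGen]
  exact DFunLike.congr_fun h r

/-- The operator `D` conjugated by the parity involution if `b` is true, else `D`. -/
def twist (b : Bool) : Op m n →ₗ[ℂ] Op m n := if b then parityOp else LinearMap.id

/-- The parity involution applied if `b` is true. -/
def twistPol (b : Bool) : Pol m n →ₐ[ℂ] Pol m n := if b then parity else AlgHom.id ℂ _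

/-- The parity of a coordinate, `true` for odd coordinates. -/
def par (a : Idx) : Bool := a.isRight

@[simp] theorem par_inl (k : ℕ+) : par (Sum.inl k) = false := rfl
@[simp] theorem par_inr (k : ℕ) : par (Sum.inr k) = true := rfl
@[simp] theorem twistPol_true : (twistPol true : Pol m n →ₐ[ℂ] Pol m n) = parity := rfl
@[simp] theorem twistPol_false : (twistPol false : Pol m n →ₐ[ℂ] Pol m n) = AlgHom.id ℂ _ := rfl
@[simp] theorem twist_true : (twist true : Op m n →ₗ[ℂ] Op m n) = parityOp := rfl
@[simp] theorem twist_false : (twist false : Op m n →ₗ[ℂ] Op m n) = LinearMap.id := rfl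

theorem twistPol_twistPol (b : Bool) (f : Pol m n) : twistPol b (twistPol b f) = f := by
  cases b <;> simp

theorem parityOp_apply (D : Op m n) (f : Pol m n) : parityOp D f = parity (D (parity f)) := rfl

theorem twist_apply (b : Bool) (D : Op m n) (f : Pol m n) :
    twist b D f = twistPol b (D (twistPol b f)) := by
  cases b
  · rfl
  · rfl

/-- The sign of the transposition of two elements of the given parities. -/
def sgn (b c : Bool) : ℂ := if b && c then -1 else 1

@[simp] theorem sgn_true_true : sgn true true = -1 := rfl
@[simp] theorem sgn_false_left (b : Bool) : sgn false b = 1 := by cases b <;> rfl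
@[simp] theorem sgn_false_right (b : Bool) : sgn b false = 1 := by cases b <;> rfl
theorem sgn_mul_self (b c : Bool) : sgn b c * sgn b c = 1 := by cases b <;> cases c <;> simp
theorem sgn_comm (b c : Bool) : sgn b c = sgn c b := by cases b <;> cases c <;> rfl

theorem coord_inl (k : ℕ+) : (coord (Sum.inl k) : Pol m n) = evenGen (Sum.inr k) := rfl
theorem coord_inr (k : ℕ) : (coord (Sum.inr k) : Pol m n) = oddGen (Sum.inr k) := rfl

theorem twistPol_coord (b : Bool) (a : Idx) :
    twistPol b (coord a : Pol m n) = sgn b (par a) • coord a := by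
  cases b <;> rcases a with k | k <;> simp [coord_inl, coord_inr]

theorem parity_coord (a : Idx) : parity (coord a : Pol m n) = sgn true (par a) • coord a :=
  twistPol_coord true a

theorem coord_mul_comm (a : Idx) (f : Pol m n) : coord a * f = twistPol (par a) f * coord a := by
  rcases a with k | k
  · exact evenGen_mul_comm _ _
  · exact oddGen_mul_comm _ _

theorem pd_inl_evenGen_mul (k : ℕ+) (e : Fin m ⊕ ℕ+) (f : Pol m n) :
    pd (Sum.inl k) (evenGen e * f) =
      (if e = Sum.inr k then f else 0) + evenGen e * pd (Sum.inl k) f := by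
  induction f using SuperPoly.induction_tmul with
  | zero => simp
  | add x y hx hy => rw [mul_add, map_add, hx, hy, map_add, mul_add]; split_ifs <;> abel
  | tmul p q =>
    simp only [pd]
    rw [evenGen_eq, SuperPoly.tmul_mul_tmul, SuperPoly.evenOp_tmul, SuperPoly.evenOp_tmul,
      SuperPoly.tmul_mul_tmul, one_mul]
    have hd : ∀ x : MvPolynomial (Fin m ⊕ ℕ+) ℂ,
        (MvPolynomial.pderiv (R := ℂ) (Sum.inr k)).toLinearMap x =
          MvPolynomial.pderiv (Sum.inr k) x := fun _ => rfl
    simp only [hd, Derivation.leibniz, MvPolynomial.pderiv_X, smul_eq_mul]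
    rw [SuperPoly.add_tmul, add_comm]
    congr 1
    by_cases h : e = Sum.inr k
    · subst h; simp
    · simp [h, SuperPoly.zero_tmul]

theorem pd_inl_oddGen_mul (k : ℕ+) (o : Fin n ⊕ ℕ) (f : Pol m n) :
    pd (Sum.inl k) (oddGen o * f) = oddGen o * pd (Sum.inl k) f := by
  induction f using SuperPoly.induction_tmul with
  | zero => simp
  | add x y hx hy => rw [mul_add, map_add, hx, hy, map_add, mul_add]
  | tmul p q =>
    simp only [pd]
    rw [oddGen_eq, SuperPoly.tmul_mul_tmul, SuperPoly.evenOp_tmul, SuperPoly.evenOp_tmul,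
      SuperPoly.tmul_mul_tmul, one_mul, one_mul]

theorem pd_inr_evenGen_mul (k : ℕ) (e : Fin m ⊕ ℕ+) (f : Pol m n) :
    pd (Sum.inr k) (evenGen e * f) = evenGen e * pd (Sum.inr k) f := by
  induction f using SuperPoly.induction_tmul with
  | zero => simp
  | add x y hx hy => rw [mul_add, map_add, hx, hy, map_add, mul_add]
  | tmul p q =>
    simp only [pd]
    rw [evenGen_eq, SuperPoly.tmul_mul_tmul, SuperPoly.oddOp_tmul, SuperPoly.oddOp_tmul,
      SuperPoly.tmul_mul_tmul, one_mul, one_mul]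

theorem pd_inr_oddGen_mul (k : ℕ) (o : Fin n ⊕ ℕ) (f : Pol m n) :
    pd (Sum.inr k) (oddGen o * f) =
      (if o = Sum.inr k then f else 0) - oddGen o * pd (Sum.inr k) f := by
  induction f using SuperPoly.induction_tmul with
  | zero => simp
  | add x y hx hy => rw [mul_add, map_add, hx, hy, map_add, mul_add]; split_ifs <;> abel
  | tmul p q =>
    simp only [pd]
    rw [oddGen_eq, SuperPoly.tmul_mul_tmul, SuperPoly.oddOp_tmul, SuperPoly.oddOp_tmul,
      SuperPoly.tmul_mul_tmul, one_mul]
    have := CliffordAlgebra.contractLeft_ι_mul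
      (Q := (0 : QuadraticForm ℂ ((Fin n ⊕ ℕ) →₀ ℂ)))
      (Finsupp.lapply (Sum.inr k)) (Finsupp.single o (1 : ℂ)) q
    rw [show (ExteriorAlgebra.ι ℂ (Finsupp.single o (1 : ℂ))) =
      CliffordAlgebra.ι 0 (Finsupp.single o (1 : ℂ)) from rfl, this, SuperPoly.tmul_sub]
    congr 1
    rw [SuperPoly.tmul_smul, Finsupp.lapply_apply, Finsupp.single_apply]
    split_ifs <;> simp

theorem pd_one (a : Idx) : pd a (1 : Pol m n) = 0 := by
  rcases a with k | k
  · simp only [pd]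
    rw [SuperPoly.one_eq, SuperPoly.evenOp_tmul]
    simp [SuperPoly.zero_tmul]
  · simp only [pd]
    rw [SuperPoly.one_eq, SuperPoly.oddOp_tmul, CliffordAlgebra.contractLeft_one,
      SuperPoly.tmul_zero]

theorem pd_coord_mul (a b : Idx) (f : Pol m n) :
    pd a (coord b * f) = (if a = b then f else 0) + sgn (par a) (par b) • (coord b * pd a f) := by
  rcases a with k | k <;> rcases b with l | l
  · rw [coord_inl, pd_inl_evenGen_mul]; simp [eq_comm]
  · rw [coord_inr, pd_inl_oddGen_mul]; simp
  · rw [coord_inl, pd_inr_evenGen_mul]; simp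
  · rw [coord_inr, pd_inr_oddGen_mul]; simp [eq_comm, sub_eq_add_neg]

theorem pd_ofBase_mul (a : Idx) (r : Base m n) (f : Pol m n) :
    pd a (ofBase r * f) = twistPol (par a) (ofBase r) * pd a f := by
  have h : ((LinearMap.mul ℂ (Pol m n)).comp ofBase.toLinearMap).compr₂ (pd a) =
      ((LinearMap.mul ℂ (Pol m n)).comp ((twistPol (par a)).toLinearMap.comp
        ofBase.toLinearMap)).compl₂ (pd a) := by
    refine SuperPoly.linearMap_ext_gen ?_ ?_ ?_
    · ext f; simp
    · intro e p hp
      ext f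
      have hq := DFunLike.congr_fun hp f
      simp only [LinearMap.compr₂_apply, LinearMap.comp_apply, AlgHom.toLinearMap_apply,
        LinearMap.mul_apply', LinearMap.compl₂_apply, map_mul, ofBase_evenGen, mul_assoc] at hq ⊢
      rcases a with k | k
      · rw [pd_inl_evenGen_mul, hq]; simp [mul_assoc]
      · rw [pd_inr_evenGen_mul, hq]; simp [mul_assoc]
    · intro e p hp
      ext f
      have hq := DFunLike.congr_fun hp f
      simp only [LinearMap.compr₂_apply, LinearMap.comp_apply, AlgHom.toLinearMap_apply,
        LinearMap.mul_apply', LinearMap.compl₂_apply, map_mul, ofBase_oddGen, mul_assoc] at hq ⊢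
      rcases a with k | k
      · rw [pd_inl_oddGen_mul, hq]; simp [mul_assoc]
      · rw [pd_inr_oddGen_mul, hq]; simp [mul_assoc]
  exact DFunLike.congr_fun (DFunLike.congr_fun h r) f

theorem ofBase_mul_comm (r : Base m n) (f : Pol m n) :
    ofBase r * f = f * ofBase ((1 / 2 : ℂ) • (r + parity r)) +
      parity f * ofBase ((1 / 2 : ℂ) • (r - parity r)) := by
  rw [mul_superComm, parity_ofBase]; simp

/-- The polynomials are spanned by the products of coordinates times elements of `R`. -/
theorem span_coord_mul_ofBase : Submodule.span ℂ
    {q : Pol m n | ∃ (r : Base m n) (a : List Idx), q = (a.map coord).prod * ofBase r} = ⊤ := by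
  have hpar : ∀ a : List Idx, ∃ c : ℂ, parity ((a.map coord).prod : Pol m n) =
      c • (a.map coord).prod := by
    intro a
    induction a with
    | nil => exact ⟨1, by simp⟩
    | cons b a ih =>
      obtain ⟨c, hc⟩ := ih
      refine ⟨sgn true (par b) * c, ?_⟩
      rw [List.map_cons, List.prod_cons, map_mul, hc, parity_coord, smul_mul_smul_comm]
  have hgen : ∀ g : Pol m n, (∀ (r : Base m n) (a : List Idx), g * ((a.map coord).prod * ofBase r)
      ∈ Submodule.span ℂ {q : Pol m n | ∃ (r : Base m n) (a : List Idx),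
        q = (a.map coord).prod * ofBase r}) →
      ∀ f ∈ Submodule.span ℂ {q : Pol m n | ∃ (r : Base m n) (a : List Idx),
        q = (a.map coord).prod * ofBase r}, g * f ∈ Submodule.span ℂ {q : Pol m n |
          ∃ (r : Base m n) (a : List Idx), q = (a.map coord).prod * ofBase r} := by
    intro g hg f hf
    induction hf using Submodule.span_induction with
    | mem x hx => obtain ⟨r, a, rfl⟩ := hx; exact hg r a
    | zero => rw [mul_zero]; exact Submodule.zero_mem _
    | add x y _ _ hx hy => rw [mul_add]; exact Submodule.add_mem _ hx hy
    | smul c x _ hx => rw [mul_smul_comm]; exact Submodule.smul_mem _ _ hx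
  refine SuperPoly.eq_top_of_gen _ (Submodule.subset_span ⟨1, [], by simp⟩) ?_ ?_
  · rintro (i | k)
    · refine hgen _ fun r a => Submodule.subset_span ⟨evenGen i * r, a, ?_⟩
      rw [← mul_assoc, evenGen_mul_comm, mul_assoc, map_mul, ofBase_evenGen]
    · exact hgen _ fun r a => Submodule.subset_span ⟨r, Sum.inl k :: a, by
        simp [coord_inl, mul_assoc]⟩
  · rintro (i | k)
    · refine hgen _ fun r a => ?_
      obtain ⟨c, hc⟩ := hpar a
      rw [← mul_assoc, oddGen_mul_comm, hc, smul_mul_assoc, smul_mul_assoc, mul_assoc]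
      exact Submodule.smul_mem _ _ (Submodule.subset_span ⟨oddGen i * r, a, by
        rw [map_mul, ofBase_oddGen]⟩)
    · exact hgen _ fun r a => Submodule.subset_span ⟨r, Sum.inr k :: a, by
        simp [coord_inr, mul_assoc]⟩

/-- A subspace containing `R` and stable under left multiplication by the coordinates is
everything. -/
theorem eq_top_of_coord (W : Submodule ℂ (Pol m n)) (h1 : ∀ r, ofBase r ∈ W)
    (hc : ∀ a, ∀ f ∈ W, coord a * f ∈ W) : W = ⊤ := by
  rw [eq_top_iff, ← span_coord_mul_ofBase, Submodule.span_le]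
  rintro _ ⟨r, a, rfl⟩
  induction a with
  | nil => simpa using h1 r
  | cons b a ih =>
    rw [List.map_cons, List.prod_cons, mul_assoc]
    exact hc _ _ ih

theorem pol_ext {B : Type*} [AddCommGroup B] [Module ℂ B]
    {f g : Pol m n →ₗ[ℂ] B} (h1 : ∀ r, f (ofBase r) = g (ofBase r))
    (hc : ∀ a p, f p = g p → f (coord a * p) = g (coord a * p)) : f = g := by
  have h : LinearMap.eqLocus f g = ⊤ :=
    eq_top_of_coord _ h1 (fun a p hp => hc a p hp)
  ext x
  have hx : x ∈ LinearMap.eqLocus f g := h ▸ Submodule.mem_top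
  exact hx

theorem pd_ofBase (a : Idx) (r : Base m n) : pd a (ofBase r : Pol m n) = 0 := by
  rw [← mul_one (ofBase r), pd_ofBase_mul, pd_one, mul_zero]

theorem twistPol_pd (b : Bool) (a : Idx) (f : Pol m n) :
    twistPol b (pd a f) = sgn b (par a) • pd a (twistPol b f) := by
  have h : (twistPol b).toLinearMap.comp (pd a : Op m n) =
      sgn b (par a) • (pd a : Op m n).comp (twistPol b).toLinearMap := by
    refine pol_ext ?_ ?_
    · intro r
      cases b <;> simp [pd_ofBase, parity_ofBase]
    · intro c p hp
      simp only [LinearMap.comp_apply, AlgHom.toLinearMap_apply, LinearMap.smul_apply,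
        pd_coord_mul, map_add, map_smul, map_mul, twistPol_coord, smul_mul_assoc] at hp ⊢
      rw [hp]
      by_cases hac : a = c
      · subst hac
        simp only [if_true, smul_add, smul_smul, mul_smul_comm, sgn_mul_self, one_smul]
        congr 2
        rw [← mul_assoc, sgn_mul_self, one_mul]
      · simp only [hac, if_false, map_zero, zero_add, smul_smul, mul_smul_comm]
        congr 1
        ring
  exact DFunLike.congr_fun h f

theorem pd_pd (a b : Idx) (f : Pol m n) :
    pd a (pd b f) = sgn (par a) (par b) • pd b (pd a f) := by
  have h : (pd a : Op m n).comp (pd b) = sgn (par a) (par b) • (pd b : Op m n).comp (pd a) := by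
    refine pol_ext ?_ ?_
    · intro r; simp [pd_ofBase]
    · intro c p hp
      simp only [LinearMap.comp_apply, LinearMap.smul_apply, pd_coord_mul, map_add, map_smul,
        smul_add, smul_smul] at hp ⊢
      rw [hp]
      by_cases hac : a = c <;> by_cases hbc : b = c
      · subst hac
        subst hbc
        cases hb : par b <;> simp [hb]
      · subst hac
        cases ha : par a <;> cases hb : par b <;> simp [ha, hb, hbc]
      · subst hbc
        cases ha : par a <;> cases hb : par b <;> simp [ha, hb, hac]
      · cases ha : par a <;> cases hb : par b <;> simp [ha, hb, hac, hbc]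
  exact DFunLike.congr_fun h f

/-- A polynomial involves only finitely many coordinates. All convergence statements for infinite
sums of operators rest on this. -/
theorem finite_pd_ne_zero (f : Pol m n) : {a : Idx | pd a f ≠ 0}.Finite := by
  let W : Submodule ℂ (Pol m n) :=
    { carrier := {f | {a : Idx | pd a f ≠ 0}.Finite}
      zero_mem' := by simp
      add_mem' := by
        intro x y hx hy
        refine (Set.Finite.union hx hy).subset ?_
        intro a ha
        by_contra h
        simp only [Set.mem_union, Set.mem_setOf_eq, not_or, not_not] at h
        exact ha (by rw [map_add, h.1, h.2, add_zero])
      smul_mem' := by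
        intro c x hx
        refine Set.Finite.subset hx ?_
        intro a ha h
        exact ha (by rw [map_smul, h, smul_zero]) }
  have h : W = ⊤ := by
    refine eq_top_of_coord _ ?_ ?_
    · intro r
      show {a : Idx | pd a (ofBase r : Pol m n) ≠ 0}.Finite
      simp [pd_ofBase]
    · intro b p hp
      refine ((Set.finite_singleton b).union hp).subset ?_
      intro a ha
      by_contra h
      simp only [Set.mem_union, Set.mem_setOf_eq, Set.mem_singleton_iff, not_or, not_not] at h
      exact ha (by rw [pd_coord_mul, if_neg h.1, h.2]; simp)
  have hf : f ∈ W := h ▸ Submodule.mem_top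
  exact hf

end PolBasics

/-! ### Pointwise finite sums of operators -/

section PSum

variable {ι κ : Type}

/-- On each polynomial only finitely many members of the family are nonzero. -/
def PFin (T : ι → Op m n) : Prop := ∀ f, (Function.support fun i => T i f).Finite

open Classical in
/-- The sum of a pointwise finite family of operators. -/
def psum (T : ι → Op m n) : Op m n :=
  if h : PFin T then
    { toFun := fun f => ∑ᶠ i, T i f
      map_add' := fun f g => by
        simp only [map_add]
        exact finsum_add_distrib (h f) (h g)
      map_smul' := fun c f => by
        simp only [map_smul, RingHom.id_apply]
        exact (smul_finsum' c (h f)).symm }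
  else 0

theorem psum_apply {T : ι → Op m n} (h : PFin T) (f : Pol m n) : psum T f = ∑ᶠ i, T i f := by
  rw [psum, dif_pos h]; rfl

theorem PFin.mono {T T' : ι → Op m n} (h : PFin T) (h' : ∀ i f, T i f = 0 → T' i f = 0) :
    PFin T' := fun f => (h f).subset fun i hi hT => hi (h' i f hT)

/-- The left factors may depend on the index in any way: convergence is decided by the factor that
acts first. -/
theorem PFin.mul_left {T : ι → Op m n} (h : PFin T) (D : ι → Op m n) :
    PFin fun i => D i * T i :=
  h.mono fun i f hT => by rw [Module.End.mul_apply, hT, map_zero]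

theorem PFin.mul_right {T : ι → Op m n} (h : PFin T) (D : Op m n) : PFin fun i => T i * D :=
  fun f => h (D f)

theorem PFin.add {T T' : ι → Op m n} (h : PFin T) (h' : PFin T') : PFin fun i => T i + T' i :=
  fun f => ((h f).union (h' f)).subset fun i hi => by
    by_contra hc
    simp only [Set.mem_union, Function.mem_support, not_or, not_not] at hc
    refine hi ?_
    show T i f + T' i f = 0
    rw [hc.1, hc.2, add_zero]

theorem PFin.smul {T : ι → Op m n} (h : PFin T) (c : ι → ℂ) : PFin fun i => c i • T i :=
  h.mono fun i f hT => by rw [LinearMap.smul_apply, hT, smul_zero]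

theorem PFin.neg {T : ι → Op m n} (h : PFin T) : PFin fun i => -T i :=
  h.mono fun i f hT => by rw [LinearMap.neg_apply, hT, neg_zero]

theorem PFin.sub {T T' : ι → Op m n} (h : PFin T) (h' : PFin T') : PFin fun i => T i - T' i := by
  simpa only [sub_eq_add_neg] using h.add h'.neg

theorem PFin.comp_injective {T : ι → Op m n} (h : PFin T) {e : κ → ι}
    (he : Function.Injective e) : PFin fun k => T (e k) := fun f =>
  (h f).preimage he.injOn

theorem PFin.of_finite {T : ι → Op m n} (h : {i | T i ≠ 0}.Finite) : PFin T := fun f =>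
  h.subset fun i hi hT => hi (by show T i f = 0; rw [hT, LinearMap.zero_apply])

theorem psum_mul_left {T : ι → Op m n} (h : PFin T) (D : Op m n) :
    D * psum T = psum fun i => D * T i := by
  ext f
  rw [psum_apply (h.mul_left fun _ => D), Module.End.mul_apply, psum_apply h,
    map_finsum D (h f)]
  rfl

theorem psum_mul_right {T : ι → Op m n} (h : PFin T) (D : Op m n) :
    psum T * D = psum fun i => T i * D := by
  ext f
  rw [psum_apply (h.mul_right D), Module.End.mul_apply, psum_apply h]
  rfl

theorem psum_add {T T' : ι → Op m n} (h : PFin T) (h' : PFin T') :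
    psum T + psum T' = psum fun i => T i + T' i := by
  ext f
  rw [psum_apply (h.add h'), LinearMap.add_apply, psum_apply h, psum_apply h']
  exact (finsum_add_distrib (h f) (h' f)).symm

theorem psum_smul {T : ι → Op m n} (h : PFin T) (c : ℂ) :
    c • psum T = psum fun i => c • T i := by
  ext f
  rw [psum_apply (h.smul fun _ => c), LinearMap.smul_apply, psum_apply h]
  exact smul_finsum' c (h f)

theorem psum_sub {T T' : ι → Op m n} (h : PFin T) (h' : PFin T') :
    psum T - psum T' = psum fun i => T i - T' i := by
  ext f
  rw [psum_apply (h.sub h'), LinearMap.sub_apply, psum_apply h, psum_apply h']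
  exact (finsum_sub_distrib (h f) (h' f)).symm

theorem psum_congr {T T' : ι → Op m n} (h : ∀ i, T i = T' i) : psum T = psum T' := by
  rw [funext h]

theorem psum_zero : psum (fun _ : ι => (0 : Op m n)) = 0 := by
  ext f
  rw [psum_apply (PFin.of_finite (by simp))]
  simp

theorem psum_eq_single {T : ι → Op m n} (i : ι) (h : ∀ j, j ≠ i → T j = 0) : psum T = T i := by
  have hT : PFin T := PFin.of_finite ((Set.finite_singleton i).subset fun j hj => by
    by_contra hne; exact hj (h j hne))
  ext f
  rw [psum_apply hT]
  exact finsum_eq_single _ i fun j hj => by rw [h j hj]; rfl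

theorem psum_eq_sum {T : ι → Op m n} (s : Finset ι) (h : ∀ j, j ∉ s → T j = 0) :
    psum T = ∑ i ∈ s, T i := by
  have hT : PFin T := PFin.of_finite (s.finite_toSet.subset fun j hj => by
    by_contra hne; exact hj (h j hne))
  ext f
  rw [psum_apply hT, LinearMap.sum_apply]
  refine finsum_eq_sum_of_support_subset _ fun j hj => ?_
  by_contra hne
  exact hj (by show T j f = 0; rw [h j hne]; rfl)

theorem psum_mem {T : ι → Op m n} (h : PFin T) {f : Pol m n} {W : Submodule ℂ (Pol m n)}
    (hW : ∀ i, T i f ∈ W) : psum T f ∈ W := by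
  rw [psum_apply h]
  exact finsum_induction (· ∈ W) W.zero_mem (fun _ _ => W.add_mem) hW

end PSum

/-! ### The degree filtration of the polynomials -/

section Degree

theorem ofBase_mem_degLE (r : Base m n) (d : ℕ) : ofBase r ∈ degLE (m := m) (n := n) d :=
  Submodule.subset_span ⟨r, [], by simp, by simp⟩

theorem degLE_mono {d e : ℕ} (h : d ≤ e) : degLE (m := m) (n := n) d ≤ degLE e :=
  Submodule.span_mono fun _ ⟨r, a, ha, hq⟩ => ⟨r, a, ha.trans h, hq⟩

theorem twistPol_ofBase (b : Bool) (r : Base m n) :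
    ∃ r' : Base m n, twistPol b (ofBase r : Pol m n) = ofBase r' := by
  cases b
  · exact ⟨r, rfl⟩
  · exact ⟨parity r, parity_ofBase r⟩

theorem coord_mul_mem_degLE {d : ℕ} (a : Idx) {f : Pol m n} (hf : f ∈ degLE d) :
    coord a * f ∈ degLE (d + 1) := by
  induction hf using Submodule.span_induction with
  | mem x hx =>
    obtain ⟨r, l, hl, rfl⟩ := hx
    obtain ⟨r', hr'⟩ := twistPol_ofBase (par a) r
    refine Submodule.subset_span ⟨r', a :: l, by simpa using hl, ?_⟩
    rw [← mul_assoc, coord_mul_comm, hr', mul_assoc, List.map_cons, List.prod_cons]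
  | zero => rw [mul_zero]; exact Submodule.zero_mem _
  | add x y _ _ hx hy => rw [mul_add]; exact Submodule.add_mem _ hx hy
  | smul c x _ hx => rw [mul_smul_comm]; exact Submodule.smul_mem _ _ hx

theorem ofBase_mul_mem_degLE {d : ℕ} (r : Base m n) {f : Pol m n} (hf : f ∈ degLE d) :
    ofBase r * f ∈ degLE d := by
  induction hf using Submodule.span_induction with
  | mem x hx =>
    obtain ⟨r', l, hl, rfl⟩ := hx
    exact Submodule.subset_span ⟨r * r', l, hl, by rw [← mul_assoc, map_mul]⟩
  | zero => rw [mul_zero]; exact Submodule.zero_mem _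
  | add x y _ _ hx hy => rw [mul_add]; exact Submodule.add_mem _ hx hy
  | smul c x _ hx => rw [mul_smul_comm]; exact Submodule.smul_mem _ _ hx

theorem exists_mem_degLE (f : Pol m n) : ∃ d, f ∈ degLE d := by
  have h : (⨆ d, degLE (m := m) (n := n) d) = ⊤ := by
    refine eq_top_of_coord _ (fun r => Submodule.mem_iSup_of_mem 0 (ofBase_mem_degLE r 0)) ?_
    intro a f hf
    rw [Submodule.mem_iSup_of_directed _ (monotone_nat_of_le_succ fun d =>
      degLE_mono (Nat.le_succ d)).directed_le] at hf ⊢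
    obtain ⟨d, hd⟩ := hf
    exact ⟨d + 1, coord_mul_mem_degLE a hd⟩
  have hf : f ∈ ⨆ d, degLE (m := m) (n := n) d := h ▸ Submodule.mem_top
  rwa [Submodule.mem_iSup_of_directed _ (monotone_nat_of_le_succ fun d =>
    degLE_mono (Nat.le_succ d)).directed_le] at hf

theorem pfin_mul_pd (D : Idx → Op m n) : PFin fun a => D a * pd a :=
  PFin.mul_left (fun f => finite_pd_ne_zero f) D

/-- The Euler operator. -/
def euler : Op m n := psum fun a : Idx => mulOp (coord a) * pd a

theorem euler_apply (f : Pol m n) : euler f = ∑ᶠ a, coord a * pd a f :=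
  psum_apply (pfin_mul_pd _) f

theorem finite_coord_mul_pd (f : Pol m n) :
    (Function.support fun a : Idx => coord a * pd a f).Finite :=
  pfin_mul_pd (fun a => mulOp (coord a)) f

theorem euler_ofBase_mul (r : Base m n) (f : Pol m n) :
    euler (ofBase r * f) = ofBase r * euler f := by
  rw [euler_apply, euler_apply, ← LinearMap.mulLeft_apply (R := ℂ) (ofBase r) (∑ᶠ a, _),
    map_finsum _ (finite_coord_mul_pd f)]
  refine finsum_congr fun a => ?_
  rw [pd_ofBase_mul, LinearMap.mulLeft_apply, ← mul_assoc, ← mul_assoc, coord_mul_comm,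
    twistPol_twistPol]

theorem euler_coord_mul (b : Idx) (f : Pol m n) :
    euler (coord b * f) = coord b * f + coord b * euler f := by
  rw [euler_apply, euler_apply, ← LinearMap.mulLeft_apply (R := ℂ) (coord b) (∑ᶠ a, _),
    map_finsum _ (finite_coord_mul_pd f)]
  have h1 : ∀ a, coord a * pd a (coord b * f) = coord a * (if a = b then f else 0) +
      LinearMap.mulLeft ℂ (coord b) (coord a * pd a f) := by
    intro a
    rw [pd_coord_mul, mul_add, LinearMap.mulLeft_apply]
    congr 1
    rw [← mul_assoc (coord b), coord_mul_comm b (coord a), twistPol_coord, sgn_comm,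
      mul_smul_comm, smul_mul_assoc, smul_mul_assoc, mul_assoc]
  simp only [h1]
  rw [finsum_add_distrib]
  · congr 1
    rw [finsum_eq_single _ b]
    · rw [if_pos rfl]
    · intro a ha
      rw [if_neg ha, mul_zero]
  · refine (Set.finite_singleton b).subset fun a ha => ?_
    by_contra hab
    exact ha (by show coord a * (if a = b then f else 0) = 0; rw [if_neg (by simpa using hab), mul_zero])
  · exact PFin.mul_left (pfin_mul_pd (fun a => mulOp (coord a))) (fun _ => mulOp (coord b)) f

theorem euler_one : euler (1 : Pol m n) = 0 := by
  rw [euler_apply]; simp [pd_one]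

theorem euler_monomial (r : Base m n) (l : List Idx) :
    euler (ofBase r * (l.map coord).prod) = (l.length : ℂ) • (ofBase r * (l.map coord).prod) := by
  rw [euler_ofBase_mul, ← mul_smul_comm]
  congr 1
  induction l with
  | nil => simp [euler_one]
  | cons a l ih =>
    rw [List.map_cons, List.prod_cons, euler_coord_mul, ih, List.length_cons, mul_smul_comm]
    push_cast
    module

/-- On polynomials of degree at most `N + 1` the Euler operator is multiplication by `N + 1` modulo
degree `N`. Hence, as long as the degree bound `N + 1` of `f` exceeds `d`, a degree bound on `euler
f` allows one to lower it by one. -/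
theorem mem_degLE_of_euler_mem {d : ℕ} {f : Pol m n} (h : euler f ∈ degLE d) : f ∈ degLE d := by
  have step : ∀ N, ∀ f ∈ degLE (m := m) (n := n) (N + 1),
      euler f - ((N + 1 : ℕ) : ℂ) • f ∈ degLE N := by
    intro N f hf
    induction hf using Submodule.span_induction with
    | mem x hx =>
      obtain ⟨r, l, hl, rfl⟩ := hx
      rw [euler_monomial, ← sub_smul]
      rcases Nat.lt_or_eq_of_le hl with h | h
      · exact Submodule.smul_mem _ _ (Submodule.subset_span ⟨r, l, Nat.lt_succ_iff.1 h, rfl⟩)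
      · rw [h, sub_self, zero_smul]; exact Submodule.zero_mem _
    | zero => rw [map_zero, smul_zero, sub_zero]; exact Submodule.zero_mem _
    | add x y _ _ hx hy =>
      rw [map_add, smul_add, add_sub_add_comm]; exact Submodule.add_mem _ hx hy
    | smul c x _ hx =>
      rw [map_smul, smul_comm, ← smul_sub]; exact Submodule.smul_mem _ _ hx
  obtain ⟨N, hN⟩ := exists_mem_degLE f
  have key : ∀ k, f ∈ degLE (d + k) → f ∈ degLE d := by
    intro k
    induction k with
    | zero => exact id
    | succ k ih =>
      intro hf
      refine ih ?_
      have h1 := step (d + k) f hf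
      have h2 := Submodule.sub_mem _ (degLE_mono (Nat.le_add_right d k) h) h1
      rw [sub_sub_cancel] at h2
      have h3 := Submodule.smul_mem _ (((d + k + 1 : ℕ) : ℂ)⁻¹) h2
      rwa [smul_smul, inv_mul_cancel₀ (Nat.cast_ne_zero.2 (Nat.succ_ne_zero _)), one_smul] at h3
  exact key N (degLE_mono (Nat.le_add_left N d) hN)

/-- The Euler operator reconstructs `f`, up to weights, from its derivatives. -/
theorem mem_degLE_succ_of_pd {d : ℕ} {f : Pol m n} (h : ∀ a, pd a f ∈ degLE d) :
    f ∈ degLE (d + 1) := by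
  refine mem_degLE_of_euler_mem ?_
  exact psum_mem (pfin_mul_pd _) fun a => coord_mul_mem_degLE a (h a)

theorem mem_degLE_zero_of_pd {f : Pol m n} (h : ∀ a, pd a f = 0) : f ∈ degLE 0 := by
  refine mem_degLE_of_euler_mem ?_
  rw [euler_apply]
  simp [h]

theorem mem_degLE_zero_iff {f : Pol m n} : f ∈ degLE 0 ↔ ∃ r, f = ofBase r := by
  constructor
  · intro hf
    induction hf using Submodule.span_induction with
    | mem x hx =>
      obtain ⟨r, l, hl, rfl⟩ := hx
      rw [List.length_eq_zero_iff.1 (Nat.le_zero.1 hl)]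
      exact ⟨r, by simp⟩
    | zero => exact ⟨0, by simp⟩
    | add x y _ _ hx hy =>
      obtain ⟨r, rfl⟩ := hx
      obtain ⟨r', rfl⟩ := hy
      exact ⟨r + r', by simp⟩
    | smul c x _ hx =>
      obtain ⟨r, rfl⟩ := hx
      exact ⟨c • r, by simp⟩
  · rintro ⟨r, rfl⟩
    exact ofBase_mem_degLE r 0

theorem twistPol_mem_degLE (b : Bool) {d : ℕ} {f : Pol m n} (hf : f ∈ degLE d) :
    twistPol b f ∈ degLE d := by
  induction hf using Submodule.span_induction with
  | mem x hx =>
    obtain ⟨r, l, hl, rfl⟩ := hx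
    obtain ⟨r', hr'⟩ := twistPol_ofBase b r
    rw [map_mul, hr']
    have : ∃ c : ℂ, twistPol b ((l.map coord).prod : Pol m n) = c • (l.map coord).prod := by
      clear hl
      induction l with
      | nil => exact ⟨1, by simp⟩
      | cons a l ih =>
        obtain ⟨c, hc⟩ := ih
        refine ⟨sgn b (par a) * c, ?_⟩
        rw [List.map_cons, List.prod_cons, map_mul, hc, twistPol_coord, smul_mul_smul_comm]
    obtain ⟨c, hc⟩ := this
    rw [hc, mul_smul_comm]
    exact Submodule.smul_mem _ _ (Submodule.subset_span ⟨r', l, hl, rfl⟩)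
  | zero => rw [map_zero]; exact Submodule.zero_mem _
  | add x y _ _ hx hy => rw [map_add]; exact Submodule.add_mem _ hx hy
  | smul c x _ hx => rw [map_smul]; exact Submodule.smul_mem _ _ hx

end Degree

/-! ### Parity of operators and twisted commutators -/

section Twist

theorem op_neg_smul (c : ℂ) (D : Op m n) : (-c) • D = -(c • D) := neg_smul c D

theorem op_mul_neg (D E : Op m n) : D * -E = -(D * E) := mul_neg D E

theorem op_neg_mul (D E : Op m n) : -D * E = -(D * E) := neg_mul D E

theorem twist_mul (b : Bool) (D E : Op m n) : twist b (D * E) = twist b D * twist b E := by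
  ext f
  simp only [twist_apply, Module.End.mul_apply, twistPol_twistPol]

theorem twist_one (b : Bool) : twist b (1 : Op m n) = 1 := by
  ext f
  simp only [twist_apply, Module.End.one_apply, twistPol_twistPol]

theorem twistPol_xor (b c : Bool) (f : Pol m n) :
    twistPol b (twistPol c f) = twistPol (xor b c) f := by
  cases b <;> cases c <;> simp

theorem twist_twist (b c : Bool) (D : Op m n) : twist b (twist c D) = twist (xor b c) D := by
  ext f
  simp only [twist_apply, twistPol_xor]
  rw [Bool.xor_comm c b]

@[simp] theorem twist_self (b : Bool) (D : Op m n) : twist b (twist b D) = D := by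
  rw [twist_twist]; simp

theorem twist_mulOp (b : Bool) (p : Pol m n) : twist b (mulOp p) = mulOp (twistPol b p) := by
  ext f
  simp only [twist_apply, mulOp, LinearMap.mulLeft_apply, map_mul, twistPol_twistPol]

theorem mulOp_apply (p f : Pol m n) : mulOp p f = p * f := rfl

theorem mulOp_smul (c : ℂ) (p : Pol m n) : mulOp (c • p) = c • mulOp p := by
  ext f; simp [mulOp_apply]

theorem mulOp_add (p q : Pol m n) : mulOp (p + q) = mulOp p + mulOp q := by
  ext f; simp [mulOp_apply, add_mul]

theorem mulOp_mul (p q : Pol m n) : mulOp (p * q) = mulOp p * mulOp q := by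
  ext f; simp [mulOp_apply, mul_assoc]

theorem mulOp_zero : mulOp (0 : Pol m n) = 0 := by
  ext f; simp [mulOp_apply]

theorem mulOp_one : mulOp (1 : Pol m n) = 1 := by
  ext f; simp [mulOp_apply]

theorem twist_pd (b : Bool) (a : Idx) : twist b (pd a : Op m n) = sgn b (par a) • pd a := by
  ext f
  rw [twist_apply, twistPol_pd, twistPol_twistPol, LinearMap.smul_apply]

theorem PFin.twist {ι : Type} {T : ι → Op m n} (h : PFin T) (b : Bool) :
    PFin fun i => twist b (T i) := fun f =>
  (h (twistPol b f)).subset fun i hi hT => hi (by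
    show SuperAiry.twist b (T i) f = 0
    rw [twist_apply, show T i (twistPol b f) = 0 from hT, map_zero])

theorem twist_psum {ι : Type} {T : ι → Op m n} (h : PFin T) (b : Bool) :
    twist b (psum T) = psum fun i => twist b (T i) := by
  ext f
  rw [psum_apply (h.twist b), twist_apply, psum_apply h, map_finsum _ (h _)]
  simp only [twist_apply]

/-- `D` is homogeneous of parity `c` (`true` for odd). -/
def HasPar (c : Bool) (D : Op m n) : Prop := ∀ b, twist b D = sgn b c • D

theorem HasPar.of_true {c : Bool} {D : Op m n} (h : twist true D = sgn true c • D) :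
    HasPar c D := by
  intro b
  cases b
  · simp
  · exact h

theorem HasPar.mul {c d : Bool} {D E : Op m n} (hD : HasPar c D) (hE : HasPar d E) :
    HasPar (xor c d) (D * E) := by
  intro b
  rw [twist_mul, hD b, hE b, smul_mul_smul_comm]
  cases b <;> cases c <;> cases d <;> simp

theorem HasPar.add {c : Bool} {D E : Op m n} (hD : HasPar c D) (hE : HasPar c E) :
    HasPar c (D + E) := by
  intro b
  rw [map_add, hD b, hE b, smul_add]

theorem HasPar.smul {c : Bool} {D : Op m n} (hD : HasPar c D) (r : ℂ) : HasPar c (r • D) := by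
  intro b
  rw [map_smul, hD b, smul_comm]

theorem HasPar.sub {c : Bool} {D E : Op m n} (hD : HasPar c D) (hE : HasPar c E) :
    HasPar c (D - E) := by
  intro b
  rw [map_sub, hD b, hE b, smul_sub]

theorem HasPar.zero (c : Bool) : HasPar c (0 : Op m n) := by
  intro b
  rw [map_zero, smul_zero]

theorem HasPar.one : HasPar false (1 : Op m n) := by
  intro b
  rw [twist_one]; simp

theorem HasPar.psum {ι : Type} {c : Bool} {T : ι → Op m n} (h : PFin T)
    (hT : ∀ i, HasPar c (T i)) : HasPar c (psum T) := by
  intro b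
  rw [twist_psum h, psum_smul h]
  exact psum_congr fun i => hT i b

theorem HasPar.twist {c : Bool} {D : Op m n} (hD : HasPar c D) (b : Bool) :
    HasPar c (twist b D) := by
  rw [hD b]
  exact hD.smul _

theorem hasPar_pd (a : Idx) : HasPar (par a) (pd a : Op m n) := fun b => twist_pd b a

theorem hasPar_coord (a : Idx) : HasPar (par a) (mulOp (coord a) : Op m n) := fun b => by
  rw [twist_mulOp, twistPol_coord, mulOp_smul]

/-- Every operator is the sum of an even and an odd one. -/
theorem eq_even_add_odd (D : Op m n) :
    D = (1 / 2 : ℂ) • (D + parityOp D) + (1 / 2 : ℂ) • (D - parityOp D) := by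
  module

theorem hasPar_even_part (D : Op m n) : HasPar false ((1 / 2 : ℂ) • (D + parityOp D)) := by
  refine HasPar.of_true ?_
  have : parityOp (parityOp D) = D := twist_self true D
  simp only [twist_true, map_smul, map_add, this, sgn_false_right, one_smul]
  rw [add_comm]

theorem hasPar_odd_part (D : Op m n) : HasPar true ((1 / 2 : ℂ) • (D - parityOp D)) := by
  refine HasPar.of_true ?_
  have : parityOp (parityOp D) = D := twist_self true D
  simp only [twist_true, map_smul, map_sub, this, sgn_true_true]
  module

/-- The twisted commutator `D y - y π_b(D)` with an element `y` of parity `b`. -/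
def ad (b : Bool) (y : Op m n) : Op m n →ₗ[ℂ] Op m n :=
  LinearMap.mulRight ℂ y - (LinearMap.mulLeft ℂ y).comp (twist b)

theorem ad_apply (b : Bool) (y D : Op m n) : ad b y D = D * y - y * twist b D := rfl

/-- The twisted commutator is a derivation from the right: since `y` stands on the right, the sign
is picked up by the factor `E`. -/
theorem ad_mul (b : Bool) (y D E : Op m n) :
    ad b y (D * E) = D * ad b y E + ad b y D * twist b E := by
  simp only [ad_apply, twist_mul, mul_sub, sub_mul, mul_assoc]
  abel

theorem ad_one (b : Bool) (y : Op m n) : ad b y 1 = 0 := by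
  simp [ad_apply, twist_one]

theorem HasPar.ad {b c : Bool} {y D : Op m n} (hy : HasPar b y) (hD : HasPar c D) :
    HasPar (xor c b) (ad b y D) := by
  have h2 := hy.mul (hD.twist b)
  rw [Bool.xor_comm] at h2
  exact (hD.mul hy).sub h2

theorem ad_psum {ι : Type} {T : ι → Op m n} (h : PFin T) (b : Bool) (y : Op m n) :
    ad b y (psum T) = psum fun i => ad b y (T i) := by
  rw [ad_apply, twist_psum h, psum_mul_right h, psum_mul_left (h.twist b),
    psum_sub (h.mul_right y) ((h.twist b).mul_left _)]
  rfl

theorem PFin.ad {ι : Type} {T : ι → Op m n} (h : PFin T) (b : Bool) (y : Op m n) :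
    PFin fun i => ad b y (T i) :=
  (h.mul_right y).sub ((h.twist b).mul_left _)

theorem twist_ad {b c : Bool} {y : Op m n} (hy : HasPar b y) (D : Op m n) :
    twist c (SuperAiry.ad b y D) = sgn c b • SuperAiry.ad b y (twist c D) := by
  simp only [ad_apply, map_sub, twist_mul, hy c, twist_twist, Bool.xor_comm c b]
  simp only [mul_smul_comm, smul_mul_assoc, smul_sub]

/-- The supercommutator of an operator `D` of parity `c` with `E`. -/
def bracket (c : Bool) (D E : Op m n) : Op m n := D * E - twist c E * D

/-- The super Jacobi identity; it drives all inductions on the degree of a bracket. -/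
theorem ad_bracket {b c : Bool} {y D : Op m n} (hy : HasPar b y) (hD : HasPar c D) (E : Op m n) :
    ad b y (bracket c D E) =
      bracket c D (ad b y E) + bracket (xor c b) (ad b y D) (twist b E) := by
  have h1 : twist (xor c b) (twist b E) = twist c E := by
    rw [twist_twist]; congr 2; cases b <;> cases c <;> rfl
  have h2 : twist b (twist c E) = twist c (twist b E) := by
    rw [twist_twist, twist_twist, Bool.xor_comm]
  rw [bracket, bracket, bracket, h1]
  simp only [ad_apply, map_sub, twist_mul, hD b, hy c, h2, sgn_comm c b]
  simp only [mul_sub, sub_mul, mul_smul_comm, smul_mul_assoc, mul_assoc]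
  abel

end Twist

/-! ### Operators that are linear over the base ring -/

section RLinear

/-- `D` commutes with right multiplication by elements of `R`. -/
def RLin (D : Op m n) : Prop := ∀ f r, D (f * ofBase r) = D f * ofBase r

theorem RLin.mul {D E : Op m n} (hD : RLin D) (hE : RLin E) : RLin (D * E) := fun f r => by
  rw [Module.End.mul_apply, hE f r, hD _ r, Module.End.mul_apply]

theorem RLin.add {D E : Op m n} (hD : RLin D) (hE : RLin E) : RLin (D + E) := fun f r => by
  simp only [LinearMap.add_apply, hE f r, hD f r, add_mul]

theorem RLin.smul {D : Op m n} (hD : RLin D) (c : ℂ) : RLin (c • D) := fun f r => by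
  simp only [LinearMap.smul_apply, hD f r, smul_mul_assoc]

theorem RLin.sub {D E : Op m n} (hD : RLin D) (hE : RLin E) : RLin (D - E) := fun f r => by
  simp only [LinearMap.sub_apply, hE f r, hD f r, sub_mul]

theorem RLin.zero : RLin (0 : Op m n) := fun f r => by simp

theorem RLin.one : RLin (1 : Op m n) := fun f r => by simp

theorem RLin.twist {D : Op m n} (hD : RLin D) (b : Bool) : RLin (twist b D) := fun f r => by
  obtain ⟨r', hr'⟩ := twistPol_ofBase b r
  rw [twist_apply, twist_apply, map_mul, hr', hD, map_mul, ← hr', twistPol_twistPol]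

theorem RLin.psum {ι : Type} {T : ι → Op m n} (h : PFin T) (hT : ∀ i, RLin (T i)) :
    RLin (psum T) := fun f r => by
  rw [psum_apply h, psum_apply h, finsum_mul' _ _ (h f)]
  exact finsum_congr fun i => hT i f r

theorem rLin_mulOp (p : Pol m n) : RLin (mulOp p) := fun f r => by
  simp only [mulOp_apply, mul_assoc]

theorem rLin_pd (a : Idx) : RLin (pd a : Op m n) := by
  intro f r
  have h : (pd a : Op m n).comp (LinearMap.mulRight ℂ (ofBase r)) =
      (LinearMap.mulRight ℂ (ofBase r)).comp (pd a) := by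
    refine pol_ext ?_ ?_
    · intro r'
      simp only [LinearMap.comp_apply, LinearMap.mulRight_apply, ← map_mul, pd_ofBase, zero_mul]
    · intro b p hp
      simp only [LinearMap.comp_apply, LinearMap.mulRight_apply] at hp ⊢
      rw [mul_assoc, pd_coord_mul, pd_coord_mul, hp, add_mul, smul_mul_assoc, mul_assoc]
      split_ifs <;> simp
  exact DFunLike.congr_fun h f

/-- An operator linear over `R` commutes with left multiplication by `R` in the super sense. -/
theorem RLin.mul_mulOp_ofBase {c : Bool} {D : Op m n} (hD : RLin D) (hp : HasPar c D)
    (r : Base m n) : D * mulOp (ofBase r) = SuperAiry.twist c (mulOp (ofBase r)) * D := by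
  have hP : ∀ f, D (parity f) = sgn true c • parity (D f) := by
    intro f
    have h1 := congrArg (fun T => T (parity f)) (hp true)
    simp only [twist_true, parityOp_apply, parity_parity, LinearMap.smul_apply] at h1
    rw [h1, smul_smul, sgn_mul_self, one_smul]
  ext f
  rw [twist_mulOp]
  simp only [Module.End.mul_apply, mulOp_apply]
  rw [ofBase_mul_comm, map_add, hD, hD, hP]
  cases c
  · simp only [sgn_false_right, one_smul, twistPol_false, AlgHom.id_apply]
    rw [← ofBase_mul_comm]
  · simp only [sgn_true_true, twistPol_true, parity_ofBase]
    rw [ofBase_mul_comm, parity_parity, ← neg_sub r, smul_neg, map_neg, neg_one_smul, add_comm r]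
    simp

end RLinear

/-! ### The intrinsic degree filtration on operators -/

section Filtration

/-- The coordinates (as multiplication operators) and the derivatives. -/
def genOp : Bool × Idx → Op m n
  | (false, a) => mulOp (coord a)
  | (true, a) => pd a

theorem hasPar_genOp (g : Bool × Idx) : HasPar (par g.2) (genOp g : Op m n) := by
  rcases g with ⟨_ | _, a⟩
  · exact hasPar_coord a
  · exact hasPar_pd a

/-- The operators of degree `< d`: those linear over `R` for which all `d`-fold supercommutators
with coordinates and derivatives vanish. -/
def Fil : ℕ → Submodule ℂ (Op m n)
  | 0 => ⊥
  | d + 1 =>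
    { carrier := {D | RLin D ∧ ∀ g, ad (par g.2) (genOp g) D ∈ Fil d}
      zero_mem' := ⟨RLin.zero, fun g => by rw [map_zero]; exact Submodule.zero_mem _⟩
      add_mem' := fun hx hy => ⟨hx.1.add hy.1, fun g => by
        rw [map_add]; exact Submodule.add_mem _ (hx.2 g) (hy.2 g)⟩
      smul_mem' := fun c _ hx => ⟨hx.1.smul c, fun g => by
        rw [map_smul]; exact Submodule.smul_mem _ c (hx.2 g)⟩ }

theorem mem_fil_zero {D : Op m n} : D ∈ Fil 0 ↔ D = 0 := Submodule.mem_bot ℂ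

theorem fil_le_succ (d : ℕ) : Fil (m := m) (n := n) d ≤ Fil (d + 1) := by
  induction d with
  | zero => exact bot_le
  | succ d ih => exact fun D hD => ⟨hD.1, fun g => ih (hD.2 g)⟩

theorem fil_mono {d e : ℕ} (h : d ≤ e) : Fil (m := m) (n := n) d ≤ Fil e :=
  monotone_nat_of_le_succ fil_le_succ h

theorem twist_mem_fil {d : ℕ} (b : Bool) {D : Op m n} (hD : D ∈ Fil d) : twist b D ∈ Fil d := by
  induction d generalizing D with
  | zero => rw [mem_fil_zero] at hD ⊢; rw [hD, map_zero]
  | succ d ih =>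
    refine ⟨hD.1.twist b, fun g => ?_⟩
    have h := Submodule.smul_mem _ (sgn b (par g.2)) (ih (hD.2 g))
    rwa [twist_ad (hasPar_genOp g), smul_smul, sgn_mul_self, one_smul] at h

theorem RLin.of_mem_fil {d : ℕ} {D : Op m n} (hD : D ∈ Fil d) : RLin D := by
  cases d with
  | zero => rw [mem_fil_zero.1 hD]; exact RLin.zero
  | succ d => exact hD.1

theorem psum_mem_fil {ι : Type} {d : ℕ} {T : ι → Op m n} (h : PFin T) (hT : ∀ i, T i ∈ Fil d) :
    psum T ∈ Fil d := by
  induction d generalizing T with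
  | zero => rw [mem_fil_zero, ← psum_zero (ι := ι)]; exact psum_congr fun i => mem_fil_zero.1 (hT i)
  | succ d ih =>
    refine ⟨RLin.psum h fun i => (hT i).1, fun g => ?_⟩
    rw [ad_psum h]
    exact ih (h.ad _ _) fun i => (hT i).2 g

/-- By the Leibniz rule a supercommutator with a coordinate or a derivative lowers the order of one
of the two factors, so induction on the sum of the orders applies. `Fil (d + 1)` stands for degree
at most `d`, whence the shift by one in the conclusion. -/
theorem mul_mem_fil {d e : ℕ} {D E : Op m n} (hD : D ∈ Fil (d + 1)) (hE : E ∈ Fil (e + 1)) :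
    D * E ∈ Fil (d + e + 1) := by
  have key : ∀ N d e : ℕ, d + e ≤ N → ∀ D E : Op m n, D ∈ Fil (d + 1) → E ∈ Fil (e + 1) →
      D * E ∈ Fil (d + e + 1) := by
    intro N
    induction N with
    | zero =>
      intro d e h D E hD hE
      obtain ⟨rfl, rfl⟩ : d = 0 ∧ e = 0 := by omega
      refine ⟨hD.1.mul hE.1, fun g => ?_⟩
      rw [ad_mul, mem_fil_zero.1 (hD.2 g), mem_fil_zero.1 (hE.2 g)]
      simp
    | succ N ih =>
      intro d e h D E hD hE
      refine ⟨hD.1.mul hE.1, fun g => ?_⟩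
      rw [ad_mul]
      refine Submodule.add_mem _ ?_ ?_
      · cases e with
        | zero => rw [mem_fil_zero.1 (hE.2 g), mul_zero]; exact Submodule.zero_mem _
        | succ e => exact ih d e (by omega) D _ hD (hE.2 g)
      · cases d with
        | zero => rw [mem_fil_zero.1 (hD.2 g), zero_mul]; exact Submodule.zero_mem _
        | succ d =>
          have := ih d e (by omega) _ _ (hD.2 g) (twist_mem_fil (par g.2) hE)
          rwa [show d + 1 + e = d + e + 1 by omega]
  exact key _ d e le_rfl D E hD hE

theorem one_mem_fil : (1 : Op m n) ∈ Fil 1 :=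
  ⟨RLin.one, fun g => by rw [ad_one]; exact Submodule.zero_mem _⟩

theorem ad_coord_coord (a b : Idx) : ad (par a) (mulOp (coord a)) (mulOp (coord b : Pol m n)) = 0 := by
  rw [ad_apply, twist_mulOp, ← mulOp_mul, ← mulOp_mul, coord_mul_comm a, twistPol_twistPol, sub_self]

theorem ad_coord_pd (a b : Idx) :
    ad (par a) (mulOp (coord a)) (pd b : Op m n) = if b = a then 1 else 0 := by
  ext f
  rw [ad_apply, twist_pd, sgn_comm]
  simp only [LinearMap.sub_apply, Module.End.mul_apply, mulOp_apply, LinearMap.smul_apply,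
    pd_coord_mul, mul_smul_comm, add_sub_cancel_right]
  split_ifs <;> rfl

theorem ad_pd_coord (a b : Idx) : ad (par a) (pd a) (mulOp (coord b : Pol m n)) =
    if a = b then -(sgn (par a) (par b)) • 1 else 0 := by
  ext f
  rw [ad_apply, twist_mulOp, twistPol_coord]
  simp only [LinearMap.sub_apply, Module.End.mul_apply, mulOp_apply,
    pd_coord_mul, smul_mul_assoc, map_smul, smul_add, smul_smul, sgn_mul_self, one_smul]
  split_ifs <;> simp

theorem ad_pd_pd (a b : Idx) : ad (par a) (pd a) (pd b : Op m n) = 0 := by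
  ext f
  rw [ad_apply, twist_pd]
  simp only [LinearMap.sub_apply, Module.End.mul_apply, LinearMap.smul_apply, map_smul]
  rw [pd_pd b a, sgn_comm, sub_self, LinearMap.zero_apply]

theorem genOp_mem_fil (g : Bool × Idx) : (genOp g : Op m n) ∈ Fil 2 := by
  rcases g with ⟨_ | _, a⟩
  · refine ⟨rLin_mulOp _, ?_⟩
    rintro ⟨_ | _, b⟩
    · simp only [genOp, ad_coord_coord]; exact Submodule.zero_mem _
    · simp only [genOp, ad_pd_coord]
      split_ifs
      · exact Submodule.smul_mem _ _ one_mem_fil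
      · exact Submodule.zero_mem _
  · refine ⟨rLin_pd _, ?_⟩
    rintro ⟨_ | _, b⟩
    · simp only [genOp, ad_coord_pd]
      split_ifs
      · exact one_mem_fil
      · exact Submodule.zero_mem _
    · simp only [genOp, ad_pd_pd]; exact Submodule.zero_mem _

theorem coord_mem_fil (a : Idx) : (mulOp (coord a) : Op m n) ∈ Fil 2 := genOp_mem_fil (false, a)

theorem pd_mem_fil (a : Idx) : (pd a : Op m n) ∈ Fil 2 := genOp_mem_fil (true, a)

theorem ofBase_mem_fil (r : Base m n) : mulOp (ofBase r) ∈ Fil (m := m) (n := n) 1 := by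
  refine ⟨rLin_mulOp _, ?_⟩
  rintro ⟨_ | _, a⟩
  · simp only [genOp]
    rw [ad_apply, twist_mulOp, ← mulOp_mul, ← mulOp_mul, coord_mul_comm a, twistPol_twistPol,
      sub_self]
    exact Submodule.zero_mem _
  · have : ad (par a) (pd a) (mulOp (ofBase r : Pol m n)) = 0 := by
      ext f
      obtain ⟨r', hr'⟩ := twistPol_ofBase (par a) r
      rw [ad_apply, twist_mulOp, hr']
      simp only [LinearMap.sub_apply, Module.End.mul_apply, mulOp_apply]
      rw [pd_ofBase_mul, ← hr', twistPol_twistPol, sub_self, LinearMap.zero_apply]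
    show ad (par a) (pd a) (mulOp (ofBase r : Pol m n)) ∈ Fil 0
    rw [this]
    exact Submodule.zero_mem _

theorem mulOp_mem_fil {d : ℕ} {p : Pol m n} (hp : p ∈ degLE d) : mulOp p ∈ Fil (d + 1) := by
  induction hp using Submodule.span_induction with
  | mem x hx =>
    obtain ⟨r, l, hl, rfl⟩ := hx
    have h2 : (mulOp ((l.map coord).prod) : Op m n) ∈ Fil (l.length + 1) := by
      clear hl
      induction l with
      | nil => simpa [mulOp_one] using one_mem_fil
      | cons a l ih =>
        rw [List.map_cons, List.prod_cons, mulOp_mul, List.length_cons]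
        have := mul_mem_fil (d := 1) (coord_mem_fil (m := m) (n := n) a) ih
        rwa [add_comm 1] at this
    rw [mulOp_mul]
    have := mul_mem_fil (d := 0) (ofBase_mem_fil r) h2
    exact fil_mono (by omega) this
  | zero => rw [mulOp_zero]; exact Submodule.zero_mem _
  | add x y _ _ hx hy => rw [mulOp_add]; exact Submodule.add_mem _ hx hy
  | smul c x _ hx => rw [mulOp_smul]; exact Submodule.smul_mem _ _ hx

/-- An operator of degree `≤ d` sends `1` to a polynomial of degree `≤ d`. -/
theorem apply_one_mem_degLE {d : ℕ} {D : Op m n} (hD : D ∈ Fil (d + 1)) : D 1 ∈ degLE d := by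
  -- Since derivatives annihilate `1`, the derivative of `D 1` is, up to sign and parity involution,
  -- the twisted commutator of `D` with that derivative, applied to `1`.
  have hpd : ∀ (D : Op m n) (a : Idx),
      pd a (D 1) = -(sgn (par a) (par a)) • twistPol (par a) (ad (par a) (pd a) D 1) := by
    intro D a
    rw [ad_apply]
    simp only [LinearMap.sub_apply, Module.End.mul_apply, pd_one, map_zero, zero_sub, twist_apply,
      map_one, map_neg, smul_neg, twistPol_pd, twistPol_twistPol, smul_smul]
    rw [neg_mul, sgn_mul_self]
    simp
  induction d generalizing D with
  | zero =>
    refine mem_degLE_zero_of_pd fun a => ?_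
    have h : ad (par a) (pd a) D = 0 := mem_fil_zero.1 (hD.2 (true, a))
    rw [hpd, h]
    simp
  | succ d ih =>
    refine mem_degLE_succ_of_pd fun a => ?_
    rw [hpd]
    exact Submodule.smul_mem _ _ (twistPol_mem_degLE _ (ih (hD.2 (true, a))))

/-- An operator that is linear over `R` and supercommutes with the coordinates is the
multiplication by its value at `1`. -/
theorem eq_mulOp_of_ad_coord {D : Op m n} (hD : RLin D)
    (h : ∀ a, ad (par a) (mulOp (coord a)) D = 0) : D = mulOp (D 1) := by
  -- For homogeneous `D` the sign for moving a coordinate past `D` agrees with the sign for moving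
  -- it past `D 1`. The general case follows because the homogeneous parts inherit the hypothesis.
  have key : ∀ (c : Bool) (D : Op m n), HasPar c D → RLin D →
      (∀ a, ad (par a) (mulOp (coord a)) D = 0) → D = mulOp (D 1) := by
    intro c D hc hD h
    refine pol_ext ?_ ?_
    · intro r
      rw [mulOp_apply, ← hD, one_mul]
    · intro a p hp
      have h1 : D * mulOp (coord a) = mulOp (coord a) * twist (par a) D := sub_eq_zero.1 (h a)
      replace h1 := DFunLike.congr_fun h1 p
      simp only [Module.End.mul_apply, mulOp_apply] at h1 hp ⊢
      have h2 := hc (par a)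
      rw [h1, h2, LinearMap.smul_apply, hp]
      have h3 := DFunLike.congr_fun h2 1
      rw [twist_apply, map_one, LinearMap.smul_apply] at h3
      rw [mul_smul_comm, ← mul_assoc, ← mul_assoc, coord_mul_comm a (D 1), h3, smul_mul_assoc,
        smul_mul_assoc, smul_smul, sgn_mul_self, one_smul]
  have hodd := key true _ (hasPar_odd_part D) ((hD.sub (hD.twist true)).smul _) fun a => by
    have h2 : ad (par a) (mulOp (coord a)) (twist true D) = 0 := by
      have := twist_ad (c := true) (hasPar_coord a) D
      rw [h a, map_zero] at this
      have h3 := congrArg (fun x => sgn true (par a) • x) this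
      simpa [smul_smul, sgn_mul_self] using h3.symm
    rw [map_smul, map_sub, h a, ← twist_true, h2]
    simp
  have heven := key false _ (hasPar_even_part D) ((hD.add (hD.twist true)).smul _) fun a => by
    have h2 : ad (par a) (mulOp (coord a)) (twist true D) = 0 := by
      have := twist_ad (c := true) (hasPar_coord a) D
      rw [h a, map_zero] at this
      have h3 := congrArg (fun x => sgn true (par a) • x) this
      simpa [smul_smul, sgn_mul_self] using h3.symm
    rw [map_smul, map_add, h a, ← twist_true, h2]
    simp
  calc D = _ := eq_even_add_odd D
    _ = mulOp (((1 / 2 : ℂ) • (D + parityOp D)) 1) + mulOp (((1 / 2 : ℂ) • (D - parityOp D)) 1) := by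
      rw [← hodd, ← heven]
    _ = mulOp (D 1) := by
      rw [← mulOp_add, ← LinearMap.add_apply, ← eq_even_add_odd]

/-- Supercommuting with the coordinates makes `D` the multiplication by `D 1`, and supercommuting
with the derivatives makes `D 1` constant in the coordinates. -/
theorem mem_fil_one {D : Op m n} : D ∈ Fil 1 ↔ ∃ r, D = mulOp (ofBase r) := by
  constructor
  · intro hD
    obtain ⟨r, hr⟩ := mem_degLE_zero_iff.1 (apply_one_mem_degLE hD)
    exact ⟨r, by rw [← hr]; exact eq_mulOp_of_ad_coord hD.1 fun a => mem_fil_zero.1 (hD.2 (false, a))⟩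
  · rintro ⟨r, rfl⟩
    exact ofBase_mem_fil r

/-- The supercommutator lowers the degree by two. -/
theorem bracket_mem_fil {c c' : Bool} {d e : ℕ} {D E : Op m n} (hc : HasPar c D)
    (hc' : HasPar c' E) (hD : D ∈ Fil d) (hE : E ∈ Fil e) : bracket c D E ∈ Fil (d + e - 3) := by
  -- The elements of `R` supercommute with every operator linear over `R`; this is the base of the
  -- induction.
  have hR : ∀ (c c' : Bool) (r : Base m n) (E : Op m n), HasPar c (mulOp (ofBase r)) →
      HasPar c' E → RLin E → bracket c (mulOp (ofBase r)) E = 0 := by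
    intro c c' r E hr hE hl
    rw [bracket, hE c, smul_mul_assoc, hl.mul_mulOp_ofBase hE, hr c', sgn_comm, smul_mul_assoc,
      smul_smul, sgn_mul_self, one_smul, sub_self]
  have key : ∀ N d e : ℕ, d + e ≤ N → ∀ (c c' : Bool) (D E : Op m n), HasPar c D → HasPar c' E →
      D ∈ Fil d → E ∈ Fil e → bracket c D E ∈ Fil (d + e - 3) := by
    intro N
    induction N with
    | zero =>
      intro d e h c c' D E _ _ hD hE
      obtain ⟨rfl, rfl⟩ : d = 0 ∧ e = 0 := by omega
      rw [mem_fil_zero.1 hD, mem_fil_zero.1 hE, bracket]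
      simp
    | succ N ih =>
      intro d e h c c' D E hc hc' hD hE
      cases d with
      | zero => rw [mem_fil_zero.1 hD, bracket]; simp
      | succ d =>
      cases e with
      | zero => rw [mem_fil_zero.1 hE, bracket]; simp
      | succ e =>
      have hl : RLin (bracket c D E) := (hD.1.mul hE.1).sub ((hE.1.twist c).mul hD.1)
      -- Below total order two one of the operators is a multiplication by an element of `R`, and
      -- the truncated bound `d + e - 3` is compensated by the vanishing of the bracket.
      rcases Nat.lt_or_ge (d + e) 2 with hde | hde
      · rcases Nat.eq_zero_or_pos d with rfl | hd
        · obtain ⟨r, rfl⟩ := mem_fil_one.1 hD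
          rw [hR c c' r E hc hc' hE.1]
          exact Submodule.zero_mem _
        · obtain rfl : e = 0 := by omega
          obtain ⟨r, rfl⟩ := mem_fil_one.1 hE
          have h0 := hR c' c r D hc' hc hD.1
          have : bracket c D (mulOp (ofBase r)) =
              -(sgn c c') • bracket c' (mulOp (ofBase r)) D := by
            rw [bracket, bracket, hc c', hc' c, smul_mul_assoc, smul_mul_assoc, op_neg_smul, smul_sub,
              smul_smul, sgn_comm c' c, sgn_mul_self, one_smul]
            abel
          rw [this, h0, smul_zero]
          exact Submodule.zero_mem _
      -- Otherwise the Jacobi identity expresses each supercommutator of the bracket through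
      -- brackets of smaller total order.
      · obtain ⟨k, hk⟩ : ∃ k, d + e = k + 2 := ⟨d + e - 2, by omega⟩
        rw [show d + 1 + (e + 1) - 3 = k + 1 by omega]
        refine ⟨hl, fun g => ?_⟩
        rw [ad_bracket (hasPar_genOp g) hc]
        refine Submodule.add_mem _ ?_ ?_
        · have := ih (d + 1) e (by omega) c _ D _ hc ((hasPar_genOp g).ad hc') hD (hE.2 g)
          rwa [show d + 1 + e - 3 = k by omega] at this
        · have := ih d (e + 1) (by omega) _ _ _ _ ((hasPar_genOp g).ad hc) (hc'.twist (par g.2))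
            (hD.2 g) (twist_mem_fil _ hE)
          rwa [show d + (e + 1) - 3 = k by omega] at this
  exact key _ d e le_rfl c c' D E hc hc' hD hE

end Filtration

/-! ### Reindexing pointwise finite sums -/

section Reindex

variable {ι κ : Type}

theorem psum_comp_injective {T : ι → Op m n} (h : PFin T) {e : κ → ι} (he : Function.Injective e)
    (h0 : ∀ i, i ∉ Set.range e → T i = 0) : psum T = psum fun k => T (e k) := by
  ext f
  rw [psum_apply h, psum_apply (h.comp_injective he)]
  rw [← finsum_mem_range (f := fun i => T i f) he]
  symm
  refine finsum_congr fun i => ?_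
  by_cases hi : i ∈ Set.range e
  · simp [hi]
  · simp [hi, h0 i hi]

theorem psum_prod {T : ι × κ → Op m n} (h : PFin T) :
    psum T = psum fun i => psum fun k => T (i, k) := by
  have h1 : ∀ i, PFin fun k => T (i, k) := fun i =>
    h.comp_injective (e := fun k => (i, k)) (Prod.mk_right_injective i)
  have h2 : PFin fun i => psum fun k => T (i, k) := fun f => by
    refine ((h f).image Prod.fst).subset fun i hi => ?_
    by_contra hc
    refine hi ?_
    show (psum fun k => T (i, k)) f = 0
    rw [psum_apply (h1 i)]
    refine finsum_eq_zero_of_forall_eq_zero fun k => ?_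
    by_contra hk
    exact hc ⟨(i, k), hk, rfl⟩
  ext f
  rw [psum_apply h, psum_apply h2, finsum_curry _ (h f)]
  exact finsum_congr fun i => (psum_apply (h1 i) f).symm

/-- On a given polynomial finitely many `B i` contribute, and on each of the resulting polynomials
finitely many `A i k` do. -/
theorem PFin.prod_mul {A : ι → κ → Op m n} {B : ι → Op m n} (hA : ∀ i, PFin (A i))
    (hB : PFin B) : PFin fun p : ι × κ => A p.1 p.2 * B p.1 := fun f => by
  have : {p : ι × κ | p.1 ∈ Function.support (fun i => B i f) ∧
      p.2 ∈ Function.support (fun k => A p.1 k (B p.1 f))}.Finite := by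
    refine ((hB f).biUnion fun i _ =>
      ((hA i (B i f)).image fun k => (i, k))).subset ?_
    rintro ⟨i, k⟩ ⟨hi, hk⟩
    exact Set.mem_biUnion hi ⟨k, hk, rfl⟩
  refine this.subset ?_
  rintro ⟨i, k⟩ hp
  refine ⟨fun h0 => hp ?_, hp⟩
  show A i k (B i f) = 0
  rw [show B i f = 0 from h0, map_zero]

theorem psum_finset_sum {σ : Type} (s : Finset σ) {T : σ → ι → Op m n} (h : ∀ r, PFin (T r)) :
    ∑ r ∈ s, psum (T r) = psum fun i => ∑ r ∈ s, T r i := by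
  classical
  induction s using Finset.induction_on with
  | empty => simp [psum_zero]
  | insert a s ha ih =>
    have hs : PFin fun i => ∑ r ∈ s, T r i := by
      clear ih ha
      induction s using Finset.induction_on with
      | empty => simpa using PFin.of_finite (T := fun _ : ι => (0 : Op m n)) (by simp)
      | insert b s hb ih => simp only [Finset.sum_insert hb]; exact (h b).add ih
    rw [Finset.sum_insert ha, ih, psum_add (h a) hs]
    simp only [Finset.sum_insert ha]

end Reindex

/-! ### Taylor expansion of operators -/

section Taylor

/-- A system of linear coordinates `y` with dual derivatives `δ`. -/
structure IsCoordSystem (y : Idx → Pol m n) (δ : Idx → Op m n) : Prop where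
  mem_degLE : ∀ a, y a ∈ degLE 1
  hasPar : ∀ a, HasPar (par a) (mulOp (y a))
  hasPar_deriv : ∀ a, HasPar (par a) (δ a)
  rLin : ∀ a, RLin (δ a)
  ad_deriv : ∀ a b, ad (par a) (mulOp (y a)) (δ b) = if b = a then 1 else 0
  deriv_one : ∀ a, δ a 1 = 0
  pfin : PFin δ
  -- This condition replaces the statement that the `y a` generate the same linear functions over
  -- `R` as the standard coordinates.
  ad_coord : ∀ D : Op m n, RLin D → (∀ a, ad (par a) (mulOp (y a)) D = 0) →
    ∀ a, ad (par a) (mulOp (coord a)) D = 0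

variable {y : Idx → Pol m n} {δ : Idx → Op m n}

theorem mul_eq_of_hasPar {b c : Bool} {p q : Pol m n} (hp : HasPar b (mulOp p))
    (hq : HasPar c (mulOp q)) : p * q = sgn b c • (q * p) := by
  have hpp : parity p = sgn true b • p := by
    have := DFunLike.congr_fun (hp true) 1
    rwa [twist_apply, map_one, twistPol_true, mulOp_apply, mul_one, LinearMap.smul_apply,
      mulOp_apply, mul_one] at this
  have hqq : parity q = sgn true c • q := by
    have := DFunLike.congr_fun (hq true) 1
    rwa [twist_apply, map_one, twistPol_true, mulOp_apply, mul_one, LinearMap.smul_apply,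
      mulOp_apply, mul_one] at this
  cases b
  · rw [IsEven.mul_comm (p := p) (by simpa [IsEven] using hpp)]; simp
  · rw [IsOdd.mul_comm (p := p) (by simpa [IsOdd] using hpp), hqq, smul_mul_assoc]

theorem ad_mulOp {b : Bool} {p : Pol m n} (hp : HasPar b (mulOp p)) (q : Pol m n) :
    ad b (mulOp p) (mulOp q) = 0 := by
  have key : ∀ c q, HasPar c (mulOp q) → ad b (mulOp p) (mulOp q) = 0 := by
    intro c q hq
    rw [ad_apply, hq b, mul_smul_comm, ← mulOp_mul, ← mulOp_mul, mul_eq_of_hasPar hq hp, sgn_comm,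
      mulOp_smul, sub_self]
  have e1 : (1 / 2 : ℂ) • (mulOp q + parityOp (mulOp q)) =
      mulOp ((1 / 2 : ℂ) • (q + parity q)) := by
    rw [mulOp_smul, mulOp_add, ← twist_true, twist_mulOp]; rfl
  have e2 : (1 / 2 : ℂ) • (mulOp q - parityOp (mulOp q)) =
      mulOp ((1 / 2 : ℂ) • (q - parity q)) := by
    rw [mulOp_smul, sub_eq_add_neg, sub_eq_add_neg, mulOp_add, ← twist_true, twist_mulOp]
    congr 2
    ext f; simp [mulOp_apply]
  rw [eq_even_add_odd (mulOp q), map_add, e1, e2,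
    key false _ (e1 ▸ hasPar_even_part (mulOp q)), key true _ (e2 ▸ hasPar_odd_part (mulOp q)),
    add_zero]

theorem ad_ad {b c : Bool} {p q : Pol m n} (hp : HasPar b (mulOp p)) (hq : HasPar c (mulOp q))
    (D : Op m n) : ad b (mulOp p) (ad c (mulOp q) D) =
      sgn b c • ad c (mulOp q) (ad b (mulOp p) D) := by
  have hpq : mulOp p * mulOp q = sgn b c • (mulOp q * mulOp p) := by
    rw [← mulOp_mul, mul_eq_of_hasPar hp hq, mulOp_smul, mulOp_mul]
  have hqp : mulOp q * mulOp p = sgn b c • (mulOp p * mulOp q) := by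
    rw [hpq, smul_smul, sgn_mul_self, one_smul]
  have h2 : twist b (twist c D) = twist c (twist b D) := by
    rw [twist_twist, twist_twist, Bool.xor_comm]
  have e1 : D * (mulOp q * mulOp p) = sgn b c • (D * (mulOp p * mulOp q)) := by
    rw [hqp, mul_smul_comm]
  have e2 : mulOp p * (mulOp q * twist c (twist b D)) =
      sgn b c • (mulOp q * (mulOp p * twist c (twist b D))) := by
    rw [← mul_assoc, hpq, smul_mul_assoc, mul_assoc]
  simp only [ad_apply, map_sub, twist_mul, hq b, hp c, h2, mul_sub, sub_mul, smul_mul_assoc,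
    mul_smul_comm, smul_sub, smul_smul, sgn_comm c b, sgn_mul_self, one_smul, mul_assoc]
  rw [e1, e2, smul_smul, sgn_mul_self, one_smul]
  abel

/-- Bracketing with a function of degree one, which is of order two in the indexing of `Fil`, lowers
the order by one. -/
theorem ad_mem_fil {b : Bool} {p : Pol m n} (hp : HasPar b (mulOp p)) (hp1 : p ∈ degLE 1) {d : ℕ}
    {D : Op m n} (hD : D ∈ Fil (d + 1)) : ad b (mulOp p) D ∈ Fil d := by
  have key : ∀ c D, HasPar c D → D ∈ Fil (d + 1) → ad b (mulOp p) D ∈ Fil d := by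
    intro c D hc hD
    have h := bracket_mem_fil hp hc (mulOp_mem_fil hp1) hD
    have h2 : ad b (mulOp p) D = -(sgn b c) • bracket b (mulOp p) D := by
      rw [ad_apply, bracket, hc b, op_neg_smul, smul_mul_assoc, smul_sub, smul_smul, sgn_mul_self,
        one_smul, mul_smul_comm]
      abel
    rw [h2]
    exact Submodule.smul_mem _ _ (by rwa [show 1 + 1 + (d + 1) - 3 = d by omega] at h)
  have hD' := twist_mem_fil true hD
  rw [eq_even_add_odd D, map_add]
  exact Submodule.add_mem _
    (key false _ (hasPar_even_part D) (Submodule.smul_mem _ _ (Submodule.add_mem _ hD hD')))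
    (key true _ (hasPar_odd_part D) (Submodule.smul_mem _ _ (Submodule.sub_mem _ hD hD')))

theorem isCoordSystem_coord : IsCoordSystem (m := m) (n := n) coord pd where
  mem_degLE a := by
    have := coord_mul_mem_degLE a (ofBase_mem_degLE (1 : Base m n) 0)
    simpa using this
  hasPar := hasPar_coord
  hasPar_deriv := hasPar_pd
  rLin := rLin_pd
  ad_deriv a b := ad_coord_pd a b
  deriv_one := pd_one
  pfin := finite_pd_ne_zero
  ad_coord _ _ h := h

/-- The part of order `r` of the Taylor expansion of an operator, times `r!`. -/
def taylor (y : Idx → Pol m n) (δ : Idx → Op m n) : ℕ → Op m n → Op m n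
  | 0, D => mulOp (D 1)
  | r + 1, D => psum fun b => taylor y δ r (ad (par b) (mulOp (y b)) D) * δ b

theorem IsCoordSystem.pfin_taylor (h : IsCoordSystem y δ) (D : Idx → Op m n) :
    PFin fun b => D b * δ b := h.pfin.mul_left D

theorem IsCoordSystem.taylor_smul (h : IsCoordSystem y δ) (r : ℕ) (c : ℂ) (D : Op m n) :
    taylor y δ r (c • D) = c • taylor y δ r D := by
  induction r generalizing D with
  | zero => exact mulOp_smul _ _
  | succ r ih =>
    simp only [taylor, map_smul, ih, smul_mul_assoc]
    rw [psum_smul (h.pfin_taylor _)]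

theorem IsCoordSystem.taylor_one (h : IsCoordSystem y δ) (r : ℕ) (D : Op m n) :
    taylor y δ (r + 1) D 1 = 0 := by
  rw [taylor, psum_apply (h.pfin_taylor _)]
  refine finsum_eq_zero_of_forall_eq_zero fun b => ?_
  rw [Module.End.mul_apply, h.deriv_one, map_zero]

theorem IsCoordSystem.taylor_rLin (h : IsCoordSystem y δ) (r : ℕ) (D : Op m n) :
    RLin (taylor y δ r D) := by
  induction r generalizing D with
  | zero => exact rLin_mulOp _
  | succ r ih => exact RLin.psum (h.pfin_taylor _) fun b => (ih _).mul (h.rLin b)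

/-- The commutator with `y c` removes one occurrence of `δ c`. The outermost derivative contributes
one term and, by induction, the inner ones contribute `r + 1` equal terms, because twisted
commutators with coordinates supercommute. -/
theorem IsCoordSystem.ad_taylor (h : IsCoordSystem y δ) (r : ℕ) (D : Op m n) (c : Idx) :
    ad (par c) (mulOp (y c)) (taylor y δ (r + 1) D) =
      ((r + 1 : ℕ) : ℂ) • taylor y δ r (ad (par c) (mulOp (y c)) D) := by
  induction r generalizing D with
  | zero =>
    rw [show taylor y δ (0 + 1) D = psum fun b => taylor y δ 0 (ad (par b) (mulOp (y b)) D) * δ b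
      from rfl, ad_psum (h.pfin_taylor _), psum_eq_single c]
    · rw [ad_mul, h.ad_deriv]
      simp only [taylor]
      rw [ad_mulOp (h.hasPar c)]
      simp
    · intro b hb
      rw [ad_mul, h.ad_deriv, if_neg hb]
      simp only [taylor]
      rw [ad_mulOp (h.hasPar c)]
      simp
  | succ r ih =>
    rw [taylor, ad_psum (h.pfin_taylor _)]
    have h1 : ∀ b, ad (par c) (mulOp (y c))
        (taylor y δ (r + 1) (ad (par b) (mulOp (y b)) D) * δ b) =
        taylor y δ (r + 1) (ad (par b) (mulOp (y b)) D) * (if b = c then 1 else 0) +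
        ((r + 1 : ℕ) : ℂ) • (taylor y δ r (ad (par b) (mulOp (y b)) (ad (par c) (mulOp (y c)) D))
          * δ b) := by
      intro b
      rw [ad_mul, h.ad_deriv, ih, ad_ad (h.hasPar c) (h.hasPar b), h.taylor_smul,
        h.hasPar_deriv b (par c)]
      congr 1
      rw [smul_mul_assoc, smul_mul_assoc, mul_smul_comm, smul_smul (sgn _ _), sgn_mul_self,
        one_smul]
    rw [psum_congr h1, ← psum_add, ← psum_smul (h.pfin_taylor _), psum_eq_single c]
    · rw [if_pos rfl, mul_one]
      simp only [taylor]
      push_cast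
      module
    · intro b hb
      rw [if_neg hb, mul_zero]
    · refine PFin.of_finite ((Set.finite_singleton c).subset fun b hb => ?_)
      by_contra hbc
      exact hb (by show _ * _ = _; rw [if_neg (by simpa using hbc), mul_zero])
    · exact (h.pfin_taylor _).smul _

theorem IsCoordSystem.ad_mem (h : IsCoordSystem y δ) {d : ℕ} {D : Op m n} (hD : D ∈ Fil (d + 1))
    (a : Idx) : ad (par a) (mulOp (y a)) D ∈ Fil d :=
  ad_mem_fil (h.hasPar a) (h.mem_degLE a) hD

/-- The difference between `D` and its Taylor sum kills `1`. By `IsCoordSystem.ad_taylor` and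
induction on the order it also supercommutes with the coordinates, so it is multiplication by its
value at `1`, which is zero. -/
theorem IsCoordSystem.eq_sum_taylor (h : IsCoordSystem y δ) {d : ℕ} {D : Op m n} (hD : D ∈ Fil d) :
    D = ∑ r ∈ Finset.range d, ((r.factorial : ℂ)⁻¹) • taylor y δ r D := by
  induction d generalizing D with
  | zero => simpa using mem_fil_zero.1 hD
  | succ d ih =>
    rw [← sub_eq_zero]
    set E := D - ∑ r ∈ Finset.range (d + 1), ((r.factorial : ℂ)⁻¹) • taylor y δ r D with hE
    have hR : RLin E := by
      refine hD.1.sub ?_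
      refine Finset.sum_induction _ RLin (fun _ _ => RLin.add) RLin.zero fun r _ => ?_
      exact (h.taylor_rLin r D).smul _
    have hE1 : E 1 = 0 := by
      rw [hE, Finset.sum_range_succ', LinearMap.sub_apply, LinearMap.add_apply,
        LinearMap.sum_apply, Finset.sum_eq_zero]
      · simp [taylor, mulOp_apply]
      · intro r _
        rw [LinearMap.smul_apply, h.taylor_one, smul_zero]
    have had : ∀ a, ad (par a) (mulOp (y a)) E = 0 := by
      intro a
      rw [hE, map_sub, sub_eq_zero, map_sum, Finset.sum_range_succ']
      have h0 : ad (par a) (mulOp (y a)) (((Nat.factorial 0 : ℂ)⁻¹) • taylor y δ 0 D) = 0 := by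
        rw [map_smul, taylor, ad_mulOp (h.hasPar a), smul_zero]
      rw [h0, add_zero]
      refine (ih (h.ad_mem hD a)).trans (Finset.sum_congr rfl fun r _ => ?_)
      rw [map_smul, h.ad_taylor, smul_smul]
      congr 1
      rw [Nat.factorial_succ]
      push_cast
      have h1 : (r.factorial : ℂ) ≠ 0 := Nat.cast_ne_zero.2 (Nat.factorial_ne_zero r)
      have h2 : (r : ℂ) + 1 ≠ 0 := by exact_mod_cast Nat.succ_ne_zero r
      field_simp
    rw [eq_mulOp_of_ad_coord hR (h.ad_coord E hR had), hE1, mulOp_zero]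

/-- The iterated twisted commutator with the coordinates of a word. -/
def adWord (y : Idx → Pol m n) (l : List Idx) : Op m n →ₗ[ℂ] Op m n :=
  (l.map fun b => (ad (par b) (mulOp (y b)) : Module.End ℂ (Op m n))).prod

/-- The last letter of a word acts first and can take only finitely many values on a given
polynomial; the remaining word is handled by induction. -/
theorem pfin_word (hδ : PFin δ) (r : ℕ) : PFin fun l : List Idx =>
    if l.length = r then (l.map δ).prod else 0 := by
  induction r with
  | zero =>
    refine PFin.of_finite ((Set.finite_singleton []).subset fun l hl => ?_)
    by_contra hc
    refine hl ?_
    show (if l.length = 0 then (l.map δ).prod else 0) = 0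
    rw [if_neg (fun h => hc (List.length_eq_zero_iff.1 h))]
  | succ r ih =>
    intro f
    have := PFin.prod_mul (A := fun _ : Idx => fun l : List Idx =>
      if l.length = r then (l.map δ).prod else 0) (fun _ => ih) hδ f
    refine (this.image fun p => p.2 ++ [p.1]).subset ?_
    intro l hl
    have hlen : l.length = r + 1 := by
      by_contra hc
      exact hl (by show (if l.length = r + 1 then (l.map δ).prod else 0) f = 0; rw [if_neg hc]; rfl)
    obtain ⟨l', b, rfl⟩ : ∃ l' b, l = l' ++ [b] := by
      rcases List.eq_nil_or_concat l with rfl | ⟨l', b, h⟩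
      · simp at hlen
      · exact ⟨l', b, by simpa using h⟩
    have hlen' : l'.length = r := by simpa using hlen
    refine ⟨(b, l'), ?_, rfl⟩
    intro h0
    refine hl ?_
    show (if (l' ++ [b]).length = r + 1 then ((l' ++ [b]).map δ).prod else 0) f = 0
    rw [if_pos hlen]
    have h0' : ((if l'.length = r then (l'.map δ).prod else 0) * δ b) f = 0 := h0
    rw [if_pos hlen'] at h0'
    simpa using h0'

theorem pfin_expansion (hδ : PFin δ) {d : ℕ} {p : List Idx → Pol m n}
    (hp : ∀ l, d < l.length → p l = 0) : PFin fun l => mulOp (p l) * (l.map δ).prod := fun f => by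
  refine ((Finset.range (d + 1)).finite_toSet.biUnion fun r _ => pfin_word hδ r f).subset ?_
  intro l hl
  by_cases hld : l.length ≤ d
  · refine Set.mem_biUnion (x := l.length) (by simpa using Nat.lt_succ_of_le hld) fun h0 => hl ?_
    show mulOp (p l) ((l.map δ).prod f) = 0
    have h1 : (if l.length = l.length then (l.map δ).prod else 0) f = 0 := h0
    rw [if_pos rfl] at h1
    rw [h1, map_zero]
  · refine absurd ?_ hl
    show mulOp (p l) ((l.map δ).prod f) = 0
    rw [hp l (not_le.1 hld), mulOp_zero, LinearMap.zero_apply]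

theorem adWord_append (l : List Idx) (b : Idx) (D : Op m n) :
    adWord y (l ++ [b]) D = adWord y l (ad (par b) (mulOp (y b)) D) := by
  simp [adWord]

theorem PFin.adWord {ι : Type} {T : ι → Op m n} (h : PFin T) (l : List Idx) :
    PFin fun i => adWord y l (T i) := by
  induction l with
  | nil => simpa [SuperAiry.adWord] using h
  | cons b l ih =>
    have := PFin.ad ih (par b) (mulOp (y b))
    simpa [SuperAiry.adWord] using this

theorem IsCoordSystem.adWord_mem (h : IsCoordSystem y δ) {d : ℕ} {D : Op m n} (l : List Idx)
    (hD : D ∈ Fil (d + 1)) (hl : l.length ≤ d) : adWord y l D ∈ Fil (d - l.length + 1) := by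
  induction l with
  | nil => simpa [adWord] using hD
  | cons b l ih =>
    rw [List.length_cons] at hl ⊢
    have h1 := h.ad_mem (show adWord y l D ∈ Fil (d - (l.length + 1) + 1 + 1) by
      rw [show d - (l.length + 1) + 1 = d - l.length by omega]
      exact ih (by omega)) b
    simpa [adWord] using h1

/-- The words of length `r` in the Taylor expansion. -/
def taylorTerm (y : Idx → Pol m n) (δ : Idx → Op m n) (r : ℕ) (D : Op m n) (l : List Idx) : Op m n :=
  mulOp (adWord y l D 1) * if l.length = r then (l.map δ).prod else 0

theorem IsCoordSystem.pfin_taylorTerm (h : IsCoordSystem y δ) (r : ℕ) (D : Op m n) :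
    PFin (taylorTerm y δ r D) :=
  (pfin_word h.pfin r).mul_left _

/-- Unfolding the recursion: each level appends a letter at the right end of the word, both for the
derivatives and for the iterated commutators. -/
theorem IsCoordSystem.taylor_eq_psum (h : IsCoordSystem y δ) (r : ℕ) (D : Op m n) :
    taylor y δ r D = psum (taylorTerm y δ r D) := by
  induction r generalizing D with
  | zero =>
    rw [psum_eq_single []]
    · simp [taylorTerm, taylor, adWord]
    · intro l hl
      rw [taylorTerm, if_neg (fun h => hl (List.length_eq_zero_iff.1 h)), mul_zero]
  | succ r ih =>
    have hinj : Function.Injective fun p : Idx × List Idx => p.2 ++ [p.1] := by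
      rintro ⟨b, l⟩ ⟨b', l'⟩ hbl
      obtain ⟨h1, h2⟩ := List.append_inj' hbl rfl
      simp at h2
      exact Prod.ext h2 h1
    have hterm : ∀ p : Idx × List Idx, taylorTerm y δ (r + 1) D (p.2 ++ [p.1]) =
        taylorTerm y δ r (ad (par p.1) (mulOp (y p.1)) D) p.2 * δ p.1 := by
      rintro ⟨b, l⟩
      simp only [taylorTerm, adWord_append, List.length_append, List.length_singleton,
        Nat.add_right_cancel_iff, List.map_append, List.prod_append, List.map_cons, List.map_nil,
        List.prod_cons, List.prod_nil, mul_one]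
      split_ifs <;> simp [mul_assoc]
    rw [psum_comp_injective (h.pfin_taylorTerm _ _) hinj]
    · rw [psum_congr hterm, psum_prod
        (PFin.prod_mul (fun b => h.pfin_taylorTerm r (ad (par b) (mulOp (y b)) D)) h.pfin)]
      refine psum_congr fun b => ?_
      rw [ih, psum_mul_right (h.pfin_taylorTerm _ _)]
    · intro l hl
      rw [taylorTerm, if_neg, mul_zero]
      intro hlen
      rcases List.eq_nil_or_concat l with rfl | ⟨l', b, h⟩
      · simp at hlen
      · exact hl ⟨(b, l'), by simpa using h.symm⟩

/-- The coefficients of the Taylor expansion of an operator of degree `≤ d`. -/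
def taylorCoeff (y : Idx → Pol m n) (d : ℕ) (D : Op m n) (l : List Idx) : Pol m n :=
  if l.length ≤ d then ((l.length.factorial : ℂ)⁻¹) • adWord y l D 1 else 0

/-- The degree bound on the coefficients holds because every commutator with a coordinate lowers the
order by one and an operator of degree `e` sends `1` to a polynomial of degree at most `e`. -/
theorem IsCoordSystem.isExpansion (h : IsCoordSystem y δ) {d : ℕ} {D : Op m n}
    (hD : D ∈ Fil (d + 1)) : IsExpansion δ d (taylorCoeff y d D) D := by
  refine ⟨fun l hl => if_neg (not_le.2 hl), fun l => ?_, fun f => ?_⟩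
  · rw [taylorCoeff]
    split_ifs with hl
    · exact Submodule.smul_mem _ _ (apply_one_mem_degLE (h.adWord_mem l hD hl))
    · exact Submodule.zero_mem _
  · conv_lhs => rw [h.eq_sum_taylor hD]
    have h1 : ∀ r, ((r.factorial : ℂ)⁻¹) • taylor y δ r D =
        psum fun l => ((r.factorial : ℂ)⁻¹) • taylorTerm y δ r D l := fun r => by
      rw [h.taylor_eq_psum, psum_smul (h.pfin_taylorTerm r D)]
    have hp : ∀ r : ℕ, PFin fun l => ((r.factorial : ℂ)⁻¹) • taylorTerm y δ r D l :=
      fun r => (h.pfin_taylorTerm r D).smul _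
    simp only [h1]
    rw [psum_finset_sum _ hp]
    have h2 : ∀ l, ∑ r ∈ Finset.range (d + 1), ((r.factorial : ℂ)⁻¹) • taylorTerm y δ r D l =
        mulOp (taylorCoeff y d D l) * (l.map δ).prod := by
      intro l
      by_cases hl : l.length ≤ d
      · rw [Finset.sum_eq_single l.length]
        · rw [taylorTerm, if_pos rfl, taylorCoeff, if_pos hl, mulOp_smul, smul_mul_assoc]
        · intro r _ hr
          rw [taylorTerm, if_neg (Ne.symm hr), mul_zero, smul_zero]
        · intro hr
          exact absurd (Finset.mem_range.2 (Nat.lt_succ_of_le hl)) hr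
      · rw [taylorCoeff, if_neg hl, mulOp_zero, zero_mul]
        refine Finset.sum_eq_zero fun r hr => ?_
        rw [taylorTerm, if_neg, mul_zero, smul_zero]
        rintro rfl
        exact hl (Nat.lt_succ_iff.1 (Finset.mem_range.1 hr))
    have hp2 : PFin fun l => mulOp (taylorCoeff y d D l) * (l.map δ).prod :=
      pfin_expansion h.pfin fun l hl => if_neg (not_le.2 hl)
    rw [psum_congr h2, psum_apply hp2]
    rfl

theorem word_mem_fil (l : List Idx) : ((l.map pd).prod : Op m n) ∈ Fil (l.length + 1) := by
  induction l with
  | nil => simpa using one_mem_fil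
  | cons a l ih =>
    rw [List.map_cons, List.prod_cons, List.length_cons]
    have := mul_mem_fil (d := 1) (pd_mem_fil (m := m) (n := n) a) ih
    rwa [add_comm 1] at this

/-- The degree filtration of the completed Weyl algebra agrees with the intrinsic one. -/
theorem mem_weylFiltration_iff {d : ℕ} {D : Op m n} :
    D ∈ weylFiltration m n d ↔ D ∈ Fil (d + 1) := by
  constructor
  · rintro ⟨p, h0, hp, hD⟩
    have hpf := pfin_expansion (m := m) (n := n) finite_pd_ne_zero h0
    have : D = psum fun l => mulOp (p l) * ((l.map pd).prod : Op m n) := by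
      ext f
      rw [psum_apply hpf, hD]
      rfl
    rw [this]
    refine psum_mem_fil hpf fun l => ?_
    by_cases hld : l.length ≤ d
    · have := mul_mem_fil (mulOp_mem_fil (hp l)) (word_mem_fil l)
      rwa [Nat.sub_add_cancel hld] at this
    · rw [h0 l (not_le.1 hld), mulOp_zero, zero_mul]
      exact Submodule.zero_mem _
  · intro hD
    exact ⟨_, isCoordSystem_coord.isExpansion hD⟩

end Taylor

/-! ### Shifted coordinates -/

section Shifted

theorem hasPar_ofBase_of_isOdd {r : Base m n} (h : IsOdd r) :
    HasPar true (mulOp (ofBase r : Pol m n)) :=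
  HasPar.of_true (by
    rw [twist_mulOp, twistPol_true, parity_ofBase, show parity r = -r from h, map_neg,
      ← neg_one_smul ℂ (ofBase r), mulOp_smul]; simp)

theorem hasPar_ofBase_of_isEven {r : Base m n} (h : IsEven r) :
    HasPar false (mulOp (ofBase r : Pol m n)) :=
  HasPar.of_true (by
    rw [twist_mulOp, twistPol_true, parity_ofBase, show parity r = r from h]; simp)

theorem RLin.mul_ofBase {D : Op m n} (hD : RLin D) {b : Bool} {r : Base m n}
    (hr : HasPar b (mulOp (ofBase r : Pol m n))) :
    D * mulOp (ofBase r) = mulOp (ofBase r) * SuperAiry.twist b D := by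
  have key : ∀ c D, HasPar c D → RLin D →
      D * mulOp (ofBase r) = mulOp (ofBase r) * SuperAiry.twist b D := by
    intro c D hc hD
    rw [hD.mul_mulOp_ofBase hc, hr c, hc b, smul_mul_assoc, mul_smul_comm, sgn_comm]
  have hD' := hD.twist true
  rw [eq_even_add_odd D, add_mul, map_add, mul_add,
    key false _ (hasPar_even_part D) ((hD.add hD').smul _),
    key true _ (hasPar_odd_part D) ((hD.sub hD').smul _)]

theorem ad_ofBase_mul {b c : Bool} {r : Base m n} (hr : HasPar b (mulOp (ofBase r : Pol m n)))
    (x : Op m n) {D : Op m n} (hD : RLin D) :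
    ad (xor c b) (mulOp (ofBase r) * x) D = mulOp (ofBase r) * ad c x (twist b D) := by
  rw [ad_apply, ad_apply, ← mul_assoc, hD.mul_ofBase hr, twist_twist, mul_sub, mul_assoc, mul_assoc]

theorem ad_add_left (b : Bool) (x y D : Op m n) : ad b (x + y) D = ad b x D + ad b y D := by
  simp only [ad_apply, mul_add, add_mul]; abel

theorem ad_zero_left (b : Bool) (D : Op m n) : ad b 0 D = 0 := by
  simp [ad_apply]

theorem ad_sum_left {σ : Type} (b : Bool) (s : Finset σ) (x : σ → Op m n) (D : Op m n) :
    ad b (∑ i ∈ s, x i) D = ∑ i ∈ s, ad b (x i) D := by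
  classical
  induction s using Finset.induction_on with
  | empty => simp [ad_zero_left]
  | insert a s ha ih => rw [Finset.sum_insert ha, ad_add_left, ih, Finset.sum_insert ha]

/-- The shift `∑ c_a x^a` of the distinguished coordinate. -/
def shiftSum (c : Idx →₀ Base m n) : Pol m n :=
  ∑ a ∈ c.support.erase theta0, ofBase (c a) * coord a

/-- The coordinates dual to `shiftedPd c`. -/
def shiftedCoord (c : Idx →₀ Base m n) (a : Idx) : Pol m n :=
  if a = theta0 then coord theta0 - shiftSum c else coord a

variable {c : Idx →₀ Base m n}

theorem hasPar_shift (hodd : ∀ k, IsOdd (c (Sum.inl k))) (heven : ∀ k, IsEven (c (Sum.inr k)))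
    (a : Idx) : HasPar (!par a) (mulOp (ofBase (c a) : Pol m n)) := by
  rcases a with k | k
  · exact hasPar_ofBase_of_isOdd (hodd k)
  · exact hasPar_ofBase_of_isEven (heven k)

theorem mulOp_sum {σ : Type} (s : Finset σ) (p : σ → Pol m n) :
    mulOp (∑ i ∈ s, p i) = ∑ i ∈ s, mulOp (p i) := by
  ext f; simp [mulOp_apply, Finset.sum_mul]

theorem mulOp_sub (p q : Pol m n) : mulOp (p - q) = mulOp p - mulOp q := by
  ext f; simp [mulOp_apply, sub_mul]

theorem ad_shiftSum (hodd : ∀ k, IsOdd (c (Sum.inl k))) (heven : ∀ k, IsEven (c (Sum.inr k)))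
    {D : Op m n} (hD : RLin D) : ad true (mulOp (shiftSum c)) D =
      ∑ a ∈ c.support.erase theta0, mulOp (ofBase (c a)) *
        ad (par a) (mulOp (coord a)) (twist (!par a) D) := by
  rw [shiftSum, mulOp_sum, ad_sum_left]
  refine Finset.sum_congr rfl fun a _ => ?_
  rw [mulOp_mul, ← ad_ofBase_mul (hasPar_shift hodd heven a) _ hD]
  congr 2
  cases par a <;> rfl

/-- The term `c_b ∂_{θ⁰}` in the derivative with label `b` is what makes it kill the new coordinate
`θ⁰ - ∑ c_a x^a`. The opposite parity of the coefficients makes the new coordinate odd and keeps the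
parities of the derivatives. -/
theorem isCoordSystem_shifted (hodd : ∀ k, IsOdd (c (Sum.inl k)))
    (heven : ∀ k, IsEven (c (Sum.inr k))) : IsCoordSystem (shiftedCoord c) (shiftedPd c) := by
  have hsum : HasPar true (mulOp (shiftSum c)) := by
    rw [shiftSum, mulOp_sum]
    refine Finset.sum_induction _ (HasPar true) (fun _ _ => HasPar.add) (HasPar.zero _) ?_
    intro a _
    rw [mulOp_mul]
    have := (hasPar_shift hodd heven a).mul (hasPar_coord a)
    rwa [show xor (!par a) (par a) = true by cases par a <;> rfl] at this
  have hpt : par theta0 = true := rfl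
  refine ⟨?_, ?_, ?_, ?_, ?_, ?_, ?_, ?_⟩
  · intro a
    rw [shiftedCoord]
    split_ifs
    · refine Submodule.sub_mem _ (isCoordSystem_coord.mem_degLE _) ?_
      exact Submodule.sum_mem _ fun a _ =>
        ofBase_mul_mem_degLE _ (isCoordSystem_coord.mem_degLE a)
    · exact isCoordSystem_coord.mem_degLE a
  · intro a
    rw [shiftedCoord]
    split_ifs with h
    · rw [mulOp_sub, h]; exact (hasPar_coord theta0).sub hsum
    · exact hasPar_coord a
  · intro a
    rw [shiftedPd]
    split_ifs with h
    · rw [h]; exact hasPar_pd _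
    · have := (hasPar_shift hodd heven a).mul (hasPar_pd theta0)
      rw [hpt, show xor (!par a) true = par a by cases par a <;> rfl] at this
      exact (hasPar_pd a).add this
  · intro a
    rw [shiftedPd]
    split_ifs with h
    · exact rLin_pd _
    · exact (rLin_pd a).add ((rLin_mulOp _).mul (rLin_pd _))
  · intro a b
    have hcoord : ∀ a b, b ≠ theta0 →
        ad (par a) (mulOp (coord a)) (mulOp (ofBase (c b)) * (pd theta0 : Op m n)) =
          if theta0 = a then mulOp (ofBase (c b)) else 0 := by
      intro a b _
      rw [ad_mul, ad_mulOp (hasPar_coord a), zero_mul, add_zero, ad_coord_pd]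
      split_ifs <;> simp
    have hs : ∀ b : Idx, ad true (mulOp (shiftSum c)) (pd b : Op m n) =
        if b = theta0 then 0 else mulOp (ofBase (c b)) := by
      intro b
      rw [ad_shiftSum hodd heven (rLin_pd b)]
      have h1 : ∀ a, mulOp (ofBase (c a)) *
          ad (par a) (mulOp (coord a)) (twist (!par a) (pd b : Op m n)) =
          if b = a then mulOp (ofBase (c a)) else 0 := by
        intro a
        rw [twist_pd, map_smul, ad_coord_pd]
        split_ifs with h
        · subst h
          cases hb : par b <;> simp
        · simp
      simp only [h1]
      rw [Finset.sum_ite_eq]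
      by_cases hb : b = theta0
      · simp [hb]
      · by_cases hcb : c b = 0
        · simp [hb, hcb, mulOp_zero]
        · simp [hb, hcb]
    by_cases ha : a = theta0
    · subst ha
      have hy : mulOp (shiftedCoord c theta0) =
          mulOp (coord theta0) + -mulOp (shiftSum c) := by
        rw [shiftedCoord, if_pos rfl, mulOp_sub, sub_eq_add_neg]
      have hneg : ∀ D : Op m n, ad true (-mulOp (shiftSum c)) D =
          -ad true (mulOp (shiftSum c)) D := by
        intro D; simp only [ad_apply, op_mul_neg, op_neg_mul]; abel
      rw [hpt, hy, ad_add_left, hneg]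
      by_cases hb : b = theta0
      · subst hb
        rw [shiftedPd, if_pos rfl, hs, if_pos rfl, if_pos rfl]
        have := ad_coord_pd (m := m) (n := n) theta0 theta0
        rw [hpt, if_pos rfl] at this
        rw [this]; simp
      -- Here the contribution of `c_b ∂_{θ⁰}` to the coordinate `θ⁰` cancels that of `∂_b` to the
      -- shift.
      · rw [shiftedPd, if_neg hb, map_add, map_add, hs, if_neg hb, if_neg hb]
        have h1 := ad_coord_pd (m := m) (n := n) theta0 b
        have h2 := hcoord theta0 b hb
        rw [hpt] at h1 h2
        rw [h1, h2, if_neg hb, if_pos rfl, ad_mul, hs, if_pos rfl, ad_mulOp hsum]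
        simp
    · rw [shiftedCoord, if_neg ha]
      by_cases hb : b = theta0
      · subst hb
        rw [shiftedPd, if_pos rfl, ad_coord_pd]
      · rw [shiftedPd, if_neg hb, map_add, hcoord a b hb, if_neg (Ne.symm ha), add_zero,
          ad_coord_pd]
  · intro a
    rw [shiftedPd]
    split_ifs <;> simp [pd_one]
  -- Outside the finite support of `c` the shifted derivatives are the old ones, up to `θ⁰`.
  · intro f
    refine ((finite_pd_ne_zero f).union c.finite_support).subset fun b hb => ?_
    by_contra hn
    simp only [Set.mem_union, not_or, Function.mem_support, not_not] at hn
    have h1 : pd b f = 0 := by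
      by_contra h; exact hn.1 h
    refine hb ?_
    show shiftedPd c b f = 0
    rw [shiftedPd]
    split_ifs with h
    · rw [← h]; exact h1
    · rw [LinearMap.add_apply, h1, hn.2, map_zero, mulOp_zero]; simp
  -- The old coordinate `θ⁰` is the new one plus a combination of the other coordinates over `R`,
  -- and commutators with the latter vanish already.
  · intro D hD h a
    have hx : ∀ a, a ≠ theta0 → ad (par a) (mulOp (coord a)) D = 0 := by
      intro a ha
      have := h a
      rwa [shiftedCoord, if_neg ha] at this
    by_cases ha : a = theta0
    · subst ha
      have h0 := h theta0
      rw [shiftedCoord, if_pos rfl] at h0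
      have : mulOp (coord theta0) = mulOp (coord theta0 - shiftSum c) + mulOp (shiftSum c) := by
        rw [← mulOp_add, sub_add_cancel]
      rw [this, ad_add_left, h0, zero_add, hpt, ad_shiftSum hodd heven hD]
      refine Finset.sum_eq_zero fun a ha => ?_
      have h1 := twist_ad (c := !par a) (hasPar_coord a) D
      rw [hx a (Finset.ne_of_mem_erase ha), map_zero] at h1
      have h2 : ad (par a) (mulOp (coord a)) (twist (!par a) D) = 0 := by
        have h3 := congrArg (fun x => sgn (!par a) (par a) • x) h1
        simpa [smul_smul, sgn_mul_self] using h3.symm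
      rw [h2, mul_zero]
    · exact hx a ha

end Shifted

/-! ### Laurent series of operators -/

section Series

/-- The ring of Laurent series in `ħ` with coefficients in the operators. -/
def Ser (m n : ℕ) : Type := HOp m n

instance : Ring (Ser m n) := inferInstanceAs (Ring (HOp m n))
instance : Algebra ℂ (Ser m n) := inferInstanceAs (Algebra ℂ (HOp m n))

/-- The coefficient of `ħ^k`. -/
def Ser.coeff (k : ℤ) : Ser m n →ₗ[ℂ] Op m n where
  toFun S := HahnSeries.coeff (show HOp m n from S) k
  map_add' _ _ := rfl
  map_smul' _ _ := rfl

/-- The series `ħ^k D`. -/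
def mono (k : ℤ) : Op m n →ₗ[ℂ] Ser m n where
  toFun D := (HahnSeries.single k D : HOp m n)
  map_add' D E := HahnSeries.ext (funext fun l => by
    show (HahnSeries.single k (D + E) : HOp m n).coeff l =
      (HahnSeries.single k D : HOp m n).coeff l + (HahnSeries.single k E : HOp m n).coeff l
    simp only [HahnSeries.coeff_single]
    split_ifs <;> simp)
  map_smul' c D := HahnSeries.ext (funext fun l => by
    show (HahnSeries.single k (c • D) : HOp m n).coeff l =
      c • (HahnSeries.single k D : HOp m n).coeff l
    simp only [HahnSeries.coeff_single]
    split_ifs <;> simp)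

theorem Ser.ext {S T : Ser m n} (h : ∀ k, Ser.coeff k S = Ser.coeff k T) : S = T :=
  HahnSeries.ext (funext h)

theorem coeff_mono (k l : ℤ) (D : Op m n) :
    Ser.coeff l (mono k D) = if l = k then D else 0 := by
  show (HahnSeries.single k D : HOp m n).coeff l = _
  by_cases h : l = k
  · rw [if_pos h, h]; exact HahnSeries.coeff_single_same k D
  · rw [if_neg h]; exact HahnSeries.coeff_single_of_ne h

theorem coeff_mono_same (k : ℤ) (D : Op m n) : Ser.coeff k (mono k D) = D := by
  rw [coeff_mono, if_pos rfl]

theorem coeff_mono_of_ne {k l : ℤ} (h : l ≠ k) (D : Op m n) : Ser.coeff l (mono k D) = 0 := by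
  rw [coeff_mono, if_neg h]

theorem mono_mul_mono (k l : ℤ) (D E : Op m n) :
    mono k D * mono l E = mono (k + l) (D * E) := by
  have h : (HahnSeries.single k D : HOp m n) * (HahnSeries.single l E : HOp m n) =
    HahnSeries.single (k + l) (D * E) := HahnSeries.single_mul_single
  exact h

theorem coeff_mono_mul (k l : ℤ) (D : Op m n) (S : Ser m n) :
    Ser.coeff l (mono k D * S) = D * Ser.coeff (l - k) S := by
  have h : ∀ S : HOp m n, ((HahnSeries.single k D : HOp m n) * S).coeff l = D * S.coeff (l - k) :=
    fun S => by
      have := HahnSeries.coeff_single_mul_add (r := D) (x := S) (a := l - k) (b := k)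
      rwa [sub_add_cancel] at this
  exact h S

theorem coeff_mul_mono (k l : ℤ) (D : Op m n) (S : Ser m n) :
    Ser.coeff l (S * mono k D) = Ser.coeff (l - k) S * D := by
  have h : ∀ S : HOp m n, (S * (HahnSeries.single k D : HOp m n)).coeff l = S.coeff (l - k) * D :=
    fun S => by
      have := HahnSeries.coeff_mul_single_add (r := D) (x := S) (a := l - k) (b := k)
      rwa [sub_add_cancel] at this
  exact h S

theorem mono_one : mono 0 (1 : Op m n) = 1 := rfl

/-- The coefficients below `ħ^N` vanish. -/
def LB (N : ℤ) (S : Ser m n) : Prop := ∀ k < N, Ser.coeff k S = 0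

theorem exists_lb (S : Ser m n) : ∃ N, LB N S := by
  by_cases h : (show HOp m n from S) = 0
  · exact ⟨0, fun k _ => by rw [show S = 0 from h, map_zero]⟩
  · exact ⟨(show HOp m n from S).order, fun k hk => HahnSeries.coeff_eq_zero_of_lt_order hk⟩

theorem LB.mono {M N : ℤ} {S : Ser m n} (h : LB N S) (hM : M ≤ N) : LB M S :=
  fun k hk => h k (hk.trans_le hM)

theorem LB.add {N : ℤ} {S T : Ser m n} (hS : LB N S) (hT : LB N T) : LB N (S + T) :=
  fun k hk => by rw [map_add, hS k hk, hT k hk, add_zero]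

theorem LB.sub {N : ℤ} {S T : Ser m n} (hS : LB N S) (hT : LB N T) : LB N (S - T) :=
  fun k hk => by rw [map_sub, hS k hk, hT k hk, sub_zero]

theorem LB.smul {N : ℤ} {S : Ser m n} (hS : LB N S) (c : ℂ) : LB N (c • S) :=
  fun k hk => by rw [map_smul, hS k hk, smul_zero]

theorem LB.zero (N : ℤ) : LB N (0 : Ser m n) := fun k _ => map_zero _

theorem lb_mono (k : ℤ) (D : Op m n) : LB k (SuperAiry.mono k D) :=
  fun l hl => coeff_mono_of_ne hl.ne D

/-- The convolution is written over a window depending only on lower bounds. When the factors run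
through families with common bounds, the window is the same for all members, and finiteness of
families passes to products. -/
theorem coeff_mul_of_lb {M N : ℤ} {X Y : Ser m n} (hX : LB M X) (hY : LB N Y) (k : ℤ) :
    Ser.coeff k (X * Y) =
      ∑ i ∈ Finset.Icc M (k - N), Ser.coeff i X * Ser.coeff (k - i) Y := by
  have h := HahnSeries.coeff_mul (x := (show HOp m n from X)) (y := (show HOp m n from Y)) (a := k)
  refine (show Ser.coeff k (X * Y) = _ from h).trans ?_
  symm
  refine Finset.sum_bij_ne_zero (fun i _ _ => (i, k - i)) ?_ ?_ ?_ ?_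
  · intro i _ hi
    rw [Finset.mem_antidiagonal]
    refine ⟨?_, ?_, ?_⟩
    · intro h0
      exact hi (by rw [show Ser.coeff i X = 0 from h0, zero_mul])
    · intro h0
      exact hi (by rw [show Ser.coeff (k - i) Y = 0 from h0, mul_zero])
    · simp
  · intro i _ _ j _ _ hij
    exact congrArg Prod.fst hij
  · rintro ⟨i, j⟩ hij hne
    rw [Finset.mem_antidiagonal] at hij
    obtain ⟨h1, h2, h3⟩ := hij
    have hj : j = k - i := by rw [← h3]; simp
    have hi1 : M ≤ i := by
      by_contra hc
      exact h1 (hX i (not_le.1 hc))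
    have hj1 : N ≤ j := by
      by_contra hc
      exact h2 (hY j (not_le.1 hc))
    refine ⟨i, Finset.mem_Icc.2 ⟨hi1, by omega⟩, ?_, by rw [hj]⟩
    rw [hj] at hne
    exact hne
  · intro i _ _
    rfl

theorem LB.mul {M N : ℤ} {X Y : Ser m n} (hX : LB M X) (hY : LB N Y) : LB (M + N) (X * Y) := by
  intro k hk
  rw [coeff_mul_of_lb hX hY]
  refine Finset.sum_eq_zero fun i hi => ?_
  have := Finset.mem_Icc.1 hi
  omega

/-- The series with the given coefficients, which vanish below `ħ^N`. -/
def Ser.ofCoeff (N : ℤ) (a : ℤ → Op m n) : Ser m n :=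
  (HahnSeries.ofSuppBddBelow (fun k => if k < N then 0 else a k)
    ⟨N, fun k hk => by
      by_contra hc
      exact hk (if_pos (not_le.1 hc))⟩ : HOp m n)

theorem coeff_ofCoeff (N : ℤ) (a : ℤ → Op m n) (k : ℤ) :
    Ser.coeff k (Ser.ofCoeff N a) = if k < N then 0 else a k := rfl

end Series

/-! ### Infinite sums of series -/

section Sums

variable {ι κ : Type}

/-- For each order in `ħ`, the family of coefficients is pointwise finite. -/
def HFin (T : ι → Ser m n) : Prop := ∀ k, PFin fun i => Ser.coeff k (T i)

/-- The members of the family vanish below `ħ^N`, and the family adds up to `S`. -/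
structure Summ (N : ℤ) (T : ι → Ser m n) (S : Ser m n) : Prop where
  lb : ∀ i, LB N (T i)
  hfin : HFin T
  coeff_eq : ∀ k, Ser.coeff k S = psum fun i => Ser.coeff k (T i)

theorem isSum_iff {T : ι → Ser m n} {S : Ser m n} :
    IsSum T S ↔ HFin T ∧ ∀ k, Ser.coeff k S = psum fun i => Ser.coeff k (T i) := by
  constructor
  · intro h
    have h1 : HFin T := fun k f => (h k f).1
    refine ⟨h1, fun k => ?_⟩
    ext f
    rw [psum_apply (h1 k)]
    exact (h k f).2
  · rintro ⟨h1, h2⟩ k f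
    refine ⟨h1 k f, ?_⟩
    have := DFunLike.congr_fun (h2 k) f
    rwa [psum_apply (h1 k)] at this

theorem Summ.isSum {N : ℤ} {T : ι → Ser m n} {S : Ser m n} (h : Summ N T S) : IsSum T S :=
  isSum_iff.2 ⟨h.hfin, h.coeff_eq⟩

theorem Summ.of_isSum {N : ℤ} {T : ι → Ser m n} {S : Ser m n} (h : IsSum T S)
    (hN : ∀ i, LB N (T i)) : Summ N T S :=
  ⟨hN, (isSum_iff.1 h).1, (isSum_iff.1 h).2⟩

theorem Summ.unique {M N : ℤ} {T : ι → Ser m n} {S S' : Ser m n} (h : Summ M T S)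
    (h' : Summ N T S') : S = S' :=
  Ser.ext fun k => by rw [h.coeff_eq, h'.coeff_eq]

theorem isSum_opSum {T : ι → HOp m n} (h : ∃ S, IsSum T S) : IsSum T (opSum T) := by
  rw [opSum, dif_pos h]
  exact h.choose_spec

/-- The sum chosen in `opSum` is unique, because its coefficients are prescribed; so it suffices to
exhibit a sum. -/
theorem Summ.opSum_eq {N : ℤ} {T : ι → Ser m n} {S : Ser m n} (h : Summ N T S) :
    opSum T = S := by
  have hex : ∃ S, IsSum T S := ⟨S, h.isSum⟩
  have h1 : IsSum T (opSum T) := isSum_opSum hex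
  exact (Summ.of_isSum h1 h.lb).unique h

theorem Summ.lb_sum {N : ℤ} {T : ι → Ser m n} {S : Ser m n} (h : Summ N T S) : LB N S := by
  intro k hk
  rw [h.coeff_eq, ← psum_zero (ι := ι)]
  exact psum_congr fun i => h.lb i k hk

theorem HFin.exists_summ {N : ℤ} {T : ι → Ser m n} (h : HFin T) (hN : ∀ i, LB N (T i)) :
    ∃ S, Summ N T S := by
  refine ⟨Ser.ofCoeff N fun k => psum fun i => Ser.coeff k (T i), hN, h, fun k => ?_⟩
  rw [coeff_ofCoeff]
  split_ifs with hk
  · rw [← psum_zero (ι := ι)]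
    exact psum_congr fun i => (hN i k hk).symm
  · rfl

theorem PFin.finset_sum {σ : Type} (s : Finset σ) {T : σ → ι → Op m n}
    (h : ∀ r ∈ s, PFin (T r)) : PFin fun i => ∑ r ∈ s, T r i := by
  classical
  induction s using Finset.induction_on with
  | empty => simpa using PFin.of_finite (T := fun _ : ι => (0 : Op m n)) (by simp)
  | insert b s hb ih =>
    simp only [Finset.sum_insert hb]
    exact (h b (Finset.mem_insert_self b s)).add
      (ih fun r hr => h r (Finset.mem_insert_of_mem hr))

/-- As for operators, the right factors govern convergence; the left factors need only a common
lower bound in `ħ`. -/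
theorem HFin.mul_left {M N : ℤ} {T : ι → Ser m n} (h : HFin T) (hN : ∀ i, LB N (T i))
    {X : ι → Ser m n} (hX : ∀ i, LB M (X i)) : HFin fun i => X i * T i := by
  intro k
  have : (fun i => Ser.coeff k (X i * T i)) = fun i => ∑ j ∈ Finset.Icc M (k - N),
      Ser.coeff j (X i) * Ser.coeff (k - j) (T i) :=
    funext fun i => coeff_mul_of_lb (hX i) (hN i) k
  rw [this]
  exact PFin.finset_sum _ fun j _ => (h (k - j)).mul_left _

theorem HFin.mul_right {N : ℤ} {T : ι → Ser m n} (h : HFin T) (hN : ∀ i, LB N (T i))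
    (Y : Ser m n) : HFin fun i => T i * Y := by
  obtain ⟨M, hM⟩ := exists_lb Y
  intro k
  have : (fun i => Ser.coeff k (T i * Y)) = fun i => ∑ j ∈ Finset.Icc N (k - M),
      Ser.coeff j (T i) * Ser.coeff (k - j) Y :=
    funext fun i => coeff_mul_of_lb (hN i) hM k
  rw [this]
  exact PFin.finset_sum _ fun j _ => (h j).mul_right _

theorem HFin.add {T T' : ι → Ser m n} (h : HFin T) (h' : HFin T') : HFin fun i => T i + T' i :=
  fun k => by simpa only [map_add] using (h k).add (h' k)

theorem HFin.sub {T T' : ι → Ser m n} (h : HFin T) (h' : HFin T') : HFin fun i => T i - T' i :=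
  fun k => by simpa only [map_sub] using (h k).sub (h' k)

theorem HFin.smul {T : ι → Ser m n} (h : HFin T) (c : ι → ℂ) : HFin fun i => c i • T i :=
  fun k => by simpa only [map_smul] using (h k).smul c

theorem HFin.comp_injective {T : ι → Ser m n} (h : HFin T) {e : κ → ι}
    (he : Function.Injective e) : HFin fun k => T (e k) := fun k => (h k).comp_injective he

theorem HFin.of_finite {T : ι → Ser m n} (h : {i | T i ≠ 0}.Finite) : HFin T := fun k =>
  PFin.of_finite (h.subset fun i hi hT => hi (by rw [hT, map_zero]))

theorem Summ.mul_left {M N : ℤ} {T : ι → Ser m n} {S X : Ser m n} (h : Summ N T S)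
    (hX : LB M X) : Summ (M + N) (fun i => X * T i) (X * S) where
  lb i := hX.mul (h.lb i)
  hfin := h.hfin.mul_left h.lb fun _ => hX
  coeff_eq k := by
    rw [coeff_mul_of_lb hX h.lb_sum]
    simp only [h.coeff_eq, psum_mul_left (h.hfin _)]
    rw [psum_finset_sum _ fun j => (h.hfin _).mul_left _]
    exact psum_congr fun i => (coeff_mul_of_lb hX (h.lb i) k).symm

theorem Summ.mul_right {M N : ℤ} {T : ι → Ser m n} {S Y : Ser m n} (h : Summ N T S)
    (hY : LB M Y) : Summ (N + M) (fun i => T i * Y) (S * Y) where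
  lb i := (h.lb i).mul hY
  hfin := h.hfin.mul_right h.lb Y
  coeff_eq k := by
    rw [coeff_mul_of_lb h.lb_sum hY]
    simp only [h.coeff_eq, psum_mul_right (h.hfin _)]
    rw [psum_finset_sum _ fun j => (h.hfin _).mul_right _]
    exact psum_congr fun i => (coeff_mul_of_lb (h.lb i) hY k).symm

theorem Summ.add {N : ℤ} {T T' : ι → Ser m n} {S S' : Ser m n} (h : Summ N T S)
    (h' : Summ N T' S') : Summ N (fun i => T i + T' i) (S + S') where
  lb i := (h.lb i).add (h'.lb i)
  hfin := h.hfin.add h'.hfin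
  coeff_eq k := by
    rw [map_add, h.coeff_eq, h'.coeff_eq, psum_add (h.hfin k) (h'.hfin k)]
    exact psum_congr fun i => (map_add _ _ _).symm

theorem Summ.sub {N : ℤ} {T T' : ι → Ser m n} {S S' : Ser m n} (h : Summ N T S)
    (h' : Summ N T' S') : Summ N (fun i => T i - T' i) (S - S') where
  lb i := (h.lb i).sub (h'.lb i)
  hfin := h.hfin.sub h'.hfin
  coeff_eq k := by
    rw [map_sub, h.coeff_eq, h'.coeff_eq, psum_sub (h.hfin k) (h'.hfin k)]
    exact psum_congr fun i => (map_sub _ _ _).symm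

theorem Summ.smul {N : ℤ} {T : ι → Ser m n} {S : Ser m n} (h : Summ N T S) (c : ℂ) :
    Summ N (fun i => c • T i) (c • S) where
  lb i := (h.lb i).smul c
  hfin := h.hfin.smul _
  coeff_eq k := by
    rw [map_smul, h.coeff_eq, psum_smul (h.hfin k)]
    exact psum_congr fun i => (map_smul _ _ _).symm

theorem Summ.of_le {M N : ℤ} {T : ι → Ser m n} {S : Ser m n} (h : Summ N T S) (hM : M ≤ N) :
    Summ M T S :=
  ⟨fun i => (h.lb i).mono hM, h.hfin, h.coeff_eq⟩

theorem Summ.congr {N : ℤ} {T T' : ι → Ser m n} {S : Ser m n} (h : Summ N T S)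
    (hT : ∀ i, T i = T' i) : Summ N T' S := by
  rwa [← funext hT]

theorem summ_zero (N : ℤ) : Summ N (fun _ : ι => (0 : Ser m n)) 0 where
  lb _ := LB.zero N
  hfin := HFin.of_finite (by simp)
  coeff_eq k := by simp [psum_zero]

theorem summ_finset (s : Finset ι) {N : ℤ} {T : ι → Ser m n} (h0 : ∀ i ∉ s, T i = 0)
    (hN : ∀ i, LB N (T i)) : Summ N T (∑ i ∈ s, T i) where
  lb := hN
  hfin := HFin.of_finite (s.finite_toSet.subset fun i hi => by
    by_contra hc; exact hi (h0 i hc))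
  coeff_eq k := by
    rw [map_sum, psum_eq_sum s fun i hi => by rw [h0 i hi, map_zero]]

theorem summ_single (i : ι) {N : ℤ} {T : ι → Ser m n} (h0 : ∀ j, j ≠ i → T j = 0)
    (hN : LB N (T i)) : Summ N T (T i) := by
  have := summ_finset {i} (T := T) (N := N) (fun j hj => h0 j (by simpa using hj)) (fun j => by
    by_cases h : j = i
    · rw [h]; exact hN
    · rw [h0 j h]; exact LB.zero N)
  simpa using this

theorem summ_mono_psum {k : ℤ} {T : ι → Op m n} (h : PFin T) :
    Summ k (fun i => mono k (T i)) (mono k (psum T)) where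
  lb i := lb_mono k _
  hfin l := by
    by_cases hl : l = k
    · subst hl; simpa only [coeff_mono_same] using h
    · simp only [coeff_mono_of_ne hl]; exact PFin.of_finite (by simp)
  coeff_eq l := by
    by_cases hl : l = k
    · subst hl; simp only [coeff_mono_same]
    · simp only [coeff_mono_of_ne hl, psum_zero]

end Sums

/-! ### The Rees algebra -/

section Rees

/-- Membership in the completed Rees Weyl algebra, in terms of the intrinsic filtration. -/
def IsRees (S : Ser m n) : Prop := LB 0 S ∧ ∀ d : ℕ, Ser.coeff (d : ℤ) S ∈ Fil (d + 1)

theorem mem_reesWeyl_iff {S : Ser m n} : (S : HOp m n) ∈ reesWeyl m n ↔ IsRees S :=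
  and_congr Iff.rfl (forall_congr' fun _ => mem_weylFiltration_iff)

theorem IsRees.add {S T : Ser m n} (hS : IsRees S) (hT : IsRees T) : IsRees (S + T) :=
  ⟨hS.1.add hT.1, fun d => by rw [map_add]; exact Submodule.add_mem _ (hS.2 d) (hT.2 d)⟩

theorem IsRees.sub {S T : Ser m n} (hS : IsRees S) (hT : IsRees T) : IsRees (S - T) :=
  ⟨hS.1.sub hT.1, fun d => by rw [map_sub]; exact Submodule.sub_mem _ (hS.2 d) (hT.2 d)⟩

theorem IsRees.smul {S : Ser m n} (hS : IsRees S) (c : ℂ) : IsRees (c • S) :=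
  ⟨hS.1.smul c, fun d => by rw [map_smul]; exact Submodule.smul_mem _ _ (hS.2 d)⟩

theorem IsRees.zero : IsRees (0 : Ser m n) :=
  ⟨LB.zero 0, fun d => by rw [map_zero]; exact Submodule.zero_mem _⟩

theorem isRees_mono {d : ℕ} {D : Op m n} (hD : D ∈ Fil (d + 1)) : IsRees (mono (d : ℤ) D) :=
  ⟨(lb_mono _ _).mono (by positivity), fun e => by
    rw [coeff_mono]
    split_ifs with h
    · rwa [Nat.cast_inj.1 h]
    · exact Submodule.zero_mem _⟩

theorem coeff_mul_rees {X Y : Ser m n} (hX : LB 0 X) (hY : LB 0 Y) (d : ℕ) :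
    Ser.coeff (d : ℤ) (X * Y) = ∑ i ∈ Finset.range (d + 1),
      Ser.coeff (i : ℤ) X * Ser.coeff ((d - i : ℕ) : ℤ) Y := by
  rw [coeff_mul_of_lb hX hY, sub_zero]
  symm
  refine Finset.sum_bij (fun i _ => (i : ℤ)) ?_ ?_ ?_ ?_
  · intro i hi
    have := Finset.mem_range.1 hi
    exact Finset.mem_Icc.2 ⟨by positivity, by omega⟩
  · intro i _ j _ h
    exact Nat.cast_inj.1 h
  · intro j hj
    have := Finset.mem_Icc.1 hj
    exact ⟨j.toNat, Finset.mem_range.2 (by omega), by omega⟩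
  · intro i hi
    have := Finset.mem_range.1 hi
    rw [Nat.cast_sub (by omega)]

theorem IsRees.mul {S T : Ser m n} (hS : IsRees S) (hT : IsRees T) : IsRees (S * T) := by
  refine ⟨by simpa using hS.1.mul hT.1, fun d => ?_⟩
  rw [coeff_mul_rees hS.1 hT.1]
  refine Submodule.sum_mem _ fun i hi => ?_
  have hi' := Finset.mem_range.1 hi
  have := mul_mem_fil (hS.2 i) (hT.2 (d - i))
  rwa [show i + (d - i) + 1 = d + 1 by omega] at this

theorem IsRees.summ {ι : Type} {N : ℤ} {T : ι → Ser m n} {S : Ser m n} (h : Summ N T S)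
    (hT : ∀ i, IsRees (T i)) : IsRees S :=
  ⟨fun k hk => by
    rw [h.coeff_eq, ← psum_zero (ι := ι)]
    exact psum_congr fun i => (hT i).1 k hk,
  fun d => by
    rw [h.coeff_eq]
    exact psum_mem_fil (h.hfin _) fun i => (hT i).2 d⟩

/-- The parity-conjugate of a series, if `b` is true. -/
def twistH (b : Bool) : Ser m n →ₗ[ℂ] Ser m n where
  toFun S := (HahnSeries.map (show HOp m n from S) (twist (m := m) (n := n) b) : HOp m n)
  map_add' S T := Ser.ext fun k => map_add (twist b) _ _
  map_smul' c S := Ser.ext fun k => map_smul (twist b) c _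

theorem coeff_twistH (b : Bool) (k : ℤ) (S : Ser m n) :
    Ser.coeff k (twistH b S) = twist b (Ser.coeff k S) := rfl

theorem LB.twistH {N : ℤ} {S : Ser m n} (h : LB N S) (b : Bool) : LB N (SuperAiry.twistH b S) :=
  fun k hk => by rw [coeff_twistH, h k hk, map_zero]

theorem twistH_mul (b : Bool) (S T : Ser m n) : twistH b (S * T) = twistH b S * twistH b T := by
  obtain ⟨M, hM⟩ := exists_lb S
  obtain ⟨N, hN⟩ := exists_lb T
  refine Ser.ext fun k => ?_
  rw [coeff_twistH, coeff_mul_of_lb hM hN, coeff_mul_of_lb (hM.twistH b) (hN.twistH b), map_sum]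
  simp only [twist_mul, coeff_twistH]

theorem twistH_mono (b : Bool) (k : ℤ) (D : Op m n) :
    twistH b (mono k D) = mono k (twist b D) := by
  refine Ser.ext fun l => ?_
  rw [coeff_twistH, coeff_mono, coeff_mono]
  split_ifs <;> simp

theorem twistH_twistH (b c : Bool) (S : Ser m n) :
    twistH b (twistH c S) = twistH (xor b c) S :=
  Ser.ext fun k => by simp only [coeff_twistH, twist_twist]

theorem IsRees.twistH {S : Ser m n} (h : IsRees S) (b : Bool) : IsRees (SuperAiry.twistH b S) :=
  ⟨h.1.twistH b, fun d => by rw [coeff_twistH]; exact twist_mem_fil b (h.2 d)⟩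

/-- `S` is homogeneous of parity `c`. -/
def HasParH (c : Bool) (S : Ser m n) : Prop := ∀ k, HasPar c (Ser.coeff k S)

theorem HasParH.twistH_eq {c : Bool} {S : Ser m n} (h : HasParH c S) (b : Bool) :
    twistH b S = sgn b c • S :=
  Ser.ext fun k => by rw [coeff_twistH, map_smul, h k b]

theorem HasParH.of_twistH {c : Bool} {S : Ser m n} (h : twistH true S = sgn true c • S) :
    HasParH c S := fun k => HasPar.of_true (by rw [← coeff_twistH, h, map_smul])

theorem HasParH.mul {c d : Bool} {S T : Ser m n} (hS : HasParH c S) (hT : HasParH d T) :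
    HasParH (xor c d) (S * T) := by
  refine HasParH.of_twistH ?_
  rw [twistH_mul, hS.twistH_eq, hT.twistH_eq, smul_mul_smul_comm]
  cases c <;> cases d <;> simp

theorem hasParH_mono {c : Bool} {D : Op m n} (h : HasPar c D) (k : ℤ) : HasParH c (mono k D) := by
  intro l
  rw [coeff_mono]
  split_ifs
  · exact h
  · exact HasPar.zero c

theorem HasParH.add {c : Bool} {S T : Ser m n} (hS : HasParH c S) (hT : HasParH c T) :
    HasParH c (S + T) := fun k => by rw [map_add]; exact (hS k).add (hT k)

theorem HasParH.summ {ι : Type} {c : Bool} {N : ℤ} {T : ι → Ser m n} {S : Ser m n}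
    (h : Summ N T S) (hT : ∀ i, HasParH c (T i)) : HasParH c S := fun k => by
  rw [h.coeff_eq]
  exact HasPar.psum (h.hfin k) fun i => hT i k

theorem HasParH.isHomogeneous {c : Bool} {S : Ser m n} (h : HasParH c S) :
    IsHomogeneous (S : HOp m n) := by
  have h1 := h.twistH_eq true
  cases c
  · left
    exact h1.trans (by simp)
  · right
    exact h1.trans (by simp; rfl)

/-- The part of `S` of the given parity. -/
def parPart (c : Bool) : Ser m n →ₗ[ℂ] Ser m n :=
  (1 / 2 : ℂ) • (LinearMap.id + sgn true c • twistH true)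

theorem parPart_apply (c : Bool) (S : Ser m n) :
    parPart c S = (1 / 2 : ℂ) • (S + sgn true c • twistH true S) := rfl

theorem hasParH_parPart (c : Bool) (S : Ser m n) : HasParH c (parPart c S) := by
  refine HasParH.of_twistH ?_
  rw [parPart_apply, map_smul, map_add, map_smul, twistH_twistH]
  have : twistH (xor true true) S = S := Ser.ext fun k => rfl
  rw [this]
  cases c <;> simp <;> module

theorem parPart_add (S : Ser m n) : parPart false S + parPart true S = S := by
  rw [parPart_apply, parPart_apply]
  simp only [sgn_false_right, sgn_true_true]
  module

theorem IsRees.parPart {S : Ser m n} (h : IsRees S) (c : Bool) : IsRees (SuperAiry.parPart c S) := by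
  rw [parPart_apply]
  exact (h.add ((h.twistH true).smul _)).smul _

/-- The supercommutator in `Ser`. -/
def scomm (X Y : Ser m n) : Ser m n :=
  X * Y - Y * parPart false X - twistH true Y * parPart true X

theorem superComm_eq (X Y : Ser m n) : (superComm X Y : HOp m n) = scomm X Y := by
  show X * Y - Y * ((1 / 2 : ℂ) • (X + twistH true X)) -
    twistH true Y * ((1 / 2 : ℂ) • (X - twistH true X)) = scomm X Y
  rw [scomm, parPart_apply, parPart_apply]
  simp [sub_eq_add_neg]

theorem scomm_eq {c : Bool} {X : Ser m n} (hX : HasParH c X) (Y : Ser m n) :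
    scomm X Y = X * Y - twistH c Y * X := by
  have h := hX.twistH_eq true
  have hid : twistH false Y = Y := Ser.ext fun k => rfl
  rw [scomm, parPart_apply, parPart_apply, h]
  cases c
  · rw [hid]; simp [← two_smul ℂ X, smul_smul]
  · simp [← two_smul ℂ X, smul_smul]

theorem scomm_add_left (X X' Y : Ser m n) : scomm (X + X') Y = scomm X Y + scomm X' Y := by
  simp only [scomm, map_add, mul_add, add_mul]; abel

theorem scomm_add_right (X Y Y' : Ser m n) : scomm X (Y + Y') = scomm X Y + scomm X Y' := by
  simp only [scomm, map_add, mul_add, add_mul]; abel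

/-- The supercommutator divided by `ħ²`. -/
def rbracket (X Y : Ser m n) : Ser m n := mono (-2) 1 * scomm X Y

theorem mono_mul_rbracket (X Y : Ser m n) : mono 2 1 * rbracket X Y = scomm X Y := by
  rw [rbracket, ← mul_assoc, mono_mul_mono, mul_one]
  show mono 0 1 * _ = _
  rw [mono_one, one_mul]

theorem coeff_rbracket (X Y : Ser m n) (k : ℤ) :
    Ser.coeff k (rbracket X Y) = Ser.coeff (k + 2) (scomm X Y) := by
  rw [rbracket, coeff_mono_mul, one_mul, sub_neg_eq_add]

/-- At order `ħ^d` the supercommutator is a sum of brackets of operators of degrees `i` and `d - i`.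
These have degree at most `d - 2`, which is what division by `ħ²` requires. -/
theorem IsRees.rbracket {X Y : Ser m n} (hX : IsRees X) (hY : IsRees Y) :
    IsRees (rbracket X Y) := by
  have key : ∀ c c' X Y, HasParH c X → HasParH c' Y → IsRees X → IsRees Y →
      LB 0 (scomm X Y) ∧ ∀ d : ℕ, Ser.coeff (d : ℤ) (scomm X Y) ∈ Fil (m := m) (n := n) (d - 1) := by
    intro c c' X Y hc hc' hX hY
    rw [scomm_eq hc]
    refine ⟨by simpa using (hX.1.mul hY.1).sub ((hY.1.twistH c).mul hX.1), fun d => ?_⟩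
    have h1 : Ser.coeff (d : ℤ) (X * Y - SuperAiry.twistH c Y * X) = ∑ i ∈ Finset.range (d + 1),
        bracket c (Ser.coeff (i : ℤ) X) (Ser.coeff ((d - i : ℕ) : ℤ) Y) := by
      rw [map_sub, coeff_mul_rees hX.1 hY.1, coeff_mul_rees (hY.1.twistH c) hX.1]
      -- Reversing the second convolution pairs the products into brackets of coefficients.
      rw [← Finset.sum_range_reflect (fun i => Ser.coeff (i : ℤ) (SuperAiry.twistH c Y) *
        Ser.coeff ((d - i : ℕ) : ℤ) X), ← Finset.sum_sub_distrib]
      refine Finset.sum_congr rfl fun i hi => ?_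
      have hi' := Finset.mem_range.1 hi
      rw [bracket, coeff_twistH, show d + 1 - 1 - i = d - i by omega,
        show d - (d - i) = i by omega]
    rw [h1]
    refine Submodule.sum_mem _ fun i hi => ?_
    have hi' := Finset.mem_range.1 hi
    have := bracket_mem_fil (hc i) (hc' ((d - i : ℕ) : ℤ)) (hX.2 i) (hY.2 (d - i))
    rwa [show i + 1 + (d - i + 1) - 3 = d - 1 by omega] at this
  have h2 : ∀ c c' X Y, HasParH c X → HasParH c' Y → IsRees X → IsRees Y →
      IsRees (m := m) (n := n) (SuperAiry.rbracket X Y) := by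
    intro c c' X Y hc hc' hX hY
    obtain ⟨h1, h2⟩ := key c c' X Y hc hc' hX hY
    refine ⟨fun k hk => ?_, fun d => ?_⟩
    · rw [coeff_rbracket]
      rcases lt_or_ge (k + 2) 0 with h | h
      · exact h1 _ h
      -- At orders `ħ⁰` and `ħ¹` the bound on the supercommutator is `Fil 0`, so it vanishes there
      -- and no negative powers appear after division.
      · have h3 := h2 (k + 2).toNat
        rw [Int.toNat_of_nonneg h, show (k + 2).toNat - 1 = 0 by omega] at h3
        exact mem_fil_zero.1 h3
    · rw [coeff_rbracket]
      exact h2 (d + 2)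
  have h3 : SuperAiry.rbracket X Y = SuperAiry.rbracket (SuperAiry.parPart false X) (SuperAiry.parPart false Y) +
      SuperAiry.rbracket (SuperAiry.parPart false X) (SuperAiry.parPart true Y) +
      (SuperAiry.rbracket (SuperAiry.parPart true X) (SuperAiry.parPart false Y) +
      SuperAiry.rbracket (SuperAiry.parPart true X) (SuperAiry.parPart true Y)) := by
    simp only [SuperAiry.rbracket]
    rw [← mul_add, ← mul_add, ← mul_add, ← scomm_add_right, ← scomm_add_right, ← scomm_add_left,
      parPart_add, parPart_add]
  rw [h3]
  exact ((h2 _ _ _ _ (hasParH_parPart _ _) (hasParH_parPart _ _) (hX.parPart _) (hY.parPart _)).add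
    (h2 _ _ _ _ (hasParH_parPart _ _) (hasParH_parPart _ _) (hX.parPart _) (hY.parPart _))).add
    ((h2 _ _ _ _ (hasParH_parPart _ _) (hasParH_parPart _ _) (hX.parPart _) (hY.parPart _)).add
    (h2 _ _ _ _ (hasParH_parPart _ _) (hasParH_parPart _ _) (hX.parPart _) (hY.parPart _)))

end Rees

/-! ### Left ideals generated by bounded families -/

section Ideal

variable {ι κ : Type}

theorem PFin.psum_right {T : ι × κ → Op m n} (h : PFin T) :
    PFin fun i => psum fun k => T (i, k) := fun f => by
  refine ((h f).image Prod.fst).subset fun i hi => ?_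
  by_contra hc
  refine hi ?_
  show (psum fun k => T (i, k)) f = 0
  rw [psum_apply (h.comp_injective (e := fun k => (i, k)) (Prod.mk_right_injective i))]
  refine finsum_eq_zero_of_forall_eq_zero fun k => ?_
  by_contra hk
  exact hc ⟨(i, k), hk, rfl⟩

theorem HFin.swap {T : ι × κ → Ser m n} (h : HFin T) : HFin fun p : κ × ι => T p.swap :=
  h.comp_injective Prod.swap_injective

theorem HFin.fst {T : ι × κ → Ser m n} (h : HFin T) (i : ι) : HFin fun k => T (i, k) :=
  h.comp_injective (e := fun k => (i, k)) (Prod.mk_right_injective i)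

theorem HFin.congr {T T' : ι → Ser m n} (h : HFin T) (hT : ∀ i, T i = T' i) : HFin T' := by
  rwa [← funext hT]

theorem HFin.prod_mul {M N : ℤ} {A : ι → κ → Ser m n} {B : ι → Ser m n}
    (hA : ∀ i, HFin (A i)) (hA0 : ∀ i k, LB M (A i k)) (hB : HFin B) (hB0 : ∀ i, LB N (B i)) :
    HFin fun p : ι × κ => A p.1 p.2 * B p.1 := by
  intro k
  have : (fun p : ι × κ => Ser.coeff k (A p.1 p.2 * B p.1)) = fun p => ∑ j ∈ Finset.Icc M (k - N),
      Ser.coeff j (A p.1 p.2) * Ser.coeff (k - j) (B p.1) :=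
    funext fun p => coeff_mul_of_lb (hA0 p.1 p.2) (hB0 p.1) k
  rw [this]
  exact PFin.finset_sum _ fun j _ =>
    PFin.prod_mul (A := fun i k => Ser.coeff j (A i k)) (fun i => hA i j) (hB (k - j))

/-- A family over pairs can be summed along the second index first. -/
theorem HFin.exists_summ_prod {N : ℤ} {T : ι × κ → Ser m n} {S : ι → Ser m n} (hT : HFin T)
    (hN : ∀ p, LB N (T p)) (hS : ∀ i, Summ N (fun k => T (i, k)) (S i)) :
    ∃ U, Summ N T U ∧ Summ N S U := by
  obtain ⟨U, hU⟩ := hT.exists_summ hN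
  refine ⟨U, hU, fun i => (hS i).lb_sum, fun k => ?_, fun k => ?_⟩
  · have := (hT k).psum_right
    rwa [show (fun i => psum fun j => Ser.coeff k (T (i, j))) = fun i => Ser.coeff k (S i) from
      funext fun i => ((hS i).coeff_eq k).symm] at this
  · rw [hU.coeff_eq, psum_prod (hT k)]
    exact psum_congr fun i => ((hS i).coeff_eq k).symm

theorem Summ.swap {N : ℤ} {T : ι × κ → Ser m n} {U : Ser m n} (h : Summ N T U) :
    Summ N (fun p : κ × ι => T p.swap) U where
  lb p := h.lb _
  hfin := h.hfin.swap
  coeff_eq k := by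
    rw [h.coeff_eq, psum_comp_injective (h.hfin k) (e := Prod.swap) Prod.swap_injective]
    intro i hi
    exact absurd ⟨i.swap, by simp⟩ hi

/-- A family of elements of the Rees algebra whose sums with coefficients converge. -/
structure IsReesFamily (H : ι → Ser m n) : Prop where
  rees : ∀ i, IsRees (H i)
  hfin : HFin H

/-- The left ideal generated by a family. -/
def lspan (H : ι → Ser m n) : Set (Ser m n) :=
  {S | ∃ c : ι → Ser m n, (∀ i, IsRees (c i)) ∧ Summ 0 (fun i => c i * H i) S}

variable {H : ι → Ser m n}

theorem lb_mul_rees {X Y : Ser m n} (hX : IsRees X) (hY : IsRees Y) : LB 0 (X * Y) := by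
  simpa using hX.1.mul hY.1

theorem IsReesFamily.leftSpan_eq (hH : IsReesFamily H) : (leftSpan H : Set (HOp m n)) = lspan H := by
  ext S
  constructor
  · rintro ⟨c, hc, hS⟩
    have hc' : ∀ i, IsRees (c i : Ser m n) := fun i => mem_reesWeyl_iff.1 (hc i)
    exact ⟨c, hc', Summ.of_isSum hS fun i => lb_mul_rees (hc' i) (hH.rees i)⟩
  · rintro ⟨c, hc, hS⟩
    exact ⟨c, fun i => mem_reesWeyl_iff.2 (hc i), hS.isSum⟩

theorem IsReesFamily.exists_summ (hH : IsReesFamily H) {c : ι → Ser m n} (hc : ∀ i, IsRees (c i)) :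
    ∃ S, Summ 0 (fun i => c i * H i) S :=
  (hH.hfin.mul_left (fun i => (hH.rees i).1) fun i => (hc i).1).exists_summ
    fun i => lb_mul_rees (hc i) (hH.rees i)

theorem IsReesFamily.isRees_of_mem (hH : IsReesFamily H) {S : Ser m n} (hS : S ∈ lspan H) :
    IsRees S := by
  obtain ⟨c, hc, h⟩ := hS
  exact IsRees.summ h fun i => (hc i).mul (hH.rees i)

theorem zero_mem_lspan (H : ι → Ser m n) : (0 : Ser m n) ∈ lspan H :=
  ⟨fun _ => 0, fun _ => IsRees.zero, (summ_zero 0).congr fun i => (zero_mul _).symm⟩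

theorem add_mem_lspan {X Y : Ser m n} (hX : X ∈ lspan H) (hY : Y ∈ lspan H) : X + Y ∈ lspan H := by
  obtain ⟨a, ha, hX⟩ := hX
  obtain ⟨b, hb, hY⟩ := hY
  exact ⟨fun i => a i + b i, fun i => (ha i).add (hb i),
    (hX.add hY).congr fun i => (add_mul _ _ _).symm⟩

theorem mul_mem_lspan {c X : Ser m n} (hc : IsRees c) (hX : X ∈ lspan H) : c * X ∈ lspan H := by
  obtain ⟨a, ha, hX⟩ := hX
  exact ⟨fun i => c * a i, fun i => hc.mul (ha i),
    (by simpa using hX.mul_left hc.1 : Summ 0 _ _).congr fun i => (mul_assoc _ _ _).symm⟩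

/-- Fubini for `∑_k ∑_i c_{ki} H_i`. It needs that, for each `i`, the coefficients `c_{ki}` are
locally finite in `k`; then the double family is summable and both iterated sums equal its sum. -/
theorem IsReesFamily.exists_sum_lspan (hH : IsReesFamily H) {X : κ → Ser m n}
    {c : κ → ι → Ser m n} (hc : ∀ k i, IsRees (c k i)) (hX : ∀ k, Summ 0 (fun i => c k i * H i) (X k))
    (hfin : ∀ i, HFin fun k => c k i) {e : ι → Ser m n} (he : ∀ i, Summ 0 (fun k => c k i) (e i)) :
    ∃ Z, Summ 0 X Z ∧ Summ 0 (fun i => e i * H i) Z := by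
  have h1 : HFin fun p : ι × κ => c p.2 p.1 * H p.1 :=
    HFin.prod_mul (A := fun i k => c k i) hfin (fun i k => (hc k i).1) hH.hfin
      fun i => (hH.rees i).1
  have hlb : ∀ p : ι × κ, LB 0 (c p.2 p.1 * H p.1) := fun p => lb_mul_rees (hc _ _) (hH.rees _)
  obtain ⟨U, hU, hU'⟩ := h1.exists_summ_prod hlb (S := fun i => e i * H i) fun i => by
    simpa using (he i).mul_right (hH.rees i).1
  obtain ⟨U2, hU2, hU2'⟩ := h1.swap.exists_summ_prod (fun p => hlb _) (S := X) fun k => hX k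
  have := hU.swap.unique hU2
  subst this
  exact ⟨U, hU2', hU'⟩

theorem IsReesFamily.exists_sum_lspan' (hH : IsReesFamily H) {X : κ → Ser m n}
    {c : κ → ι → Ser m n} (hc : ∀ k i, IsRees (c k i)) (hX : ∀ k, Summ 0 (fun i => c k i * H i) (X k))
    (hfin : ∀ i, HFin fun k => c k i) :
    ∃ e : ι → Ser m n, (∀ i, Summ 0 (fun k => c k i) (e i)) ∧ (∀ i, IsRees (e i)) ∧
      ∃ Z, Summ 0 X Z ∧ Summ 0 (fun i => e i * H i) Z := by
  choose e he using fun i => (hfin i).exists_summ fun k => (hc k i).1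
  exact ⟨e, he, fun i => IsRees.summ (he i) fun k => hc k i, hH.exists_sum_lspan hc hX hfin he⟩

theorem IsReesFamily.summ_mem_lspan (hH : IsReesFamily H) {X : κ → Ser m n}
    {c : κ → ι → Ser m n} (hc : ∀ k i, IsRees (c k i)) (hX : ∀ k, Summ 0 (fun i => c k i * H i) (X k))
    (hfin : ∀ i, HFin fun k => c k i) {Z : Ser m n} (hZ : Summ 0 X Z) : Z ∈ lspan H := by
  obtain ⟨e, -, he, Z', h1, h2⟩ := hH.exists_sum_lspan' hc hX hfin
  rw [hZ.unique h1]
  exact ⟨e, he, h2⟩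

/-! ### Brackets in left ideals -/

theorem scomm_mul_right {α : Bool} {X : Ser m n} (hX : HasParH α X) (b Y : Ser m n) :
    scomm X (b * Y) = scomm X b * Y + twistH α b * scomm X Y := by
  rw [scomm_eq hX, scomm_eq hX, scomm_eq hX, twistH_mul]
  noncomm_ring

theorem scomm_mul_left {α ε : Bool} {a X : Ser m n} (ha : HasParH α a) (hX : HasParH ε X)
    (Y : Ser m n) :
    scomm (a * X) Y = a * scomm X Y + scomm a (twistH ε Y) * X := by
  rw [scomm_eq (ha.mul hX), scomm_eq hX, scomm_eq ha, twistH_twistH]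
  noncomm_ring

theorem mono_central (k : ℤ) (X : Ser m n) : X * mono k 1 = mono k 1 * X :=
  Ser.ext fun l => by rw [coeff_mono_mul, coeff_mul_mono, one_mul, mul_one]

theorem rbracket_mul_right {α : Bool} {X : Ser m n} (hX : HasParH α X) (b Y : Ser m n) :
    rbracket X (b * Y) = rbracket X b * Y + twistH α b * rbracket X Y := by
  simp only [rbracket, scomm_mul_right hX, mul_add, ← mul_assoc, mono_central]

theorem rbracket_mul_left {α ε : Bool} {a X : Ser m n} (ha : HasParH α a) (hX : HasParH ε X)
    (Y : Ser m n) :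
    rbracket (a * X) Y = a * rbracket X Y + rbracket a (twistH ε Y) * X := by
  simp only [rbracket, scomm_mul_left ha hX, mul_add, ← mul_assoc, mono_central]

theorem Summ.twistH {N : ℤ} {T : ι → Ser m n} {S : Ser m n} (h : Summ N T S) (b : Bool) :
    Summ N (fun i => SuperAiry.twistH b (T i)) (SuperAiry.twistH b S) where
  lb i := (h.lb i).twistH b
  hfin k := (h.hfin k).twist b
  coeff_eq k := by
    rw [coeff_twistH, h.coeff_eq, twist_psum (h.hfin k)]
    rfl

theorem HFin.twistH {T : ι → Ser m n} (h : HFin T) (b : Bool) :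
    HFin (fun i => SuperAiry.twistH b (T i)) := fun k => (h k).twist b

theorem Summ.parPart {N : ℤ} {T : ι → Ser m n} {S : Ser m n} (h : Summ N T S) (b : Bool) :
    Summ N (fun i => SuperAiry.parPart b (T i)) (SuperAiry.parPart b S) := by
  simp only [parPart_apply]
  exact (h.add ((h.twistH true).smul _)).smul _

theorem LB.parPart {N : ℤ} {S : Ser m n} (h : LB N S) (b : Bool) :
    LB N (SuperAiry.parPart b S) := by
  rw [parPart_apply]
  exact (h.add ((h.twistH true).smul _)).smul _

theorem Summ.scomm_right {X : Ser m n} (hX : LB 0 X) {T : ι → Ser m n} {S : Ser m n}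
    (h : Summ 0 T S) : Summ 0 (fun i => scomm X (T i)) (scomm X S) := by
  have h1 := h.mul_left hX
  have h2 := h.mul_right (hX.parPart false)
  have h3 := (h.twistH true).mul_right (hX.parPart true)
  simp only [add_zero] at h1 h2 h3
  exact (h1.sub h2).sub h3

theorem Summ.scomm_left {Y : Ser m n} (hY : LB 0 Y) {T : ι → Ser m n} {S : Ser m n}
    (h : Summ 0 T S) : Summ 0 (fun i => scomm (T i) Y) (scomm S Y) := by
  have h1 := h.mul_right hY
  have h2 := (h.parPart false).mul_left hY
  have h3 := (h.parPart true).mul_left (hY.twistH true)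
  simp only [add_zero] at h1 h2 h3
  exact (h1.sub h2).sub h3

theorem HFin.scomm_right {X : Ser m n} (hX : LB 0 X) {T : ι → Ser m n} (h : HFin T)
    (h0 : ∀ i, LB 0 (T i)) : HFin fun i => scomm X (T i) := by
  obtain ⟨S, hS⟩ := h.exists_summ h0
  exact (hS.scomm_right hX).hfin

theorem HFin.mono_mul {T : ι → Ser m n} (h : HFin T) (k : ℤ) (D : Op m n) :
    HFin fun i => mono k D * T i := fun l => by
  simp only [coeff_mono_mul]
  exact (h (l - k)).mul_left _

theorem HFin.rbracket_right {X : Ser m n} (hX : LB 0 X) {T : ι → Ser m n} (h : HFin T)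
    (h0 : ∀ i, LB 0 (T i)) : HFin fun i => rbracket X (T i) :=
  (h.scomm_right hX h0).mono_mul _ _

theorem Summ.rees {T : ι → Ser m n} {S : Ser m n} {N : ℤ} (h : Summ N T S)
    (hT : ∀ i, IsRees (T i)) : Summ 0 T S := ⟨fun i => (hT i).1, h.hfin, h.coeff_eq⟩

theorem Summ.rbracket_right {X : Ser m n} (hX : IsRees X) {T : ι → Ser m n} {S : Ser m n}
    (h : Summ 0 T S) (hT : ∀ i, IsRees (T i)) :
    Summ 0 (fun i => rbracket X (T i)) (rbracket X S) :=
  ((h.scomm_right hX.1).mul_left (SuperAiry.lb_mono (-2) 1)).rees fun i => hX.rbracket (hT i)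

theorem Summ.rbracket_left {Y : Ser m n} (hY : IsRees Y) {T : ι → Ser m n} {S : Ser m n}
    (h : Summ 0 T S) (hT : ∀ i, IsRees (T i)) :
    Summ 0 (fun i => rbracket (T i) Y) (rbracket S Y) :=
  ((h.scomm_left hY.1).mul_left (SuperAiry.lb_mono (-2) 1)).rees fun i => (hT i).rbracket hY

theorem rbracket_add_left (X X' Y : Ser m n) :
    rbracket (X + X') Y = rbracket X Y + rbracket X' Y := by
  rw [rbracket, scomm_add_left, mul_add]; rfl

/-- The brackets of the members of the family are sums of members of the family, in a way that
is locally finite. -/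
structure IsClosedFamily (ε : ι → Bool) (H : ι → Ser m n) : Prop extends IsReesFamily H where
  hasPar : ∀ i, HasParH (ε i) (H i)
  closed : ∃ c : ι → ι → ι → Ser m n, (∀ i j l, IsRees (c i j l)) ∧
    (∀ i j, Summ 0 (fun l => c i j l * H l) (rbracket (H i) (H j))) ∧
    ∀ l, HFin fun p : ι × ι => c p.1 p.2 l

theorem parPart_mul {ε : Bool} {X : Ser m n} (hX : HasParH ε X) (α : Bool) (a : Ser m n) :
    parPart α (a * X) = parPart (xor α ε) a * X := by
  rw [parPart_apply, parPart_apply, twistH_mul, hX.twistH_eq]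
  cases α <;> cases ε <;> simp [add_mul]

/-- By the Leibniz rule the bracket of `∑ a_i H_i` and `∑ b_j H_j` consists of terms with a bracket
of two generators and terms in which a bracket of a coefficient stands to the left of a generator.
All are in the left ideal as brackets divided by `ħ²` stay in the Rees algebra. The substance is
that the infinite sums can be rearranged. The parity of `a_i` is chosen so that all `a_i H_i` have
parity `α`. -/
theorem IsClosedFamily.rbracket_mem_of_hasParH {ε : ι → Bool} (hH : IsClosedFamily ε H) {α : Bool}
    {a b : ι → Ser m n} (ha : ∀ i, IsRees (a i)) (hb : ∀ i, IsRees (b i))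
    (hpar : ∀ i, HasParH (xor α (ε i)) (a i)) {X Y : Ser m n}
    (hX : Summ 0 (fun i => a i * H i) X) (hY : Summ 0 (fun i => b i * H i) Y) :
    SuperAiry.rbracket X Y ∈ lspan H := by
  obtain ⟨c, hc, hcH, hcfin⟩ := hH.closed
  have hXpar : HasParH α X := HasParH.summ hX fun i => by
    have := (hpar i).mul (hH.hasPar i)
    rwa [show xor (xor α (ε i)) (ε i) = α by cases α <;> cases ε i <;> rfl] at this
  have hXR : IsRees X := IsRees.summ hX fun i => (ha i).mul (hH.rees i)
  have hd : ∀ j i, IsRees (SuperAiry.rbracket (a i) (SuperAiry.twistH (ε i) (H j))) := fun j i =>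
    (ha i).rbracket ((hH.rees j).twistH _)
  -- For fixed `j`, the expansions of the brackets of `H i` with `H j` are multiplied by `a i` and
  -- summed over `i`; `e j l` is the resulting coefficient of `H l`.
  have h1 : ∀ j, ∃ e : ι → Ser m n, (∀ l, Summ 0 (fun i => a i * c i j l) (e l)) ∧
      (∀ l, IsRees (e l)) ∧ ∃ Z, Summ 0 (fun i => a i * SuperAiry.rbracket (H i) (H j)) Z ∧
        Summ 0 (fun l => e l * H l) Z := fun j =>
    hH.exists_sum_lspan' (c := fun i l => a i * c i j l) (fun i l => (ha i).mul (hc i j l))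
      (fun i => ((by simpa using (hcH i j).mul_left (ha i).1 : Summ 0 _ _)).congr
        fun l => (mul_assoc _ _ _).symm)
      fun l => (((hcfin l).swap.fst j).mul_left (fun i => (hc i j l).1) fun i => (ha i).1)
  choose e he heR Z hZ hZe using h1
  -- The expansion of the bracket of `X` with a single generator: the part from brackets of
  -- generators plus the part in which the coefficient `a l` is bracketed and `H l` stays on the
  -- right.
  have h2 : ∀ j, Summ 0 (fun l => (e j l + SuperAiry.rbracket (a l) (SuperAiry.twistH (ε l) (H j))) *
      H l) (SuperAiry.rbracket X (H j)) := by
    intro j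
    obtain ⟨S, hS⟩ := hH.exists_summ (hd j)
    have h3 := (hZ j).add hS
    have h4 := hX.rbracket_left (hH.rees j) fun i => (ha i).mul (hH.rees i)
    have h5 : SuperAiry.rbracket X (H j) = Z j + S := by
      refine (h4.congr fun i => ?_).unique h3
      exact rbracket_mul_left (hpar i) (hH.hasPar i) _
    rw [h5]
    exact ((hZe j).add hS).congr fun l => (add_mul _ _ _).symm
  -- The coefficients of these expansions are locally finite in `j`, which allows summation over `j`
  -- after multiplication by the coefficients of `Y`.
  have h3 : ∀ l, HFin fun j => e j l + SuperAiry.rbracket (a l) (SuperAiry.twistH (ε l) (H j)) := by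
    intro l
    refine HFin.add ?_ (HFin.rbracket_right (ha l).1 (hH.hfin.twistH _) fun j =>
      ((hH.rees j).twistH _).1)
    have h4 : HFin fun p : ι × ι => a p.2 * c p.2 p.1 l :=
      ((hcfin l).swap).mul_left (fun p => (hc _ _ _).1) fun p => (ha p.2).1
    obtain ⟨U, -, hU⟩ := h4.exists_summ_prod (fun p => lb_mul_rees (ha _) (hc _ _ _))
      (S := fun j => e j l) fun j => he j l
    exact hU.hfin
  have h4 := hY.rbracket_right hXR fun i => (hb i).mul (hH.rees i)
  obtain ⟨S, hS⟩ := hH.exists_summ (c := fun j => SuperAiry.rbracket X (b j)) fun j =>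
    hXR.rbracket (hb j)
  have hcoef : ∀ j l, IsRees (SuperAiry.twistH α (b j) *
      (e j l + SuperAiry.rbracket (a l) (SuperAiry.twistH (ε l) (H j)))) := fun j l =>
    ((hb j).twistH α).mul ((heR j l).add (hd j l))
  obtain ⟨-, -, -, Z', hZ', -⟩ := hH.exists_sum_lspan'
    (X := fun j => SuperAiry.twistH α (b j) * SuperAiry.rbracket X (H j)) hcoef
    (fun j => ((by simpa using (h2 j).mul_left ((hb j).twistH α).1 : Summ 0 _ _)).congr
      fun l => (mul_assoc _ _ _).symm)
    (fun l => (h3 l).mul_left (fun j => ((heR j l).add (hd j l)).1) fun j => ((hb j).twistH α).1)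
  have h5 : Z' ∈ lspan H := hH.summ_mem_lspan hcoef
    (fun j => ((by simpa using (h2 j).mul_left ((hb j).twistH α).1 : Summ 0 _ _)).congr
      fun l => (mul_assoc _ _ _).symm)
    (fun l => (h3 l).mul_left (fun j => ((heR j l).add (hd j l)).1) fun j => ((hb j).twistH α).1) hZ'
  -- The Leibniz rule in the second argument: `S` collects the brackets of `X` with the coefficients
  -- `b j`, and `Z'` those with the generators.
  have h6 : SuperAiry.rbracket X Y = S + Z' :=
    (h4.congr fun j => rbracket_mul_right hXpar _ _).unique (hS.add hZ')
  rw [h6]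
  exact add_mem_lspan ⟨_, fun j => hXR.rbracket (hb j), hS⟩ h5

/-- The parity components of `X` are obtained by taking suitable parity components of its
coefficients, so the homogeneous case suffices. -/
theorem IsClosedFamily.rbracket_mem {ε : ι → Bool} (hH : IsClosedFamily ε H) {X Y : Ser m n}
    (hX : X ∈ lspan H) (hY : Y ∈ lspan H) : SuperAiry.rbracket X Y ∈ lspan H := by
  obtain ⟨a, ha, hX⟩ := hX
  obtain ⟨b, hb, hY⟩ := hY
  have h : ∀ α, SuperAiry.rbracket (SuperAiry.parPart α X) Y ∈ lspan H := fun α =>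
    hH.rbracket_mem_of_hasParH (α := α) (a := fun i => SuperAiry.parPart (xor α (ε i)) (a i))
      (fun i => (ha i).parPart _) hb (fun i => hasParH_parPart _ _)
      ((hX.parPart α).congr fun i => parPart_mul (hH.hasPar i) α _) hY
  rw [← parPart_add X, rbracket_add_left]
  exact add_mem_lspan (h false) (h true)

/-! ### Change of generators -/

theorem IsReesFamily.of_combination (hH : IsReesFamily H) {H' : κ → Ser m n} {N : κ → ι → Ser m n}
    (hN : ∀ k i, IsRees (N k i)) (hfin : ∀ i, HFin fun k => N k i)
    (hH' : ∀ k, Summ 0 (fun i => N k i * H i) (H' k)) : IsReesFamily H' where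
  rees k := IsRees.summ (hH' k) fun i => (hN k i).mul (hH.rees i)
  hfin := by
    obtain ⟨-, -, -, Z, h, -⟩ := hH.exists_sum_lspan' hN hH' hfin
    exact h.hfin

theorem IsReesFamily.lspan_le (hH : IsReesFamily H) {H' : κ → Ser m n} {N : κ → ι → Ser m n}
    (hN : ∀ k i, IsRees (N k i)) (hfin : ∀ i, HFin fun k => N k i)
    (hH' : ∀ k, Summ 0 (fun i => N k i * H i) (H' k)) : lspan H' ⊆ lspan H := by
  rintro S ⟨c, hc, hS⟩
  exact hH.summ_mem_lspan (c := fun k i => c k * N k i) (fun k i => (hc k).mul (hN k i))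
    (fun k => ((by simpa using (hH' k).mul_left (hc k).1 : Summ 0 _ _)).congr
      fun i => (mul_assoc _ _ _).symm)
    (fun i => (hfin i).mul_left (fun k => (hN k i).1) fun k => (hc k).1) hS

/-- If `N` is the inverse of `M`, and `H' = N H`, then `H = M H'`. -/
theorem IsReesFamily.summ_of_inverse (hH : IsReesFamily H) {H' : κ → Ser m n}
    {N : κ → ι → Ser m n} {M : ι → κ → Ser m n} (hN : ∀ k i, IsRees (N k i))
    (hM : ∀ i k, IsRees (M i k)) (hfin : ∀ i, HFin fun k => N k i)
    (hH' : ∀ k, Summ 0 (fun i => N k i * H i) (H' k)) (i : ι)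
    (hMN : ∀ j, Summ 0 (fun k => M i k * N k j) (open Classical in if j = i then 1 else 0)) :
    Summ 0 (fun k => M i k * H' k) (H i) := by
  classical
  obtain ⟨Z, h1, h2⟩ := hH.exists_sum_lspan (X := fun k => M i k * H' k)
    (c := fun k j => M i k * N k j) (fun k j => (hM i k).mul (hN k j))
    (fun k => ((by simpa using (hH' k).mul_left (hM i k).1 : Summ 0 _ _)).congr
      fun j => (mul_assoc _ _ _).symm)
    (fun j => (hMN j).hfin) hMN
  have h3 : Summ 0 (fun j => (if j = i then 1 else 0) * H j) (H i) := by
    have := summ_single i (N := 0) (T := fun j => (if j = i then (1 : Ser m n) else 0) * H j)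
      (fun j hj => by rw [if_neg hj, zero_mul]) (by rw [if_pos rfl, one_mul]; exact (hH.rees i).1)
    simpa using this
  rw [← h2.unique h3]
  exact h1

/-- The Taylor coefficients are iterated commutators of the members evaluated at `1`, so finiteness
of the family on the single polynomial `1`, after commutators, gives boundedness in any coordinate
system. -/
theorem IsReesFamily.isBounded {y : Idx → Pol m n} {δ : Idx → Op m n} (hH : IsReesFamily H)
    (h : IsCoordSystem y δ) : IsBounded δ (H : ι → HOp m n) := by
  refine ⟨fun j => (hH.rees j).1, fun j d => taylorCoeff y d (Ser.coeff (d : ℤ) (H j)),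
    fun j d => h.isExpansion ((hH.rees j).2 d), fun d a => ?_⟩
  refine (PFin.adWord (y := y) (hH.hfin (d : ℤ)) a 1).subset fun j hj h0 => hj ?_
  show taylorCoeff y d (Ser.coeff (d : ℤ) (H j)) a = 0
  unfold taylorCoeff
  split_ifs
  · exact (congrArg _ h0).trans (smul_zero _)
  · rfl

end Ideal

/-! ### Heisenberg and Clifford modes as operators -/

section Modes

/-- The modes `J_k = ħ j_k` (`b = false`) and `Γ_k = ħ γ_k` (`b = true`) divided by `ħ`. -/
def md : Bool → ℤ → Op m n
  | false, k => if 0 < k then pd (Sum.inl k.toNat.toPNat')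
      else if k = 0 then 0
      else (-k : ℂ) • mulOp (coord (Sum.inl (-k).toNat.toPNat'))
  | true, k => if 0 < k then pd (Sum.inr k.toNat)
      else if k = 0 then (1 / 2 : ℂ) • mulOp (coord theta0) + pd theta0
      else mulOp (coord (Sum.inr (-k).toNat))

/-- The operator `½ θ⁰ - ∂_{θ⁰}`, which anticommutes with all Clifford modes. -/
def gp : Op m n := (1 / 2 : ℂ) • mulOp (coord theta0) - pd theta0

theorem J_eq (k : ℤ) : (J k : HOp m n) = mono 1 (md false k) := by
  have h : ∀ D : Op m n, (hbar 1 * ofOp D : HOp m n) = mono 1 D := fun D => by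
    have : (HahnSeries.single 1 1 : HOp m n) * HahnSeries.single 0 D =
      HahnSeries.single (1 + 0) (1 * D) := HahnSeries.single_mul_single
    rw [one_mul, add_zero] at this
    exact this
  simp only [J, md]
  split_ifs
  · exact h _
  · exact (map_zero (mono 1)).symm
  · exact h _

theorem Gam_eq (k : ℤ) : (Gam k : HOp m n) = mono 1 (md true k) := by
  have h : ∀ D : Op m n, (hbar 1 * ofOp D : HOp m n) = mono 1 D := fun D => by
    have : (HahnSeries.single 1 1 : HOp m n) * HahnSeries.single 0 D =
      HahnSeries.single (1 + 0) (1 * D) := HahnSeries.single_mul_single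
    rw [one_mul, add_zero] at this
    exact this
  simp only [Gam, md]
  split_ifs <;> exact h _

theorem toPNat'_inj {k l : ℤ} (hk : 0 < k) (hl : 0 < l)
    (h : k.toNat.toPNat' = l.toNat.toPNat') : k = l := by
  have := congrArg PNat.val h
  simp only [Nat.toPNat'_coe] at this
  split_ifs at this <;> omega

theorem md_false_zero : (md false 0 : Op m n) = 0 := by simp [md]

theorem md_true_zero : (md true 0 : Op m n) = (1 / 2 : ℂ) • mulOp (coord theta0) + pd theta0 := by
  simp [md]

theorem exists_md_pos (b : Bool) {k : ℤ} (hk : 0 < k) :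
    ∃ a, par a = b ∧ (md b k : Op m n) = pd a := by
  cases b
  · exact ⟨Sum.inl k.toNat.toPNat', rfl, by simp [md, hk]⟩
  · exact ⟨Sum.inr k.toNat, rfl, by simp [md, hk]⟩

theorem exists_md_neg (b : Bool) {k : ℤ} (hk : k < 0) :
    ∃ a, par a = b ∧ ∃ c : ℂ, (md b k : Op m n) = c • mulOp (coord a) := by
  cases b
  · exact ⟨Sum.inl (-k).toNat.toPNat', rfl, _, by simp only [md]; rw [if_neg (by omega), if_neg hk.ne]⟩
  · exact ⟨Sum.inr (-k).toNat, rfl, 1, by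
      simp only [md]; rw [if_neg (by omega), if_neg hk.ne, one_smul]⟩

theorem hasPar_md (b : Bool) (k : ℤ) : HasPar b (md b k : Op m n) := by
  rcases lt_trichotomy k 0 with hk | hk | hk
  · obtain ⟨a, rfl, c, h⟩ := exists_md_neg (m := m) (n := n) b hk
    rw [h]; exact (hasPar_coord a).smul c
  · subst hk
    cases b
    · rw [md_false_zero]; exact HasPar.zero _
    · rw [md_true_zero]
      exact ((hasPar_coord theta0).smul _).add (hasPar_pd theta0)
  · obtain ⟨a, rfl, h⟩ := exists_md_pos (m := m) (n := n) b hk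
    rw [h]; exact hasPar_pd a

theorem hasPar_gp : HasPar true (gp : Op m n) :=
  ((hasPar_coord theta0).smul _).sub (hasPar_pd theta0)

theorem rLin_md (b : Bool) (k : ℤ) : RLin (md b k : Op m n) := by
  rcases lt_trichotomy k 0 with hk | hk | hk
  · obtain ⟨a, rfl, c, h⟩ := exists_md_neg (m := m) (n := n) b hk
    rw [h]; exact (rLin_mulOp _).smul c
  · subst hk
    cases b
    · rw [md_false_zero]; exact RLin.zero
    · rw [md_true_zero]; exact ((rLin_mulOp _).smul _).add (rLin_pd _)
  · obtain ⟨a, rfl, h⟩ := exists_md_pos (m := m) (n := n) b hk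
    rw [h]; exact rLin_pd a

theorem rLin_gp : RLin (gp : Op m n) := ((rLin_mulOp _).smul _).sub (rLin_pd _)

theorem md_mem_fil (b : Bool) (k : ℤ) : (md b k : Op m n) ∈ Fil 2 := by
  rcases lt_trichotomy k 0 with hk | hk | hk
  · obtain ⟨a, rfl, c, h⟩ := exists_md_neg (m := m) (n := n) b hk
    rw [h]; exact Submodule.smul_mem _ _ (coord_mem_fil a)
  · subst hk
    cases b
    · rw [md_false_zero]; exact Submodule.zero_mem _
    · rw [md_true_zero]
      exact Submodule.add_mem _ (Submodule.smul_mem _ _ (coord_mem_fil _)) (pd_mem_fil _)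
  · obtain ⟨a, rfl, h⟩ := exists_md_pos (m := m) (n := n) b hk
    rw [h]; exact pd_mem_fil a

theorem ad_smul_left (b : Bool) (c : ℂ) (y D : Op m n) : ad b (c • y) D = c • ad b y D := by
  simp only [ad_apply, mul_smul_comm, smul_mul_assoc]; module

theorem ad_sub_left (b : Bool) (x y D : Op m n) : ad b (x - y) D = ad b x D - ad b y D := by
  simp only [ad_apply, mul_sub, sub_mul]; abel

theorem ad_of_ne {a a' : Idx} (h : a ≠ a') {y y' : Op m n}
    (hy : y = pd a ∨ y = mulOp (coord a)) (hy' : y' = pd a' ∨ y' = mulOp (coord a')) :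
    ad (par a) y y' = 0 := by
  rcases hy with rfl | rfl <;> rcases hy' with rfl | rfl
  · exact ad_pd_pd a a'
  · rw [ad_pd_coord, if_neg h]
  · rw [ad_coord_pd, if_neg (Ne.symm h)]
  · exact ad_coord_coord a a'

/-- The value of the bracket of a mode with the mode of opposite index. -/
def wt (b : Bool) (k : ℤ) : ℂ := if b then 1 else k

/-- The Heisenberg and Clifford relations, with `wt` equal to the index for bosonic and to one for
fermionic modes. The zero modes fit in: `J_0 = 0` has weight zero, and `½θ⁰ + ∂_{θ⁰}` has square one
half. -/
theorem ad_md_md_same (b : Bool) (k l : ℤ) :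
    ad b (md b k) (md b l : Op m n) = if l = -k then wt b l • 1 else 0 := by
  cases b
  · rcases lt_trichotomy k 0 with hk | hk | hk
    · have e1 : (md false k : Op m n) = (-k : ℂ) • mulOp (coord (Sum.inl (-k).toNat.toPNat')) := by
        simp only [md]; rw [if_neg (by omega), if_neg hk.ne]
      rw [e1, ad_smul_left]
      rcases lt_trichotomy l 0 with hl | hl | hl
      · obtain ⟨a, ha, c, h⟩ := exists_md_neg (m := m) (n := n) false hl
        rw [h, map_smul, ← show par (Sum.inl (-k).toNat.toPNat') = false from rfl, ad_coord_coord,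
          if_neg (by omega), smul_zero, smul_zero]
      · subst hl
        rw [md_false_zero, map_zero, if_neg (by omega), smul_zero]
      · have e2 : (md false l : Op m n) = pd (Sum.inl l.toNat.toPNat') := by simp [md, hl]
        have e3 := ad_coord_pd (m := m) (n := n) (Sum.inl (-k).toNat.toPNat') (Sum.inl l.toNat.toPNat')
        rw [show par (Sum.inl (-k).toNat.toPNat') = false from rfl] at e3
        rw [e2, e3]
        by_cases h : l = -k
        · subst h
          rw [if_pos rfl, if_pos rfl]
          simp [wt]
        · rw [if_neg h, if_neg (fun hc => h (toPNat'_inj hl (by omega) (Sum.inl_injective hc))),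
            smul_zero]
    · subst hk
      rw [md_false_zero, ad_zero_left]
      split_ifs with h
      · simp [wt, h]
      · rfl
    · have e1 : (md false k : Op m n) = pd (Sum.inl k.toNat.toPNat') := by simp [md, hk]
      rw [e1]
      rcases lt_trichotomy l 0 with hl | hl | hl
      · have e2 : (md false l : Op m n) = (-l : ℂ) • mulOp (coord (Sum.inl (-l).toNat.toPNat')) := by
          simp only [md]; rw [if_neg (by omega), if_neg hl.ne]
        have e3 := ad_pd_coord (m := m) (n := n) (Sum.inl k.toNat.toPNat') (Sum.inl (-l).toNat.toPNat')
        rw [show par (Sum.inl k.toNat.toPNat') = false from rfl] at e3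
        rw [e2, map_smul, e3]
        by_cases h : l = -k
        · subst h
          rw [if_pos (by rw [neg_neg]), if_pos rfl]
          simp [wt]
          module
        · rw [if_neg h, if_neg (fun hc => h (by
            have := toPNat'_inj hk (by omega : 0 < -l) (Sum.inl_injective hc); omega)), smul_zero]
      · subst hl
        rw [md_false_zero, map_zero, if_neg (by omega)]
      · obtain ⟨a, ha, h⟩ := exists_md_pos (m := m) (n := n) false hl
        rw [h, ← show par (Sum.inl k.toNat.toPNat') = false from rfl, ad_pd_pd, if_neg (by omega)]
  · have e0 : par theta0 = true := rfl
    have z1 : ad true (mulOp (coord theta0)) (mulOp (coord theta0) : Op m n) = 0 :=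
      ad_coord_coord theta0 theta0
    have z2 : ad true (pd theta0) (pd theta0 : Op m n) = 0 := ad_pd_pd theta0 theta0
    have z3 : ad true (mulOp (coord theta0)) (pd theta0 : Op m n) = 1 := by
      have := ad_coord_pd (m := m) (n := n) theta0 theta0
      rwa [if_pos rfl] at this
    have z4 : ad true (pd theta0) (mulOp (coord theta0) : Op m n) = 1 := by
      have := ad_pd_coord (m := m) (n := n) theta0 theta0
      rw [if_pos rfl, e0, sgn_true_true, neg_neg, one_smul] at this
      exact this
    rcases lt_trichotomy k 0 with hk | hk | hk
    · have e1 : (md true k : Op m n) = mulOp (coord (Sum.inr (-k).toNat)) := by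
        simp only [md]; rw [if_neg (by omega), if_neg hk.ne]
      rw [e1]
      rcases lt_trichotomy l 0 with hl | hl | hl
      · obtain ⟨a, ha, c, h⟩ := exists_md_neg (m := m) (n := n) true hl
        rw [h, map_smul, ← show par (Sum.inr (-k).toNat) = true from rfl, ad_coord_coord,
          if_neg (by omega), smul_zero]
      · subst hl
        have hne : (Sum.inr (-k).toNat : Idx) ≠ theta0 := fun h => by
          have := Sum.inr_injective h; omega
        rw [md_true_zero, map_add, map_smul, if_neg (by omega),
          show ad true (mulOp (coord (Sum.inr (-k).toNat))) (mulOp (coord theta0) : Op m n) = 0 from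
            ad_of_ne hne (Or.inr rfl) (Or.inr rfl),
          show ad true (mulOp (coord (Sum.inr (-k).toNat))) (pd theta0 : Op m n) = 0 from
            ad_of_ne hne (Or.inr rfl) (Or.inl rfl), smul_zero, add_zero]
      · have e2 : (md true l : Op m n) = pd (Sum.inr l.toNat) := by simp [md, hl]
        have e3 := ad_coord_pd (m := m) (n := n) (Sum.inr (-k).toNat) (Sum.inr l.toNat)
        rw [show par (Sum.inr (-k).toNat) = true from rfl] at e3
        rw [e2, e3]
        by_cases h : l = -k
        · subst h
          rw [if_pos rfl, if_pos rfl]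
          simp [wt]
        · rw [if_neg h, if_neg (fun hc => h (by have := Sum.inr_injective hc; omega))]
    · subst hk
      rw [md_true_zero, ad_add_left, ad_smul_left]
      rcases lt_trichotomy l 0 with hl | hl | hl
      · have e2 : (md true l : Op m n) = mulOp (coord (Sum.inr (-l).toNat)) := by
          simp only [md]; rw [if_neg (by omega), if_neg hl.ne]
        have hne : theta0 ≠ (Sum.inr (-l).toNat : Idx) := fun h => by
          have := Sum.inr_injective h; omega
        rw [e2, if_neg (by omega),
          show ad true (mulOp (coord theta0)) (mulOp (coord (Sum.inr (-l).toNat)) : Op m n) = 0 from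
            ad_of_ne hne (Or.inr rfl) (Or.inr rfl),
          show ad true (pd theta0) (mulOp (coord (Sum.inr (-l).toNat)) : Op m n) = 0 from
            ad_of_ne hne (Or.inl rfl) (Or.inr rfl), smul_zero, add_zero]
      · subst hl
        rw [md_true_zero, map_add, map_smul, map_add, map_smul, z1, z2, z3, z4]
        simp only [wt]
        simp
        module
      · have e2 : (md true l : Op m n) = pd (Sum.inr l.toNat) := by simp [md, hl]
        have hne : theta0 ≠ (Sum.inr l.toNat : Idx) := fun h => by
          have := Sum.inr_injective h; omega
        rw [e2, if_neg (by omega),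
          show ad true (mulOp (coord theta0)) (pd (Sum.inr l.toNat) : Op m n) = 0 from
            ad_of_ne hne (Or.inr rfl) (Or.inl rfl),
          show ad true (pd theta0) (pd (Sum.inr l.toNat) : Op m n) = 0 from
            ad_of_ne hne (Or.inl rfl) (Or.inl rfl), smul_zero, add_zero]
    · have e1 : (md true k : Op m n) = pd (Sum.inr k.toNat) := by simp [md, hk]
      rw [e1]
      rcases lt_trichotomy l 0 with hl | hl | hl
      · have e2 : (md true l : Op m n) = mulOp (coord (Sum.inr (-l).toNat)) := by
          simp only [md]; rw [if_neg (by omega), if_neg hl.ne]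
        have e3 := ad_pd_coord (m := m) (n := n) (Sum.inr k.toNat) (Sum.inr (-l).toNat)
        rw [show par (Sum.inr k.toNat) = true from rfl,
          show par (Sum.inr (-l).toNat) = true from rfl] at e3
        rw [e2, e3]
        by_cases h : l = -k
        · subst h
          rw [if_pos (by rw [neg_neg]), if_pos rfl]
          simp [wt]
        · rw [if_neg h, if_neg (fun hc => h (by have := Sum.inr_injective hc; omega))]
      · subst hl
        have hne : (Sum.inr k.toNat : Idx) ≠ theta0 := fun h => by
          have := Sum.inr_injective h; omega
        rw [md_true_zero, map_add, map_smul, if_neg (by omega),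
          show ad true (pd (Sum.inr k.toNat)) (mulOp (coord theta0) : Op m n) = 0 from
            ad_of_ne hne (Or.inl rfl) (Or.inr rfl),
          show ad true (pd (Sum.inr k.toNat)) (pd theta0 : Op m n) = 0 from
            ad_of_ne hne (Or.inl rfl) (Or.inl rfl), smul_zero, add_zero]
      · obtain ⟨a, ha, h⟩ := exists_md_pos (m := m) (n := n) true hl
        rw [h, ← show par (Sum.inr k.toNat) = true from rfl, ad_pd_pd, if_neg (by omega)]

end Modes

/-! ### Linear forms, vacuum expectation values and supercentral operators -/

section Central

/-- The span of the coordinates and derivatives of parity `b`. -/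
def linForms (m n : ℕ) (b : Bool) (S : Set Idx) : Submodule ℂ (Op m n) :=
  Submodule.span ℂ {y | ∃ a, par a = b ∧ a ∈ S ∧ (y = pd a ∨ y = mulOp (coord a))}

theorem pd_mem_linForms {a : Idx} {S : Set Idx} (ha : a ∈ S) :
    (pd a : Op m n) ∈ linForms m n (par a) S :=
  Submodule.subset_span ⟨a, rfl, ha, Or.inl rfl⟩

theorem coord_mem_linForms {a : Idx} {S : Set Idx} (ha : a ∈ S) :
    (mulOp (coord a) : Op m n) ∈ linForms m n (par a) S :=
  Submodule.subset_span ⟨a, rfl, ha, Or.inr rfl⟩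

theorem md_mem_linForms (b : Bool) (k : ℤ) :
    (md b k : Op m n) ∈ linForms m n b {a | a = theta0 ↔ b = true ∧ k = 0} := by
  rcases lt_trichotomy k 0 with hk | hk | hk
  · cases b
    · simp only [md]; rw [if_neg (by omega), if_neg hk.ne]
      refine Submodule.smul_mem _ _ (coord_mem_linForms (a := Sum.inl _) ?_)
      simp [theta0]
    · simp only [md]; rw [if_neg (by omega), if_neg hk.ne]
      refine coord_mem_linForms (a := Sum.inr _) ?_
      simp [theta0]; omega
  · subst hk
    cases b
    · rw [md_false_zero]; exact Submodule.zero_mem _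
    · rw [md_true_zero]
      exact Submodule.add_mem _ (Submodule.smul_mem _ _ (coord_mem_linForms (a := theta0) (by simp)))
        (pd_mem_linForms (a := theta0) (by simp))
  · cases b
    · simp only [md]; rw [if_pos hk]
      refine pd_mem_linForms (a := Sum.inl _) ?_
      simp [theta0]
    · simp only [md]; rw [if_pos hk]
      refine pd_mem_linForms (a := Sum.inr _) ?_
      simp [theta0]; omega

theorem gp_mem_linForms : (gp : Op m n) ∈ linForms m n true {theta0} :=
  Submodule.sub_mem _ (Submodule.smul_mem _ _ (coord_mem_linForms (a := theta0) (by simp)))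
        (pd_mem_linForms (a := theta0) (by simp))

/-- Coordinates and derivatives with different labels supercommute, so linear forms in disjoint sets
of variables do. -/
theorem ad_linForms {b c : Bool} {S T : Set Idx}
    (hST : ∀ a ∈ S, ∀ a' ∈ T, par a = b → par a' = c → a ≠ a') {y z : Op m n}
    (hy : y ∈ linForms m n b S) (hz : z ∈ linForms m n c T) : ad b y z = 0 := by
  induction hy using Submodule.span_induction with
  | mem y hy =>
    obtain ⟨a, rfl, ha, hy⟩ := hy
    induction hz using Submodule.span_induction with
    | mem z hz =>
      obtain ⟨a', rfl, ha', hz⟩ := hz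
      exact ad_of_ne (hST a ha a' ha' rfl rfl) hy hz
    | zero => exact map_zero _
    | add z z' _ _ h h' => rw [map_add, h, h', add_zero]
    | smul r z _ h => rw [map_smul, h, smul_zero]
  | zero => exact ad_zero_left _ _
  | add y y' _ _ h h' => rw [ad_add_left, h, h', add_zero]
  | smul r y _ h => rw [ad_smul_left, h, smul_zero]

theorem ad_md_md (b c : Bool) (k l : ℤ) :
    ad b (md b k) (md c l : Op m n) = if c = b ∧ l = -k then wt b l • 1 else 0 := by
  by_cases h : c = b
  · subst h
    simp [ad_md_md_same]
  · rw [if_neg (fun hc => h hc.1)]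
    refine ad_linForms ?_ (md_mem_linForms b k) (md_mem_linForms c l)
    rintro a - a' - rfl rfl rfl
    exact h rfl

/-- Only the fermionic zero mode involves `θ⁰`; there the two contractions between `½θ⁰ - ∂_{θ⁰}`
and `½θ⁰ + ∂_{θ⁰}` have opposite signs. -/
theorem ad_gp_md (c : Bool) (l : ℤ) : ad true gp (md c l : Op m n) = 0 := by
  by_cases h : c = true ∧ l = 0
  · obtain ⟨rfl, rfl⟩ := h
    have z1 : ad true (mulOp (coord theta0)) (mulOp (coord theta0) : Op m n) = 0 :=
      ad_coord_coord theta0 theta0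
    have z2 : ad true (pd theta0) (pd theta0 : Op m n) = 0 := ad_pd_pd theta0 theta0
    have z3 : ad true (mulOp (coord theta0)) (pd theta0 : Op m n) = 1 := by
      have := ad_coord_pd (m := m) (n := n) theta0 theta0
      rwa [if_pos rfl] at this
    have z4 : ad true (pd theta0) (mulOp (coord theta0) : Op m n) = 1 := by
      have := ad_pd_coord (m := m) (n := n) theta0 theta0
      rw [if_pos rfl, show par theta0 = true from rfl, sgn_true_true, neg_neg, one_smul] at this
      exact this
    rw [md_true_zero, gp, ad_sub_left, ad_smul_left, map_add, map_smul, map_add, map_smul,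
      z1, z2, z3, z4]
    module
  · refine ad_linForms ?_ gp_mem_linForms (md_mem_linForms c l)
    rintro a rfl a' ha' - - hc
    exact h (ha'.1 hc.symm)

theorem coord_eq_md (a : Idx) (ha : a ≠ theta0) :
    ∃ k : ℤ, ∃ c : ℂ, (mulOp (coord a) : Op m n) = c • md (par a) k := by
  rcases a with k | k
  · refine ⟨-(k : ℤ), (k : ℂ)⁻¹, ?_⟩
    have hk : (0 : ℤ) < k := by exact_mod_cast k.pos
    show _ = (k : ℂ)⁻¹ • md false (-(k : ℤ))
    simp only [md]
    rw [if_neg (by omega), if_neg (by omega), smul_smul]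
    have : (- -(k : ℤ)).toNat.toPNat' = k := by
      apply PNat.eq; simp
    rw [this]
    have hk' : ((k : ℕ) : ℂ) ≠ 0 := by exact_mod_cast k.ne_zero
    simp [hk']
  · have hk : k ≠ 0 := fun h => ha (by rw [h]; rfl)
    refine ⟨-(k : ℤ), 1, ?_⟩
    show _ = (1 : ℂ) • md true (-(k : ℤ))
    simp only [md]
    rw [if_neg (by omega), if_neg (by omega), one_smul]
    simp

theorem pd_eq_md (a : Idx) (ha : a ≠ theta0) :
    ∃ k : ℤ, 0 < k ∧ (pd a : Op m n) = md (par a) k := by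
  rcases a with k | k
  · have hk : (0 : ℤ) < k := by exact_mod_cast k.pos
    refine ⟨k, hk, ?_⟩
    show _ = md false (k : ℤ)
    simp only [md]
    rw [if_pos hk]
    have : ((k : ℤ)).toNat.toPNat' = k := by
      apply PNat.eq; simp
    rw [this]
  · have hk : k ≠ 0 := fun h => ha (by rw [h]; rfl)
    refine ⟨k, by omega, ?_⟩
    show _ = md true (k : ℤ)
    simp only [md]
    rw [if_pos (by omega)]
    simp

/-- The value at `A = 0` of the image of `1`. -/
def vac : Op m n →ₗ[ℂ] Pol m n := evalZero.toLinearMap.comp (LinearMap.applyₗ 1)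

theorem vac_apply (D : Op m n) : vac D = evalZero (D 1) := rfl

theorem vacuumOp_apply (D : Op m n) : vacuumOp D = mulOp (vac D) := rfl

theorem evalZero_ofBase (r : Base m n) : (evalZero (ofBase r) : Pol m n) = ofBase r := by
  have h : ((evalZero : Pol m n →ₐ[ℂ] Pol m n).comp ofBase : Base m n →ₐ[ℂ] Pol m n) = ofBase := by
    refine SuperPoly.algHom_ext ?_ ?_ <;> intro e
    · rw [AlgHom.comp_apply, ofBase_evenGen, evalZero, SuperPoly.map_evenGen, MvPolynomial.aeval_X]
      rfl
    · rw [AlgHom.comp_apply, ofBase_oddGen, evalZero, SuperPoly.map_oddGen,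
        ExteriorAlgebra.map_apply_ι, Finsupp.linearCombination_single]
      simp; rfl
  exact DFunLike.congr_fun h r

theorem evalZero_coord (a : Idx) : (evalZero (coord a) : Pol m n) = 0 := by
  rcases a with k | k
  · rw [coord_inl, evalZero, SuperPoly.map_evenGen, MvPolynomial.aeval_X]
    exact SuperPoly.zero_tmul _
  · rw [coord_inr, evalZero, SuperPoly.map_oddGen,
        ExteriorAlgebra.map_apply_ι, Finsupp.linearCombination_single]
    simp only [Sum.elim_inr, smul_zero, map_zero]
    exact SuperPoly.tmul_zero _

theorem evalZero_mem_range (f : Pol m n) : ∃ r : Base m n, evalZero f = ofBase r := by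
  have h : (LinearMap.range (ofBase : Base m n →ₐ[ℂ] Pol m n).toLinearMap).comap
      (evalZero : Pol m n →ₐ[ℂ] Pol m n).toLinearMap = ⊤ := by
    refine eq_top_of_coord _ ?_ ?_
    · intro r; exact ⟨r, (evalZero_ofBase r).symm⟩
    · intro a f _; exact ⟨0, by simp [evalZero_coord]⟩
  obtain ⟨r, hr⟩ : f ∈ (LinearMap.range (ofBase : Base m n →ₐ[ℂ] Pol m n).toLinearMap).comap
      (evalZero : Pol m n →ₐ[ℂ] Pol m n).toLinearMap := by rw [h]; trivial
  exact ⟨r, hr.symm⟩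

/-- An operator that supercommutes with all modes is determined by its vacuum expectation value. -/
theorem eq_mulOp_vac {D : Op m n} (hD : RLin D) (h : ∀ b k, ad b (md b k) D = 0)
    (h0 : ad true gp D = 0) : D = mulOp (vac D) := by
  -- The modes alone contain only the combination `½θ⁰ + ∂_{θ⁰}`. Together with `gp` they recover
  -- `θ⁰` and `∂_{θ⁰}` separately, so supercommuting with all of them means supercommuting with all
  -- coordinates and derivatives.
  have ht : (mulOp (coord theta0) : Op m n) = md true 0 + gp := by
    rw [md_true_zero, gp]; module
  have htp : (pd theta0 : Op m n) = (1 / 2 : ℂ) • (md true 0 - gp) := by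
    rw [md_true_zero, gp]; module
  have hc : ∀ a, ad (par a) (mulOp (coord a)) D = 0 := by
    intro a
    by_cases ha : a = theta0
    · subst ha
      rw [ht, ad_add_left]
      show ad true _ D + ad true _ D = 0
      rw [h true, h0, add_zero]
    · obtain ⟨k, c, hk⟩ := coord_eq_md (m := m) (n := n) a ha
      rw [hk, ad_smul_left, h, smul_zero]
  have hp : ∀ a, ad (par a) (pd a) D = 0 := by
    intro a
    by_cases ha : a = theta0
    · subst ha
      rw [htp, ad_smul_left, ad_sub_left]
      show (1 / 2 : ℂ) • (ad true _ D - ad true _ D) = 0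
      rw [h true, h0, sub_zero, smul_zero]
    · obtain ⟨k, -, hk⟩ := pd_eq_md (m := m) (n := n) a ha
      rw [hk, h]
  have h1 : D ∈ Fil 1 := ⟨hD, fun g => by
    rcases g with ⟨_ | _, a⟩
    · exact mem_fil_zero.2 (hc a)
    · exact mem_fil_zero.2 (hp a)⟩
  obtain ⟨r, rfl⟩ := mem_fil_one.1 h1
  rw [vac_apply, mulOp_apply, mul_one, evalZero_ofBase]

/-! ### Operators that act on the modes by shifting the index -/

/-- The operator `D` of parity `c` sends, under the adjoint action, each mode to a multiple of the
mode with index raised by `k`. -/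
structure IsShift (c : Bool) (k : ℤ) (d : Bool → ℤ → ℂ) (D : Op m n) : Prop where
  rLin : RLin D
  hasPar : HasPar c D
  ad_md : ∀ b i, ad b (md b i) D = d b i • md (xor b c) (i + k)
  ad_gp : ad true gp D = 0

theorem bracket_eq_ad {b c : Bool} {D y : Op m n} (hD : HasPar c D) (hy : HasPar b y) :
    bracket c D y = ad b y D := by
  rw [bracket, ad_apply, hD b, hy c, mul_smul_comm, smul_mul_assoc, sgn_comm]

theorem bracket_smul_right (c : Bool) (r : ℂ) (D E : Op m n) :
    bracket c D (r • E) = r • bracket c D E := by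
  simp only [bracket, map_smul, mul_smul_comm, smul_mul_assoc]; module

theorem bracket_smul_left (c : Bool) (r : ℂ) (D E : Op m n) :
    bracket c (r • D) E = r • bracket c D E := by
  simp only [bracket, mul_smul_comm, smul_mul_assoc]; module

theorem bracket_symm {b c : Bool} {D E : Op m n} (hD : HasPar b D) (hE : HasPar c E) :
    bracket b D E = -sgn b c • bracket c E D := by
  rw [bracket, bracket, hD c, hE b]
  cases b <;> cases c <;> simp <;> module

theorem xor_cancel (b e c : Bool) : xor (xor b e) c = xor b (xor c e) := by
  cases b <;> cases e <;> cases c <;> rfl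

/-- By the Jacobi identity the adjoint action of a bracket is the bracket of the adjoint actions,
that is, of weighted shifts of the index. -/
theorem IsShift.bracket {c e : Bool} {k l : ℤ} {d d' : Bool → ℤ → ℂ} {D E : Op m n}
    (hD : IsShift c k d D) (hE : IsShift e l d' E) :
    IsShift (xor c e) (k + l) (fun b i => d' b i * d (xor b e) (i + l) -
      sgn c e * (d b i * d' (xor b c) (i + k))) (SuperAiry.bracket c D E) where
  rLin := by
    rw [SuperAiry.bracket]
    exact (hD.rLin.mul hE.rLin).sub ((hE.rLin.twist c).mul hD.rLin)
  hasPar := by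
    rw [SuperAiry.bracket]
    refine (hD.hasPar.mul hE.hasPar).sub ?_
    have := (hE.hasPar.twist c).mul hD.hasPar
    rwa [Bool.xor_comm] at this
  ad_md b i := by
    rw [ad_bracket (hasPar_md b i) hD.hasPar, hE.ad_md, hD.ad_md, hE.hasPar b, bracket_smul_right,
      bracket_smul_right, bracket_smul_left, bracket_eq_ad hD.hasPar (hasPar_md _ _), hD.ad_md,
      Bool.xor_comm c b, bracket_symm (hasPar_md _ _) hE.hasPar,
      bracket_eq_ad hE.hasPar (hasPar_md _ _), hE.ad_md, xor_cancel b e c,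
      show xor (xor b c) e = xor b (xor c e) by rw [Bool.xor_assoc],
      show i + l + k = i + (k + l) by ring, show i + k + l = i + (k + l) by ring]
    simp only [smul_smul]
    rw [← add_smul]
    congr 1
    have : sgn b e * sgn (xor b c) e = sgn c e := by
      cases b <;> cases c <;> cases e <;> simp
    linear_combination (-(d b i * d' (xor b c) (i + k))) * this
  ad_gp := by
    rw [ad_bracket hasPar_gp hD.hasPar, hE.ad_gp, hD.ad_gp]
    simp [SuperAiry.bracket]

theorem IsShift.smul {c : Bool} {k : ℤ} {d : Bool → ℤ → ℂ} {D : Op m n}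
    (hD : IsShift c k d D) (r : ℂ) : IsShift c k (fun b i => r * d b i) (r • D) where
  rLin := hD.rLin.smul r
  hasPar := hD.hasPar.smul r
  ad_md b i := by rw [map_smul, hD.ad_md, smul_smul]
  ad_gp := by rw [map_smul, hD.ad_gp, smul_zero]

theorem IsShift.zero (c : Bool) (k : ℤ) : IsShift c k (fun _ _ => 0) (0 : Op m n) where
  rLin := RLin.zero
  hasPar := HasPar.zero _
  ad_md b i := by rw [map_zero, zero_smul]
  ad_gp := map_zero _

/-- The difference supercommutes with all modes and with `gp`, so it is multiplication by its vacuum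
expectation value. Every commutation relation thus reduces to comparing weights and one scalar. -/
theorem IsShift.ext {c : Bool} {k : ℤ} {d d' : Bool → ℤ → ℂ} {D D' : Op m n}
    (hD : IsShift c k d D) (hD' : IsShift c k d' D') (hd : ∀ b i, d b i = d' b i)
    (hv : vac D = vac D') : D = D' := by
  have := eq_mulOp_vac (hD.rLin.sub hD'.rLin)
    (fun b i => by rw [map_sub, hD.ad_md, hD'.ad_md, hd, sub_self])
    (by rw [map_sub, hD.ad_gp, hD'.ad_gp, sub_self])
  rw [map_sub, hv, sub_self] at this
  have h0 : (mulOp 0 : Op m n) = 0 := by ext; simp [mulOp_apply]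
  rw [h0] at this
  exact sub_eq_zero.1 this

end Central

/-! ### Quadratic expressions in the modes -/

section Quadratic

/-- Modes of large positive index are derivatives in variables that do not occur in `f`. -/
theorem exists_md_bound (b : Bool) (f : Pol m n) : ∃ N : ℤ, 0 ≤ N ∧ ∀ k, N < k → md b k f = 0 := by
  have h : {k : ℤ | 0 < k ∧ md b k f ≠ 0}.Finite := by
    have hf := finite_pd_ne_zero f
    cases b
    · refine Set.Finite.of_finite_image (f := fun k : ℤ => (Sum.inl k.toNat.toPNat' : Idx))
        (hf.subset ?_) ?_
      · rintro _ ⟨k, ⟨hk, hne⟩, rfl⟩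
        simpa [md, hk] using hne
      · rintro k ⟨hk, -⟩ l ⟨hl, -⟩ hkl
        exact toPNat'_inj hk hl (Sum.inl_injective hkl)
    · refine Set.Finite.of_finite_image (f := fun k : ℤ => (Sum.inr k.toNat : Idx))
        (hf.subset ?_) ?_
      · rintro _ ⟨k, ⟨hk, hne⟩, rfl⟩
        simpa [md, hk] using hne
      · rintro k ⟨hk, -⟩ l ⟨hl, -⟩ hkl
        have := Sum.inr_injective hkl
        omega
  obtain ⟨N, hN⟩ := h.bddAbove
  refine ⟨max N 0, le_max_right _ _, fun k hk => ?_⟩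
  by_contra hne
  have := hN (show k ∈ {k : ℤ | 0 < k ∧ md b k f ≠ 0} from
    ⟨(le_max_right _ _).trans_lt hk, hne⟩)
  exact absurd hk (not_lt.2 (this.trans (le_max_left _ _)))

theorem pfin_int {T : ℤ → Op m n} (h : ∀ f, ∃ N : ℤ, ∀ j, (N < j ∨ j < -N) → T j f = 0) :
    PFin T := fun f => by
  obtain ⟨N, hN⟩ := h f
  refine (Set.finite_Icc (-N) N).subset fun j hj => ?_
  by_contra hc
  rw [Set.mem_Icc, not_and_or, not_le, not_le] at hc
  exact hj (hN j hc.symm)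

theorem md_pos_one (b : Bool) {k : ℤ} (hk : 0 < k) : md b k (1 : Pol m n) = 0 := by
  obtain ⟨a, -, h⟩ := exists_md_pos (m := m) (n := n) b hk
  rw [h, pd_one]

theorem vac_neg_mul (b : Bool) {k : ℤ} (hk : k < 0) (D : Op m n) : vac (md b k * D) = 0 := by
  obtain ⟨a, -, c, h⟩ := exists_md_neg (m := m) (n := n) b hk
  rw [h, vac_apply, Module.End.mul_apply, LinearMap.smul_apply, mulOp_apply, map_smul, map_mul,
    evalZero_coord, zero_mul, smul_zero]

theorem vac_mul_pos (b : Bool) {k : ℤ} (hk : 0 < k) (D : Op m n) : vac (D * md b k) = 0 := by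
  rw [vac_apply, Module.End.mul_apply, md_pos_one b hk, map_zero, map_zero]

theorem vac_one : vac (1 : Op m n) = 1 := by
  rw [vac_apply]; exact map_one _

/-- Normal ordering. -/
def nordOp : Op m n →ₗ[ℂ] Op m n := LinearMap.id - vacuumOp

theorem nordOp_apply (D : Op m n) : nordOp D = D - mulOp (vac D) := rfl

theorem nordOp_one : nordOp (1 : Op m n) = 0 := by
  rw [nordOp_apply, vac_one]
  ext; simp [mulOp_apply]

theorem md_mul_md (b c : Bool) (x y : ℤ) : (md b x * md c y : Op m n) =
    sgn b c • (md c y * md b x) + if c = b ∧ y = -x then wt b x • 1 else 0 := by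
  have h := ad_md_md (m := m) (n := n) c b y x
  rw [ad_apply, (hasPar_md b x) c, mul_smul_comm, sgn_comm] at h
  rw [← sub_eq_iff_eq_add', h]
  by_cases hc : c = b
  · subst hc
    have : x = -y ↔ y = -x := by omega
    simp [this]
  · rw [if_neg (fun h => hc h.1.symm), if_neg (fun h => hc h.1)]

/-- Two modes supercommute up to a complex scalar, and normal ordering kills scalars. -/
theorem nordOp_md_mul_md (b : Bool) (x y : ℤ) : nordOp (md b x * md b y : Op m n) =
    sgn b b • nordOp (md b y * md b x) := by
  rw [md_mul_md b b x y, map_add, map_smul]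
  split_ifs
  · rw [map_smul, nordOp_one, smul_zero, add_zero]
  · rw [map_zero, add_zero]

theorem nordOp_apply_right (b : Bool) (x : ℤ) {y : ℤ} (hy : 0 < y) {f : Pol m n}
    (h : md b y f = 0) : nordOp (md b x * md b y) f = 0 := by
  rw [nordOp_apply, vac_mul_pos b hy, LinearMap.sub_apply, Module.End.mul_apply, h, map_zero,
    mulOp_apply, zero_mul, sub_zero]

theorem nordOp_apply_left (b : Bool) {x : ℤ} (y : ℤ) (hx : 0 < x) {f : Pol m n}
    (h : md b x f = 0) : nordOp (md b x * md b y) f = 0 := by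
  rw [nordOp_md_mul_md, LinearMap.smul_apply, nordOp_apply_right b y hx h, smul_zero]

theorem ad_ofBase {b : Bool} {y : Op m n} (hy : RLin y) (hp : HasPar b y) (r : Base m n) :
    ad b y (mulOp (ofBase r)) = 0 := by
  obtain ⟨r', hr'⟩ := twistPol_ofBase (m := m) (n := n) b r
  have h : twist b (mulOp (ofBase r) : Op m n) = mulOp (ofBase r') := by
    rw [twist_mulOp, hr']
  rw [ad_apply, h, hy.mul_mulOp_ofBase hp, ← h, twist_self, sub_self]

/-- Normal ordering subtracts an element of `R`, which supercommutes with operators linear over `R`.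
-/
theorem ad_nordOp {b : Bool} {y : Op m n} (hy : RLin y) (hp : HasPar b y) (D : Op m n) :
    ad b y (nordOp D) = ad b y D := by
  obtain ⟨r, hr⟩ := evalZero_mem_range (D 1)
  rw [nordOp_apply, map_sub, vac_apply, hr, ad_ofBase hy hp, sub_zero]

theorem parity_evalZero (f : Pol m n) : parity (evalZero f) = evalZero (parity f) := by
  have h : (parity.comp evalZero : Pol m n →ₐ[ℂ] Pol m n) = evalZero.comp parity := by
    refine SuperPoly.algHom_ext ?_ ?_
    · rintro (e | e)
      · have : evenGen (Sum.inl e) = (ofBase (evenGen e) : Pol m n) := (ofBase_evenGen e).symm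
        rw [AlgHom.comp_apply, AlgHom.comp_apply, parity_evenGen, this, evalZero_ofBase,
          parity_ofBase, parity_evenGen]
      · have := evalZero_coord (m := m) (n := n) (Sum.inl e)
        rw [coord_inl] at this
        rw [AlgHom.comp_apply, AlgHom.comp_apply, parity_evenGen, this, map_zero]
    · rintro (e | e)
      · have : oddGen (Sum.inl e) = (ofBase (oddGen e) : Pol m n) := (ofBase_oddGen e).symm
        rw [AlgHom.comp_apply, AlgHom.comp_apply, parity_oddGen, map_neg, this, evalZero_ofBase,
          parity_ofBase, parity_oddGen, map_neg]
      · have := evalZero_coord (m := m) (n := n) (Sum.inr e)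
        rw [coord_inr] at this
        rw [AlgHom.comp_apply, AlgHom.comp_apply, parity_oddGen, map_neg, this, map_zero, neg_zero]
  exact DFunLike.congr_fun h f

theorem hasPar_nordOp {D : Op m n} (hD : HasPar false D) : HasPar false (nordOp D) := by
  refine hD.sub (HasPar.of_true ?_)
  have h1 : parity (D 1) = D 1 := by
    have h2 := congrArg (fun T : Op m n => T 1) (hD true)
    simp only [sgn_false_right, one_smul] at h2
    rw [twist_apply, twistPol_true, map_one] at h2
    exact h2
  rw [vacuumOp_apply, twist_mulOp, twistPol_true, vac_apply, parity_evalZero, h1]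
  simp

theorem rLin_nordOp {D : Op m n} (hD : RLin D) : RLin (nordOp D) := hD.sub (rLin_mulOp _)

theorem nordOp_mem_fil {D : Op m n} (hD : D ∈ Fil 3) : nordOp D ∈ Fil 3 := by
  obtain ⟨r, hr⟩ := evalZero_mem_range (D 1)
  rw [nordOp_apply, vac_apply, hr]
  exact Submodule.sub_mem _ hD (fil_mono (by omega) (ofBase_mem_fil r))

/-- The bracket of a mode with a sum of quadratic expressions of constant total index. -/
theorem ad_md_psum {b b₁ b₂ : Bool} {i u v : ℤ} {T : ℤ → Op m n} (hT : PFin T) (w : ℤ → ℂ)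
    (h : ∀ j, ad b (md b i) (T j) = w j • ad b (md b i) (md b₁ (u - j) * md b₂ (v + j))) :
    ad b (md b i) (psum T) =
      (if b₂ = b then w (-i - v) * wt b (-i) else 0) • md b₁ (i + (u + v)) +
      (if b₁ = b then w (u + i) * wt b (-i) * sgn b b₂ else 0) • md b₂ (i + (u + v)) := by
  rw [ad_psum hT, psum_congr h]
  -- `A` collects the contractions with the second factor and `B` those with the first. Each occurs
  -- for exactly one value of `j`, so the infinite sum collapses to two terms.
  set A : ℤ → Op m n := fun j => if b₂ = b ∧ j = -i - v then
    (w j * wt b (-i)) • md b₁ (i + (u + v)) else 0 with hA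
  set B : ℤ → Op m n := fun j => if b₁ = b ∧ j = u + i then
    (w j * wt b (-i) * sgn b b₂) • md b₂ (i + (u + v)) else 0 with hB
  have h1 : ∀ j, w j • ad b (md b i) (md b₁ (u - j) * md b₂ (v + j)) = A j + B j := by
    intro j
    rw [ad_mul, ad_md_md, ad_md_md, (hasPar_md b₂ (v + j)) b, smul_add, hA, hB]
    congr 1
    · by_cases hc : b₂ = b ∧ j = -i - v
      · have e1 : v + j = -i := by omega
        have e2 : u - j = i + (u + v) := by omega
        simp only [hc.1, e1, and_self, if_true, mul_smul_comm, mul_one, e2, smul_smul]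
        rw [if_pos ⟨trivial, hc.2⟩]
      · have : ¬(b₂ = b ∧ v + j = -i) := fun h => hc ⟨h.1, by omega⟩
        simp only [if_neg hc, if_neg this, mul_zero, smul_zero]
    · by_cases hc : b₁ = b ∧ j = u + i
      · have e1 : u - j = -i := by omega
        have e2 : v + j = i + (u + v) := by omega
        simp only [hc.1, e1, and_self, if_true, smul_mul_assoc, one_mul, e2, smul_smul]
        rw [if_pos ⟨trivial, hc.2⟩]
        congr 1
        ring
      · have : ¬(b₁ = b ∧ u - j = -i) := fun h => hc ⟨h.1, by omega⟩
        simp only [if_neg hc, if_neg this, zero_mul, smul_zero]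
  have hA0 : ∀ j, j ≠ -i - v → A j = 0 := fun j hj => if_neg fun h => hj h.2
  have hB0 : ∀ j, j ≠ u + i → B j = 0 := fun j hj => if_neg fun h => hj h.2
  have hAf : PFin A := PFin.of_finite ((Set.finite_singleton (-i - v)).subset fun j hj => by
    by_contra hc; exact hj (hA0 j hc))
  have hBf : PFin B := PFin.of_finite ((Set.finite_singleton (u + i)).subset fun j hj => by
    by_contra hc; exact hj (hB0 j hc))
  rw [psum_congr h1, ← psum_add hAf hBf, psum_eq_single _ hA0, psum_eq_single _ hB0, hA, hB]
  simp only [and_true]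
  congr 1 <;> split_ifs <;> simp

theorem ad_gp_mul_md (b₁ b₂ : Bool) (x y : ℤ) : ad true gp (md b₁ x * md b₂ y : Op m n) = 0 := by
  rw [ad_mul, ad_gp_md, ad_gp_md, mul_zero, zero_mul, add_zero]

/-! ### The operators `L_k` and `G_k` -/

/-- The coefficients in the sums defining `L_k`. -/
def virCoeff (b : Bool) (k j : ℤ) : ℂ :=
  if b then (-1) ^ j * ((j : ℂ) + (k : ℂ) / 2) else (-1) ^ (j - 1)

/-- The members of the sums defining `L_k`. -/
def virTerm (b : Bool) (k j : ℤ) : Op m n :=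
  virCoeff b k j • nordOp (md b (-j) * md b (k + j))

/-- For large `|j|` one of the two modes has large positive index, and inside the normal ordering it
may be moved to the right. -/
theorem pfin_virTerm (b : Bool) (k : ℤ) : PFin (virTerm b k : ℤ → Op m n) := pfin_int fun f => by
  obtain ⟨N, hN0, hN⟩ := exists_md_bound b f
  refine ⟨N + |k|, fun j hj => ?_⟩
  have := neg_abs_le k
  have := abs_nonneg k
  rw [virTerm, LinearMap.smul_apply]
  rcases hj with hj | hj
  · rw [nordOp_apply_right b _ (by omega) (hN _ (by omega)), smul_zero]
  · rw [nordOp_apply_left b _ (by omega) (hN _ (by omega)), smul_zero]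

/-- The operator `L_k = ħ² ℓ_k` divided by `ħ²`. -/
def virOp (k : ℤ) : Op m n :=
  (1 / 2 : ℂ) • psum (virTerm false k) + (1 / 2 : ℂ) • psum (virTerm true k) +
    if k = 0 then (1 / 4 : ℂ) • 1 else 0

/-- The members of the sum defining `G_k`. -/
def gTerm (k j : ℤ) : Op m n := (-1 : ℂ) ^ (j - 1) • (md false (-j) * md true (k + j))

theorem pfin_gTerm (k : ℤ) : PFin (gTerm k : ℤ → Op m n) := pfin_int fun f => by
  obtain ⟨N, hN0, hN⟩ := exists_md_bound true f
  obtain ⟨N', hN0', hN'⟩ := exists_md_bound false f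
  refine ⟨N + N' + |k|, fun j hj => ?_⟩
  have := neg_abs_le k
  have := abs_nonneg k
  rw [gTerm, LinearMap.smul_apply]
  rcases hj with hj | hj
  · rw [Module.End.mul_apply, hN _ (by omega), map_zero, smul_zero]
  · rw [md_mul_md, if_neg (fun h => Bool.noConfusion h.1), add_zero, LinearMap.smul_apply,
      Module.End.mul_apply, hN' _ (by omega), map_zero, smul_zero, smul_zero]

/-- The operator `G_k` divided by `ħ²`. -/
def gOp (k : ℤ) : Op m n := psum (gTerm k)

theorem normOrd_eq (A B : Op m n) :
    (normOrd (mono 1 A : Ser m n) (mono 1 B : Ser m n) : HOp m n) = mono 2 (nordOp (A * B)) := by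
  have h1 : (mono 1 A * mono 1 B : Ser m n) = mono 2 (A * B) := mono_mul_mono 1 1 A B
  refine Ser.ext fun k => ?_
  have h2 : Ser.coeff k (normOrd (mono 1 A : Ser m n) (mono 1 B : Ser m n)) =
    Ser.coeff k (mono 1 A * mono 1 B) - vacuumOp (Ser.coeff k (mono 1 A * mono 1 B)) := rfl
  rw [h2, h1, coeff_mono, coeff_mono]
  split_ifs
  · rfl
  · rw [map_zero, sub_zero]

theorem opSum_mono {ι : Type} {T : ι → HOp m n} {T' : ι → Op m n} (k : ℤ) (h : PFin T')
    (hT : ∀ i, T i = (mono k (T' i) : Ser m n)) : opSum T = (mono k (psum T') : Ser m n) := by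
  have : T = fun i => (mono k (T' i) : Ser m n) := funext hT
  subst this
  exact (summ_mono_psum h).opSum_eq

theorem Lvir_eq (k : ℤ) : (Lvir k : HOp m n) = mono 2 (virOp k) := by
  have h1 : opSum (fun j : ℤ => (-1 : ℂ) ^ (j - 1) • normOrd (J (-j)) (J (k + j)) : ℤ → HOp m n) =
      mono 2 (psum (virTerm false k)) := opSum_mono 2 (pfin_virTerm false k) fun j => by
    rw [J_eq, J_eq, normOrd_eq, virTerm, map_smul]; rfl
  have h2 : opSum (fun j : ℤ => ((-1 : ℂ) ^ j * ((j : ℂ) + (k : ℂ) / 2)) •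
      normOrd (Gam (-j)) (Gam (k + j)) : ℤ → HOp m n) =
      mono 2 (psum (virTerm true k)) := opSum_mono 2 (pfin_virTerm true k) fun j => by
    rw [Gam_eq, Gam_eq, normOrd_eq, virTerm, map_smul]; rfl
  rw [Lvir, h1, h2, virOp, map_add, map_add, map_smul, map_smul]
  have h3 : (if k = 0 then (1 / 4 : ℂ) • hbar 2 else 0 : HOp m n) =
      (mono 2 (if k = 0 then (1 / 4 : ℂ) • (1 : Op m n) else 0) : Ser m n) := by
    split_ifs
    · rw [map_smul]; rfl
    · rw [map_zero]; rfl
  rw [h3]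
  rfl

theorem Gvir_eq (k : ℤ) : (Gvir k : HOp m n) = mono 2 (gOp k) := by
  refine opSum_mono 2 (pfin_gTerm k) fun j => ?_
  rw [J_eq, Gam_eq, gTerm, map_smul, ← show (1 : ℤ) + 1 = 2 from rfl, ← mono_mul_mono]
  rfl

end Quadratic

/-! ### The super Virasoro algebra of the remaining modes -/

section Virasoro

/-- The coefficients of the correction of `L_k` by the modes `J_{2j}` and `Γ_{2j-1}`. -/
def corrCoeff (b : Bool) (k l : ℤ) : ℂ :=
  if 0 < l ∧ (if b then Odd l else Even l) then
    (if 0 < k - l then 1 / 2 else 1) * (if b then (l : ℂ) - k / 2 else 1) else 0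

/-- The members of the correction of `L_k`. -/
def corrTerm (b : Bool) (k l : ℤ) : Op m n := corrCoeff b k l • (md b (k - l) * md b l)

theorem pfin_corrTerm (b : Bool) (k : ℤ) : PFin (corrTerm b k : ℤ → Op m n) := pfin_int fun f => by
  obtain ⟨N, hN0, hN⟩ := exists_md_bound b f
  refine ⟨N, fun j hj => ?_⟩
  rw [corrTerm, LinearMap.smul_apply]
  rcases hj with hj | hj
  · rw [Module.End.mul_apply, hN _ hj, map_zero, smul_zero]
  · rw [corrCoeff, if_neg (by omega), zero_smul]

/-- The Virasoro operators that commute with all `J_{2j}` and `Γ_{2j-1}`. -/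
def mOp (k : ℤ) : Op m n := virOp k + (psum (corrTerm false k) + psum (corrTerm true k))

/-- The coefficients of the correction of `G_k`. -/
def gCorrCoeff (b : Bool) (k l : ℤ) : ℂ :=
  if b then (if 0 < l ∧ Odd l ∧ k - l < 0 then 1 else 0) else if 0 < l ∧ Even l then 1 else 0

theorem gCorrCoeff_of_nonpos (b : Bool) (k : ℤ) {l : ℤ} (hl : ¬0 < l) : gCorrCoeff b k l = 0 := by
  cases b <;> simp [gCorrCoeff, hl]

/-- The members of the correction of `G_k`. -/
def gCorrTerm (b : Bool) (k l : ℤ) : Op m n := gCorrCoeff b k l • (md (!b) (k - l) * md b l)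

theorem pfin_gCorrTerm (b : Bool) (k : ℤ) : PFin (gCorrTerm b k : ℤ → Op m n) := pfin_int fun f => by
  obtain ⟨N, hN0, hN⟩ := exists_md_bound b f
  refine ⟨N, fun j hj => ?_⟩
  rw [gCorrTerm, LinearMap.smul_apply]
  rcases hj with hj | hj
  · rw [Module.End.mul_apply, hN _ hj, map_zero, smul_zero]
  · rw [gCorrCoeff_of_nonpos b k (by omega), zero_smul]

/-- The odd generators of the super Virasoro algebra, (anti)commuting with all `J_{2j}` and
`Γ_{2j-1}`. -/
def nOp (k : ℤ) : Op m n := gOp k + (psum (gCorrTerm false k) + psum (gCorrTerm true k))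

/-- The adjoint action of `mOp` on the modes. -/
def mShift (k : ℤ) (b : Bool) (i : ℤ) : ℂ :=
  if b then (if Even i then -((i : ℂ) + k / 2) else 0) else if Odd i then -i else 0

/-- The adjoint action of `nOp` on the modes. -/
def nShift (b : Bool) (i : ℤ) : ℂ :=
  if b then (if Even i then 1 else 0) else if Odd i then -i else 0

theorem ad_virTerm (b b' : Bool) (k i : ℤ) (j : ℤ) :
    ad b' (md b' i) (virTerm b k j : Op m n) =
      virCoeff b k j • ad b' (md b' i) (md b (0 - j) * md b (k + j)) := by
  rw [virTerm, map_smul, ad_nordOp (rLin_md _ _) (hasPar_md _ _), zero_sub]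

theorem ad_md_virSum (b b' : Bool) (k i : ℤ) : ad b' (md b' i) (psum (virTerm b k) : Op m n) =
    if b = b' then (wt b (-i) * (virCoeff b k (-i - k) + sgn b b * virCoeff b k i)) • md b (i + k)
      else 0 := by
  rw [ad_md_psum (pfin_virTerm b k) (virCoeff b k) (ad_virTerm b b' k i)]
  by_cases h : b = b'
  · subst h
    rw [if_pos rfl, if_pos rfl, if_pos rfl, ← add_smul, zero_add, zero_add]
    congr 1
    ring
  · rw [if_neg h, if_neg h, if_neg h]; simp

theorem ad_md_corrSum (b b' : Bool) (k i : ℤ) : ad b' (md b' i) (psum (corrTerm b k) : Op m n) =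
    if b = b' then (wt b (-i) * (corrCoeff b k (-i) + sgn b b * corrCoeff b k (i + k))) •
      md b (i + k) else 0 := by
  rw [ad_md_psum (u := k) (v := 0) (pfin_corrTerm b k) (corrCoeff b k)
    (fun j => by rw [corrTerm, map_smul, zero_add])]
  by_cases h : b = b'
  · subst h
    rw [if_pos rfl, if_pos rfl, if_pos rfl, ← add_smul, add_zero, sub_zero, add_comm k i]
    congr 1
    ring
  · rw [if_neg h, if_neg h, if_neg h]; simp

theorem neg_one_zpow_of_odd {j : ℤ} (h : Odd j) : (-1 : ℂ) ^ j = -1 := h.neg_one_zpow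
theorem neg_one_zpow_of_even {j : ℤ} (h : Even j) : (-1 : ℂ) ^ j = 1 := h.neg_one_zpow

theorem virCoeff_false_odd {k j : ℤ} (h : Odd j) : virCoeff false k j = 1 := by
  simp only [virCoeff]
  exact neg_one_zpow_of_even (by obtain ⟨a, rfl⟩ := h; exact ⟨a, by ring⟩)

theorem virCoeff_false_even {k j : ℤ} (h : Even j) : virCoeff false k j = -1 := by
  simp only [virCoeff]
  exact neg_one_zpow_of_odd (by obtain ⟨a, rfl⟩ := h; exact ⟨a - 1, by ring⟩)

theorem virCoeff_true_odd {k j : ℤ} (h : Odd j) : virCoeff true k j = -((j : ℂ) + k / 2) := by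
  simp only [virCoeff, if_true]
  rw [neg_one_zpow_of_odd h]; ring

theorem virCoeff_true_even {k j : ℤ} (h : Even j) : virCoeff true k j = (j : ℂ) + k / 2 := by
  simp only [virCoeff, if_true]
  rw [neg_one_zpow_of_even h]; ring

theorem ad_md_ite_one (b : Bool) (i : ℤ) (p : Prop) [Decidable p] (c : ℂ) :
    ad b (md b i) (if p then c • 1 else 0 : Op m n) = 0 := by
  split_ifs
  · rw [map_smul, ad_one, smul_zero]
  · exact map_zero _

/-- The weights of the uncorrected and corrected sums are added and compared case by case. For modes
of the wrong parity (even bosonic, odd fermionic) the correction cancels the uncorrected weight; for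
the others it does not contribute. The factor one half in the correction belongs to pairs in which
both modes are positive, as these are counted twice in the sum. -/
theorem ad_md_mOp {k : ℤ} (hk : Even k) (hk2 : -2 ≤ k) (b : Bool) (i : ℤ) :
    ad b (md b i) (mOp k : Op m n) = mShift k b i • md b (i + k) := by
  rw [mOp, virOp]
  simp only [map_add, map_smul, ad_md_virSum, ad_md_corrSum, ad_md_ite_one, add_zero]
  cases b
  · simp only [if_true, Bool.true_eq_false, if_false, smul_zero, add_zero, smul_smul, ← add_smul,
      sgn_false_left, one_mul, wt, mShift, Bool.false_eq_true]
    -- If the target is `J_0 = 0`, the weights need not agree.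
    by_cases h0 : i + k = 0
    · rw [h0, md_false_zero, smul_zero, smul_zero]
    congr 1
    rcases Int.even_or_odd i with hi | hi
    · have hi' : Even (-i - k) := hi.neg.sub hk
      rw [virCoeff_false_even hi, virCoeff_false_even hi', if_neg (by simpa using hi)]
      simp only [corrCoeff, Bool.false_eq_true, if_false]
      by_cases hi0 : i = 0
      · simp [hi0]
      have e1 : Even (-i) := hi.neg
      have e2 : Even (i + k) := hi.add hk
      obtain ⟨a, ha⟩ := hi
      obtain ⟨c, hc⟩ := hk
      simp only [e1, e2, and_true]
      rcases lt_or_gt_of_ne hi0 with hlt | hgt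
      · rw [if_pos (by omega)]
        rcases lt_or_gt_of_ne h0 with h1 | h1
        · rw [if_neg (by omega), if_neg (by omega)]; push_cast; ring
        · rw [if_pos (by omega), if_pos h1, if_pos (by omega)]; push_cast; ring
      · rw [if_neg (by omega), if_pos (by omega), if_neg (by omega)]; push_cast; ring
    · have hi' : Odd (-i - k) := hi.neg.sub_even hk
      have e1 : ¬Even (-i) := by simpa using hi
      have e2 : ¬Even (i + k) := by
        rw [Int.not_even_iff_odd]; exact hi.add_even hk
      rw [virCoeff_false_odd hi, virCoeff_false_odd hi', if_pos hi]
      simp only [corrCoeff, Bool.false_eq_true, if_false, e1, e2, and_false]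
      push_cast; ring
  · simp only [if_true, Bool.false_eq_true, if_false, smul_zero, zero_add, smul_smul, ← add_smul,
      sgn_true_true, one_mul, wt, mShift]
    congr 1
    rcases Int.even_or_odd i with hi | hi
    · have hi' : Even (-i - k) := hi.neg.sub hk
      have e1 : ¬Odd (-i) := by simpa using hi
      have e2 : ¬Odd (i + k) := by
        rw [Int.not_odd_iff_even]; exact hi.add hk
      rw [virCoeff_true_even hi, virCoeff_true_even hi', if_pos hi]
      simp only [corrCoeff, if_true, e1, e2, and_false, if_false]
      push_cast; ring
    · have hi' : Odd (-i - k) := hi.neg.sub_even hk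
      rw [virCoeff_true_odd hi, virCoeff_true_odd hi', if_neg (by simpa using hi)]
      have e1 : Odd (-i) := hi.neg
      have e2 : Odd (i + k) := hi.add_even hk
      obtain ⟨a, ha⟩ := hi
      obtain ⟨c, hc⟩ := hk
      simp only [corrCoeff, if_true, e1, e2, and_true]
      by_cases hlt : 0 < -i
      · rw [if_pos hlt]
        by_cases h1 : 0 < i + k
        · rw [if_pos (by omega), if_pos h1, if_pos (by omega)]; push_cast; ring
        · rw [if_neg (by omega), if_neg h1]; push_cast; ring
      · rw [if_neg hlt]
        by_cases h1 : 0 < i + k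
        · rw [if_pos h1, if_neg (by omega)]; push_cast; ring
        -- With neither contraction available, `i` odd and `-2 ≤ k` leave only `i = 1`, `k = -2`,
        -- where the weight `i + k/2` vanishes.
        · have hk' : k = -2 := by omega
          have hi' : i = 1 := by omega
          rw [if_neg h1, hk', hi']
          norm_num

theorem hasPar_md_mul_md (b : Bool) (x y : ℤ) : HasPar false (md b x * md b y : Op m n) := by
  have := (hasPar_md (m := m) (n := n) b x).mul (hasPar_md b y)
  rwa [Bool.xor_self] at this

theorem isShift_mOp {k : ℤ} (hk : Even k) (hk2 : -2 ≤ k) :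
    IsShift false k (mShift k) (mOp k : Op m n) where
  rLin := by
    have h1 : ∀ b, RLin (psum (virTerm b k) : Op m n) := fun b =>
      RLin.psum (pfin_virTerm b k) fun j => (rLin_nordOp ((rLin_md _ _).mul (rLin_md _ _))).smul _
    have h2 : ∀ b, RLin (psum (corrTerm b k) : Op m n) := fun b =>
      RLin.psum (pfin_corrTerm b k) fun j => ((rLin_md _ _).mul (rLin_md _ _)).smul _
    rw [mOp, virOp]
    refine ((((h1 _).smul _).add ((h1 _).smul _)).add ?_).add ((h2 _).add (h2 _))
    split_ifs
    · exact RLin.one.smul _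
    · exact RLin.zero
  hasPar := by
    have h1 : ∀ b, HasPar false (psum (virTerm b k) : Op m n) := fun b =>
      HasPar.psum (pfin_virTerm b k) fun j => (hasPar_nordOp (hasPar_md_mul_md _ _ _)).smul _
    have h2 : ∀ b, HasPar false (psum (corrTerm b k) : Op m n) := fun b =>
      HasPar.psum (pfin_corrTerm b k) fun j => (hasPar_md_mul_md _ _ _).smul _
    rw [mOp, virOp]
    refine ((((h1 _).smul _).add ((h1 _).smul _)).add ?_).add ((h2 _).add (h2 _))
    split_ifs
    · exact HasPar.one.smul _
    · exact HasPar.zero _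
  ad_md b i := by rw [Bool.xor_false]; exact ad_md_mOp hk hk2 b i
  ad_gp := by
    have h1 : ∀ b, ad true gp (psum (virTerm b k) : Op m n) = 0 := fun b => by
      rw [ad_psum (pfin_virTerm b k), ← psum_zero (ι := ℤ)]
      refine psum_congr fun j => ?_
      rw [virTerm, map_smul, ad_nordOp rLin_gp hasPar_gp, ad_gp_mul_md, smul_zero]
    have h2 : ∀ b, ad true gp (psum (corrTerm b k) : Op m n) = 0 := fun b => by
      rw [ad_psum (pfin_corrTerm b k), ← psum_zero (ι := ℤ)]
      refine psum_congr fun j => ?_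
      rw [corrTerm, map_smul, ad_gp_mul_md, smul_zero]
    rw [mOp, virOp]
    simp only [map_add, map_smul, h1, h2, smul_zero, add_zero, zero_add]
    split_ifs
    · rw [map_smul, ad_one, smul_zero]
    · exact map_zero _

/-- As for `mOp`: the correction removes the even bosonic and odd fermionic modes. A pair with both
of them positive is subtracted in the bosonic sum only, which is why the fermionic correction
requires the other index to be negative. -/
theorem ad_md_nOp {k : ℤ} (hk : Odd k) (hk2 : -1 ≤ k) (b : Bool) (i : ℤ) :
    ad b (md b i) (nOp k : Op m n) = nShift b i • md (!b) (i + k) := by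
  have h1 := ad_md_psum (m := m) (n := n) (b := b) (b₁ := false) (b₂ := true) (i := i) (u := 0)
    (v := k) (pfin_gTerm k) (fun j => (-1) ^ (j - 1))
    (fun j => by rw [gTerm, map_smul, zero_sub])
  have h2 := ad_md_psum (m := m) (n := n) (b := b) (b₁ := true) (b₂ := false) (i := i) (u := k)
    (v := 0) (pfin_gCorrTerm false k) (gCorrCoeff false k)
    (fun j => by rw [gCorrTerm, map_smul, zero_add]; rfl)
  have h3 := ad_md_psum (m := m) (n := n) (b := b) (b₁ := false) (b₂ := true) (i := i) (u := k)
    (v := 0) (pfin_gCorrTerm true k) (gCorrCoeff true k)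
    (fun j => by rw [gCorrTerm, map_smul, zero_add]; rfl)
  rw [nOp, gOp, map_add, map_add, h1, h2, h3]
  cases b
  · simp only [if_true, Bool.true_eq_false, Bool.false_eq_true, if_false, zero_smul, add_zero,
      zero_add, ← add_smul, sgn_false_left, mul_one, wt, nShift, Bool.not_false, sub_zero]
    congr 1
    rcases Int.even_or_odd i with hi | hi
    · have e1 : Even (-i) := hi.neg
      have e2 : Odd (k + i) := hk.add_even hi
      have e3 : Odd (i - 1) := hi.sub_odd odd_one
      rw [neg_one_zpow_of_odd e3, if_neg (by simpa using hi)]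
      simp only [gCorrCoeff, Bool.false_eq_true, if_false, if_true, e1, e2, and_true, true_and]
      by_cases hi0 : i = 0
      · simp [hi0]
      obtain ⟨a, ha⟩ := hi
      obtain ⟨c, hc⟩ := hk
      rcases lt_or_gt_of_ne hi0 with hlt | hgt
      · rw [if_pos (by omega), if_neg (by omega)]; push_cast; ring
      · rw [if_neg (by omega), if_pos (by omega)]; push_cast; ring
    · have e1 : ¬Even (-i) := by simpa using hi
      have e2 : ¬Odd (k + i) := by rw [Int.not_odd_iff_even]; exact hk.add_odd hi
      have e3 : Even (i - 1) := hi.sub_odd odd_one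
      rw [neg_one_zpow_of_even e3, if_pos hi]
      simp only [gCorrCoeff, Bool.false_eq_true, if_false, if_true, e1, e2, and_false, false_and]
      push_cast; ring
  · simp only [if_true, Bool.true_eq_false, Bool.false_eq_true, if_false, zero_smul, add_zero,
      zero_add, ← add_smul, sgn_false_right, mul_one, wt, nShift, Bool.not_true, sub_zero]
    by_cases h0 : i + k = 0
    · rw [h0, md_false_zero, smul_zero, smul_zero]
    congr 1
    rcases Int.even_or_odd i with hi | hi
    · have e1 : ¬Odd (-i) := by simpa using hi
      have e2 : ¬Even (k + i) := by rw [Int.not_even_iff_odd]; exact hk.add_even hi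
      have e3 : Even (-i - k - 1) := (hi.neg.sub_odd hk).sub_odd odd_one
      rw [neg_one_zpow_of_even e3, if_pos hi]
      simp only [gCorrCoeff, Bool.false_eq_true, if_false, if_true, e1, e2, and_false, false_and]
      ring
    · have e1 : Odd (-i) := hi.neg
      have e2 : Even (k + i) := hk.add_odd hi
      have e3 : Odd (-i - k - 1) := (hi.neg.sub_odd hk).sub_odd odd_one
      rw [neg_one_zpow_of_odd e3, if_neg (by simpa using hi)]
      simp only [gCorrCoeff, Bool.false_eq_true, if_false, if_true, e1, e2, and_true, true_and]
      obtain ⟨a, ha⟩ := hi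
      obtain ⟨c, hc⟩ := hk
      rcases lt_or_gt_of_ne h0 with hlt | hgt
      · rw [if_neg (by omega), if_pos (by omega)]; ring
      · rw [if_pos (by omega), if_neg (by omega)]; ring

theorem hasPar_md_mul_md_not (b : Bool) (x y : ℤ) : HasPar true (md (!b) x * md b y : Op m n) := by
  have := (hasPar_md (m := m) (n := n) (!b) x).mul (hasPar_md b y)
  rwa [show xor (!b) b = true by cases b <;> rfl] at this

theorem isShift_nOp {k : ℤ} (hk : Odd k) (hk2 : -1 ≤ k) :
    IsShift true k nShift (nOp k : Op m n) where
  rLin := by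
    have h2 : ∀ b, RLin (psum (gCorrTerm b k) : Op m n) := fun b =>
      RLin.psum (pfin_gCorrTerm b k) fun j => ((rLin_md _ _).mul (rLin_md _ _)).smul _
    exact (RLin.psum (pfin_gTerm k) fun j => ((rLin_md _ _).mul (rLin_md _ _)).smul _).add
      ((h2 _).add (h2 _))
  hasPar := by
    have h2 : ∀ b, HasPar true (psum (gCorrTerm b k) : Op m n) := fun b =>
      HasPar.psum (pfin_gCorrTerm b k) fun j => (hasPar_md_mul_md_not _ _ _).smul _
    exact (HasPar.psum (pfin_gTerm k) fun j => (hasPar_md_mul_md_not true _ _).smul _).add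
      ((h2 _).add (h2 _))
  ad_md b i := by rw [Bool.xor_true]; exact ad_md_nOp hk hk2 b i
  ad_gp := by
    have h1 : ad true gp (psum (gTerm k) : Op m n) = 0 := by
      rw [ad_psum (pfin_gTerm k), ← psum_zero (ι := ℤ)]
      refine psum_congr fun j => ?_
      rw [gTerm, map_smul, ad_gp_mul_md, smul_zero]
    have h2 : ∀ b, ad true gp (psum (gCorrTerm b k) : Op m n) = 0 := fun b => by
      rw [ad_psum (pfin_gCorrTerm b k), ← psum_zero (ι := ℤ)]
      refine psum_congr fun j => ?_
      rw [gCorrTerm, map_smul, ad_gp_mul_md, smul_zero]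
    rw [nOp, gOp]
    simp only [map_add, h1, h2, add_zero]

/-! ### Vacuum vectors -/

theorem psum_apply_eq_zero {ι : Type} {T : ι → Op m n} (h : PFin T) {f : Pol m n}
    (h0 : ∀ i, T i f = 0) : psum T f = 0 := by
  rw [psum_apply h]
  exact finsum_eq_zero_of_forall_eq_zero h0

theorem psum_corrTerm_one (b : Bool) (k : ℤ) : psum (corrTerm b k) (1 : Pol m n) = 0 :=
  psum_apply_eq_zero (pfin_corrTerm b k) fun l => by
    rw [corrTerm, LinearMap.smul_apply, Module.End.mul_apply]
    by_cases hl : 0 < l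
    · rw [md_pos_one b hl, map_zero, smul_zero]
    · rw [corrCoeff, if_neg (fun h => hl h.1), zero_smul]

theorem psum_gCorrTerm_one (b : Bool) (k : ℤ) : psum (gCorrTerm b k) (1 : Pol m n) = 0 :=
  psum_apply_eq_zero (pfin_gCorrTerm b k) fun l => by
    rw [gCorrTerm, LinearMap.smul_apply, Module.End.mul_apply]
    by_cases hl : 0 < l
    · rw [md_pos_one b hl, map_zero, smul_zero]
    · rw [gCorrCoeff_of_nonpos b k hl, zero_smul]

/-- The fermionic zero mode anticommutes with itself to one, so twice its square is one. -/
theorem md_zero_sq (b : Bool) : (md b 0 * md b 0 : Op m n) = (if b then 1 / 2 else 0 : ℂ) • 1 := by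
  have h := ad_md_md (m := m) (n := n) b b 0 0
  rw [ad_apply, (hasPar_md b 0) b, mul_smul_comm] at h
  cases b
  · rw [md_false_zero]; simp
  · simp [wt] at h
    simp only [if_true]
    have h2 : (md true 0 * md true 0 : Op m n) =
        (1 / 2 : ℂ) • (md true 0 * md true 0 - (-1 : ℂ) • (md true 0 * md true 0)) := by module
    rw [h2, h]

theorem virTerm_one_eq_zero (b : Bool) {k j : ℤ} (h : 0 < -j ∨ 0 < k + j ∨ (j = 0 ∧ k = 0)) :
    virTerm b k j (1 : Pol m n) = 0 := by
  rw [virTerm, LinearMap.smul_apply]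
  rcases h with h | h | ⟨rfl, rfl⟩
  · rw [nordOp_apply_left b _ h (md_pos_one b h), smul_zero]
  · rw [nordOp_apply_right b _ h (md_pos_one b h), smul_zero]
  · rw [neg_zero, add_zero, md_zero_sq, map_smul, nordOp_one, smul_zero]
    simp

/-- For `k ≥ 0` every normally ordered pair contains a positive mode or consists of two zero modes,
so only the additive constant of `L_0` acts on the vacuum; the corrections end in positive modes. -/
theorem mOp_one {k : ℤ} (hk : 0 ≤ k) : mOp k (1 : Pol m n) =
    (if k = 0 then 1 / 4 else 0 : ℂ) • 1 := by
  have h1 : ∀ b, psum (virTerm b k) (1 : Pol m n) = 0 := fun b =>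
    psum_apply_eq_zero (pfin_virTerm b k) fun j => virTerm_one_eq_zero b (by omega)
  rw [mOp, virOp]
  simp only [LinearMap.add_apply, LinearMap.smul_apply, h1, psum_corrTerm_one, smul_zero, add_zero,
    zero_add]
  split_ifs <;> simp

theorem gTerm_one_eq_zero {k j : ℤ} (h : j ≤ 0 ∨ 0 < k + j) :
    gTerm k j (1 : Pol m n) = 0 := by
  rw [gTerm, LinearMap.smul_apply]
  by_cases hj : 0 < k + j
  · rw [Module.End.mul_apply, md_pos_one _ hj, map_zero, smul_zero]
  · rw [md_mul_md, if_neg (fun h => Bool.noConfusion h.1), add_zero, LinearMap.smul_apply,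
      Module.End.mul_apply]
    rcases lt_or_eq_of_le (h.resolve_right hj) with h0 | h0
    · rw [md_pos_one _ (by omega), map_zero, smul_zero, smul_zero]
    · rw [h0, neg_zero, md_false_zero]; simp

theorem nOp_one {k : ℤ} (hk : 0 < k) : nOp k (1 : Pol m n) = 0 := by
  have h1 : psum (gTerm k) (1 : Pol m n) = 0 :=
    psum_apply_eq_zero (pfin_gTerm k) fun j => gTerm_one_eq_zero (by omega)
  rw [nOp, gOp]
  simp only [LinearMap.add_apply, h1, psum_gCorrTerm_one, add_zero]

theorem nOp_neg_one : nOp (-1) (1 : Pol m n) = (md false (-1) * md true 0 : Op m n) 1 := by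
  have h1 : psum (gTerm (-1)) (1 : Pol m n) = (md false (-1) * md true 0 : Op m n) 1 := by
    rw [psum_apply (pfin_gTerm (-1)), finsum_eq_single _ 1 fun j hj => gTerm_one_eq_zero (by omega)]
    rw [gTerm]
    simp
  rw [nOp, gOp]
  simp only [LinearMap.add_apply, h1, psum_gCorrTerm_one, add_zero]

theorem nordOp_neg (b : Bool) {x : ℤ} (hx : x < 0) (y : ℤ) :
    nordOp (md b x * md b y : Op m n) = md b x * md b y := by
  rw [nordOp_apply, vac_neg_mul b hx]
  ext; simp [mulOp_apply]

/-- The lowest index is the only one for which the even operators do not act on the vacuum as a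
scalar. The quadratic terms that survive have both indices in `{0, -1, -2}`; they produce the vacuum
terms in the brackets below. -/
theorem mOp_neg_two : mOp (-2) (1 : Pol m n) =
    ((1 / 2 : ℂ) • (md false (-1) * md false (-1)) + md true (-2) * md true 0 : Op m n) 1 := by
  have h1 : ∀ b, psum (virTerm b (-2)) (1 : Pol m n) =
      (virTerm b (-2) 0 + virTerm b (-2) 1 + virTerm b (-2) 2 : Op m n) 1 := by
    intro b
    rw [psum_apply (pfin_virTerm b (-2)), finsum_eq_sum_of_support_subset (s := {0, 1, 2})]
    · rw [Finset.sum_insert (by decide), Finset.sum_insert (by decide), Finset.sum_singleton]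
      simp [add_assoc]
    · intro j hj
      by_contra hc
      refine hj (virTerm_one_eq_zero b ?_)
      simp at hc
      omega
  have h2 : (virTerm false (-2) 0 : Op m n) = 0 := by
    rw [virTerm, neg_zero, md_false_zero, zero_mul, map_zero, smul_zero]
  have h3 : (virTerm false (-2) 2 : Op m n) = 0 := by
    rw [virTerm, show (-2 : ℤ) + 2 = 0 by norm_num, md_false_zero, mul_zero, map_zero, smul_zero]
  have h4 : (virTerm false (-2) 1 : Op m n) = md false (-1) * md false (-1) := by
    rw [virTerm, show (-2 : ℤ) + 1 = -1 by norm_num, nordOp_neg _ (by norm_num),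
      virCoeff_false_odd odd_one, one_smul]
  have h5 : (virTerm true (-2) 0 : Op m n) = md true (-2) * md true 0 := by
    rw [virTerm, neg_zero, nordOp_md_mul_md, show (-2 : ℤ) + 0 = -2 by norm_num,
      nordOp_neg _ (by norm_num), virCoeff_true_even (by decide), sgn_true_true, smul_smul]
    norm_num
  have h6 : (virTerm true (-2) 2 : Op m n) = md true (-2) * md true 0 := by
    rw [virTerm, show (-2 : ℤ) + 2 = 0 by norm_num,
      nordOp_neg _ (by norm_num), virCoeff_true_even (by decide)]
    norm_num
  -- The fermionic weight `j + k/2` is zero at `j = 1`, `k = -2`.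
  have h7 : (virTerm true (-2) 1 : Op m n) = 0 := by
    rw [virTerm, virCoeff_true_odd odd_one]
    norm_num
  rw [mOp, virOp]
  simp only [LinearMap.add_apply, LinearMap.smul_apply, h1, psum_corrTerm_one, add_zero, h2, h3, h4,
    h5, h6, h7, LinearMap.zero_apply, zero_add]
  rw [if_neg (by norm_num), LinearMap.zero_apply]
  module

end Virasoro

/-! ### The super Virasoro relations of the corrected operators -/

section Commutators

theorem vac_md_mul_zero (i : ℤ) :
    vac (md true i * md true 0 : Op m n) = (if i = 0 then 1 / 2 else 0 : ℂ) • 1 := by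
  rcases lt_trichotomy i 0 with h | h | h
  · rw [vac_neg_mul _ h, if_neg h.ne, zero_smul]
  · rw [h, md_zero_sq, map_smul, vac_one]; simp
  · rw [md_mul_md, if_neg (by omega), add_zero, map_smul, vac_mul_pos _ h, if_neg h.ne', smul_zero,
      zero_smul]

theorem vac_md_false_mul_zero (i : ℤ) : vac (md false i * md true 0 : Op m n) = 0 := by
  rcases lt_trichotomy i 0 with h | h | h
  · rw [vac_neg_mul _ h]
  · rw [h, md_false_zero, zero_mul, map_zero]
  · rw [md_mul_md, if_neg (fun h => Bool.noConfusion h.1), add_zero, map_smul, vac_mul_pos _ h,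
      smul_zero]

theorem vac_md_true_mul_neg (i : ℤ) : vac (md true i * md false (-1) : Op m n) = 0 := by
  rw [md_mul_md, if_neg (fun h => Bool.noConfusion h.1), add_zero, map_smul,
    vac_neg_mul _ (by norm_num), smul_zero]

theorem vac_md_mul_neg (i : ℤ) :
    vac (md false i * md false (-1) : Op m n) = (if i = 1 then 1 else 0 : ℂ) • 1 := by
  rw [md_mul_md, map_add, map_smul, vac_neg_mul _ (by norm_num), smul_zero, zero_add]
  by_cases h : i = 1
  · subst h
    rw [if_pos (by simp), map_smul, vac_one]; simp [wt]
  · rw [if_neg (by omega), map_zero, if_neg h, zero_smul]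

variable {c : Bool} {k : ℤ} {d : Bool → ℤ → ℂ} {D : Op m n}

theorem IsShift.mul_md (hD : IsShift c k d D) (b : Bool) (i : ℤ) :
    D * md b i = d b i • md (xor b c) (i + k) + sgn b c • (md b i * D) := by
  have h := hD.ad_md b i
  rw [ad_apply, hD.hasPar b, mul_smul_comm] at h
  rw [← h, sub_add_cancel]

/-- The negative mode is moved to the left, where it disappears in the vacuum expectation value;
what remains is the mode with shifted index. -/
theorem IsShift.vac_mul_md_mul (hD : IsShift c k d D) (b : Bool) {i : ℤ} (hi : i < 0)
    (E : Op m n) : vac (D * (md b i * E)) = d b i • vac (md (xor b c) (i + k) * E) := by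
  rw [← mul_assoc, hD.mul_md, add_mul, smul_mul_assoc, smul_mul_assoc, map_add, map_smul, map_smul,
    mul_assoc, vac_neg_mul b hi, smul_zero, add_zero]

theorem vac_mul_congr {E E' : Op m n} (h : E 1 = E' 1) (D : Op m n) : vac (D * E) = vac (D * E') := by
  rw [vac_apply, vac_apply, Module.End.mul_apply, Module.End.mul_apply, h]

theorem IsShift.vac_mul_mOp_neg (hD : IsShift c k d D) : vac (D * mOp (-2)) =
    (1 / 2 * d false (-1)) • vac (md c (k - 1) * md false (-1)) +
      d true (-2) • vac (md (!c) (k - 2) * md true 0) := by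
  rw [vac_mul_congr mOp_neg_two, mul_add, mul_smul_comm, map_add, map_smul,
    hD.vac_mul_md_mul false (by norm_num), hD.vac_mul_md_mul true (by norm_num), smul_smul,
    Bool.false_xor, Bool.true_xor, show -1 + k = k - 1 by ring, show -2 + k = k - 2 by ring]

theorem IsShift.vac_mul_nOp_neg (hD : IsShift c k d D) : vac (D * nOp (-1)) =
    d false (-1) • vac (md c (k - 1) * md true 0) := by
  rw [vac_mul_congr nOp_neg_one, hD.vac_mul_md_mul false (by norm_num), Bool.false_xor,
    show -1 + k = k - 1 by ring]

theorem vac_mul_mOp (D : Op m n) {l : ℤ} (hl : 0 ≤ l) :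
    vac (D * mOp l) = (if l = 0 then 1 / 4 else 0 : ℂ) • vac D := by
  have := vac_mul_congr (E' := (if l = 0 then 1 / 4 else 0 : ℂ) • (1 : Op m n)) (mOp_one hl) D
  rw [this, mul_smul_comm, mul_one, map_smul]

theorem vac_mul_nOp (D : Op m n) {l : ℤ} (hl : 0 < l) : vac (D * nOp l) = 0 := by
  rw [vac_apply, Module.End.mul_apply, nOp_one hl, map_zero, map_zero]

theorem vac_mOp {k : ℤ} (hk : -2 ≤ k) (hke : Even k) :
    vac (mOp k : Op m n) = (if k = 0 then 1 / 4 else 0 : ℂ) • 1 := by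
  have hcase : k = -2 ∨ 0 ≤ k := by obtain ⟨a, rfl⟩ := hke; omega
  rcases hcase with rfl | h
  · have := vac_mul_congr (mOp_neg_two (m := m) (n := n)) 1
    rw [one_mul, one_mul] at this
    rw [this, map_add, map_smul, vac_neg_mul _ (by norm_num), vac_neg_mul _ (by norm_num)]
    norm_num
  · have := vac_mul_mOp (1 : Op m n) h
    rwa [one_mul, vac_one] at this

theorem vac_nOp {k : ℤ} (hk : -1 ≤ k) (hko : Odd k) : vac (nOp k : Op m n) = 0 := by
  have hcase : k = -1 ∨ 0 < k := by obtain ⟨a, rfl⟩ := hko; omega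
  rcases hcase with rfl | h
  · have := vac_mul_congr (nOp_neg_one (m := m) (n := n)) 1
    rw [one_mul, one_mul] at this
    rw [this, vac_neg_mul _ (by norm_num)]
  · have := vac_mul_nOp (1 : Op m n) h
    rwa [one_mul] at this

theorem vac_mOp_mul_mOp {k l : ℤ} (hk : -2 ≤ k) (hl : -2 ≤ l) (hke : Even k) (hle : Even l) :
    vac (mOp k * mOp l : Op m n) =
      (if l = -2 then (if k = 2 then 1 else 0) else
        (if l = 0 then 1 / 4 else 0) * (if k = 0 then 1 / 4 else 0) : ℂ) • 1 := by
  have hcase : l = -2 ∨ 0 ≤ l := by obtain ⟨a, rfl⟩ := hle; omega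
  rcases hcase with rfl | h
  · rw [(isShift_mOp hke hk).vac_mul_mOp_neg, Bool.not_false, vac_md_mul_neg, vac_md_mul_zero,
      smul_smul, smul_smul, ← add_smul, if_pos rfl]
    have e1 : mShift k false (-1) = 1 := by
      simp only [mShift, Bool.false_eq_true, if_false]; rw [if_pos (by decide)]; norm_num
    have e2 : mShift k true (-2) = 2 - (k : ℂ) / 2 := by
      simp only [mShift, if_true]; rw [if_pos (by decide)]; push_cast; ring
    rw [e1, e2]
    congr 1
    by_cases h2 : k = 2
    · subst h2; norm_num
    · rw [if_neg (by omega), if_neg (by omega), if_neg h2]; ring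
  · rw [vac_mul_mOp _ h, vac_mOp hk hke, smul_smul, if_neg (by omega : ¬ l = -2)]

theorem bracket_false (D E : Op m n) : bracket false D E = D * E - E * D := rfl

theorem bracket_true {E : Op m n} (hE : HasPar true E) (D : Op m n) :
    bracket true D E = D * E + E * D := by
  rw [bracket, hE true, smul_mul_assoc, sgn_true_true]; module

/-- Both sides shift the modes with the same weights, so only vacuum expectation values are to be
compared. A nonzero scalar appears just for the indices `2` and `-2`: there the expectation of the
product is one, and `(2 - (-2)) · 1/4 = 1`. The constant in `L_0` is fixed by this. -/
theorem bracket_mOp_mOp {k l : ℤ} (hk : -2 ≤ k) (hl : -2 ≤ l) (hke : Even k) (hle : Even l) :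
    bracket false (mOp k) (mOp l : Op m n) = ((k : ℂ) - l) • mOp (k + l) := by
  by_cases hkl : k = l
  · subst hkl
    rw [bracket_false, sub_self, sub_self, zero_smul]
  have hs : -2 ≤ k + l := by
    obtain ⟨a, rfl⟩ := hke; obtain ⟨b, rfl⟩ := hle; omega
  refine ((isShift_mOp hke hk).bracket (isShift_mOp hle hl)).ext
    ((isShift_mOp (hke.add hle) hs).smul _) ?_ ?_
  · intro b i
    cases b
    · rcases Int.even_or_odd i with hi | hi
      · have : ¬Odd i := by simpa using hi
        simp [mShift, this]
      · have e1 : Odd (i + k) := hi.add_even hke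
        have e2 : Odd (i + l) := hi.add_even hle
        simp [mShift, hi, e1, e2]
        ring
    · rcases Int.even_or_odd i with hi | hi
      · have e1 : Even (i + k) := hi.add hke
        have e2 : Even (i + l) := hi.add hle
        simp [mShift, hi, e1, e2]
        ring
      · have : ¬Even i := by simpa using hi
        simp [mShift, this]
  · rw [bracket_false, map_sub, map_smul, vac_mOp_mul_mOp hk hl hke hle,
      vac_mOp_mul_mOp hl hk hle hke, vac_mOp hs (hke.add hle), smul_smul, ← sub_smul]
    congr 1
    obtain ⟨a, rfl⟩ := hke; obtain ⟨b, rfl⟩ := hle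
    by_cases h1 : b + b = -2
    · have hb : b = -1 := by omega
      subst hb
      rw [if_pos h1]
      by_cases h2 : a = 1
      · subst h2; norm_num
      · have e1 : ¬(-1 + -1 : ℤ) = 2 := by omega
        have e2 : ¬(a + a + (-1 + -1) : ℤ) = 0 := by omega
        have e3 : ¬a + a = -2 := by omega
        have e4 : ¬a + a = 2 := by omega
        rw [if_neg e4, if_neg e3, if_neg e2]; simp
    · by_cases h2 : a + a = -2
      · have ha : a = -1 := by omega
        subst ha
        rw [if_neg h1, if_pos h2]
        by_cases h3 : b = 1
        · subst h3; norm_num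
        · have e1 : ¬(-1 + -1 + (b + b) : ℤ) = 0 := by omega
          have e2 : ¬b + b = 2 := by omega
          rw [if_neg e1, if_neg e2]; simp
      · rw [if_neg h1, if_neg h2]
        by_cases h3 : a + a + (b + b) = 0
        · have : a = b := by omega
          subst this
          ring
        · rw [if_neg h3]; ring

theorem vac_nOp_mul_nOp {k l : ℤ} (hk : -1 ≤ k) (hl : -1 ≤ l) (hko : Odd k) (hlo : Odd l) :
    vac (nOp k * nOp l : Op m n) =
      (if l = -1 then (if k = 1 then 1 / 2 else 0) else 0 : ℂ) • 1 := by
  have hcase : l = -1 ∨ 0 < l := by obtain ⟨a, rfl⟩ := hlo; omega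
  rcases hcase with rfl | h
  · rw [(isShift_nOp hko hk).vac_mul_nOp_neg, vac_md_mul_zero, smul_smul, if_pos rfl]
    have e1 : nShift false (-1) = 1 := by
      simp only [nShift, Bool.false_eq_true, if_false]; rw [if_pos (by decide)]; norm_num
    rw [e1, one_mul]
    simp only [sub_eq_zero]
  · rw [vac_mul_nOp _ h, if_neg (by omega), zero_smul]

/-- The only nonzero vacuum contribution is at the indices `1` and `-1`, where one half equals twice
the constant `1/4`. -/
theorem bracket_nOp_nOp {k l : ℤ} (hk : -1 ≤ k) (hl : -1 ≤ l) (hko : Odd k) (hlo : Odd l) :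
    bracket true (nOp k) (nOp l : Op m n) = (2 : ℂ) • mOp (k + l) := by
  have hs : -2 ≤ k + l := by omega
  have hse : Even (k + l) := hko.add_odd hlo
  refine ((isShift_nOp hko hk).bracket (isShift_nOp hlo hl)).ext
    ((isShift_mOp hse hs).smul _) ?_ ?_
  · intro b i
    cases b
    · rcases Int.even_or_odd i with hi | hi
      · have : ¬Odd i := by simpa using hi
        simp [mShift, nShift, this]
      · have e1 : Even (i + k) := hi.add_odd hko
        have e2 : Even (i + l) := hi.add_odd hlo
        simp [mShift, nShift, hi, e1, e2]
        ring
    · rcases Int.even_or_odd i with hi | hi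
      · have e1 : Odd (i + k) := hi.add_odd hko
        have e2 : Odd (i + l) := hi.add_odd hlo
        simp [mShift, nShift, hi, e1, e2]
        ring
      · have : ¬Even i := by simpa using hi
        simp [mShift, nShift, this]
  · rw [bracket_true (isShift_nOp hlo hl).hasPar, map_add, map_smul, vac_nOp_mul_nOp hk hl hko hlo,
      vac_nOp_mul_nOp hl hk hlo hko, vac_mOp hs hse, smul_smul, ← add_smul]
    congr 1
    by_cases h1 : l = -1
    · subst h1
      rw [if_pos rfl]
      by_cases h2 : k = 1
      · subst h2; norm_num
      · have e1 : ¬k + -1 = 0 := by omega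
        rw [if_neg h2, if_neg e1]; simp
    · rw [if_neg h1]
      by_cases h2 : k = -1
      · subst h2
        rw [if_pos rfl]
        by_cases h3 : l = 1
        · subst h3; norm_num
        · have e1 : ¬-1 + l = 0 := by omega
          rw [if_neg h3, if_neg e1]; ring
      · have e1 : ¬k + l = 0 := by
          obtain ⟨a, rfl⟩ := hko
          omega
        rw [if_neg h2, if_neg e1]; ring

theorem vac_mOp_mul_nOp {k l : ℤ} (hk : -2 ≤ k) (hl : -1 ≤ l) (hke : Even k) (hlo : Odd l) :
    vac (mOp k * nOp l : Op m n) = 0 := by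
  have hcase : l = -1 ∨ 0 < l := by obtain ⟨a, rfl⟩ := hlo; omega
  rcases hcase with rfl | h
  · rw [(isShift_mOp hke hk).vac_mul_nOp_neg, vac_md_false_mul_zero, smul_zero]
  · exact vac_mul_nOp _ h

theorem vac_nOp_mul_mOp {k l : ℤ} (hk : -1 ≤ k) (hl : -2 ≤ l) (hko : Odd k) (hle : Even l) :
    vac (nOp k * mOp l : Op m n) = 0 := by
  have hcase : l = -2 ∨ 0 ≤ l := by obtain ⟨a, rfl⟩ := hle; omega
  rcases hcase with rfl | h
  · rw [(isShift_nOp hko hk).vac_mul_mOp_neg, Bool.not_true, vac_md_false_mul_zero,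
      vac_md_true_mul_neg, smul_zero, smul_zero, add_zero]
  · rw [vac_mul_mOp _ h, vac_nOp hk hko, smul_zero]

theorem bracket_mOp_nOp {k l : ℤ} (hk : -2 ≤ k) (hl : -1 ≤ l) (hke : Even k) (hlo : Odd l) :
    bracket false (mOp k) (nOp l : Op m n) = ((k : ℂ) / 2 - l) • nOp (k + l) := by
  have hso : Odd (k + l) := hke.add_odd hlo
  -- The sum `k + l` can be `-3`, outside the range where `nOp` is known to act by shifts. This
  -- happens only for `k = -2`, `l = -1`, and then the structure constant vanishes.
  have hsh : IsShift true (k + l) (fun b i => ((k : ℂ) / 2 - l) * nShift b i)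
      (((k : ℂ) / 2 - l) • nOp (k + l) : Op m n) ∧
      ((k : ℂ) / 2 - l) • vac (nOp (k + l) : Op m n) = 0 := by
    by_cases hs : -1 ≤ k + l
    · exact ⟨(isShift_nOp hso hs).smul _, by rw [vac_nOp hs hso, smul_zero]⟩
    · have h0 : (k : ℂ) / 2 - l = 0 := by
        have h1 : k = -2 := by obtain ⟨a, rfl⟩ := hke; obtain ⟨b, rfl⟩ := hlo; omega
        have h2 : l = -1 := by obtain ⟨a, rfl⟩ := hke; obtain ⟨b, rfl⟩ := hlo; omega
        rw [h1, h2]; norm_num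
      rw [h0]
      simp only [zero_smul, zero_mul]
      exact ⟨IsShift.zero _ _, trivial⟩
  refine ((isShift_mOp hke hk).bracket (isShift_nOp hlo hl)).ext hsh.1 ?_ ?_
  · intro b i
    cases b
    · rcases Int.even_or_odd i with hi | hi
      · have : ¬Odd i := by simpa using hi
        simp [mShift, nShift, this]
      · have e1 : Even (i + l) := hi.add_odd hlo
        have e2 : Odd (i + k) := hi.add_even hke
        simp [mShift, nShift, hi, e1, e2]
        ring
    · rcases Int.even_or_odd i with hi | hi
      · have e1 : Even (i + k) := hi.add hke
        have e2 : Odd (i + l) := hi.add_odd hlo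
        simp [mShift, nShift, hi, e1, e2]
        ring
      · have : ¬Even i := by simpa using hi
        simp [mShift, nShift, this]
  · rw [bracket_false, map_sub, map_smul, vac_mOp_mul_nOp hk hl hke hlo,
      vac_nOp_mul_mOp hl hk hlo hke, hsh.2, sub_zero]

end Commutators

/-! ### Exponentials of locally nilpotent operators -/

section Exp

/-- The commutator with `A`. -/
def comm (A : Op m n) : Module.End ℂ (Op m n) := LinearMap.mulLeft ℂ A - LinearMap.mulRight ℂ A

theorem comm_apply (A D : Op m n) : comm A D = A * D - D * A := rfl

/-- Each polynomial is annihilated by a power of `A`. -/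
def LocNil (A : Op m n) : Prop := ∀ f, ∃ N, ∀ r, N ≤ r → (A ^ r) f = 0

theorem neg_pow_apply (A : Op m n) (r : ℕ) : (-A) ^ r = ((-1 : ℂ) ^ r) • A ^ r := by
  rw [← neg_one_smul ℂ A, smul_pow]

theorem LocNil.neg {A : Op m n} (h : LocNil A) : LocNil (-A) := fun f => by
  obtain ⟨N, hN⟩ := h f
  exact ⟨N, fun r hr => by rw [neg_pow_apply, LinearMap.smul_apply, hN r hr, smul_zero]⟩

/-- The exponential series. -/
def expTerm (A : Op m n) (r : ℕ) : Op m n := ((r.factorial : ℂ)⁻¹) • A ^ r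

theorem LocNil.pfin {A : Op m n} (h : LocNil A) : PFin (expTerm A) := fun f => by
  obtain ⟨N, hN⟩ := h f
  refine (Set.finite_Iio N).subset fun r hr => ?_
  by_contra hc
  refine hr ?_
  show (((r.factorial : ℂ)⁻¹) • A ^ r) f = 0
  rw [LinearMap.smul_apply, hN r (not_lt.1 hc), smul_zero]

/-- The exponential of a locally nilpotent operator. -/
def expOp (A : Op m n) : Op m n := psum (expTerm A)

/-- Left multiplication by `A` and right multiplication by `-A` commute, so the binomial theorem
applies to their sum. -/
theorem comm_pow (A D : Op m n) (r : ℕ) : ((comm A) ^ r) D =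
    ∑ p ∈ Finset.HasAntidiagonal.antidiagonal r, (r.choose p.1) • (A ^ p.1 * D * (-A) ^ p.2) := by
  have h : comm A = LinearMap.mulLeft ℂ A + LinearMap.mulRight ℂ (-A) := by
    ext D : 1
    show A * D - D * A = A * D + D * (-A)
    rw [op_mul_neg, sub_eq_add_neg]
  have hc : Commute (LinearMap.mulLeft ℂ A : Module.End ℂ (Op m n)) (LinearMap.mulRight ℂ (-A)) :=
    LinearMap.commute_mulLeft_right A (-A)
  rw [h, hc.add_pow', LinearMap.sum_apply]
  refine Finset.sum_congr rfl fun p _ => ?_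
  rw [LinearMap.pow_mulLeft, LinearMap.pow_mulRight, LinearMap.smul_apply]
  rw [Module.End.mul_apply, LinearMap.mulLeft_apply, LinearMap.mulRight_apply, mul_assoc]

theorem finsum_antidiagonal {F : ℕ × ℕ → Pol m n} (hF : (Function.support F).Finite) :
    ∑ᶠ p, F p = ∑ᶠ r : ℕ, ∑ p ∈ Finset.HasAntidiagonal.antidiagonal r, F p := by
  obtain ⟨N, hN⟩ := (hF.image fun p => p.1 + p.2).bddAbove
  have hN' : ∀ p, F p ≠ 0 → p.1 + p.2 ≤ N := fun p hp => hN ⟨p, hp, rfl⟩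
  rw [finsum_eq_sum_of_support_subset (s := (Finset.range (N + 1)).biUnion Finset.HasAntidiagonal.antidiagonal),
    finsum_eq_sum_of_support_subset (s := Finset.range (N + 1)), Finset.sum_biUnion]
  · intro r _ r' _ hrr
    refine Finset.disjoint_left.2 fun p hp hp' => hrr ?_
    rw [Finset.HasAntidiagonal.mem_antidiagonal] at hp hp'
    rw [← hp, ← hp']
  · intro r hr
    obtain ⟨p, hp, hne⟩ := Finset.exists_ne_zero_of_sum_ne_zero hr
    have := hN' p hne
    rw [Finset.HasAntidiagonal.mem_antidiagonal] at hp
    rw [Finset.coe_range, Set.mem_Iio]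
    omega
  · intro p hp
    rw [Finset.mem_coe, Finset.mem_biUnion]
    exact ⟨p.1 + p.2, Finset.mem_range.2 (Nat.lt_succ_of_le (hN' p hp)), by simp⟩

theorem LocNil.pfin_pairs {A : Op m n} (h : LocNil A) (D : Op m n) :
    PFin fun p : ℕ × ℕ => expTerm A p.1 * D * expTerm (-A) p.2 := by
  have := (PFin.prod_mul (A := fun (_ : ℕ) j => expTerm A j) (B := fun i => D * expTerm (-A) i)
    (fun _ => h.pfin) (h.neg.pfin.mul_left fun _ => D)).comp_injective Prod.swap_injective
  simp only [mul_assoc]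
  exact this

theorem antidiagonal_expTerm (A D : Op m n) (r : ℕ) :
    ∑ p ∈ Finset.HasAntidiagonal.antidiagonal r, expTerm A p.1 * D * expTerm (-A) p.2 =
      ((r.factorial : ℂ)⁻¹) • ((comm A) ^ r) D := by
  rw [comm_pow, Finset.smul_sum]
  refine Finset.sum_congr rfl fun p hp => ?_
  rw [Finset.HasAntidiagonal.mem_antidiagonal] at hp
  rw [expTerm, expTerm, smul_mul_assoc, smul_mul_assoc, mul_smul_comm, smul_smul,
    ← Nat.cast_smul_eq_nsmul ℂ, smul_smul]
  congr 1
  have h1 := Nat.add_choose_mul_factorial_mul_factorial p.2 p.1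
  rw [add_comm, hp] at h1
  have h2 : ((r.choose p.1 : ℂ)) * (p.1.factorial : ℂ) * (p.2.factorial : ℂ) = (r.factorial : ℂ) := by
    rw [mul_right_comm]
    exact_mod_cast h1
  have e1 : (p.1.factorial : ℂ) ≠ 0 := by exact_mod_cast Nat.factorial_ne_zero _
  have e2 : (p.2.factorial : ℂ) ≠ 0 := by exact_mod_cast Nat.factorial_ne_zero _
  have e3 : (r.factorial : ℂ) ≠ 0 := by exact_mod_cast Nat.factorial_ne_zero _
  field_simp
  linear_combination -h2

/-- The commutator with `A` need not be locally nilpotent on operators. The series still converges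
on each polynomial, since its terms group the pairs of the double series for `exp(A) D exp(-A)` by
total degree. -/
theorem LocNil.pfin_comm {A : Op m n} (h : LocNil A) (D : Op m n) :
    PFin fun r : ℕ => ((r.factorial : ℂ)⁻¹) • ((comm A) ^ r) D := fun f => by
  refine ((h.pfin_pairs D f).image fun p => p.1 + p.2).subset fun r hr => ?_
  have h1 := antidiagonal_expTerm A D r
  have h2 : (((r.factorial : ℂ)⁻¹) • ((comm A) ^ r) D) f ≠ 0 := hr
  rw [← h1, LinearMap.sum_apply] at h2
  obtain ⟨p, hp, hne⟩ := Finset.exists_ne_zero_of_sum_ne_zero h2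
  exact ⟨p, hne, by simpa using hp⟩

/-- The identity `exp(A) D exp(-A) = exp(ad A) D`, which makes the series of commutators
multiplicative and compatible with infinite sums in `D`. -/
theorem LocNil.expOp_mul_mul {A : Op m n} (h : LocNil A) (D : Op m n) :
    expOp A * D * expOp (-A) = psum fun r : ℕ => ((r.factorial : ℂ)⁻¹) • ((comm A) ^ r) D := by
  have h1 : expOp A * D * expOp (-A) =
      psum fun p : ℕ × ℕ => expTerm A p.1 * D * expTerm (-A) p.2 := by
    rw [psum_prod (h.pfin_pairs D), expOp, psum_mul_right h.pfin,
      psum_mul_right (h.pfin.mul_right D)]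
    exact psum_congr fun i => psum_mul_left h.neg.pfin _
  rw [h1]
  ext f
  rw [psum_apply (h.pfin_pairs D), psum_apply (h.pfin_comm D), finsum_antidiagonal (h.pfin_pairs D f)]
  refine finsum_congr fun r => ?_
  rw [← antidiagonal_expTerm, LinearMap.sum_apply]

theorem LocNil.expOp_mul_expOp_neg {A : Op m n} (h : LocNil A) : expOp A * expOp (-A) = 1 := by
  have h1 := h.expOp_mul_mul 1
  rw [mul_one] at h1
  rw [h1, psum_eq_single 0]
  · simp
  · intro r hr
    obtain ⟨r, rfl⟩ := Nat.exists_eq_succ_of_ne_zero hr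
    rw [pow_succ, Module.End.mul_apply, comm_apply, mul_one, one_mul, sub_self, map_zero, smul_zero]

theorem LocNil.expOp_neg_mul_expOp {A : Op m n} (h : LocNil A) : expOp (-A) * expOp A = 1 := by
  have := h.neg.expOp_mul_expOp_neg
  rwa [neg_neg] at this

/-- Conjugation by the exponential of `A`. -/
def conjExp (A : Op m n) : Op m n →ₗ[ℂ] Op m n :=
  (LinearMap.mulLeft ℂ (expOp A)).comp (LinearMap.mulRight ℂ (expOp (-A)))

theorem conjExp_apply (A D : Op m n) : conjExp A D = expOp A * (D * expOp (-A)) := rfl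

theorem LocNil.conjExp_eq {A : Op m n} (h : LocNil A) (D : Op m n) :
    conjExp A D = psum fun r : ℕ => ((r.factorial : ℂ)⁻¹) • ((comm A) ^ r) D := by
  rw [conjExp_apply, ← mul_assoc, h.expOp_mul_mul]

/-- Insert `exp(-A) exp(A) = 1` between the factors. -/
theorem LocNil.conjExp_mul {A : Op m n} (h : LocNil A) (D E : Op m n) :
    conjExp A (D * E) = conjExp A D * conjExp A E := by
  have h1 := h.expOp_neg_mul_expOp
  rw [conjExp_apply, conjExp_apply, conjExp_apply]
  calc expOp A * (D * E * expOp (-A))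
      = expOp A * (D * ((1 : Op m n) * (E * expOp (-A)))) := by rw [one_mul, mul_assoc D]
    _ = _ := by rw [← h1]; simp only [mul_assoc]

theorem LocNil.conjExp_of_comm {A D : Op m n} (h : LocNil A) (hc : comm A D = 0) :
    conjExp A D = D := by
  rw [h.conjExp_eq, psum_eq_single 0]
  · simp
  · intro r hr
    obtain ⟨r, rfl⟩ := Nat.exists_eq_succ_of_ne_zero hr
    rw [pow_succ, Module.End.mul_apply, hc, map_zero, smul_zero]

theorem PFin.conjExp {ι : Type} {T : ι → Op m n} (h : PFin T) (A : Op m n) :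
    PFin fun i => SuperAiry.conjExp A (T i) :=
  (h.mul_right _).mul_left _

theorem conjExp_psum {ι : Type} {T : ι → Op m n} (h : PFin T) (A : Op m n) :
    conjExp A (psum T) = psum fun i => conjExp A (T i) := by
  rw [conjExp_apply, psum_mul_right h, psum_mul_left (h.mul_right _)]
  rfl

theorem HasPar.comm {c : Bool} {A D : Op m n} (hA : HasPar false A) (hD : HasPar c D) :
    HasPar c (SuperAiry.comm A D) := by
  have h1 := hA.mul hD
  have h2 := hD.mul hA
  rw [Bool.false_xor] at h1
  rw [Bool.xor_false] at h2
  exact h1.sub h2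

/-- The bracket lowers total degree by two, so commuting with an operator of degree two preserves
the filtration. -/
theorem comm_mem_fil {A : Op m n} (hA : HasPar false A) (hA3 : A ∈ Fil 3) {d : ℕ} {D : Op m n}
    (hD : D ∈ Fil d) : comm A D ∈ Fil d := by
  have h : ∀ c D, HasPar c D → D ∈ Fil (m := m) (n := n) d → comm A D ∈ Fil d := by
    intro c D hc hD
    have := bracket_mem_fil hA hc hA3 hD
    rwa [show 3 + d - 3 = d by omega] at this
  have hp : parityOp D ∈ Fil d := twist_mem_fil true hD
  rw [eq_even_add_odd D, map_add]
  exact Submodule.add_mem _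
    (h _ _ (hasPar_even_part D) (Submodule.smul_mem _ _ (Submodule.add_mem _ hD hp)))
    (h _ _ (hasPar_odd_part D) (Submodule.smul_mem _ _ (Submodule.sub_mem _ hD hp)))

theorem LocNil.conjExp_mem_fil {A : Op m n} (h : LocNil A) (hA : HasPar false A) (hA3 : A ∈ Fil 3)
    {d : ℕ} {D : Op m n} (hD : D ∈ Fil d) : conjExp A D ∈ Fil d := by
  rw [h.conjExp_eq]
  refine psum_mem_fil (h.pfin_comm D) fun r => Submodule.smul_mem _ _ ?_
  induction r with
  | zero => exact hD
  | succ r ih => rw [pow_succ', Module.End.mul_apply]; exact comm_mem_fil hA hA3 ih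

theorem LocNil.hasPar_conjExp {A : Op m n} (h : LocNil A) (hA : HasPar false A) {c : Bool}
    {D : Op m n} (hD : HasPar c D) : HasPar c (conjExp A D) := by
  rw [h.conjExp_eq]
  refine HasPar.psum (h.pfin_comm D) fun r => HasPar.smul ?_ _
  induction r with
  | zero => exact hD
  | succ r ih => rw [pow_succ', Module.End.mul_apply]; exact hA.comm ih

theorem LocNil.twist_conjExp {A : Op m n} (h : LocNil A) (hA : HasPar false A) (b : Bool)
    (D : Op m n) : twist b (conjExp A D) = conjExp A (twist b D) := by
  obtain ⟨D₀, D₁, h₀, h₁, rfl⟩ : ∃ D₀ D₁, HasPar false D₀ ∧ HasPar true D₁ ∧ D = D₀ + D₁ :=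
    ⟨_, _, hasPar_even_part D, hasPar_odd_part D, eq_even_add_odd D⟩
  simp only [map_add, h.hasPar_conjExp hA h₀ b, h.hasPar_conjExp hA h₁ b, h₀ b, h₁ b, map_smul]

/-! ### Conjugation of series -/

theorem iterate_comm (a b : ℤ) (A D : Op m n) (r : ℕ) :
    (fun Z : Ser m n => mono a A * Z - Z * mono a A)^[r] (mono b D) =
      mono (b + r * a) (((comm A) ^ r) D) := by
  induction r with
  | zero => simp
  | succ r ih =>
    rw [Function.iterate_succ_apply', ih, mono_mul_mono, mono_mul_mono, pow_succ',
      Module.End.mul_apply, comm_apply, map_sub]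
    have e1 : a + (b + r * a) = b + (r + 1 : ℕ) * a := by push_cast; ring
    have e2 : b + r * a + a = b + (r + 1 : ℕ) * a := by push_cast; ring
    rw [e1, e2]

theorem iterate_comm_add (X : Ser m n) (Y Z : Ser m n) (r : ℕ) :
    (fun Z : Ser m n => X * Z - Z * X)^[r] (Y + Z) =
      (fun Z : Ser m n => X * Z - Z * X)^[r] Y + (fun Z : Ser m n => X * Z - Z * X)^[r] Z := by
  induction r with
  | zero => rfl
  | succ r ih =>
    rw [Function.iterate_succ_apply', ih, Function.iterate_succ_apply', Function.iterate_succ_apply']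
    noncomm_ring

theorem summ_iterate {A : Op m n} (h : LocNil A) (b : ℤ) (D : Op m n) :
    Summ b (fun r : ℕ => ((r.factorial : ℂ)⁻¹) •
      (fun Z : Ser m n => mono 0 A * Z - Z * mono 0 A)^[r] (mono b D)) (mono b (conjExp A D)) := by
  rw [h.conjExp_eq]
  refine (summ_mono_psum (h.pfin_comm D)).congr fun r => ?_
  rw [iterate_comm, mul_zero, add_zero, map_smul]

theorem expConj_mono_add {A : Op m n} (h : LocNil A) {b : ℤ} (D E : Op m n) :
    (expConj (mono 0 A : Ser m n) (mono b D + mono (b - 1) E : Ser m n) : HOp m n) =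
      mono b (conjExp A D) + mono (b - 1) (conjExp A E) := by
  refine Summ.opSum_eq (N := b - 1) ?_
  refine (((summ_iterate h b D).of_le (by omega)).add (summ_iterate h (b - 1) E)).congr fun r => ?_
  rw [← smul_add, ← iterate_comm_add]
  rfl

/-- The `r`-th term of the series lives at `ħ^{b-r}`. Vanishing of the double commutator stops the
series after the linear term, so the powers of `ħ` remain bounded below. -/
theorem expConj_mono_neg {A D : Op m n} (b : ℤ) (h : comm A (comm A D) = 0) :
    (expConj (mono (-1) A : Ser m n) (mono b D : Ser m n) : HOp m n) =
      mono b D + mono (b - 1) (comm A D) := by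
  have h1 := summ_finset (N := b - 1) (m := m) (n := n) {0, 1} (T := fun r : ℕ => ((r.factorial : ℂ)⁻¹) •
      (fun Z : Ser m n => mono (-1) A * Z - Z * mono (-1) A)^[r] (mono b D)) ?_ ?_
  · rw [Finset.sum_insert (by simp), Finset.sum_singleton] at h1
    simp only [iterate_comm] at h1
    simp at h1
    refine Summ.opSum_eq (N := b - 1) ?_
    rw [sub_eq_add_neg]
    refine Summ.congr h1 fun r => ?_
    show _ = ((r.factorial : ℂ)⁻¹) •
      (fun Z : Ser m n => mono (-1) A * Z - Z * mono (-1) A)^[r] (mono b D)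
    rw [iterate_comm]
    simp
  · intro r hr
    have : ∃ q, r = q + 2 := ⟨r - 2, by simp at hr; omega⟩
    obtain ⟨q, rfl⟩ := this
    rw [iterate_comm, pow_add, Module.End.mul_apply, pow_two, Module.End.mul_apply, h, map_zero,
      map_zero, smul_zero]
  · intro r
    rw [iterate_comm]
    by_cases hr : 2 ≤ r
    · obtain ⟨q, rfl⟩ := Nat.exists_eq_add_of_le' hr
      rw [pow_add, Module.End.mul_apply, pow_two, Module.End.mul_apply, h, map_zero,
        map_zero, smul_zero]
      exact LB.zero _
    · refine LB.smul ((lb_mono _ _).mono ?_) _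
      have : r ≤ 1 := by omega
      have : (r : ℤ) ≤ 1 := by exact_mod_cast this
      linarith

end Exp

/-! ### Multiplication by scalars -/

section Scalars

/-- The operator of multiplication by an element of `R`. -/
def sc : Base m n →ₐ[ℂ] Op m n := (Algebra.lmul ℂ (Pol m n)).comp ofBase

theorem sc_apply (r : Base m n) : (sc r : Op m n) = mulOp (ofBase r) := rfl

theorem scalar_eq (r : Base m n) : (scalar r : HOp m n) = mono 0 (sc r) := rfl

theorem sc_mem_fil (r : Base m n) : (sc r : Op m n) ∈ Fil 1 := ofBase_mem_fil r

theorem hasPar_sc_of_isEven {r : Base m n} (h : IsEven r) : HasPar false (sc r : Op m n) :=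
  hasPar_ofBase_of_isEven h

theorem hasPar_sc_of_isOdd {r : Base m n} (h : IsOdd r) : HasPar true (sc r : Op m n) :=
  hasPar_ofBase_of_isOdd h

theorem ad_sc {b : Bool} {y : Op m n} (hy : RLin y) (hp : HasPar b y) (r : Base m n) :
    ad b y (sc r) = 0 := ad_ofBase hy hp r

theorem ad_sc_mul {b : Bool} {y : Op m n} (hy : RLin y) (hp : HasPar b y) (r : Base m n)
    (D : Op m n) : ad b y (sc r * D) = sc r * ad b y D := by
  rw [ad_mul, ad_sc hy hp, zero_mul, add_zero]

theorem mul_sc_of_even {r : Base m n} (h : IsEven r) {D : Op m n} (hD : RLin D) :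
    D * sc r = sc r * D := by
  have := hD.mul_ofBase (hasPar_sc_of_isEven h)
  rwa [twist_false] at this

theorem mul_sc_of_odd {c : Bool} {r : Base m n} (h : IsOdd r) {D : Op m n} (hD : RLin D)
    (hc : HasPar c D) : D * sc r = sgn true c • (sc r * D) := by
  have := hD.mul_ofBase (hasPar_sc_of_isOdd h)
  rw [hc true, mul_smul_comm] at this
  exact this

theorem mul_sc_of_hasPar {r : Base m n} {D : Op m n} (hD : RLin D) (hc : HasPar false D) :
    D * sc r = sc r * D := by
  have := hD.mul_mulOp_ofBase hc r
  rwa [twist_false] at this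

end Scalars

/-! ### The change of polarisation -/

section Polarisation

/-- The data of a change of polarisation. -/
structure IsPolarisation (B V φ : ℕ → ℕ → Base m n) : Prop where
  even_B : ∀ k l, IsEven (B k l)
  even_V : ∀ k l, IsEven (V k l)
  odd_φ : ∀ k l, IsOdd (φ k l)
  V_zero : V 0 0 = 0

/-- The members of the sum defining the logarithm of the change of polarisation. -/
def polTerm (B V φ : ℕ → ℕ → Base m n) (p : ℕ × ℕ) : Op m n :=
  (((p.1 : ℂ) * (p.2 : ℂ))⁻¹) • (md false p.1 * md false p.2 * sc (B p.1 p.2))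
    - (2 * (p.1 : ℂ)⁻¹) • (md false p.1 * md true p.2 * sc (φ p.1 p.2))
    + md true p.1 * md true p.2 * sc (V p.1 p.2)

/-- The logarithm of the change of polarisation. -/
def polOp (B V φ : ℕ → ℕ → Base m n) : Op m n := (1 / 2 : ℂ) • psum (polTerm B V φ)

variable {B V φ : ℕ → ℕ → Base m n}

/-- The scalars are moved to the left, so that convergence is governed by the modes. The odd scalar
passes an odd operator, which reverses the sign of the mixed term. -/
theorem IsPolarisation.polTerm_eq (h : IsPolarisation B V φ) (p : ℕ × ℕ) :
    polTerm B V φ p =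
      sc (B p.1 p.2) * ((((p.1 : ℂ) * (p.2 : ℂ))⁻¹) • (md false p.1 * md false p.2))
      + sc (φ p.1 p.2) * ((2 * (p.1 : ℂ)⁻¹) • (md false p.1 * md true p.2))
      + sc (V p.1 p.2) * (md true p.1 * md true p.2) := by
  have h1 := mul_sc_of_even (h.even_B p.1 p.2) ((rLin_md (m := m) (n := n) false p.1).mul (rLin_md false p.2))
  have h2 := mul_sc_of_even (h.even_V p.1 p.2) ((rLin_md (m := m) (n := n) true p.1).mul (rLin_md true p.2))
  have h3 := mul_sc_of_odd (h.odd_φ p.1 p.2) ((rLin_md (m := m) (n := n) false p.1).mul (rLin_md true p.2))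
    ((hasPar_md false _).mul (hasPar_md true _))
  rw [polTerm, h1, h2, h3, Bool.false_xor, sgn_true_true, mul_smul_comm, mul_smul_comm]
  module

theorem pfin_md_nat (b : Bool) : PFin fun k : ℕ => (md b k : Op m n) := fun f => by
  obtain ⟨N, hN0, hN⟩ := exists_md_bound b f
  refine (Set.finite_Iic N.toNat).subset fun k hk => ?_
  by_contra hc
  rw [Set.mem_Iic, not_le] at hc
  exact hk (hN k (by omega))

theorem pfin_md_mul_md (b c : Bool) :
    PFin fun p : ℕ × ℕ => (md b (p.1 : ℤ) * md c (p.2 : ℤ) : Op m n) := by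
  have h := PFin.prod_mul (A := fun (_ : ℕ) (k : ℕ) => (md b (k : ℤ) : Op m n))
    (B := fun l : ℕ => (md c (l : ℤ) : Op m n)) (fun _ => pfin_md_nat b) (pfin_md_nat c)
  exact h.comp_injective Prod.swap_injective

theorem IsPolarisation.pfin (h : IsPolarisation B V φ) : PFin (polTerm B V φ) := by
  rw [show polTerm B V φ = _ from funext h.polTerm_eq]
  exact ((((pfin_md_mul_md false false).smul _).mul_left _).add
    (((pfin_md_mul_md false true).smul _).mul_left _)).add
    ((pfin_md_mul_md true true).mul_left _)

theorem hop_mul_mul {X Y Z : HOp m n} {a b c d : ℤ} {A B C : Op m n} (hX : X = (mono a A : Ser m n))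
    (hY : Y = (mono b B : Ser m n)) (hZ : Z = (mono c C : Ser m n)) (h : a + b + c = d) :
    X * Y * Z = (mono d (A * B * C) : Ser m n) := by
  rw [← h, ← mono_mul_mono, ← mono_mul_mono, hX, hY, hZ]
  rfl

theorem hop_mul {X Y : HOp m n} {a b d : ℤ} {A B : Op m n} (hX : X = (mono a A : Ser m n))
    (hY : Y = (mono b B : Ser m n)) (h : a + b = d) : X * Y = (mono d (A * B) : Ser m n) := by
  rw [← h, ← mono_mul_mono, hX, hY]
  rfl

theorem hop_smul {X : HOp m n} {a : ℤ} {A : Op m n} (z : ℂ) (hX : X = (mono a A : Ser m n)) :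
    z • X = (mono a (z • A) : Ser m n) := by
  rw [map_smul, hX]
  rfl

theorem hop_add {X Y : HOp m n} {a : ℤ} {A B : Op m n} (hX : X = (mono a A : Ser m n))
    (hY : Y = (mono a B : Ser m n)) : X + Y = (mono a (A + B) : Ser m n) := by
  rw [map_add, hX, hY]
  rfl

theorem hop_sub {X Y : HOp m n} {a : ℤ} {A B : Op m n} (hX : X = (mono a A : Ser m n))
    (hY : Y = (mono a B : Ser m n)) : X - Y = (mono a (A - B) : Ser m n) := by
  rw [map_sub, hX, hY]
  rfl

theorem hbar_eq (k : ℤ) : (hbar k : HOp m n) = (mono k 1 : Ser m n) := rfl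

theorem logPhi_eq (h : IsPolarisation B V φ) :
    (logPhi B V φ : HOp m n) = (mono 0 (polOp B V φ) : Ser m n) := by
  have h0 : ∀ p : ℕ × ℕ, (((p.1 : ℂ) * (p.2 : ℂ))⁻¹) • (J p.1 * J p.2 * scalar (B p.1 p.2))
    - (2 * (p.1 : ℂ)⁻¹) • (J p.1 * Gam p.2 * scalar (φ p.1 p.2))
    + Gam p.1 * Gam p.2 * scalar (V p.1 p.2) = (mono 2 (polTerm B V φ p) : Ser m n) := fun p => by
    have a1 := hop_mul_mul (d := 2) (J_eq (m := m) (n := n) p.1) (J_eq p.2) (scalar_eq (B p.1 p.2))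
      (by norm_num)
    have a2 := hop_mul_mul (d := 2) (J_eq (m := m) (n := n) p.1) (Gam_eq p.2) (scalar_eq (φ p.1 p.2))
      (by norm_num)
    have a3 := hop_mul_mul (d := 2) (Gam_eq (m := m) (n := n) p.1) (Gam_eq p.2)
      (scalar_eq (V p.1 p.2)) (by norm_num)
    exact hop_add (hop_sub (hop_smul _ a1) (hop_smul _ a2)) a3
  have h1 := opSum_mono 2 h.pfin h0
  have h2 := hop_smul (1 / 2 : ℂ) (hop_mul (d := 0) (hbar_eq (-2)) h1 (by norm_num))
  rw [one_mul] at h2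
  exact h2

theorem IsPolarisation.hasPar_polTerm (h : IsPolarisation B V φ) (p : ℕ × ℕ) :
    HasPar false (polTerm B V φ p) := by
  have h1 : HasPar (xor false false) (md false p.1 * md false p.2 : Op m n) :=
    (hasPar_md false _).mul (hasPar_md false _)
  have h2 : HasPar (xor false true) (md false p.1 * md true p.2 : Op m n) :=
    (hasPar_md false _).mul (hasPar_md true _)
  have h3 : HasPar (xor true true) (md true p.1 * md true p.2 : Op m n) :=
    (hasPar_md true _).mul (hasPar_md true _)
  rw [h.polTerm_eq]
  have e1 := (hasPar_sc_of_isEven (h.even_B p.1 p.2)).mul (h1.smul (((p.1 : ℂ) * (p.2 : ℂ))⁻¹))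
  have e2 := (hasPar_sc_of_isOdd (h.odd_φ p.1 p.2)).mul (h2.smul (2 * (p.1 : ℂ)⁻¹))
  have e3 := (hasPar_sc_of_isEven (h.even_V p.1 p.2)).mul h3
  exact (e1.add e2).add e3

theorem IsPolarisation.hasPar (h : IsPolarisation B V φ) : HasPar false (polOp B V φ) :=
  (HasPar.psum h.pfin h.hasPar_polTerm).smul _

theorem md_mul_md_mem_fil (b c : Bool) (k l : ℤ) : (md b k * md c l : Op m n) ∈ Fil 3 :=
  mul_mem_fil (md_mem_fil b k) (md_mem_fil c l)

theorem sc_mul_mem_fil {d : ℕ} {D : Op m n} (r : Base m n) (hD : D ∈ Fil d) : sc r * D ∈ Fil d := by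
  cases d with
  | zero => rw [mem_fil_zero.1 hD, mul_zero]; exact Submodule.zero_mem _
  | succ d =>
    have := mul_mem_fil (sc_mem_fil r) hD
    rwa [zero_add] at this

theorem IsPolarisation.mem_fil (h : IsPolarisation B V φ) : polOp B V φ ∈ Fil 3 := by
  refine Submodule.smul_mem _ _ (psum_mem_fil h.pfin fun p => ?_)
  rw [h.polTerm_eq]
  exact Submodule.add_mem _ (Submodule.add_mem _
    (sc_mul_mem_fil _ (Submodule.smul_mem _ _ (md_mul_md_mem_fil _ _ _ _)))
    (sc_mul_mem_fil _ (Submodule.smul_mem _ _ (md_mul_md_mem_fil _ _ _ _))))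
    (sc_mul_mem_fil _ (md_mul_md_mem_fil _ _ _ _))

theorem comm_eq_ad {b : Bool} {A y : Op m n} (hA : HasPar false A) : comm A y = ad b y A := by
  have : twist b A = A := by rw [hA b]; simp
  rw [comm_apply, ad_apply, this]

theorem ad_md_mul_md_nonneg {b : Bool} {l : ℤ} (hl : 0 < l) (b₁ b₂ : Bool) (p : ℕ × ℕ) :
    ad b (md b l) (md b₁ p.1 * md b₂ p.2 : Op m n) = 0 := by
  rw [ad_mul, ad_md_md, ad_md_md, if_neg (by omega), if_neg (by omega), mul_zero, zero_mul, add_zero]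

/-- Only modes of index at least zero occur, and a mode of index `l > 0` pairs only with the index
`-l`. -/
theorem IsPolarisation.comm_md (h : IsPolarisation B V φ) (b : Bool) {l : ℤ} (hl : 0 < l) :
    comm (polOp B V φ) (md b l) = 0 := by
  rw [comm_eq_ad (b := b) h.hasPar, polOp, map_smul, ad_psum h.pfin]
  have : ∀ p, ad b (md b l) (polTerm B V φ p) = 0 := fun p => by
    rw [h.polTerm_eq, map_add, map_add, ad_sc_mul (rLin_md b l) (hasPar_md b l),
      ad_sc_mul (rLin_md b l) (hasPar_md b l), ad_sc_mul (rLin_md b l) (hasPar_md b l), map_smul,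
      map_smul, ad_md_mul_md_nonneg hl, ad_md_mul_md_nonneg hl, ad_md_mul_md_nonneg hl]
    simp
  rw [psum_congr this, psum_zero, smul_zero]

/-- Polynomials of degree less than `d` in the coordinates other than `θ⁰`. -/
def partialDeg (m n : ℕ) : ℕ → Submodule ℂ (Pol m n)
  | 0 => ⊥
  | d + 1 => ⨅ a : {a : Idx // a ≠ theta0}, (partialDeg m n d).comap (pd a.1)

theorem mem_partialDeg_succ {d : ℕ} {f : Pol m n} :
    f ∈ partialDeg m n (d + 1) ↔ ∀ a, a ≠ theta0 → pd a f ∈ partialDeg m n d := by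
  simp [partialDeg, Submodule.mem_iInf]

theorem partialDeg_le_succ (d : ℕ) : partialDeg m n d ≤ partialDeg m n (d + 1) := by
  induction d with
  | zero => exact bot_le
  | succ d ih =>
    intro f hf
    rw [mem_partialDeg_succ] at hf ⊢
    exact fun a ha => ih (hf a ha)

theorem partialDeg_mono {d e : ℕ} (h : d ≤ e) : partialDeg m n d ≤ partialDeg m n e :=
  monotone_nat_of_le_succ partialDeg_le_succ h

theorem exists_mem_partialDeg (f : Pol m n) : ∃ d, f ∈ partialDeg m n d := by
  let W : Submodule ℂ (Pol m n) :=
    { carrier := {f | ∃ d, f ∈ partialDeg m n d}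
      zero_mem' := ⟨0, Submodule.zero_mem _⟩
      add_mem' := by
        rintro f g ⟨d, hf⟩ ⟨e, hg⟩
        exact ⟨max d e, Submodule.add_mem _ (partialDeg_mono (le_max_left _ _) hf)
          (partialDeg_mono (le_max_right _ _) hg)⟩
      smul_mem' := by
        rintro c f ⟨d, hf⟩
        exact ⟨d, Submodule.smul_mem _ _ hf⟩ }
  have hW : W = ⊤ := by
    refine eq_top_of_coord W ?_ ?_
    · intro r
      exact ⟨1, mem_partialDeg_succ.2 fun a _ => by rw [pd_ofBase]; exact Submodule.zero_mem _⟩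
    · rintro a f ⟨d, hf⟩
      refine ⟨d + 1, ?_⟩
      have key : ∀ d f, f ∈ partialDeg m n d → coord a * f ∈ partialDeg m n (d + 1) := by
        intro d
        induction d with
        | zero =>
          intro f hf
          rw [show f = 0 from hf, mul_zero]
          exact Submodule.zero_mem _
        | succ d ih =>
          intro f hf
          rw [mem_partialDeg_succ]
          intro b hb
          rw [pd_coord_mul]
          refine Submodule.add_mem _ ?_ (Submodule.smul_mem _ _ (ih _ (mem_partialDeg_succ.1 hf b hb)))
          split_ifs
          · exact hf
          · exact Submodule.zero_mem _
      exact key d f hf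
  have : f ∈ W := by rw [hW]; trivial
  exact this

theorem mem_partialDeg_of_ad {c : Bool} {y : Op m n} (hc : HasPar c y)
    (h : ∀ a, a ≠ theta0 → ad (par a) (pd a) y = 0) {d : ℕ} {f : Pol m n}
    (hf : f ∈ partialDeg m n d) : y f ∈ partialDeg m n d := by
  induction d generalizing f with
  | zero => rw [show f = 0 from hf, map_zero]; exact Submodule.zero_mem _
  | succ d ih =>
    rw [mem_partialDeg_succ] at hf ⊢
    intro a ha
    have h1 := h a ha
    rw [ad_apply, hc (par a), sub_eq_zero, mul_smul_comm] at h1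
    have h2 := DFunLike.congr_fun h1 f
    have h3 : pd a (y f) = sgn (par a) c • y (pd a f) := by
      rw [← Module.End.mul_apply y, h2, LinearMap.smul_apply, smul_smul, sgn_mul_self, one_smul]
      rfl
    rw [h3]
    exact Submodule.smul_mem _ _ (ih (hf a ha))

theorem md_nonneg_mem_partialDeg (b : Bool) (k : ℕ) {d : ℕ} {f : Pol m n}
    (hf : f ∈ partialDeg m n d) : md b k f ∈ partialDeg m n d := by
  refine mem_partialDeg_of_ad (hasPar_md b k) (fun a ha => ?_) hf
  obtain ⟨l, hl, h⟩ := pd_eq_md (m := m) (n := n) a ha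
  rw [h, ad_md_md, if_neg (by omega)]

theorem md_pos_mem_partialDeg (b : Bool) {k : ℕ} (hk : 0 < k) {d : ℕ} {f : Pol m n}
    (hf : f ∈ partialDeg m n (d + 1)) : md b k f ∈ partialDeg m n d := by
  rw [mem_partialDeg_succ] at hf
  have hk' : (0 : ℤ) < k := by exact_mod_cast hk
  cases b
  · simp only [md]; rw [if_pos hk']
    exact hf _ (by simp [theta0])
  · simp only [md]; rw [if_pos hk']
    exact hf _ (by simp [theta0]; omega)

theorem sc_mem_partialDeg {c : Bool} {r : Base m n} (hr : HasPar c (sc r : Op m n)) {d : ℕ}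
    {f : Pol m n} (hf : f ∈ partialDeg m n d) : sc r f ∈ partialDeg m n d :=
  mem_partialDeg_of_ad hr (fun a _ => ad_sc (rLin_pd a) (hasPar_pd a) r) hf

/-- Every term contains a mode of positive index, except those with `J_0 = 0` and the term `Γ_0 Γ_0
V_{00}`, which vanish. The zero mode `Γ_0` multiplies by `θ⁰` and raises the usual degree, so the
degree is taken in the other coordinates, where positive modes lower it and `Γ_0` does nothing. -/
theorem IsPolarisation.polTerm_mem (h : IsPolarisation B V φ) (p : ℕ × ℕ) {d : ℕ} {f : Pol m n}
    (hf : f ∈ partialDeg m n (d + 1)) : polTerm B V φ p f ∈ partialDeg m n d := by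
  obtain ⟨k, l⟩ := p
  rw [h.polTerm_eq]
  simp only [LinearMap.add_apply, Module.End.mul_apply, LinearMap.smul_apply]
  refine Submodule.add_mem _ (Submodule.add_mem _ (sc_mem_partialDeg (hasPar_sc_of_isEven (h.even_B _ _))
    (Submodule.smul_mem _ _ ?_)) (sc_mem_partialDeg (hasPar_sc_of_isOdd (h.odd_φ _ _))
    (Submodule.smul_mem _ _ ?_))) ?_
  · rcases Nat.eq_zero_or_pos l with rfl | hl
    · rw [Nat.cast_zero, md_false_zero, LinearMap.zero_apply, map_zero]
      exact Submodule.zero_mem _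
    · exact md_nonneg_mem_partialDeg _ _ (md_pos_mem_partialDeg _ hl hf)
  · rcases Nat.eq_zero_or_pos k with rfl | hk
    · rw [Nat.cast_zero, md_false_zero, LinearMap.zero_apply]
      exact Submodule.zero_mem _
    · exact md_pos_mem_partialDeg _ hk (md_nonneg_mem_partialDeg _ _ hf)
  · rcases Nat.eq_zero_or_pos l with rfl | hl
    · rcases Nat.eq_zero_or_pos k with rfl | hk
      · rw [h.V_zero, map_zero, LinearMap.zero_apply]
        exact Submodule.zero_mem _
      · exact sc_mem_partialDeg (hasPar_sc_of_isEven (h.even_V _ _))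
          (md_pos_mem_partialDeg _ hk (md_nonneg_mem_partialDeg _ _ hf))
    · exact sc_mem_partialDeg (hasPar_sc_of_isEven (h.even_V _ _))
        (md_nonneg_mem_partialDeg _ _ (md_pos_mem_partialDeg _ hl hf))

theorem IsPolarisation.locNil (h : IsPolarisation B V φ) : LocNil (polOp B V φ) := fun f => by
  obtain ⟨d, hd⟩ := exists_mem_partialDeg f
  have h1 : ∀ d, ∀ f ∈ partialDeg m n (d + 1), polOp B V φ f ∈ partialDeg m n d := fun d f hf => by
    rw [polOp, LinearMap.smul_apply]
    exact Submodule.smul_mem _ _ (psum_mem h.pfin fun p => h.polTerm_mem p hf)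
  have h2 : ∀ r d f, f ∈ partialDeg m n d → (polOp B V φ ^ r) f ∈ partialDeg m n (d - r) := by
    intro r
    induction r with
    | zero => intro d f hf; exact hf
    | succ r ih =>
      intro d f hf
      cases d with
      | zero => rw [show f = 0 from hf, map_zero]; exact Submodule.zero_mem _
      | succ d =>
        rw [pow_succ, Module.End.mul_apply]
        have := ih d _ (h1 d f hf)
        rwa [Nat.succ_sub_succ]
  refine ⟨d, fun r hr => ?_⟩
  have := h2 r d f hd
  rwa [Nat.sub_eq_zero_of_le hr] at this

theorem IsPolarisation.conjExp_md (h : IsPolarisation B V φ) (b : Bool) {l : ℤ} (hl : 0 < l) :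
    conjExp (polOp B V φ) (md b l) = md b l :=
  h.locNil.conjExp_of_comm (h.comm_md b hl)

theorem IsPolarisation.rLin (h : IsPolarisation B V φ) : RLin (polOp B V φ) :=
  RLin.of_mem_fil h.mem_fil

theorem IsPolarisation.conjExp_sc_mul (h : IsPolarisation B V φ) (r : Base m n) (D : Op m n) :
    conjExp (polOp B V φ) (sc r * D) = sc r * conjExp (polOp B V φ) D := by
  rw [h.locNil.conjExp_mul, h.locNil.conjExp_of_comm]
  rw [comm_apply, mul_sc_of_hasPar h.rLin h.hasPar, sub_self]

end Polarisation

/-! ### The dilaton shift -/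

section Dilation

/-- The data of a dilaton shift. -/
structure IsDilation (t τ : ℤ → Base m n) : Prop where
  even_t : ∀ k, IsEven (t k)
  odd_τ : ∀ k, IsOdd (τ k)
  bdd : ∃ N : ℤ, ∀ k < N, t k = 0 ∧ τ k = 0
  t_zero : t 0 = 0

/-- The members of the sum defining the logarithm of the dilaton shift. -/
def dilTerm (t τ : ℤ → Base m n) (k : ℤ) : Op m n :=
  ((k : ℂ)⁻¹) • (md false k * sc (t k)) - md true k * sc (τ k)

/-- The logarithm of the dilaton shift. -/
def dilOp (t τ : ℤ → Base m n) : Op m n := psum (dilTerm t τ)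

/-- The derivation `[log T, -]`, at `ħ = 1`. -/
def dilDer (t τ : ℤ → Base m n) : Op m n →ₗ[ℂ] Op m n := comm (dilOp t τ)

variable {t τ : ℤ → Base m n}

theorem IsDilation.bdd_t (h : IsDilation t τ) : ∃ N : ℤ, ∀ k < N, t k = 0 :=
  h.bdd.imp fun _ hN k hk => (hN k hk).1

theorem IsDilation.bdd_τ (h : IsDilation t τ) : ∃ N : ℤ, ∀ k < N, τ k = 0 :=
  h.bdd.imp fun _ hN k hk => (hN k hk).2

theorem IsDilation.dilTerm_eq (h : IsDilation t τ) (k : ℤ) :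
    dilTerm t τ k = sc (t k) * (((k : ℂ)⁻¹) • md false k) + sc (τ k) * md true k := by
  rw [dilTerm, mul_sc_of_even (h.even_t k) (rLin_md false k),
    mul_sc_of_odd (h.odd_τ k) (rLin_md true k) (hasPar_md true k), sgn_true_true, mul_smul_comm]
  module

/-- Large positive indices are cut off by the modes, large negative ones by the vanishing of `u`. -/
theorem pfin_sc_mul_md {u : ℤ → Base m n} (hu : ∃ N : ℤ, ∀ k < N, u k = 0) (z : ℤ → ℂ) (b : Bool)
    (l : ℤ) : PFin fun i => (sc (u i) * (z i • md b (i + l)) : Op m n) := by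
  obtain ⟨N, hN⟩ := hu
  refine pfin_int fun f => ?_
  obtain ⟨M, hM0, hM⟩ := exists_md_bound b f
  refine ⟨max (M - l) (-N), fun j hj => ?_⟩
  rcases hj with hj | hj
  · rw [Module.End.mul_apply, LinearMap.smul_apply, hM _ (by omega), smul_zero, map_zero]
  · rw [hN j (by omega), map_zero, zero_mul, LinearMap.zero_apply]

theorem IsDilation.pfin (h : IsDilation t τ) : PFin (dilTerm t τ) := by
  rw [show dilTerm t τ = _ from funext h.dilTerm_eq]
  have h1 := pfin_sc_mul_md h.bdd_t (fun k => (k : ℂ)⁻¹) false 0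
  have h2 := pfin_sc_mul_md h.bdd_τ (fun _ => 1) true 0
  simp only [add_zero, one_smul] at h1 h2
  exact h1.add h2

theorem logT_eq (h : IsDilation t τ) : (logT t τ : HOp m n) = (mono (-1) (dilOp t τ) : Ser m n) := by
  have h0 : ∀ k : ℤ, ((k : ℂ)⁻¹) • (J k * scalar (t k)) - Gam k * scalar (τ k) =
      (mono 1 (dilTerm t τ k) : Ser m n) := fun k => by
    have a1 := hop_mul (d := 1) (J_eq (m := m) (n := n) k) (scalar_eq (t k)) (by norm_num)
    have a2 := hop_mul (d := 1) (Gam_eq (m := m) (n := n) k) (scalar_eq (τ k)) (by norm_num)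
    exact hop_sub (hop_smul _ a1) a2
  have h2 := hop_mul (d := -1) (hbar_eq (-2)) (opSum_mono 1 h.pfin h0) (by norm_num)
  rw [one_mul] at h2
  exact h2

theorem IsDilation.hasPar (h : IsDilation t τ) : HasPar false (dilOp t τ) := by
  refine HasPar.psum h.pfin fun k => ?_
  rw [h.dilTerm_eq]
  have e1 := (hasPar_sc_of_isEven (h.even_t k)).mul ((hasPar_md (m := m) (n := n) false k).smul (k : ℂ)⁻¹)
  have e2 := (hasPar_sc_of_isOdd (h.odd_τ k)).mul (hasPar_md (m := m) (n := n) true k)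
  exact e1.add e2

theorem IsDilation.mem_fil (h : IsDilation t τ) : dilOp t τ ∈ Fil 2 := by
  refine psum_mem_fil h.pfin fun k => ?_
  rw [h.dilTerm_eq]
  exact Submodule.add_mem _ (sc_mul_mem_fil _ (Submodule.smul_mem _ _ (md_mem_fil _ _)))
    (sc_mul_mem_fil _ (md_mem_fil _ _))

theorem IsDilation.rLin (h : IsDilation t τ) : RLin (dilOp t τ) := RLin.of_mem_fil h.mem_fil

theorem dilDer_mul (D E : Op m n) :
    dilDer t τ (D * E) = dilDer t τ D * E + D * dilDer t τ E := by
  simp only [dilDer, comm_apply, sub_mul, mul_sub, mul_assoc]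
  abel

theorem IsDilation.dilDer_sc (h : IsDilation t τ) (r : Base m n) : dilDer t τ (sc r) = 0 := by
  rw [dilDer, comm_apply, mul_sc_of_hasPar h.rLin h.hasPar, sub_self]

theorem IsDilation.dilDer_sc_mul (h : IsDilation t τ) (r : Base m n) (D : Op m n) :
    dilDer t τ (sc r * D) = sc r * dilDer t τ D := by
  rw [dilDer_mul, h.dilDer_sc, zero_mul, zero_add]

theorem dilDer_psum {ι : Type} {T : ι → Op m n} (hT : PFin T) :
    dilDer t τ (psum T) = psum fun i => dilDer t τ (T i) := by
  simp only [dilDer, comm_apply]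
  rw [psum_mul_left hT, psum_mul_right hT, psum_sub (hT.mul_left _) (hT.mul_right _)]

/-- The values `t_k` for `b = false` and `τ_k` for `b = true`. -/
def dilVal (t τ : ℤ → Base m n) (b : Bool) (k : ℤ) : Base m n := if b then τ k else t k

theorem IsDilation.dilDer_md (h : IsDilation t τ) (b : Bool) (l : ℤ) :
    dilDer t τ (md b l) = sc (dilVal t τ b (-l)) := by
  rw [dilDer, comm_eq_ad (b := b) h.hasPar, dilOp, ad_psum h.pfin]
  have h1 : ∀ k, ad b (md b l) (dilTerm t τ k) =
      if k = -l then sc (dilVal t τ b (-l)) else 0 := fun k => by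
    rw [h.dilTerm_eq, map_add, ad_sc_mul (rLin_md b l) (hasPar_md b l),
      ad_sc_mul (rLin_md b l) (hasPar_md b l), map_smul, ad_md_md, ad_md_md]
    by_cases hk : k = -l
    · subst hk
      cases b
      -- For the zero mode the left side is zero because `J_0 = 0`; the right side is zero because
      -- `t_0 = 0`. Otherwise the factor `1/k` in `log T` cancels the weight of the Heisenberg
      -- relation.
      · by_cases h0 : l = 0
        · subst h0
          simp [dilVal, h.t_zero]
        · have : ((-l : ℤ) : ℂ) ≠ 0 := by exact_mod_cast neg_ne_zero.2 h0
          simp only [true_and, if_true, wt, dilVal, if_false, Bool.false_eq_true, smul_smul,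
            inv_mul_cancel₀ this, one_smul, mul_one, mul_zero, add_zero, reduceCtorEq, false_and]
      · simp [dilVal, wt]
    · simp [hk]
  rw [psum_congr h1, psum_eq_single (-l) fun j hj => if_neg hj, if_pos rfl]

theorem IsDilation.dilDer_of_isShift (h : IsDilation t τ) {c : Bool} {k : ℤ} {d : Bool → ℤ → ℂ}
    {D : Op m n} (hD : IsShift c k d D) :
    dilDer t τ D = psum fun i => sc (t i) * ((-((i : ℂ)⁻¹ * d false i)) • md c (i + k)) +
      sc (τ i) * ((-(sgn true c * d true i)) • md (!c) (i + k)) := by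
  have h1 : ∀ b i, ad c D (md b i) = (-(sgn b c * d b i)) • md (xor b c) (i + k) := fun b i => by
    rw [← bracket_eq_ad (hasPar_md b i) hD.hasPar, bracket_symm (hasPar_md b i) hD.hasPar,
      bracket_eq_ad hD.hasPar (hasPar_md b i), hD.ad_md, smul_smul, neg_mul]
  rw [dilDer, comm_eq_ad (b := c) h.hasPar, dilOp, ad_psum h.pfin]
  refine psum_congr fun i => ?_
  rw [h.dilTerm_eq, map_add, ad_sc_mul hD.rLin hD.hasPar, ad_sc_mul hD.rLin hD.hasPar, map_smul, h1,
    h1, smul_smul, Bool.false_xor, Bool.true_xor, sgn_false_left, one_mul, mul_neg]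

end Dilation

/-! ### The charged super Virasoro modes -/

section Charged

/-- The modes `mOp` for `c = false` and `nOp` for `c = true`. -/
def vop (c : Bool) (k : ℤ) : Op m n := if c then nOp k else mOp k

/-- The labels of the modes that are used. -/
def IsLabel (c : Bool) (k : ℤ) : Prop := if c then Odd k ∧ -1 ≤ k else Even k ∧ -2 ≤ k

/-- The adjoint action of `vop` on the modes. -/
def vShift (c : Bool) (k : ℤ) : Bool → ℤ → ℂ := if c then nShift else mShift k

theorem isShift_vop {c : Bool} {k : ℤ} (h : IsLabel c k) :
    IsShift c k (vShift c k) (vop c k : Op m n) := by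
  cases c
  · exact isShift_mOp h.1 h.2
  · exact isShift_nOp h.1 h.2

/-- The structure constants of the super Virasoro algebra. -/
def vConst (b c : Bool) (k l : ℤ) : ℂ :=
  if b then (if c then 2 else k - l / 2) else if c then k / 2 - l else k - l

theorem bracket_vop {b c : Bool} {k l : ℤ} (hk : IsLabel b k) (hl : IsLabel c l) :
    bracket b (vop b k : Op m n) (vop c l) = vConst b c k l • vop (xor b c) (k + l) := by
  cases b <;> cases c
  · exact bracket_mOp_mOp hk.2 hl.2 hk.1 hl.1
  · exact bracket_mOp_nOp hk.2 hl.2 hk.1 hl.1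
  · rw [bracket_symm (isShift_vop hk).hasPar (isShift_vop hl).hasPar]
    have := bracket_mOp_nOp (m := m) (n := n) hl.2 hk.2 hl.1 hk.1
    simp only [vop, if_true, Bool.false_eq_true, if_false, Bool.xor_false, vConst] at this ⊢
    rw [this, smul_smul, add_comm k l]
    congr 1
    simp
  · exact bracket_nOp_nOp hk.2 hl.2 hk.1 hl.1

variable {t τ : ℤ → Base m n}

/-- The coefficients of the modes of the parity of `vop c k` in its image under `dilDer`. -/
def rowT (t : ℤ → Base m n) (i : ℤ) : Base m n := if Odd i then t i else 0

/-- The coefficients of the modes of the other parity in the image of `vop c k` under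
`dilDer`. -/
def rowTau (τ : ℤ → Base m n) (c : Bool) (k i : ℤ) : Base m n :=
  if Even i then (if c then 1 else (i : ℂ) + k / 2) • τ i else 0

/-- The members of the sum over modes that is the image of `vop c k` under `dilDer`. -/
def rowTerm (t τ : ℤ → Base m n) (c : Bool) (k i : ℤ) : Op m n :=
  sc (rowT t i) * md c (i + k) + sc (rowTau τ c k i) * md (!c) (i + k)

theorem IsDilation.pfin_rowTerm (h : IsDilation t τ) (c : Bool) (k : ℤ) :
    PFin (rowTerm t τ c k) := by
  obtain ⟨N, hN⟩ := h.bdd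
  have h1 := pfin_sc_mul_md (u := rowT t) ⟨N, fun i hi => by simp [rowT, hN i hi]⟩ (fun _ => 1) c k
  have h2 := pfin_sc_mul_md (u := rowTau τ c k) ⟨N, fun i hi => by simp [rowTau, hN i hi]⟩
    (fun _ => 1) (!c) k
  simp only [one_smul] at h1 h2
  exact h1.add h2

/-- The weight `-i` of the action on odd bosonic modes cancels against `1/i` in `log T`, so the
coefficients are the `t_i` themselves; even fermionic modes contribute the multiples of `τ_i` in
`rowTau`. -/
theorem IsDilation.dilDer_vop (h : IsDilation t τ) {c : Bool} {k : ℤ} (hk : IsLabel c k) :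
    dilDer t τ (vop c k) = psum (rowTerm t τ c k) := by
  rw [h.dilDer_of_isShift (isShift_vop hk)]
  refine psum_congr fun i => ?_
  rw [rowTerm]
  congr 1
  · by_cases hi : Odd i
    · have h0 : (i : ℂ) ≠ 0 := by
        have : i ≠ 0 := by rintro rfl; exact absurd hi (by decide)
        exact_mod_cast this
      have : -((i : ℂ)⁻¹ * vShift c k false i) = 1 := by
        cases c <;> simp [vShift, mShift, nShift, hi, h0]
      rw [this, one_smul, rowT, if_pos hi]
    · have : vShift c k false i = 0 := by
        cases c <;> simp [vShift, mShift, nShift, hi]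
      rw [this, rowT, if_neg hi]
      simp
  · by_cases hi : Even i
    · rw [rowTau, if_pos hi, map_smul, smul_mul_assoc, mul_smul_comm]
      congr 1
      cases c <;> simp [vShift, mShift, nShift, hi]
    · have : vShift c k true i = 0 := by
        cases c <;> simp [vShift, mShift, nShift, hi]
      rw [this, rowTau, if_neg hi]
      simp

/-- The vacuum part of the doubly shifted mode. -/
def rowSq (t τ : ℤ → Base m n) (c : Bool) (k i : ℤ) : Base m n :=
  rowT t i * dilVal t τ c (-(i + k)) + rowTau τ c k i * dilVal t τ (!c) (-(i + k))

theorem IsDilation.finite_rowSq (h : IsDilation t τ) (c : Bool) (k : ℤ) :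
    (Function.support (rowSq t τ c k)).Finite := by
  obtain ⟨N, hN⟩ := h.bdd
  refine (Set.finite_Icc N (-k - N)).subset fun i hi => ?_
  by_contra hc
  rw [Set.mem_Icc, not_and_or, not_le, not_le] at hc
  refine hi ?_
  rcases hc with hc | hc
  · simp [rowSq, rowT, rowTau, hN i hc]
  · have h1 := hN (-(i + k)) (by omega)
    have h2 : ∀ b, dilVal t τ b (-(i + k)) = 0 := fun b => by
      cases b
      · exact h1.1
      · exact h1.2
    rw [rowSq, h2, h2, mul_zero, mul_zero, add_zero]

/-- The first commutator is linear in the modes, so the second is a scalar, and its convolution sum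
has finitely many terms because `t` and `τ` are bounded below. -/
theorem IsDilation.dilDer_dilDer_vop (h : IsDilation t τ) {c : Bool} {k : ℤ} (hk : IsLabel c k) :
    dilDer t τ (dilDer t τ (vop c k)) = sc (∑ᶠ i, rowSq t τ c k i) := by
  rw [h.dilDer_vop hk, dilDer_psum (h.pfin_rowTerm c k)]
  have h1 : ∀ i, dilDer t τ (rowTerm t τ c k i) = sc (rowSq t τ c k i) := fun i => by
    rw [rowTerm, map_add, h.dilDer_sc_mul, h.dilDer_sc_mul, h.dilDer_md, h.dilDer_md, ← map_mul,
      ← map_mul, ← map_add, rowSq]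
  rw [psum_congr h1, finsum_eq_sum _ (h.finite_rowSq c k), map_sum]
  exact psum_eq_sum _ fun j hj => by
    rw [Set.Finite.mem_toFinset, Function.notMem_support] at hj
    rw [hj, map_zero]

end Charged

/-! ### Consequences of the conditions on the differential -/

section Conditions

variable {t τ : ℤ → Base m n}

theorem omega01_c0 (t τ : ℤ → Base m n) (k : ℤ) : (omega01 t τ).c0 k = τ k := by
  simp [omega01, dzForm, dthetaForm, DiscSection.plus]

theorem omega01_c1 (t τ : ℤ → Base m n) (k : ℤ) : (omega01 t τ).c1 k = t k := by
  simp [omega01, dzForm, dthetaForm, DiscSection.plus]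

/-- The pullback by `σ` multiplies the term of `t_k` by `(-1)^k`, so the sum of the form and its
pullback doubles the even ones. For `τ_k`, the additional sign of `[dθ]` exchanges even and odd. -/
theorem t_eq_zero_of_isBigO (h : ((omega01 t τ).plus (omega01 t τ).pullSigma).IsBigO 1) {k : ℤ}
    (hk : k ≤ 0) (he : Even k) : t k = 0 := by
  have h1 := (h k (by omega)).2
  simp only [DiscSection.plus, DiscSection.pullSigma, omega01_c1, he.neg_one_zpow, one_smul,
    neg_neg] at h1
  rw [← two_smul ℂ, smul_eq_zero] at h1
  exact h1.resolve_left two_ne_zero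

theorem tau_eq_zero_of_isBigO (h : ((omega01 t τ).plus (omega01 t τ).pullSigma).IsBigO 1) {k : ℤ}
    (hk : k ≤ 0) (ho : Odd k) : τ k = 0 := by
  have h1 := (h k (by omega)).1
  simp only [DiscSection.plus, DiscSection.pullSigma, omega01_c0, ho.neg_one_zpow, neg_smul, one_smul,
    neg_neg] at h1
  rw [← two_smul ℂ, smul_eq_zero] at h1
  exact h1.resolve_left two_ne_zero

theorem IsOdd.mul_anticomm {E O : Type} {p q : SuperPoly E O} (hp : IsOdd p) (hq : IsOdd q) :
    p * q = -(q * p) := by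
  rw [hp.mul_comm, show parity q = -q from hq, neg_mul]

theorem IsOdd.mul_self {E O : Type} {p : SuperPoly E O} (hp : IsOdd p) : p * p = 0 := by
  have h := hp.mul_anticomm hp
  rw [eq_neg_iff_add_eq_zero, ← two_smul ℂ, smul_eq_zero] at h
  exact h.resolve_left two_ne_zero

theorem neg_one_zpow_sub_of_even {r : ℤ} (hr : Even r) (k : ℤ) : (-1 : ℂ) ^ (r - k) = (-1) ^ k := by
  rcases Int.even_or_odd k with hk | hk
  · rw [hk.neg_one_zpow, (hr.sub hk).neg_one_zpow]
  · rw [hk.neg_one_zpow, (hr.sub_odd hk).neg_one_zpow]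

theorem neg_one_zpow_sub_of_odd {r : ℤ} (hr : Odd r) (k : ℤ) : (-1 : ℂ) ^ (r - k) = -(-1) ^ k := by
  rcases Int.even_or_odd k with hk | hk
  · rw [hk.neg_one_zpow, (hr.sub_even hk).neg_one_zpow]
  · rw [hk.neg_one_zpow, (hr.sub_odd hk).neg_one_zpow, neg_neg]

theorem finite_support_conv {u v : ℤ → Base m n} (hu : ∃ N : ℤ, ∀ k < N, u k = 0)
    (hv : ∃ N : ℤ, ∀ k < N, v k = 0) (r : ℤ) :
    (Function.support fun k => u k * v (r - k)).Finite := by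
  obtain ⟨N, hN⟩ := hu
  obtain ⟨M, hM⟩ := hv
  refine (Set.finite_Icc N (r - M)).subset fun k hk => ?_
  by_contra hc
  rw [Set.mem_Icc, not_and_or, not_le, not_le] at hc
  refine hk ?_
  rcases hc with hc | hc
  · simp [hN k hc]
  · simp only [hM (r - k) (by omega), mul_zero]

/-- The summands of the coefficient of the twisted Casimir without `θ`. -/
def casOdd (t τ : ℤ → Base m n) (r k : ℤ) : Base m n := (-1 : ℂ) ^ k • (t k * τ (r - k))

/-- The summands of the coefficient of `θ` in the twisted Casimir. -/
def casEven (t τ : ℤ → Base m n) (r k : ℤ) : Base m n :=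
  (-1 : ℂ) ^ k • ((k : ℂ) • (τ k * τ (r - k)) - t k * t (r - k))

/-- For odd `r` the two specialisations of the coefficient without `θ` are opposite, so their
difference is twice one of them; for even `r` they would cancel and give no condition. -/
theorem IsDilation.finsum_casOdd (h : IsDilation t τ) {s : ℤ}
    (hq : (twistedCasimir (boxTimes (omega01 t τ) (omega01 t τ))).IsBigO s) {r : ℤ} (hr : r < s)
    (ho : Odd r) : ∑ᶠ k, casOdd t τ r k = 0 := by
  have h1 := (hq r hr).1
  simp only [twistedCasimir, BiSection.dStar, boxTimes, BiSection.specRight, BiSection.specLeft,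
    omega01_c0, omega01_c1, neg_one_zpow_sub_of_odd ho, neg_smul, finsum_neg_distrib] at h1
  rw [smul_eq_zero, ← neg_add', neg_eq_zero, ← two_smul ℂ, smul_eq_zero] at h1
  exact (h1.resolve_left (by norm_num)).resolve_left two_ne_zero

theorem IsDilation.finsum_casEven (h : IsDilation t τ) {s : ℤ}
    (hq : (twistedCasimir (boxTimes (omega01 t τ) (omega01 t τ))).IsBigO s) {r : ℤ} (hr : r < s)
    (he : Even r) : ∑ᶠ k, casEven t τ r k = 0 := by
  have h1 := (hq r hr).2
  simp only [twistedCasimir, BiSection.dStar, boxTimes, BiSection.specRight, BiSection.specLeft,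
    omega01_c0, omega01_c1, neg_one_zpow_sub_of_even he, show ∀ k, parity (t k) = t k from h.even_t]
    at h1
  have h2 : ∑ᶠ k : ℤ, (-1 : ℂ) ^ k • (t k * t (r - k) - (k : ℂ) • (τ k * τ (r - k))) =
      -∑ᶠ k, casEven t τ r k := by
    rw [← finsum_neg_distrib]
    refine finsum_congr fun k => ?_
    rw [casEven, ← smul_neg, neg_sub]
  rw [h2, sub_neg_eq_add, smul_eq_zero] at h1
  have h3 := h1.resolve_left (by norm_num)
  change ∑ᶠ k, casEven t τ r k + _ = 0 at h3
  rw [← two_smul ℂ, smul_eq_zero] at h3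
  exact h3.resolve_left two_ne_zero

/-- The double commutator is compared with the coefficient of `z^{-k}` in the twisted Casimir. For
even `k` the summands agree up to `k/2` times `τ_i τ_{-k-i}`, whose sum vanishes. For odd `k` they
are minus the summand of the Casimir symmetrised under `i ↔ -k-i`. Terms of the wrong parity in the
Casimir vanish by the linear condition and by `s ≤ 3`. -/
theorem IsDilation.finsum_rowSq (h : IsDilation t τ) {s : ℤ} (hs : s = 1 ∨ s = 3)
    (hl : ((omega01 t τ).plus (omega01 t τ).pullSigma).IsBigO 1)
    (hq : (twistedCasimir (boxTimes (omega01 t τ) (omega01 t τ))).IsBigO s) {c : Bool} {k : ℤ}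
    (hk : IsLabel c k) (hks : -s < k) : ∑ᶠ i, rowSq t τ c k i = 0 := by
  have e : ∀ i : ℤ, -(i + k) = -k - i := fun i => by ring
  have hr : -k < s := by omega
  cases c
  · have hke : Even k := hk.1
    have hE := h.finsum_casEven hq hr hke.neg
    have hfin : (Function.support fun i => if Even i then τ i * τ (-k - i) else 0).Finite :=
      (finite_support_conv h.bdd_τ h.bdd_τ (-k)).subset fun i hi hc => hi (by
        dsimp only at hc ⊢
        rw [hc, ite_self])
    -- The substitution `i ↔ -k-i` reverses the sign, as odd elements anticommute.
    have h0 : ∑ᶠ i, (if Even i then τ i * τ (-k - i) else 0) = 0 := by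
      have h1 := finsum_comp_equiv (Equiv.subLeft (-k))
        (f := fun i => if Even i then τ i * τ (-k - i) else 0)
      have h2 : ∀ i, (if Even (Equiv.subLeft (-k) i) then τ (Equiv.subLeft (-k) i) *
          τ (-k - Equiv.subLeft (-k) i) else 0) = -(if Even i then τ i * τ (-k - i) else 0) := by
        intro i
        simp only [Equiv.subLeft_apply, sub_sub_cancel]
        by_cases hi : Even i
        · rw [if_pos hi, if_pos (hke.neg.sub hi), (h.odd_τ _).mul_anticomm (h.odd_τ _)]
        · rw [if_neg hi, if_neg (fun hc => hi (by
            have := hke.neg.sub hc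
            rwa [sub_sub_cancel] at this)), neg_zero]
      rw [finsum_congr h2, finsum_neg_distrib, neg_eq_iff_add_eq_zero, ← two_smul ℂ,
        smul_eq_zero] at h1
      exact h1.resolve_left two_ne_zero
    -- The Casimir weights `τ_i τ_{-k-i}` by `i`, the double commutator by `i + k/2`. For the
    -- products of two even-indexed `t`, a positive even index is at least two, and `-k < s ≤ 3`
    -- makes the other one nonpositive.
    have h2 : ∀ i, rowSq t τ false k i = casEven t τ (-k) i +
        ((k : ℂ) / 2) • (if Even i then τ i * τ (-k - i) else 0) := fun i => by
      simp only [rowSq, rowT, rowTau, dilVal, casEven, e, Bool.false_eq_true, if_false, Bool.not_false,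
        if_true]
      by_cases hi : Even i
      · have ht : t i * t (-k - i) = 0 := by
          rcases le_or_gt i 0 with h0 | h0
          · rw [t_eq_zero_of_isBigO hl h0 hi, zero_mul]
          · have h2 := hi.two_dvd
            rw [t_eq_zero_of_isBigO (k := -k - i) hl (by omega) (hke.neg.sub hi), mul_zero]
        rw [if_neg (by simpa using hi), if_pos hi, if_pos hi, hi.neg_one_zpow, ht, zero_mul, zero_add,
          smul_mul_assoc, one_smul, sub_zero, ← add_smul]
      · have hi' : Odd i := by simpa using hi
        have ho : Odd (-k - i) := hke.neg.sub_odd hi'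
        have hτ : τ i * τ (-k - i) = 0 := by
          rcases le_or_gt i 0 with h0 | h0
          · rw [tau_eq_zero_of_isBigO hl h0 hi', zero_mul]
          · rcases le_or_gt (-k - i) 0 with h1 | h1
            · rw [tau_eq_zero_of_isBigO hl h1 ho, mul_zero]
            -- Two positive odd indices with sum `-k ≤ 2` are both one, and the square of an odd
            -- element is zero.
            · rw [show -k - i = i by omega, (h.odd_τ i).mul_self]
        rw [if_pos hi', if_neg hi, if_neg hi, hi'.neg_one_zpow, hτ]
        simp
    rw [finsum_congr h2, finsum_add_distrib _ (hfin.subset fun i hi hc => hi (by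
      dsimp only at hc ⊢
      rw [hc, smul_zero])), hE, zero_add, ← smul_finsum' _ hfin, h0, smul_zero]
    refine ((finite_support_conv h.bdd_τ h.bdd_τ (-k)).union
      (finite_support_conv h.bdd_t h.bdd_t (-k))).subset fun i hi => ?_
    by_contra hc
    rw [Set.mem_union, not_or, Function.notMem_support, Function.notMem_support] at hc
    exact hi (by rw [casEven, hc.1, hc.2, smul_zero, sub_zero, smul_zero])
  · have hko : Odd k := hk.1
    have hE := h.finsum_casOdd hq hr hko.neg
    have hfin : (Function.support fun i => casOdd t τ (-k) i).Finite :=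
      (finite_support_conv h.bdd_t h.bdd_τ (-k)).subset fun i hi hc => hi (by
        dsimp only at hc ⊢
        rw [casOdd, hc, smul_zero])
    have h0 : ∀ i, Even i → casOdd t τ (-k) i = 0 := fun i hi => by
      rw [casOdd]
      have ho : Odd (-k - i) := hko.neg.sub_even hi
      rcases le_or_gt i 0 with h0 | h0
      · rw [t_eq_zero_of_isBigO hl h0 hi, zero_mul, smul_zero]
      · have h2 := hi.two_dvd
        rw [tau_eq_zero_of_isBigO (k := -k - i) hl (by omega) ho, mul_zero, smul_zero]
    -- Odd `i` comes from the coefficients `t_i`, even `i` from the `τ_i`. The latter are Casimir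
    -- terms at the reflected index `-k-i`, so only one of the two summands on the right is nonzero.
    have h2 : ∀ i, rowSq t τ true k i =
        -(casOdd t τ (-k) i + casOdd t τ (-k) (Equiv.subLeft (-k) i)) := fun i => by
      simp only [rowSq, rowT, rowTau, dilVal, e, if_true, Bool.not_true, Bool.false_eq_true, if_false,
        Equiv.subLeft_apply]
      by_cases hi : Even i
      · rw [if_neg (by simpa using hi), if_pos hi, h0 i hi, casOdd,
          (hko.neg.sub_even hi).neg_one_zpow, sub_sub_cancel, (h.even_t _).mul_comm]
        simp
      · have hi' : Odd i := by simpa using hi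
        rw [if_pos hi', if_neg hi, h0 _ (hko.neg.sub_odd hi'), casOdd, hi'.neg_one_zpow]
        simp
    rw [finsum_congr h2, finsum_neg_distrib, finsum_add_distrib hfin
      (hfin.preimage (Equiv.injective _).injOn), finsum_comp_equiv (Equiv.subLeft (-k))
      (f := casOdd t τ (-k)), hE, add_zero, neg_zero]

end Conditions

/-! ### Conjugation of quadratic operators -/

section ShiftConj

theorem bracket_comm_right {c : Bool} {Q : Op m n} (hQ : HasPar false Q) (D E : Op m n) :
    comm Q (bracket c D E) = bracket c (comm Q D) E + bracket c D (comm Q E) := by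
  have h : twist c Q = Q := by rw [hQ c]; simp
  simp only [bracket, comm_apply, map_sub, twist_mul, h, mul_sub, sub_mul, mul_assoc]
  abel

theorem LocNil.conjExp_bracket {A : Op m n} (h : LocNil A) (hA : HasPar false A) (c : Bool)
    (D E : Op m n) :
    conjExp A (bracket c D E) = bracket c (conjExp A D) (conjExp A E) := by
  rw [bracket, map_sub, h.conjExp_mul, h.conjExp_mul, ← h.twist_conjExp hA, bracket]

theorem rbracket_mono {c : Bool} {D : Op m n} (hD : HasPar c D) (E : Op m n) {a b d : ℤ}
    (h : a + b = d + 2) : rbracket (mono a D) (mono b E) = mono d (bracket c D E) := by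
  rw [rbracket, scomm_eq (hasParH_mono hD a), twistH_mono, mono_mul_mono, mono_mul_mono, add_comm b a,
    ← map_sub, mono_mul_mono, one_mul, bracket, h, show -2 + (d + 2) = d by ring]

theorem rbracket_add_right {c : Bool} {X : Ser m n} (hX : HasParH c X) (Y Y' : Ser m n) :
    rbracket X (Y + Y') = rbracket X Y + rbracket X Y' := by
  rw [rbracket, rbracket, rbracket, scomm_eq hX, scomm_eq hX, scomm_eq hX, map_add, ← mul_add]
  congr 1
  rw [mul_add, add_mul]
  abel

/-- The conjugate of `ħ² D` by `exp A` after `exp (ħ⁻¹ Q)`, if the double commutator of `Q` with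
`D` vanishes. -/
def shiftConj (A Q D : Op m n) : Ser m n :=
  mono 2 (conjExp A D) + mono 1 (conjExp A (comm Q D))

variable {A Q : Op m n}

theorem hasParH_shiftConj (h : LocNil A) (hA : HasPar false A) (hQ : HasPar false Q) {c : Bool}
    {D : Op m n} (hD : HasPar c D) : HasParH c (shiftConj A Q D) :=
  (hasParH_mono (h.hasPar_conjExp hA hD) 2).add
    (hasParH_mono (h.hasPar_conjExp hA (hQ.comm hD)) 1)

theorem comm_mem_fil_sub_one (hQ : HasPar false Q) (hQ2 : Q ∈ Fil 2) {c : Bool} {D : Op m n}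
    (hc : HasPar c D) {d : ℕ} (hD : D ∈ Fil (d + 1)) : comm Q D ∈ Fil d := by
  have := bracket_mem_fil hQ hc hQ2 hD
  rw [show 2 + (d + 1) - 3 = d by omega] at this
  rwa [comm_apply, ← bracket_false]

theorem isRees_shiftConj (h : LocNil A) (hA : HasPar false A) (hA3 : A ∈ Fil 3)
    (hQ : HasPar false Q) (hQ2 : Q ∈ Fil 2) {c : Bool} {D : Op m n} (hc : HasPar c D)
    (hD : D ∈ Fil 3) : IsRees (shiftConj A Q D) :=
  (isRees_mono (d := 2) (h.conjExp_mem_fil hA hA3 hD)).add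
    (isRees_mono (d := 1) (h.conjExp_mem_fil hA hA3 (comm_mem_fil_sub_one hQ hQ2 hc hD)))

/-- Applying the derivation `[Q, -]` twice to the bracket of `D` and `E` gives twice the bracket of
`[Q, D]` and `[Q, E]`, since the double commutators of `D` and `E` vanish. So the term of lowest
order in `ħ` is zero and the other terms assemble to the conjugate of the bracket. -/
theorem rbracket_shiftConj (h : LocNil A) (hA : HasPar false A) (hQ : HasPar false Q) {c c' : Bool}
    {D E : Op m n} (hD : HasPar c D) (hE : HasPar c' E) (hD2 : comm Q (comm Q D) = 0)
    (hE2 : comm Q (comm Q E) = 0) (hDE : comm Q (comm Q (bracket c D E)) = 0) :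
    rbracket (shiftConj A Q D) (shiftConj A Q E) = shiftConj A Q (bracket c D E) := by
  have h0 : bracket c (comm Q D) (comm Q E) = 0 := by
    rw [bracket_comm_right hQ, map_add, bracket_comm_right hQ, bracket_comm_right hQ, hD2, hE2] at hDE
    have e1 : bracket c 0 E = 0 := by simp [bracket]
    have e2 : bracket c D 0 = 0 := by simp [bracket]
    rw [e1, e2, zero_add, add_zero, ← two_smul ℂ, smul_eq_zero] at hDE
    exact hDE.resolve_left two_ne_zero
  have p1 := h.hasPar_conjExp hA hD
  have p2 := h.hasPar_conjExp hA (hQ.comm hD)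
  rw [shiftConj, rbracket_add_left, shiftConj,
    rbracket_add_right (hasParH_mono p1 2), rbracket_add_right (hasParH_mono p2 1),
    rbracket_mono p1 _ (show (2 : ℤ) + 2 = 2 + 2 by norm_num),
    rbracket_mono p1 _ (show (2 : ℤ) + 1 = 1 + 2 by norm_num),
    rbracket_mono p2 _ (show (1 : ℤ) + 2 = 1 + 2 by norm_num),
    rbracket_mono p2 _ (show (1 : ℤ) + 1 = 0 + 2 by norm_num),
    ← h.conjExp_bracket hA, ← h.conjExp_bracket hA, ← h.conjExp_bracket hA, ← h.conjExp_bracket hA,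
    h0, map_zero, map_zero, add_zero, shiftConj, bracket_comm_right hQ, map_add, map_add]
  abel

theorem rbracket_mono_shiftConj (h : LocNil A) (hA : HasPar false A) (hQ : HasPar false Q) {c : Bool}
    {X D : Op m n} (hX : HasPar c X) (hAX : conjExp A X = X) (hQX : comm Q X = 0)
    (h0 : bracket c X D = 0) : rbracket (mono 1 X) (shiftConj A Q D) = 0 := by
  have h1 : bracket c X (comm Q D) = 0 := by
    have := bracket_comm_right (c := c) hQ X D
    rw [h0, map_zero, hQX] at this
    rw [eq_comm] at this
    simpa [bracket] using this
  have e : ∀ E, bracket c X (conjExp A E) = conjExp A (bracket c X E) := fun E => by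
    rw [h.conjExp_bracket hA, hAX]
  rw [shiftConj, rbracket_add_right (hasParH_mono hX 1),
    rbracket_mono hX _ (show (1 : ℤ) + 2 = 1 + 2 by norm_num),
    rbracket_mono hX _ (show (1 : ℤ) + 1 = 0 + 2 by norm_num), e, e, h0, h1]
  simp

theorem rbracket_shiftConj_mono (h : LocNil A) (hA : HasPar false A) (hQ : HasPar false Q) {c : Bool}
    {X D : Op m n} (hD : HasPar c D) (hAX : conjExp A X = X) (hQX : comm Q X = 0)
    (h0 : bracket c D X = 0) : rbracket (shiftConj A Q D) (mono 1 X) = 0 := by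
  have h1 : bracket c (comm Q D) X = 0 := by
    have := bracket_comm_right (c := c) hQ D X
    rw [h0, map_zero, hQX] at this
    rw [eq_comm] at this
    simpa [bracket] using this
  have e : ∀ E, bracket c (conjExp A E) X = conjExp A (bracket c E X) := fun E => by
    rw [h.conjExp_bracket hA, hAX]
  rw [shiftConj, rbracket_add_left,
    rbracket_mono (h.hasPar_conjExp hA hD) _ (show (2 : ℤ) + 1 = 1 + 2 by norm_num),
    rbracket_mono (h.hasPar_conjExp hA (hQ.comm hD)) _ (show (1 : ℤ) + 1 = 0 + 2 by norm_num), e, e,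
    h0, h1]
  simp

theorem expConj_expConj (h : LocNil A) {D : Op m n} (hD : comm Q (comm Q D) = 0) :
    (expConj (mono 0 A : Ser m n) (expConj (mono (-1) Q : Ser m n) (mono 2 D : Ser m n)) : HOp m n) =
      shiftConj A Q D := by
  rw [expConj_mono_neg 2 hD, show (2 : ℤ) - 1 = 2 - 1 from rfl]
  exact expConj_mono_add h (b := 2) D (comm Q D)

end ShiftConj

/-! ### The closed family of generators -/

section VopBounds

theorem virOp_mem_fil (k : ℤ) : (virOp k : Op m n) ∈ Fil 3 := by
  have h : ∀ b, psum (virTerm b k : ℤ → Op m n) ∈ Fil 3 := fun b =>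
    psum_mem_fil (pfin_virTerm b k) fun j =>
      Submodule.smul_mem _ _ (nordOp_mem_fil (md_mul_md_mem_fil _ _ _ _))
  refine Submodule.add_mem _ (Submodule.add_mem _ (Submodule.smul_mem _ _ (h _))
    (Submodule.smul_mem _ _ (h _))) ?_
  split_ifs
  · exact Submodule.smul_mem _ _ (by
      have := sc_mem_fil (m := m) (n := n) 1
      rw [map_one] at this
      exact fil_mono (by norm_num) this)
  · exact Submodule.zero_mem _

theorem gOp_mem_fil (k : ℤ) : (gOp k : Op m n) ∈ Fil 3 :=
  psum_mem_fil (pfin_gTerm k) fun _ => Submodule.smul_mem _ _ (md_mul_md_mem_fil _ _ _ _)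

theorem vop_mem_fil (c : Bool) (k : ℤ) : (vop c k : Op m n) ∈ Fil 3 := by
  have h1 : ∀ b, psum (corrTerm b k : ℤ → Op m n) ∈ Fil 3 := fun b =>
    psum_mem_fil (pfin_corrTerm b k) fun j =>
      Submodule.smul_mem _ _ (md_mul_md_mem_fil _ _ _ _)
  have h2 : ∀ b, psum (gCorrTerm b k : ℤ → Op m n) ∈ Fil 3 := fun b =>
    psum_mem_fil (pfin_gCorrTerm b k) fun j =>
      Submodule.smul_mem _ _ (md_mul_md_mem_fil _ _ _ _)
  cases c
  · exact Submodule.add_mem _ (virOp_mem_fil k) (Submodule.add_mem _ (h1 _) (h1 _))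
  · exact Submodule.add_mem _ (gOp_mem_fil k) (Submodule.add_mem _ (h2 _) (h2 _))

theorem vop_one (c : Bool) {k : ℤ} (hk : 0 < k) : (vop c k : Op m n) 1 = 0 := by
  cases c
  · show mOp k 1 = 0
    rw [mOp_one hk.le, if_neg hk.ne']
    simp
  · exact nOp_one hk

theorem apply_md_apply {c : Bool} {k : ℤ} {d : Bool → ℤ → ℂ} {D : Op m n} (hD : IsShift c k d D)
    (b : Bool) (i : ℤ) (f : Pol m n) :
    D (md b i f) = d b i • md (xor b c) (i + k) f + sgn b c • md b i (D f) := by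
  have h := DFunLike.congr_fun (hD.ad_md b i) f
  rw [ad_apply, hD.hasPar b, mul_smul_comm, LinearMap.sub_apply, LinearMap.smul_apply,
    LinearMap.smul_apply, sub_eq_iff_eq_add] at h
  exact h

theorem apply_gp_apply {c : Bool} {k : ℤ} {d : Bool → ℤ → ℂ} {D : Op m n} (hD : IsShift c k d D)
    (f : Pol m n) : D (gp f) = sgn true c • gp (D f) := by
  have h := DFunLike.congr_fun hD.ad_gp f
  rw [ad_apply, hD.hasPar true, mul_smul_comm, LinearMap.sub_apply, LinearMap.smul_apply,
    sub_eq_iff_eq_add, LinearMap.zero_apply, zero_add] at h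
  exact h

/-- For positive index these operators kill `1`, and hence `R`. The shift relation carries the
vanishing for large index from `f` to a mode applied to `f`, and polynomials are generated from `R`
by the modes and `gp`. -/
theorem exists_vop_bound (c : Bool) (f : Pol m n) :
    ∃ N : ℤ, ∀ k, N < k → IsLabel c k → vop c k f = 0 := by
  let W : Submodule ℂ (Pol m n) :=
    { carrier := {f | ∃ N : ℤ, ∀ k, N < k → IsLabel c k → vop c k f = 0}
      zero_mem' := ⟨0, fun k _ _ => map_zero _⟩
      add_mem' := by
        rintro f g ⟨N, hf⟩ ⟨M, hg⟩
        exact ⟨max N M, fun k hk hl => by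
          rw [map_add, hf k (by omega) hl, hg k (by omega) hl, add_zero]⟩
      smul_mem' := by
        rintro z f ⟨N, hf⟩
        exact ⟨N, fun k hk hl => by rw [map_smul, hf k hk hl, smul_zero]⟩ }
  have hmd : ∀ b i, ∀ f ∈ W, md b i f ∈ W := by
    rintro b i f ⟨N, hf⟩
    obtain ⟨M, -, hM⟩ := exists_md_bound (xor b c) f
    refine ⟨max N (M - i), fun k hk hl => ?_⟩
    rw [apply_md_apply (isShift_vop hl), hM _ (by omega), hf k (by omega) hl]
    simp
  have hgp : ∀ f ∈ W, gp f ∈ W := by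
    rintro f ⟨N, hf⟩
    refine ⟨N, fun k hk hl => ?_⟩
    rw [apply_gp_apply (isShift_vop hl), hf k hk hl]
    simp
  have hW : W = ⊤ := by
    refine eq_top_of_coord W ?_ ?_
    · intro r
      refine ⟨0, fun k hk hl => ?_⟩
      have := (isShift_vop (m := m) (n := n) hl).rLin 1 r
      rw [one_mul, vop_one c hk, zero_mul] at this
      exact this
    · intro a f hf
      by_cases ha : a = theta0
      · have ht : (mulOp (coord theta0) : Op m n) = md true 0 + gp := by
          rw [md_true_zero, gp]; module
        have := DFunLike.congr_fun ht f
        rw [ha]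
        rw [show coord theta0 * f = _ from this]
        exact W.add_mem (hmd _ _ f hf) (hgp f hf)
      · obtain ⟨k, z, h⟩ := coord_eq_md (m := m) (n := n) a ha
        rw [show coord a * f = _ from DFunLike.congr_fun h f]
        exact W.smul_mem _ (hmd _ _ f hf)
  have : f ∈ W := by rw [hW]; trivial
  exact this

theorem finite_pnat_le (N : ℤ) : {a : ℕ+ | (a : ℤ) ≤ N}.Finite := by
  refine Set.Finite.of_finite_image (f := fun a : ℕ+ => (a : ℤ))
    ((Set.finite_Icc 0 N).subset ?_) ?_
  · rintro _ ⟨a, ha, rfl⟩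
    exact ⟨by positivity, ha⟩
  · intro a _ a' _ haa
    have : (a : ℤ) = a' := haa
    exact PNat.coe_injective (by exact_mod_cast this)

theorem pfin_label {T : Bool × ℕ+ → Op m n}
    (h : ∀ b f, ∃ N : ℤ, ∀ a : ℕ+, N < a → T (b, a) f = 0) : PFin T := fun f => by
  choose N hN using fun b => h b f
  have : (⋃ b, {b} ×ˢ {a : ℕ+ | (a : ℤ) ≤ N b}).Finite := by
    exact Set.finite_iUnion fun b => (Set.finite_singleton b).prod (finite_pnat_le _)
  refine this.subset ?_
  rintro ⟨b, a⟩ hba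
  rw [Set.mem_iUnion]
  refine ⟨b, rfl, ?_⟩
  by_contra hc
  exact hba (hN b a (by simpa using hc))

end VopBounds

/-! ### The conjugated corrected operators form a closed family -/

section HatGen

/-- The data of the theorem, at `ħ = 1`. -/
structure IsAiryData (t τ : ℤ → Base m n) (B V φ : ℕ → ℕ → Base m n) (s : ℤ) : Prop where
  pol : IsPolarisation B V φ
  dil : IsDilation t τ
  hs : s = 1 ∨ s = 3
  linear : ((omega01 t τ).plus (omega01 t τ).pullSigma).IsBigO 1
  quadratic : (twistedCasimir (boxTimes (omega01 t τ) (omega01 t τ))).IsBigO s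
  isUnit : IsUnit (t s)

/-- The positive modes that are members of the family. -/
def IsMode (b : Bool) (a : ℤ) : Prop := if b then Odd a else Even a

open Classical in
/-- The closed family of generators. -/
def hatGen (t τ : ℤ → Base m n) (B V φ : ℕ → ℕ → Base m n) (s : ℤ) (p : Bool × ℕ+) : Ser m n :=
  if IsMode p.1 p.2 then mono 1 (md p.1 p.2)
  else shiftConj (polOp B V φ) (dilOp t τ) (vop p.1 (p.2 - s))

variable {t τ : ℤ → Base m n} {B V φ : ℕ → ℕ → Base m n} {s : ℤ}

theorem hatGen_of_isMode {b : Bool} {a : ℕ+} (h : IsMode b a) :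
    hatGen t τ B V φ s (b, a) = mono 1 (md b a) := if_pos h

theorem hatGen_of_not_isMode {b : Bool} {a : ℕ+} (h : ¬IsMode b a) :
    hatGen t τ B V φ s (b, a) = shiftConj (polOp B V φ) (dilOp t τ) (vop b (a - s)) := if_neg h

theorem IsAiryData.odd (h : IsAiryData t τ B V φ s) : Odd s := by
  rcases h.hs with h | h <;> rw [h] <;> decide

/-- A corrected operator is labelled by the index `a` of the mode with coefficient `t_s` in its
linear part, so its own index is `a - s`. Since `s ≤ 3` and `a ≥ 1`, respectively `a ≥ 2` for the
odd ones, this stays in the admissible range. -/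
theorem IsAiryData.isLabel (h : IsAiryData t τ B V φ s) {b : Bool} {a : ℤ} (ha : 0 < a)
    (hm : ¬IsMode b a) : IsLabel b (a - s) := by
  have hs := h.hs
  have ho := h.odd
  cases b
  · have h1 : Odd a := by simpa [IsMode] using hm
    exact ⟨h1.sub_odd ho, by omega⟩
  · have h1 : Even a := by simpa [IsMode] using hm
    have h2 := h1.two_dvd
    exact ⟨h1.sub_odd ho, by omega⟩

theorem IsAiryData.dilDer_dilDer_vop (h : IsAiryData t τ B V φ s) {b : Bool} {a : ℤ} (ha : 0 < a)
    (hm : ¬IsMode b a) : dilDer t τ (dilDer t τ (vop b (a - s))) = 0 := by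
  rw [h.dil.dilDer_dilDer_vop (h.isLabel ha hm),
    h.dil.finsum_rowSq h.hs h.linear h.quadratic (h.isLabel ha hm) (by omega), map_zero]

theorem IsAiryData.dilDer_md (h : IsAiryData t τ B V φ s) {b : Bool} {a : ℤ} (ha : 0 < a)
    (hm : IsMode b a) : dilDer t τ (md b a) = 0 := by
  rw [h.dil.dilDer_md]
  cases b
  · have h1 : Even a := hm
    rw [dilVal, if_neg (by simp), t_eq_zero_of_isBigO h.linear (by omega) h1.neg, map_zero]
  · have h1 : Odd a := hm
    rw [dilVal, if_pos rfl, tau_eq_zero_of_isBigO h.linear (by omega) h1.neg, map_zero]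

theorem ad_md_vop_of_isMode {b c : Bool} {a k : ℤ} (hk : IsLabel c k) (hm : IsMode b a) :
    ad b (md b a) (vop c k : Op m n) = 0 := by
  rw [(isShift_vop hk).ad_md]
  have : vShift c k b a = 0 := by
    cases b
    · have h1 : Even a := hm
      have h2 : ¬Odd a := by simpa using h1
      cases c <;> simp [vShift, mShift, nShift, h2]
    · have h1 : Odd a := hm
      have h2 : ¬Even a := by simpa using h1
      cases c <;> simp [vShift, mShift, nShift, h2]
  rw [this, zero_smul]

theorem bracket_vop_md {b c : Bool} {a k : ℤ} (hk : IsLabel c k) (hm : IsMode b a) :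
    bracket c (vop c k : Op m n) (md b a) = 0 := by
  rw [bracket_eq_ad (isShift_vop hk).hasPar (hasPar_md b a), ad_md_vop_of_isMode hk hm]

theorem bracket_md_vop {b c : Bool} {a k : ℤ} (hk : IsLabel c k) (hm : IsMode b a) :
    bracket b (md b a) (vop c k : Op m n) = 0 := by
  rw [bracket_symm (hasPar_md b a) (isShift_vop hk).hasPar, bracket_vop_md hk hm, smul_zero]

theorem bracket_md_md {b c : Bool} {k l : ℤ} (hk : 0 < k) (hl : 0 < l) :
    bracket b (md b k : Op m n) (md c l) = 0 := by
  rw [bracket_eq_ad (hasPar_md b k) (hasPar_md c l), ad_md_md, if_neg (by omega)]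

theorem shiftConj_smul (A Q : Op m n) (z : ℂ) (D : Op m n) :
    shiftConj A Q (z • D) = z • shiftConj A Q D := by
  simp only [shiftConj, map_smul, smul_add]

theorem smul_one_mul_ser (z : ℂ) (X : Ser m n) : mono 0 (z • (1 : Op m n)) * X = z • X := by
  rw [map_smul, smul_mul_assoc, show (mono 0 1 : Ser m n) = 1 from mono_one, one_mul]

theorem PFin.comm {ι : Type} {T : ι → Op m n} (h : PFin T) (Q : Op m n) :
    PFin fun i => SuperAiry.comm Q (T i) := (h.mul_left fun _ => Q).sub (h.mul_right Q)

theorem hfin_mono {ι : Type} {T : ι → Op m n} (h : PFin T) (k : ℤ) : HFin fun i => mono k (T i) :=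
  (summ_mono_psum h).hfin

theorem hfin_shiftConj {ι : Type} {T : ι → Op m n} (h : PFin T) (A Q : Op m n) :
    HFin fun i => shiftConj A Q (T i) :=
  (hfin_mono (h.conjExp A) 2).add (hfin_mono ((h.comm Q).conjExp A) 1)

open Classical in
theorem IsAiryData.pfin_vop (h : IsAiryData t τ B V φ s) : PFin fun p : Bool × ℕ+ =>
    if IsMode p.1 p.2 then (0 : Op m n) else vop p.1 (p.2 - s) := by
  refine pfin_label fun b f => ?_
  obtain ⟨N, hN⟩ := exists_vop_bound b f
  refine ⟨N + s, fun a ha => ?_⟩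
  by_cases hm : IsMode b a
  · simp [hm]
  · simp only [hm, if_false]
    exact hN _ (by omega) (h.isLabel (by positivity) hm)

open Classical in
theorem pfin_modes : PFin fun p : Bool × ℕ+ =>
    if IsMode p.1 p.2 then (md p.1 p.2 : Op m n) else 0 := by
  refine pfin_label fun b f => ?_
  obtain ⟨N, -, hN⟩ := exists_md_bound b f
  refine ⟨N, fun a ha => ?_⟩
  dsimp only
  split_ifs
  · exact hN _ ha
  · rfl

theorem IsAiryData.hasPar_vop (h : IsAiryData t τ B V φ s) {b : Bool} {a : ℕ+} (hm : ¬IsMode b a) :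
    HasPar b (vop b (a - s) : Op m n) := (isShift_vop (h.isLabel (by positivity) hm)).hasPar

theorem IsAiryData.hasParH_hatGen (h : IsAiryData t τ B V φ s) (p : Bool × ℕ+) :
    HasParH p.1 (hatGen t τ B V φ s p) := by
  obtain ⟨b, a⟩ := p
  by_cases hm : IsMode b a
  · rw [hatGen_of_isMode hm]
    exact hasParH_mono (hasPar_md _ _) _
  · rw [hatGen_of_not_isMode hm]
    exact hasParH_shiftConj h.pol.locNil h.pol.hasPar h.dil.hasPar (h.hasPar_vop hm)

theorem IsAiryData.isReesFamily_hatGen (h : IsAiryData t τ B V φ s) :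
    IsReesFamily (hatGen t τ B V φ s) where
  rees := by
    rintro ⟨b, a⟩
    by_cases hm : IsMode b a
    · rw [hatGen_of_isMode hm]
      exact isRees_mono (d := 1) (md_mem_fil _ _)
    · rw [hatGen_of_not_isMode hm]
      exact isRees_shiftConj h.pol.locNil h.pol.hasPar h.pol.mem_fil h.dil.hasPar h.dil.mem_fil
        (h.hasPar_vop hm) (vop_mem_fil _ _)
  hfin := by
    refine ((hfin_mono pfin_modes 1).add
      (hfin_shiftConj h.pfin_vop (polOp B V φ) (dilOp t τ))).congr fun p => ?_
    obtain ⟨b, a⟩ := p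
    by_cases hm : IsMode b a
    · rw [hatGen_of_isMode hm]
      simp [hm, shiftConj]
    · rw [hatGen_of_not_isMode hm]
      simp [hm]

open Classical in
/-- The structure constants of the closed family. -/
def hatConst (s : ℤ) (p q l : Bool × ℕ+) : Ser m n :=
  if ¬IsMode p.1 p.2 ∧ ¬IsMode q.1 q.2 ∧ l.1 = xor p.1 q.1 ∧ (l.2 : ℤ) = p.2 + q.2 - s then
    mono 0 (vConst p.1 q.1 (p.2 - s) (q.2 - s) • (1 : Op m n)) else 0

/-- The family uses only part of the algebra, and a bracket could leave it downwards. Parity and `s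
≤ 3` leave few cases: equal indices of two even operators, or the lowest even with the lowest odd
one for `s = 3`. Their brackets vanish. -/
theorem IsAiryData.vConst_eq_zero (h : IsAiryData t τ B V φ s) {b c : Bool} {k l : ℤ} (hk : 0 < k)
    (hl : 0 < l) (hbk : ¬IsMode b k) (hcl : ¬IsMode c l) (hkl : k + l - s ≤ 0) :
    vConst b c (k - s) (l - s) = 0 := by
  have hs := h.hs
  cases b <;> cases c
  · have : k = l := by
      have h1 : Odd k := by simpa [IsMode] using hbk
      have h2 : Odd l := by simpa [IsMode] using hcl
      obtain ⟨u, rfl⟩ := h1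
      obtain ⟨v, rfl⟩ := h2
      omega
    simp [vConst, this]
  · have h2 : Even l := by simpa [IsMode] using hcl
    have h3 := h2.two_dvd
    -- The actual indices are then `-2` and `-1`, for which `(-2)/2 - (-1) = 0`.
    obtain ⟨rfl, rfl, rfl⟩ : k = 1 ∧ l = 2 ∧ s = 3 := by omega
    norm_num [vConst]
  · have h2 : Even k := by simpa [IsMode] using hbk
    have h3 := h2.two_dvd
    obtain ⟨rfl, rfl, rfl⟩ : k = 2 ∧ l = 1 ∧ s = 3 := by omega
    norm_num [vConst]
  · have h1 : Even k := by simpa [IsMode] using hbk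
    have h2 : Even l := by simpa [IsMode] using hcl
    have h3 := h1.two_dvd
    have h4 := h2.two_dvd
    omega

theorem IsAiryData.not_isMode_add (h : IsAiryData t τ B V φ s) {b c : Bool} {k l : ℤ}
    (hbk : ¬IsMode b k) (hcl : ¬IsMode c l) : ¬IsMode (xor b c) (k + l - s) := by
  have ho := h.odd
  cases b <;> cases c <;> simp only [IsMode, Bool.false_eq_true, if_false, if_true, Int.not_even_iff_odd,
    Int.not_odd_iff_even, Bool.xor_false, Bool.xor_true, Bool.not_false, Bool.not_true] at hbk hcl ⊢
  · exact (hbk.add_odd hcl).sub_odd ho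
  · exact (hbk.add_even hcl).sub_odd ho
  · exact (hbk.add_odd hcl).sub_odd ho
  · exact (hbk.add hcl).sub_odd ho

/-- The modes of the family are fixed by both conjugations and supercommute with each other and with
the corrected operators. Brackets of the conjugated corrected operators follow the super Virasoro
relations, so each has at most one term with a constant coefficient. -/
theorem IsAiryData.isClosedFamily_hatGen (h : IsAiryData t τ B V φ s) :
    IsClosedFamily Prod.fst (hatGen t τ B V φ s) where
  toIsReesFamily := h.isReesFamily_hatGen
  hasPar := h.hasParH_hatGen
  closed := by
    have hrees : ∀ p q l, IsRees (hatConst s p q l : Ser m n) := fun p q l => by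
      rw [hatConst]
      split_ifs
      · refine isRees_mono (d := 0) (Submodule.smul_mem _ _ ?_)
        have := sc_mem_fil (m := m) (n := n) 1
        rwa [map_one] at this
      · exact IsRees.zero
    refine ⟨hatConst s, hrees, ?_, ?_⟩
    · rintro ⟨b, k⟩ ⟨c, l⟩
      have hk0 : (0 : ℤ) < k := by exact_mod_cast k.pos
      have hl0 : (0 : ℤ) < l := by exact_mod_cast l.pos
      have hz : (∀ j, (hatConst s (b, k) (c, l) j : Ser m n) = 0) →
          rbracket (hatGen t τ B V φ s (b, k)) (hatGen t τ B V φ s (c, l)) = 0 →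
          Summ 0 (fun j => hatConst s (b, k) (c, l) j * hatGen t τ B V φ s j)
            (rbracket (hatGen t τ B V φ s (b, k)) (hatGen t τ B V φ s (c, l))) := fun h1 h2 => by
        rw [h2]
        exact (summ_zero 0).congr fun j => by rw [h1, zero_mul]
      by_cases hbk : IsMode b k
      · refine hz (fun j => if_neg fun hc => hc.1 hbk) ?_
        rw [hatGen_of_isMode hbk]
        by_cases hcl : IsMode c l
        · rw [hatGen_of_isMode hcl, rbracket_mono (hasPar_md _ _) _ (show (1 : ℤ) + 1 = 0 + 2 by norm_num),
            bracket_md_md hk0 hl0, map_zero]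
        · rw [hatGen_of_not_isMode hcl]
          exact rbracket_mono_shiftConj h.pol.locNil h.pol.hasPar h.dil.hasPar (hasPar_md _ _)
            (h.pol.conjExp_md _ hk0) (h.dilDer_md hk0 hbk) (bracket_md_vop (h.isLabel hl0 hcl) hbk)
      by_cases hcl : IsMode c l
      · refine hz (fun j => if_neg fun hc => hc.2.1 hcl) ?_
        rw [hatGen_of_isMode hcl, hatGen_of_not_isMode hbk]
        exact rbracket_shiftConj_mono h.pol.locNil h.pol.hasPar h.dil.hasPar (h.hasPar_vop hbk)
          (h.pol.conjExp_md _ hl0) (h.dilDer_md hl0 hcl) (bracket_vop_md (h.isLabel hk0 hbk) hcl)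
      have hbr := bracket_vop (m := m) (n := n) (h.isLabel hk0 hbk) (h.isLabel hl0 hcl)
      rw [show (k : ℤ) - s + (l - s) = (k + l - s) - s by ring] at hbr
      -- The bracket is a multiple of a corrected operator of the family, whose double commutator
      -- vanishes, or its structure constant is zero.
      have hnil : comm (dilOp t τ) (comm (dilOp t τ) (bracket b (vop b (k - s)) (vop c (l - s)))) = 0 := by
        rw [hbr, map_smul, map_smul]
        rcases le_or_gt ((k : ℤ) + l - s) 0 with h0 | h0
        · rw [h.vConst_eq_zero hk0 hl0 hbk hcl h0, zero_smul]
        · rw [show comm (dilOp t τ) (comm (dilOp t τ) (vop (xor b c) ((k : ℤ) + l - s - s))) = 0 from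
            h.dilDer_dilDer_vop h0 (h.not_isMode_add hbk hcl), smul_zero]
      have hrb : rbracket (hatGen t τ B V φ s (b, k)) (hatGen t τ B V φ s (c, l)) =
          vConst b c (k - s) (l - s) •
            shiftConj (polOp B V φ) (dilOp t τ) (vop (xor b c) (k + l - s - s)) := by
        rw [hatGen_of_not_isMode hbk, hatGen_of_not_isMode hcl, rbracket_shiftConj h.pol.locNil
          h.pol.hasPar h.dil.hasPar (h.hasPar_vop hbk) (h.hasPar_vop hcl)
          (h.dilDer_dilDer_vop hk0 hbk) (h.dilDer_dilDer_vop hl0 hcl) hnil, hbr, shiftConj_smul]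
      rcases le_or_gt ((k : ℤ) + l - s) 0 with h0 | h0
      · refine hz (fun j => if_neg fun hc => ?_) ?_
        · have : (0 : ℤ) < j.2 := by exact_mod_cast j.2.pos
          have := hc.2.2.2
          dsimp only at this
          omega
        · rw [hrb, h.vConst_eq_zero hk0 hl0 hbk hcl h0, zero_smul]
      · obtain ⟨a, ha⟩ : ∃ a : ℕ+, (a : ℤ) = k + l - s := by
          refine ⟨⟨((k : ℤ) + l - s).toNat, by omega⟩, ?_⟩
          show ((((k : ℤ) + l - s).toNat : ℕ) : ℤ) = _
          omega
        have hsum := summ_single (m := m) (n := n) (N := 0) (xor b c, a)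
          (T := fun j => hatConst s (b, k) (c, l) j * hatGen t τ B V φ s j)
          (fun j hj => by
            rw [hatConst, if_neg, zero_mul]
            rintro ⟨-, -, h1, h2⟩
            refine hj (Prod.ext h1 (PNat.coe_injective ?_))
            have : (j.2 : ℤ) = a := h2.trans ha.symm
            exact_mod_cast this)
          ((hrees _ _ _).mul (h.isReesFamily_hatGen.rees _)).1
        have hm : ¬IsMode (xor b c) a := by
          rw [ha]; exact h.not_isMode_add hbk hcl
        have e : hatConst s (b, k) (c, l) (xor b c, a) * hatGen t τ B V φ s (xor b c, a) =
            rbracket (hatGen t τ B V φ s (b, k)) (hatGen t τ B V φ s (c, l)) := by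
          rw [hatConst, if_pos ⟨hbk, hcl, rfl, ha⟩, smul_one_mul_ser, hrb, hatGen_of_not_isMode hm, ha]
        rw [← e]
        exact hsum
    -- For a given target label the sum of the two positive indices is fixed, so only finitely many
    -- pairs contribute.
    · intro l
      refine HFin.of_finite ?_
      have hfin : ((Set.univ : Set Bool) ×ˢ {a : ℕ+ | (a : ℤ) ≤ l.2 + s}).Finite :=
        Set.finite_univ.prod (finite_pnat_le _)
      refine (hfin.prod hfin).subset ?_
      rintro ⟨⟨b, k⟩, ⟨c, j⟩⟩ hne
      have hk0 : (0 : ℤ) < k := by exact_mod_cast k.pos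
      have hl0 : (0 : ℤ) < j := by exact_mod_cast j.pos
      by_contra hc
      refine hne (if_neg fun h2 => hc ?_)
      have := h2.2.2.2
      dsimp only at this
      exact ⟨⟨trivial, show (k : ℤ) ≤ _ by omega⟩, ⟨trivial, show (j : ℤ) ≤ _ by omega⟩⟩

end HatGen

/-! ### Comparison with the given collection of generators -/

section Triangular

variable {ι : Type} {H G : ι → Ser m n}

open Classical in
theorem hfin_delta (q : ι) : HFin fun p : ι => (if q = p then (1 : Ser m n) else 0) :=
  HFin.of_finite ((Set.finite_singleton q).subset fun p hp => by
    by_contra hc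
    exact hp (if_neg fun h => hc h.symm))

open Classical in
theorem isRees_delta (p q : ι) : IsRees (if q = p then (1 : Ser m n) else 0) := by
  split_ifs
  · have := sc_mem_fil (m := m) (n := n) 1
    rw [map_one] at this
    exact isRees_mono (d := 0) this
  · exact IsRees.zero

open Classical in
theorem summ_delta (p : ι) (h : IsRees (H p)) :
    Summ 0 (fun q => (if q = p then (1 : Ser m n) else 0) * H q) (H p) := by
  have := summ_single p (N := 0) (T := fun j => (if j = p then (1 : Ser m n) else 0) * H j)
    (fun j hj => by rw [if_neg hj, zero_mul]) (by rw [if_pos rfl, one_mul]; exact h.1)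
  simpa using this

/-- A change of a family by combinations of members which do not change. -/
theorem IsReesFamily.of_triangular (hH : IsReesFamily H) {A : ι → ι → Ser m n}
    (hA : ∀ p q, IsRees (A p q)) (hfin : ∀ q, HFin fun p => A p q)
    (hfix : ∀ p q, G q = H q ∨ A p q = 0)
    (hHG : ∀ p, Summ 0 (fun q => A p q * H q) (H p - G p)) :
    IsReesFamily G ∧ lspan G = lspan H := by
  classical
  have h1 : ∀ p, Summ 0 (fun q => ((if q = p then 1 else 0) - A p q) * H q) (G p) := fun p => by
    have := (summ_delta p (hH.rees p)).sub (hHG p)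
    rw [sub_sub_cancel] at this
    exact this.congr fun q => (sub_mul _ _ _).symm
  have hG := hH.of_combination (N := fun p q => (if q = p then 1 else 0) - A p q)
    (fun p q => (isRees_delta p q).sub (hA p q)) (fun q => (hfin_delta q).sub (hfin q)) h1
  refine ⟨hG, Set.Subset.antisymm (hH.lspan_le (N := fun p q => (if q = p then 1 else 0) - A p q)
    (fun p q => (isRees_delta p q).sub (hA p q)) (fun q => (hfin_delta q).sub (hfin q)) h1)
    (hG.lspan_le (N := fun p q => (if q = p then 1 else 0) + A p q)
    (fun p q => (isRees_delta p q).add (hA p q)) (fun q => (hfin_delta q).add (hfin q)) fun p => ?_)⟩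
  -- `A` only uses members common to both families, so the same combination can be read in terms of
  -- `G`; this yields the inverse change of family.
  have h2 : Summ 0 (fun q => A p q * G q) (H p - G p) := (hHG p).congr fun q => by
    rcases hfix p q with h | h
    · rw [h]
    · rw [h, zero_mul, zero_mul]
  have := (summ_delta p (hG.rees p)).add h2
  rw [add_sub_cancel] at this
  exact this.congr fun q => (add_mul _ _ _).symm

theorem Summ.of_equiv {κ : Type} {N : ℤ} {T : ι → Ser m n} {S : Ser m n} (h : Summ N T S) (e : κ ≃ ι) :
    Summ N (fun k => T (e k)) S where
  lb k := h.lb (e k)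
  hfin := h.hfin.comp_injective e.injective
  coeff_eq k := by
    rw [h.coeff_eq, psum_comp_injective (h.hfin k) e.injective]
    intro i hi
    exact absurd (e.surjective i) hi

theorem lspan_comp_equiv {κ : Type} (e : κ ≃ ι) : lspan (fun k => H (e k)) = lspan H := by
  ext S
  constructor
  · rintro ⟨c, hc, hS⟩
    refine ⟨fun i => c (e.symm i), fun i => hc _, ?_⟩
    exact (hS.of_equiv e.symm).congr fun i => by simp
  · rintro ⟨c, hc, hS⟩
    exact ⟨fun k => c (e k), fun k => hc _, hS.of_equiv e⟩

theorem IsReesFamily.comp_equiv {κ : Type} (hH : IsReesFamily H) (e : κ ≃ ι) :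
    IsReesFamily (fun k => H (e k)) where
  rees k := hH.rees _
  hfin := hH.hfin.comp_injective e.injective

end Triangular

/-! ### From the corrected operators back to the given operators -/

section Generators

/-- The modes `L_k` and `G_k`. -/
def bareOp (c : Bool) (k : ℤ) : Op m n := if c then gOp k else virOp k

/-- The coefficients of the correction of `bareOp`. -/
def cCoeff (c : Bool) (k : ℤ) (b : Bool) (l : ℤ) : ℂ := if c then gCorrCoeff b k l else corrCoeff b k l

/-- The members of the correction of `bareOp`. -/
def cTerm (c : Bool) (k : ℤ) (b : Bool) (l : ℤ) : Op m n :=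
  cCoeff c k b l • (md (xor b c) (k - l) * md b l)

theorem cCoeff_eq_zero {c : Bool} {k : ℤ} {b : Bool} {l : ℤ} (h : ¬(0 < l ∧ IsMode b l)) :
    cCoeff c k b l = 0 := by
  cases c
  · exact if_neg h
  · cases b
    · exact if_neg h
    · exact if_neg fun hc : 0 < l ∧ Odd l ∧ k - l < 0 => h ⟨hc.1, hc.2.1⟩

theorem pfin_cTerm (c : Bool) (k : ℤ) (b : Bool) : PFin (cTerm c k b : ℤ → Op m n) := by
  cases c
  · refine (pfin_corrTerm b k).mono fun i f h => ?_
    rw [cTerm, Bool.xor_false]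
    exact h
  · refine (pfin_gCorrTerm b k).mono fun i f h => ?_
    rw [cTerm, Bool.xor_true]
    exact h

theorem psum_bool {ι : Type} {T : Bool × ι → Op m n} (h : PFin T) :
    psum T = psum (fun i => T (false, i)) + psum (fun i => T (true, i)) := by
  rw [psum_prod h, psum_eq_sum Finset.univ (by simp), Fintype.sum_bool, add_comm]

theorem pfin_bool {ι : Type} {T : Bool × ι → Op m n} (h : ∀ b, PFin fun i => T (b, i)) : PFin T := by
  intro f
  have : (⋃ b, (fun i => (b, i)) '' (Function.support fun i => T (b, i) f)).Finite :=
    Set.finite_iUnion fun b => (h b f).image _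
  refine this.subset ?_
  rintro ⟨b, i⟩ hi
  exact Set.mem_iUnion.2 ⟨b, i, hi, rfl⟩

theorem pnat_cast_injective : Function.Injective fun a : ℕ+ => (a : ℤ) := fun a a' h => by
  have : (a : ℤ) = a' := h
  exact PNat.coe_injective (by exact_mod_cast this)

theorem pfin_cTerm_prod (c : Bool) (k : ℤ) :
    PFin fun q : Bool × ℕ+ => (cTerm c k q.1 q.2 : Op m n) :=
  pfin_bool fun b => (pfin_cTerm c k b).comp_injective pnat_cast_injective

theorem psum_cTerm (c : Bool) (k : ℤ) :
    psum (fun q : Bool × ℕ+ => (cTerm c k q.1 q.2 : Op m n)) = vop c k - bareOp c k := by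
  have h : ∀ b, psum (cTerm c k b : ℤ → Op m n) = psum fun a : ℕ+ => cTerm c k b a := fun b =>
    psum_comp_injective (pfin_cTerm c k b) pnat_cast_injective fun i hi => by
      have : ¬(0 < i ∧ IsMode b i) := fun (hc : 0 < i ∧ IsMode b i) => hi ⟨⟨i.toNat, by have := hc.1; omega⟩, by
        show ((i.toNat : ℕ) : ℤ) = i
        have := hc.1
        omega⟩
      rw [cTerm, cCoeff_eq_zero this, zero_smul]
  rw [psum_bool (pfin_cTerm_prod c k), ← h, ← h]
  cases c
  · have e : ∀ b, (cTerm false k b : ℤ → Op m n) = corrTerm b k := fun b => funext fun l => by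
      rw [cTerm, Bool.xor_false]; rfl
    rw [e, e, vop, bareOp]
    exact (add_sub_cancel_left _ _).symm
  · have e : ∀ b, (cTerm true k b : ℤ → Op m n) = gCorrTerm b k := fun b => funext fun l => by
      rw [cTerm, Bool.xor_true]; rfl
    rw [e, e, vop, bareOp]
    exact (add_sub_cancel_left _ _).symm

open Classical in
/-- The given collection of generators, labelled by the modes. -/
def gen (t τ : ℤ → Base m n) (B V φ : ℕ → ℕ → Base m n) (s : ℤ) (p : Bool × ℕ+) : Ser m n :=
  if IsMode p.1 p.2 then mono 1 (md p.1 p.2)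
  else shiftConj (polOp B V φ) (dilOp t τ) (bareOp p.1 (p.2 - s))

open Classical in
/-- The coefficients of the positive modes in the difference of the two families. -/
def corrMatrix (t τ : ℤ → Base m n) (B V φ : ℕ → ℕ → Base m n) (s : ℤ) (p q : Bool × ℕ+) : Ser m n :=
  (if IsMode p.1 p.2 then 0 else cCoeff p.1 (p.2 - s) q.1 q.2) •
    (mono 1 (conjExp (polOp B V φ) (md (xor q.1 p.1) (p.2 - s - q.2))) +
      mono 0 (sc (dilVal t τ (xor q.1 p.1) (-(p.2 - s - q.2)))))

variable {t τ : ℤ → Base m n} {B V φ : ℕ → ℕ → Base m n} {s : ℤ}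

theorem IsAiryData.dilDer_cTerm (h : IsAiryData t τ B V φ s) (c : Bool) (k : ℤ) (b : Bool) (l : ℤ) :
    dilDer t τ (cTerm c k b l) = cCoeff c k b l • (sc (dilVal t τ (xor b c) (-(k - l))) * md b l) := by
  by_cases hl : 0 < l ∧ IsMode b l
  · rw [cTerm, map_smul, dilDer_mul, h.dil.dilDer_md, h.dilDer_md hl.1 hl.2, mul_zero, add_zero]
  · rw [cTerm, cCoeff_eq_zero hl, zero_smul, zero_smul, map_zero]

theorem IsAiryData.dilDer_dilDer_cTerm (h : IsAiryData t τ B V φ s) (c : Bool) (k : ℤ) (b : Bool)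
    (l : ℤ) : dilDer t τ (dilDer t τ (cTerm c k b l)) = 0 := by
  rw [h.dilDer_cTerm]
  by_cases hl : 0 < l ∧ IsMode b l
  · rw [map_smul, h.dil.dilDer_sc_mul, h.dilDer_md hl.1 hl.2, mul_zero, smul_zero]
  · rw [cCoeff_eq_zero hl, zero_smul, map_zero]

/-- The correction ends in a mode killed by the derivation, so one commutator already removes its
other factor and the second gives zero. Thus the series for conjugation by `T` also stops after two
terms on the given operators. -/
theorem IsAiryData.dilDer_dilDer_bareOp (h : IsAiryData t τ B V φ s) {b : Bool} {a : ℤ} (ha : 0 < a)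
    (hm : ¬IsMode b a) : dilDer t τ (dilDer t τ (bareOp b (a - s))) = 0 := by
  have e : (bareOp b (a - s) : Op m n) = vop b (a - s) -
      psum fun q : Bool × ℕ+ => cTerm b (a - s) q.1 q.2 := by
    rw [psum_cTerm, sub_sub_cancel]
  have hp := pfin_cTerm_prod (m := m) (n := n) b (a - s)
  rw [e, map_sub, map_sub, h.dilDer_dilDer_vop ha hm, dilDer_psum hp,
    dilDer_psum (T := fun q : Bool × ℕ+ => dilDer t τ (cTerm b (a - s) q.1 q.2)) (hp.comm _),
    psum_congr fun q => h.dilDer_dilDer_cTerm _ _ _ _, psum_zero, sub_zero]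

theorem IsAiryData.isRees_corrMatrix (h : IsAiryData t τ B V φ s) (p q : Bool × ℕ+) :
    IsRees (corrMatrix t τ B V φ s p q) :=
  ((isRees_mono (d := 1) (h.pol.locNil.conjExp_mem_fil h.pol.hasPar h.pol.mem_fil
    (md_mem_fil _ _))).add (isRees_mono (d := 0) (sc_mem_fil _))).smul _

/-- For a fixed column, large row labels produce modes of large positive index and scalars `t`, `τ`
of large negative index; the former vanish on a given polynomial and the latter vanish identically.
-/
theorem IsAiryData.hfin_corrMatrix (h : IsAiryData t τ B V φ s) (q : Bool × ℕ+) :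
    HFin fun p => corrMatrix t τ B V φ s p q := by
  refine HFin.smul ((hfin_mono (PFin.conjExp ?_ _) 1).add (hfin_mono ?_ 0)) _
  · refine pfin_label fun c f => ?_
    obtain ⟨N, -, hN⟩ := exists_md_bound (xor q.1 c) f
    exact ⟨N + s + q.2, fun a ha => hN _ (by dsimp only; omega)⟩
  · refine pfin_label fun c f => ?_
    obtain ⟨N, hN⟩ := h.dil.bdd
    refine ⟨s + q.2 - N, fun a ha => ?_⟩
    have h1 := hN (-((a : ℤ) - s - q.2)) (by omega)
    have h2 : ∀ b, dilVal t τ b (-((a : ℤ) - s - q.2)) = 0 := fun b => by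
      cases b
      · exact h1.1
      · exact h1.2
    dsimp only
    rw [h2, map_zero, LinearMap.zero_apply]

/-- The right factor of each correction term is a mode fixed by `T` and `Φ`. It remains on the right
after conjugation, and the conjugated left factor becomes the coefficient. -/
theorem IsAiryData.summ_corrMatrix (h : IsAiryData t τ B V φ s) (p : Bool × ℕ+) :
    Summ 0 (fun q => corrMatrix t τ B V φ s p q * hatGen t τ B V φ s q)
      (hatGen t τ B V φ s p - gen t τ B V φ s p) := by
  obtain ⟨c, a⟩ := p
  by_cases hm : IsMode c a
  · rw [hatGen_of_isMode hm, gen, if_pos hm, sub_self]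
    exact (summ_zero 0).congr fun q => by simp [corrMatrix, hm]
  · have hp := pfin_cTerm_prod (m := m) (n := n) c (a - s)
    have h1 := (summ_mono_psum (k := 2) (hp.conjExp (polOp B V φ))).of_le (show (0 : ℤ) ≤ 2 by norm_num)
    have h2 := (summ_mono_psum (k := 1) ((hp.comm (dilOp t τ)).conjExp (polOp B V φ))).of_le
      (show (0 : ℤ) ≤ 1 by norm_num)
    have h3 : hatGen t τ B V φ s (c, a) - gen t τ B V φ s (c, a) =
        mono 2 (psum fun q : Bool × ℕ+ => conjExp (polOp B V φ) (cTerm c (a - s) q.1 q.2)) +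
        mono 1 (psum fun q : Bool × ℕ+ =>
          conjExp (polOp B V φ) (comm (dilOp t τ) (cTerm c (a - s) q.1 q.2))) := by
      rw [hatGen_of_not_isMode hm, gen, if_neg hm, ← conjExp_psum hp, ← conjExp_psum (hp.comm _)]
      have e := dilDer_psum (t := t) (τ := τ) hp
      rw [dilDer] at e
      rw [← e, psum_cTerm, shiftConj, shiftConj, map_sub, map_sub, map_sub, map_sub, map_sub]
      abel
    rw [h3]
    refine (h1.add h2).congr fun q => ?_
    obtain ⟨b, l⟩ := q
    have hl0 : (0 : ℤ) < l := by exact_mod_cast l.pos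
    have e := h.dilDer_cTerm c (a - s) b l
    rw [dilDer] at e
    dsimp only
    rw [e, corrMatrix, if_neg hm]
    by_cases hl : IsMode b l
    · have e2 : ∀ (z : ℂ) (r : Base m n) (X : Op m n),
          conjExp (polOp B V φ) (z • (sc r * X)) = z • (sc r * conjExp (polOp B V φ) X) :=
        fun z r X => by rw [map_smul, h.pol.conjExp_sc_mul]
      rw [e2, hatGen_of_isMode hl, cTerm, (conjExp (polOp B V φ)).map_smul,
        h.pol.locNil.conjExp_mul, h.pol.conjExp_md b hl0, map_smul, map_smul, ← smul_add,
        smul_mul_assoc, add_mul, mono_mul_mono, mono_mul_mono]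
      rfl
    · have : cCoeff c ((a : ℤ) - s) b l = 0 := cCoeff_eq_zero fun hc => hl hc.2
      rw [cTerm, this]
      simp

theorem IsAiryData.isReesFamily_gen (h : IsAiryData t τ B V φ s) :
    IsReesFamily (gen t τ B V φ s) ∧ lspan (gen t τ B V φ s) = lspan (hatGen t τ B V φ s) := by
  refine h.isReesFamily_hatGen.of_triangular h.isRees_corrMatrix h.hfin_corrMatrix ?_ h.summ_corrMatrix
  rintro p ⟨b, l⟩
  by_cases hl : IsMode b l
  · left
    rw [hatGen_of_isMode hl, gen, if_pos hl]
  · right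
    rw [corrMatrix, cCoeff_eq_zero fun hc => hl hc.2]
    simp

/-- The positive integer `2 j - 1`. -/
def pnatOdd (j : ℕ+) : ℕ+ := ⟨2 * j - 1, by have := j.pos; omega⟩

theorem pnatOdd_cast (j : ℕ+) : ((pnatOdd j : ℕ+) : ℤ) = 2 * j - 1 := by
  show ((2 * (j : ℕ) - 1 : ℕ) : ℤ) = _
  have := j.pos
  omega

theorem pnat_two_mul_cast (j : ℕ+) : ((2 * j : ℕ+) : ℤ) = 2 * j := by push_cast; ring

/-- The labels of the given collection. -/
def genLabel : Fin 4 × ℕ+ → Bool × ℕ+ := fun i =>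
  ![(false, 2 * i.2), (true, pnatOdd i.2), (false, pnatOdd i.2), (true, 2 * i.2)] i.1

theorem genLabel_injective : Function.Injective genLabel := by
  rintro ⟨i, j⟩ ⟨i', j'⟩ h
  have h1 : (genLabel (i, j)).1 = (genLabel (i', j')).1 := by rw [h]
  have h2 : ((genLabel (i, j)).2 : ℤ) = (genLabel (i', j')).2 := by rw [h]
  have key : i = i' ∧ (j : ℤ) = j' := by
    fin_cases i <;> fin_cases i' <;>
      simp [genLabel, pnatOdd_cast] at h1 h2 ⊢ <;> omega
  exact Prod.ext key.1 (pnat_cast_injective key.2)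

theorem genLabel_surjective : Function.Surjective genLabel := by
  rintro ⟨b, a⟩
  have ha := a.pos
  rcases Nat.even_or_odd' (a : ℕ) with ⟨k, hk | hk⟩
  · obtain ⟨j, hj⟩ : ∃ j : ℕ+, (j : ℕ) = k := ⟨⟨k, by omega⟩, rfl⟩
    have e : 2 * j = a := PNat.coe_injective (by rw [PNat.mul_coe, hj, hk]; rfl)
    cases b
    · exact ⟨(0, j), Prod.ext rfl e⟩
    · exact ⟨(3, j), Prod.ext rfl e⟩
  · have e : pnatOdd ⟨k + 1, by omega⟩ = a := PNat.coe_injective (by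
      show 2 * (k + 1) - 1 = (a : ℕ)
      omega)
    cases b
    · exact ⟨(2, ⟨k + 1, by omega⟩), Prod.ext rfl e⟩
    · exact ⟨(1, ⟨k + 1, by omega⟩), Prod.ext rfl e⟩

/-- The labels of the given collection. -/
def genEquiv : Fin 4 × ℕ+ ≃ Bool × ℕ+ :=
  Equiv.ofBijective genLabel ⟨genLabel_injective, genLabel_surjective⟩

theorem IsAiryData.expConj_bareOp (h : IsAiryData t τ B V φ s) {b : Bool} {a : ℤ} (ha : 0 < a)
    (hm : ¬IsMode b a) : (expConj (logPhi B V φ) (expConj (logT t τ)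
      (mono 2 (bareOp b (a - s)) : Ser m n)) : HOp m n) =
    shiftConj (polOp B V φ) (dilOp t τ) (bareOp b (a - s)) := by
  rw [logPhi_eq h.pol, logT_eq h.dil]
  exact expConj_expConj h.pol.locNil (h.dilDer_dilDer_bareOp ha hm)

/-- The indices match since `2j - s - 1 = (2j - 1) - s` for the even operators and `2j - s` for the
odd ones. -/
theorem IsAiryData.generators_eq (h : IsAiryData t τ B V φ s) (i : Fin 4 × ℕ+) :
    (generators t τ B V φ s i : HOp m n) = gen t τ B V φ s (genEquiv i) := by
  obtain ⟨i, j⟩ := i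
  have hj : (0 : ℤ) < j := by exact_mod_cast j.pos
  have e1 := pnat_two_mul_cast j
  have e2 := pnatOdd_cast j
  fin_cases i
  · show J (2 * (j : ℤ)) = gen t τ B V φ s (false, 2 * j)
    have ho : IsMode false (2 * j : ℕ+) := by rw [e1]; exact even_two_mul _
    rw [gen, if_pos ho, J_eq, ← e1]
  · show Gam (2 * (j : ℤ) - 1) = gen t τ B V φ s (true, pnatOdd j)
    have ho : IsMode true (pnatOdd j) := by rw [e2]; exact (even_two_mul _).sub_odd odd_one
    rw [gen, if_pos ho, Gam_eq, ← e2]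
  · show expConj (logPhi B V φ) (expConj (logT t τ) (Lvir (2 * (j : ℤ) - s - 1))) =
      gen t τ B V φ s (false, pnatOdd j)
    have ho : ¬IsMode false (pnatOdd j) := by
      rw [e2]
      simp only [IsMode, Bool.false_eq_true, if_false, Int.not_even_iff_odd]
      exact (even_two_mul _).sub_odd odd_one
    rw [gen, if_neg ho]
    rw [← h.expConj_bareOp (by omega) ho, Lvir_eq,
      show 2 * (j : ℤ) - s - 1 = (pnatOdd j : ℤ) - s by rw [e2]; ring]
    rfl
  · show expConj (logPhi B V φ) (expConj (logT t τ) (Gvir (2 * (j : ℤ) - s))) =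
      gen t τ B V φ s (true, 2 * j)
    have ho : ¬IsMode true (2 * j : ℕ+) := by
      rw [e1]
      simp only [IsMode, if_true, Int.not_odd_iff_even]
      exact even_two_mul _
    rw [gen, if_neg ho]
    rw [← h.expConj_bareOp (by omega) ho, Gvir_eq, ← e1]
    rfl

end Generators

/-! ### The filtration of the base ring by the powers of the odd generators -/

section OddFilt

theorem isOdd_oddGen {E O : Type} (o : O) : IsOdd (oddGen o : SuperPoly E O) := by
  rw [IsOdd, parity_oddGen]

/-- The `j`-th power of the ideal generated by the odd generators. -/
def oddFilt (m n j : ℕ) : Submodule ℂ (Base m n) := Submodule.span ℂ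
  {x | ∃ (r : Base m n) (l : List (Fin n)), j ≤ l.length ∧ x = r * (l.map oddGen).prod}

theorem mul_mem_oddFilt_left {j : ℕ} (r : Base m n) {x : Base m n} (hx : x ∈ oddFilt m n j) :
    r * x ∈ oddFilt m n j := by
  have : oddFilt m n j ≤ (oddFilt m n j).comap (LinearMap.mulLeft ℂ r) := Submodule.span_le.2 (by
    rintro _ ⟨r', l, hl, rfl⟩
    exact Submodule.subset_span ⟨r * r', l, hl, (mul_assoc _ _ _).symm⟩)
  exact this hx

theorem prod_oddGen_mul (l : List (Fin n)) (r : Base m n) :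
    ∃ r', (l.map oddGen).prod * r = r' * (l.map oddGen).prod := by
  induction l with
  | nil => exact ⟨r, by simp⟩
  | cons o l ih =>
    obtain ⟨r', h⟩ := ih
    exact ⟨parity r', by rw [List.map_cons, List.prod_cons, mul_assoc, h, ← mul_assoc,
      oddGen_mul_comm, mul_assoc]⟩

theorem mul_mem_oddFilt {i j : ℕ} {x y : Base m n} (hx : x ∈ oddFilt m n i)
    (hy : y ∈ oddFilt m n j) : x * y ∈ oddFilt m n (i + j) := by
  have h1 : oddFilt m n i ≤ (oddFilt m n (i + j)).comap (LinearMap.mulRight ℂ y) :=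
    Submodule.span_le.2 (by
      rintro _ ⟨r, l, hl, rfl⟩
      have h2 : oddFilt m n j ≤ (oddFilt m n (i + j)).comap
          (LinearMap.mulLeft ℂ (r * (l.map oddGen).prod)) := Submodule.span_le.2 (by
        rintro _ ⟨r', l', hl', rfl⟩
        obtain ⟨r'', h⟩ := prod_oddGen_mul l r'
        refine Submodule.subset_span ⟨r * r'', l ++ l', ?_, ?_⟩
        · rw [List.length_append]; omega
        · rw [LinearMap.mulLeft_apply, List.map_append, List.prod_append, mul_assoc, ← mul_assoc _ r',
            h]
          simp only [mul_assoc])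
      exact h2 hy)
  exact h1 hx

theorem mem_oddFilt_zero (x : Base m n) : x ∈ oddFilt m n 0 :=
  Submodule.subset_span ⟨x, [], le_rfl, by simp⟩

theorem mul_mem_oddFilt_right {j : ℕ} {x : Base m n} (hx : x ∈ oddFilt m n j) (r : Base m n) :
    x * r ∈ oddFilt m n j := by
  have := mul_mem_oddFilt hx (mem_oddFilt_zero r)
  rwa [add_zero] at this

theorem oddGen_mul_prod_eq_zero {o : Fin n} {l : List (Fin n)} (h : o ∈ l) :
    (oddGen o * (l.map oddGen).prod : Base m n) = 0 := by
  induction l with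
  | nil => simp at h
  | cons b l ih =>
    rw [List.map_cons, List.prod_cons, ← mul_assoc]
    rcases List.mem_cons.1 h with rfl | h
    · rw [(isOdd_oddGen o).mul_self, zero_mul]
    · rw [(isOdd_oddGen o).mul_anticomm (isOdd_oddGen b), neg_mul, mul_assoc, ih h, mul_zero, neg_zero]

theorem prod_oddGen_eq_zero {l : List (Fin n)} (h : ¬l.Nodup) :
    ((l.map oddGen).prod : Base m n) = 0 := by
  induction l with
  | nil => simp at h
  | cons b l ih =>
    rw [List.map_cons, List.prod_cons]
    by_cases hb : b ∈ l
    · exact oddGen_mul_prod_eq_zero hb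
    · rw [ih fun hl => h (List.nodup_cons.2 ⟨hb, hl⟩), mul_zero]

/-- Among `n + 1` factors one odd generator is repeated, and odd generators anticommute and square
to zero. -/
theorem eq_zero_of_mem_oddFilt {x : Base m n} (hx : x ∈ oddFilt m n (n + 1)) : x = 0 := by
  have : oddFilt m n (n + 1) ≤ ⊥ := Submodule.span_le.2 (by
    rintro _ ⟨r, l, hl, rfl⟩
    rw [prod_oddGen_eq_zero fun h => ?_, mul_zero]
    · exact Submodule.zero_mem _
    · have := h.length_le_card
      rw [Fintype.card_fin] at this
      omega)
  exact (Submodule.mem_bot ℂ).1 (this hx)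

theorem isNilpotent_of_mem_oddFilt {x : Base m n} (hx : x ∈ oddFilt m n 1) : IsNilpotent x := by
  have : ∀ k, x ^ k ∈ oddFilt m n k := fun k => by
    induction k with
    | zero => exact mem_oddFilt_zero _
    | succ k ih => rw [pow_succ]; exact mul_mem_oddFilt ih hx
  exact ⟨n + 1, eq_zero_of_mem_oddFilt (this _)⟩

/-- The quotient by the ideal generated by the odd generators. -/
def body : Base m n →ₐ[ℂ] MvPolynomial (Fin m) ℂ :=
  ((Algebra.TensorProduct.rid ℂ ℂ (MvPolynomial (Fin m) ℂ)).toAlgHom.comp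
    (Algebra.TensorProduct.map (AlgHom.id ℂ _) ExteriorAlgebra.algebraMapInv) :
    MvPolynomial (Fin m) ℂ ⊗[ℂ] ExteriorAlgebra ℂ (Fin n →₀ ℂ) →ₐ[ℂ] MvPolynomial (Fin m) ℂ)

/-- The inclusion of the polynomials in the even generators. -/
def ofBody : MvPolynomial (Fin m) ℂ →ₐ[ℂ] Base m n :=
  (Algebra.TensorProduct.includeLeft :
    MvPolynomial (Fin m) ℂ →ₐ[ℂ] MvPolynomial (Fin m) ℂ ⊗[ℂ] ExteriorAlgebra ℂ (Fin n →₀ ℂ))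

theorem body_tmul (p : MvPolynomial (Fin m) ℂ) (q : ExteriorAlgebra ℂ (Fin n →₀ ℂ)) :
    body (SuperPoly.tmul p q) = ExteriorAlgebra.algebraMapInv q • p := rfl

theorem body_evenGen (e : Fin m) : body (evenGen e : Base m n) = MvPolynomial.X e := by
  rw [evenGen_eq, body_tmul, map_one, one_smul]

theorem body_oddGen (o : Fin n) : body (oddGen o : Base m n) = 0 := by
  rw [oddGen_eq, body_tmul]
  simp [ExteriorAlgebra.algebraMapInv]

theorem ofBody_X (e : Fin m) : (ofBody (MvPolynomial.X e) : Base m n) = evenGen e := rfl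

theorem sub_ofBody_body_mem (r : Base m n) : r - ofBody (body r) ∈ oddFilt m n 1 := by
  let W : Submodule ℂ (Base m n) := (oddFilt m n 1).comap
    (LinearMap.id - (ofBody.comp body : Base m n →ₐ[ℂ] Base m n).toLinearMap)
  have hW : W = ⊤ := by
    refine SuperPoly.eq_top_of_gen W ?_ ?_ ?_
    · show (1 : Base m n) - ofBody (body 1) ∈ oddFilt m n 1
      rw [map_one, map_one, sub_self]
      exact Submodule.zero_mem _
    · intro e f hf
      show evenGen e * f - ofBody (body (evenGen e * f)) ∈ oddFilt m n 1
      rw [map_mul, map_mul, body_evenGen, ofBody_X, ← mul_sub]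
      exact mul_mem_oddFilt_left _ hf
    · intro o f _
      show oddGen o * f - ofBody (body (oddGen o * f)) ∈ oddFilt m n 1
      rw [map_mul, body_oddGen, zero_mul, map_zero, sub_zero]
      exact mul_mem_oddFilt_right (Submodule.subset_span ⟨1, [o], le_rfl, by simp⟩) f
  have : r ∈ W := by rw [hW]; trivial
  exact this

theorem mem_oddFilt_of_body {r : Base m n} (h : body r = 0) : r ∈ oddFilt m n 1 := by
  have := sub_ofBody_body_mem r
  rwa [h, map_zero, sub_zero] at this

/-- The parity involution becomes trivial after the odd generators are set to zero, so the image of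
an odd element equals its negative. -/
theorem IsOdd.body_eq_zero {r : Base m n} (h : IsOdd r) : body r = 0 := by
  have h1 : (body.comp parity : Base m n →ₐ[ℂ] _) = body := by
    refine SuperPoly.algHom_ext ?_ ?_ <;> intro e
    · rw [AlgHom.comp_apply, parity_evenGen]
    · rw [AlgHom.comp_apply, parity_oddGen, map_neg, body_oddGen, neg_zero]
  have h2 := DFunLike.congr_fun h1 r
  rw [AlgHom.comp_apply, show parity r = -r from h, map_neg, neg_eq_iff_add_eq_zero, ← two_smul ℂ,
    smul_eq_zero] at h2
  exact h2.resolve_left two_ne_zero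

theorem IsOdd.mem_oddFilt {r : Base m n} (h : IsOdd r) : r ∈ oddFilt m n 1 :=
  mem_oddFilt_of_body h.body_eq_zero

variable {t τ : ℤ → Base m n} {B V φ : ℕ → ℕ → Base m n} {s : ℤ}

/-- The odd coefficients below the leading one are nilpotent. -/
theorem IsAiryData.body_t_eq_zero (h : IsAiryData t τ B V φ s) {i : ℤ} (hi : i < s) (ho : Odd i) :
    body (t i) = 0 := by
  obtain ⟨N, hN⟩ := h.dil.bdd
  have key : ∀ d : ℕ, ∀ i : ℤ, i < N + d → i < s → Odd i → body (t i) = 0 := by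
    intro d
    induction d with
    | zero => intro i hiN _ _; rw [(hN i (by simpa using hiN)).1, map_zero]
    | succ d ih =>
      intro i hiN hi ho
      have hs := h.hs
      have hso := h.odd
      -- For `s = 1` an odd `i < s` is negative, for `s = 3` it is at most one.
      have h2 : 2 * i < s := by
        obtain ⟨u, rfl⟩ := ho
        omega
      -- Modulo nilpotents the vanishing of the double commutator at index `-2i` reads `∑ t_j
      -- t_{2i-j} = 0` over odd `j`. If `j ≠ i`, one of the indices is below `i` and its factor is
      -- zero by induction; the remaining `t_i²` is the square of an element of a domain.
      have hlab : IsLabel false (-(2 * i)) := ⟨(even_two_mul i).neg, by omega⟩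
      have h3 := congrArg body (h.dil.finsum_rowSq h.hs h.linear h.quadratic hlab (by omega))
      rw [map_zero, map_finsum _ (h.dil.finite_rowSq false (-(2 * i)))] at h3
      have h4 : ∀ j, j ≠ i → body (rowSq t τ false (-(2 * i)) j) = 0 := fun j hj => by
        rw [rowSq, map_add, map_mul, map_mul, Bool.not_false, dilVal, dilVal, if_neg (by simp),
          if_pos rfl, (h.dil.odd_τ _).body_eq_zero, mul_zero, add_zero, rowT]
        split_ifs with hjo
        · rcases lt_or_gt_of_ne hj with hlt | hlt
          · rw [ih j (by push_cast at hiN; omega) (by omega) hjo, zero_mul]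
          · rw [ih (-(j + -(2 * i))) (by push_cast at hiN; omega) (by omega)
              (hjo.add_even (even_two_mul i).neg).neg, mul_zero]
        · rw [map_zero, zero_mul]
      rw [finsum_eq_single _ i h4, rowSq, map_add, map_mul, map_mul, Bool.not_false, dilVal, dilVal,
        if_neg (by simp), if_pos rfl, (h.dil.odd_τ _).body_eq_zero, mul_zero, add_zero, rowT,
        if_pos ho, show -(i + -(2 * i)) = i by ring, mul_self_eq_zero] at h3
      exact h3
  exact key (i + 1 - N).toNat i (by omega) hi ho

end OddFilt

/-! ### Inversion of column-finite matrices -/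

section ColMap

variable {K : Type}

/-- Multiplication of a column from the right by scalars. -/
def colMul (v : K →₀ Base m n) : Base m n →ₗ[ℂ] K →₀ Base m n where
  toFun r := v.mapRange (· * r) (zero_mul r)
  map_add' r r' := Finsupp.ext fun p => by simp [mul_add]
  map_smul' z r := Finsupp.ext fun p => by simp

theorem colMul_apply (v : K →₀ Base m n) (r : Base m n) (p : K) : colMul v r p = v p * r := by
  simp [colMul]

/-- The operator on columns with the matrix whose columns are `C`. -/
def colMap (C : K → K →₀ Base m n) : (K →₀ Base m n) →ₗ[ℂ] K →₀ Base m n :=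
  Finsupp.lsum ℂ fun q => colMul (C q)

theorem colMap_apply (C : K → K →₀ Base m n) (v : K →₀ Base m n) (p : K) :
    colMap C v p = ∑ q ∈ v.support, C q p * v q := by
  rw [colMap, Finsupp.lsum_apply, Finsupp.sum, Finsupp.finsetSum_apply]
  simp only [colMul_apply]

theorem colMap_single (C : K → K →₀ Base m n) (q : K) (r : Base m n) :
    colMap C (Finsupp.single q r) = colMul (C q) r := by
  rw [colMap, Finsupp.lsum_single]

theorem colMap_colMul (C : K → K →₀ Base m n) (v : K →₀ Base m n) (r : Base m n) :
    colMap C (colMul v r) = colMul (colMap C v) r := by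
  classical
  have hsub : (colMul v r).support ⊆ v.support := fun q hq => by
    rw [Finsupp.mem_support_iff, colMul_apply] at hq
    exact Finsupp.mem_support_iff.2 fun h => hq (by rw [h, zero_mul])
  refine Finsupp.ext fun p => ?_
  rw [colMul_apply, colMap_apply, colMap_apply, Finset.sum_mul]
  refine Finset.sum_subset_zero_on_sdiff hsub (fun q hq => ?_) fun q _ => by
    rw [colMul_apply, mul_assoc]
  rw [Finset.mem_sdiff, Finsupp.notMem_support_iff, colMul_apply] at hq
  rw [mul_assoc, hq.2, mul_zero]

theorem colMul_one (v : K →₀ Base m n) : colMul v 1 = v :=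
  Finsupp.ext fun p => by rw [colMul_apply, mul_one]

theorem colMap_mem_oddFilt {C : K → K →₀ Base m n} {v : K →₀ Base m n} {j : ℕ}
    (hv : ∀ q, v q ∈ oddFilt m n j) (p : K) : colMap C v p ∈ oddFilt m n j := by
  rw [colMap_apply]
  exact Submodule.sum_mem _ fun q _ => mul_mem_oddFilt_left _ (hv q)

open Classical in
/-- The matrix is unitriangular with respect to a weight, up to nilpotent entries. -/
def IsUnitriangular (w : K → ℕ) (C : K → K →₀ Base m n) : Prop :=
  ∀ p q, ¬w p < w q → C q p - (if p = q then 1 else 0) ∈ oddFilt m n 1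

variable {w : K → ℕ} {C : K → K →₀ Base m n}

open Classical in
theorem colMap_sub_apply (C : K → K →₀ Base m n) (v : K →₀ Base m n) (p : K) :
    (colMap C - LinearMap.id : Module.End ℂ (K →₀ Base m n)) v p = ∑ q ∈ v.support, (C q p - if p = q then 1 else 0) * v q := by
  rw [LinearMap.sub_apply, Finsupp.sub_apply, colMap_apply]
  simp only [sub_mul, ite_mul, one_mul, zero_mul, Finset.sum_sub_distrib, LinearMap.id_apply,
    Finset.sum_ite_eq]
  by_cases hp : p ∈ v.support
  · rw [if_pos hp]
  · rw [if_neg hp, Finsupp.notMem_support_iff.1 hp]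

/-- Each application of `C - 1` either lowers the weight or gains a power of the nilpotent ideal.
The support of a column is finite, so after finitely many steps all entries gain a power, and the
power `n + 1` of the ideal is zero. -/
theorem IsUnitriangular.exists_pow_eq_zero (h : IsUnitriangular w C) (v : K →₀ Base m n) :
    ∃ k, ((colMap C - LinearMap.id : Module.End ℂ (K →₀ Base m n)) ^ k) v = 0 := by
  classical
  have outer : ∀ d j, j + d = n + 1 → ∀ v : K →₀ Base m n, (∀ q, v q ∈ oddFilt m n j) →
      ∃ k, ((colMap C - LinearMap.id : Module.End ℂ (K →₀ Base m n)) ^ k) v = 0 := by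
    intro d
    induction d with
    | zero =>
      intro j hj v hv
      rw [add_zero] at hj
      subst hj
      exact ⟨0, Finsupp.ext fun q => eq_zero_of_mem_oddFilt (hv q)⟩
    | succ d ih =>
      intro j hj v hv
      -- Induction on a weight from which on the entries already lie in the next power of the ideal.
      have inner : ∀ N, ∀ v : K →₀ Base m n, (∀ q, v q ∈ oddFilt m n j) →
          (∀ q, N ≤ w q → v q ∈ oddFilt m n (j + 1)) →
          ∃ k, ((colMap C - LinearMap.id : Module.End ℂ (K →₀ Base m n)) ^ k) v = 0 := by
        intro N
        induction N with
        | zero => intro v _ hv1; exact ih (j + 1) (by omega) v fun q => hv1 q (Nat.zero_le _)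
        | succ N ihN =>
          intro v hv hv1
          obtain ⟨k, hk⟩ := ihN ((colMap C - LinearMap.id : Module.End ℂ (K →₀ Base m n)) v)
            (fun p => by
              rw [colMap_sub_apply]
              exact Submodule.sum_mem _ fun q _ => mul_mem_oddFilt_left _ (hv q))
            (fun p hp => by
              rw [colMap_sub_apply]
              refine Submodule.sum_mem _ fun q _ => ?_
              by_cases hw : w p < w q
              · exact mul_mem_oddFilt_left _ (hv1 q (by omega))
              · rw [add_comm]
                exact mul_mem_oddFilt (h p q hw) (hv q))
          exact ⟨k + 1, by rw [pow_succ, Module.End.mul_apply]; exact hk⟩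
      refine inner (v.support.sup w + 1) v hv fun q hq => ?_
      by_cases hqs : q ∈ v.support
      · have := Finset.le_sup (f := w) hqs
        omega
      · rw [Finsupp.notMem_support_iff.1 hqs]
        exact Submodule.zero_mem _
  exact outer (n + 1) 0 (by omega) v fun q => mem_oddFilt_zero _

/-- With `E = C - 1` locally nilpotent, `E v = -v` forces `v = 0`, and preimages are found
recursively from `v = C v - E v`. -/
theorem IsUnitriangular.bijective (h : IsUnitriangular w C) : Function.Bijective (colMap C) := by
  set E : Module.End ℂ (K →₀ Base m n) := colMap C - LinearMap.id with hE
  have hC : ∀ v, colMap C v = E v + v := fun v => by simp [hE]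
  constructor
  · refine (injective_iff_map_eq_zero _).2 fun v hv => ?_
    rw [hC, add_eq_zero_iff_eq_neg] at hv
    have : ∀ k, (E ^ k) v = ((-1 : ℂ) ^ k) • v := fun k => by
      induction k with
      | zero => simp
      | succ k ih => rw [pow_succ, Module.End.mul_apply, hv, map_neg, ih, pow_succ]; simp
    obtain ⟨k, hk⟩ := h.exists_pow_eq_zero v
    rw [this, smul_eq_zero] at hk
    exact hk.resolve_left (pow_ne_zero _ (by norm_num))
  · have : ∀ k v, (E ^ k) v = 0 → ∃ u, colMap C u = v := by
      intro k
      induction k with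
      | zero => intro v hv; exact ⟨0, by rw [map_zero]; exact hv.symm⟩
      | succ k ih =>
        intro v hv
        rw [pow_succ, Module.End.mul_apply] at hv
        obtain ⟨u, hu⟩ := ih _ hv
        exact ⟨v - u, by rw [map_sub, hu, hC]; abel⟩
    intro v
    obtain ⟨k, hk⟩ := h.exists_pow_eq_zero v
    exact this k v hk

/-- The columns of the inverse are the preimages of the unit vectors. They determine the inverse
map, as all maps commute with right multiplication by `R`. -/
theorem IsUnitriangular.exists_inverse (h : IsUnitriangular w C) : ∃ N : K → K →₀ Base m n,
    (∀ v, colMap C (colMap N v) = v) ∧ ∀ v, colMap N (colMap C v) = v := by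
  choose N hN using fun q => h.bijective.2 (Finsupp.single q 1)
  have h1 : ∀ v, colMap C (colMap N v) = v := by
    have : (colMap C).comp (colMap N) = LinearMap.id := by
      refine Finsupp.lhom_ext fun q r => ?_
      rw [LinearMap.comp_apply, colMap_single, colMap_colMul, hN]
      refine Finsupp.ext fun p => ?_
      classical
      rw [colMul_apply, LinearMap.id_apply, Finsupp.single_apply, Finsupp.single_apply]
      split_ifs
      · rw [one_mul]
      · rw [zero_mul]
    exact fun v => DFunLike.congr_fun this v
  exact ⟨N, h1, fun v => h.bijective.1 (h1 _)⟩

/-- `r` has parity `c`. -/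
def HasParB (c : Bool) (r : Base m n) : Prop := parity r = sgn true c • r

theorem HasParB.mul {c d : Bool} {r r' : Base m n} (h : HasParB c r) (h' : HasParB d r') :
    HasParB (xor c d) (r * r') := by
  rw [HasParB, map_mul, show parity r = _ from h, show parity r' = _ from h', smul_mul_smul_comm]
  cases c <;> cases d <;> simp

/-- The entries of the column have the parities of the labels, shifted by `c`. -/
def HasParCol (ε : K → Bool) (c : Bool) (v : K →₀ Base m n) : Prop := ∀ p, HasParB (xor c (ε p)) (v p)

/-- The parity involution of columns. -/
def colParity (ε : K → Bool) (v : K →₀ Base m n) : K →₀ Base m n :=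
  Finsupp.onFinset v.support (fun p => sgn true (ε p) • parity (v p)) fun p hp => by
    rw [Finsupp.mem_support_iff]
    rintro h0
    exact hp (by rw [h0, map_zero, smul_zero])

theorem colParity_apply (ε : K → Bool) (v : K →₀ Base m n) (p : K) :
    colParity ε v p = sgn true (ε p) • parity (v p) := rfl

theorem hasParCol_iff {ε : K → Bool} {c : Bool} {v : K →₀ Base m n} :
    HasParCol ε c v ↔ colParity ε v = sgn true c • v := by
  rw [Finsupp.ext_iff]
  refine forall_congr' fun p => ?_
  rw [colParity_apply, Finsupp.smul_apply, HasParB]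
  constructor
  · intro h
    rw [h, smul_smul]
    cases c <;> cases ε p <;> simp
  · intro h
    rw [← one_smul ℂ (parity (v p)), ← sgn_mul_self true (ε p), ← smul_smul, h, smul_smul]
    cases c <;> cases ε p <;> simp

theorem colParity_colMap {ε : K → Bool} (hC : ∀ q, HasParCol ε (ε q) (C q)) (v : K →₀ Base m n) :
    colParity ε (colMap C v) = colMap C (colParity ε v) := by
  classical
  refine Finsupp.ext fun p => ?_
  have hsub : (colParity ε v).support ⊆ v.support := Finsupp.support_onFinset_subset
  rw [colParity_apply, colMap_apply, colMap_apply, map_sum, Finset.smul_sum]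
  refine (Finset.sum_subset_zero_on_sdiff hsub ?_ fun q _ => ?_).symm
  · intro q hq
    rw [Finset.mem_sdiff, Finsupp.notMem_support_iff, colParity_apply] at hq
    have h0 : parity (v q) = 0 := (smul_eq_zero.1 hq.2).resolve_left (by
      cases ε q <;> simp)
    rw [map_mul, h0, mul_zero, smul_zero]
  · rw [colParity_apply, map_mul, show parity (C q p) = _ from hC q p, mul_smul_comm, smul_mul_assoc,
      smul_smul]
    congr 1
    cases ε p <;> cases ε q <;> simp

/-- A matrix with homogeneous entries commutes with the parity involution of columns, and by
injectivity the preimage has the parity of its image. -/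
theorem HasParCol.of_colMap {ε : K → Bool} (hC : ∀ q, HasParCol ε (ε q) (C q))
    (hinj : Function.Injective (colMap C)) {c : Bool} {v : K →₀ Base m n}
    (h : HasParCol ε c (colMap C v)) : HasParCol ε c v := by
  rw [hasParCol_iff] at h ⊢
  refine hinj ?_
  rw [← colParity_colMap hC, h, map_smul]

end ColMap

/-! ### The linear part of the closed family -/

section LinPart

/-- The retraction of the inclusion `ofBase`. -/
def toBase : Pol m n →ₐ[ℂ] Base m n :=
  SuperPoly.map
    (MvPolynomial.aeval (Sum.elim (fun i => MvPolynomial.X i) (fun _ => 0)))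
    (ExteriorAlgebra.map (Finsupp.linearCombination ℂ
      (Sum.elim (fun i => Finsupp.single i 1) (fun _ => 0))))

theorem toBase_ofBase (r : Base m n) : toBase (ofBase r) = r := by
  have h : ((toBase : Pol m n →ₐ[ℂ] Base m n).comp ofBase : Base m n →ₐ[ℂ] Base m n) =
      AlgHom.id ℂ _ := by
    refine SuperPoly.algHom_ext ?_ ?_ <;> intro e
    · rw [AlgHom.comp_apply, ofBase_evenGen, toBase, SuperPoly.map_evenGen, MvPolynomial.aeval_X]
      rfl
    · rw [AlgHom.comp_apply, ofBase_oddGen, toBase, SuperPoly.map_oddGen,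
        ExteriorAlgebra.map_apply_ι, Finsupp.linearCombination_single, one_smul]
      rfl
  exact DFunLike.congr_fun h r

/-- The coefficient of `∂_a` in an operator of degree at most one. -/
def lin (a : Idx) : Op m n →ₗ[ℂ] Base m n :=
  toBase.toLinearMap.comp ((LinearMap.applyₗ (1 : Pol m n)).comp (ad (par a) (mulOp (coord a))))

theorem lin_apply (a : Idx) (D : Op m n) :
    lin a D = toBase (ad (par a) (mulOp (coord a)) D 1) := rfl

theorem lin_sc_mul (a : Idx) (r : Base m n) (D : Op m n) : lin a (sc r * D) = r * lin a D := by
  rw [lin_apply, ad_sc_mul (rLin_mulOp _) (hasPar_coord a), Module.End.mul_apply, sc_apply, mulOp_apply,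
    map_mul, toBase_ofBase, lin_apply]

theorem lin_pd (a b : Idx) : lin a (pd b : Op m n) = if b = a then 1 else 0 := by
  rw [lin_apply, ad_coord_pd]
  split_ifs <;> simp

theorem finite_lin {ι : Type} {T : ι → Op m n} (h : PFin T) (a : Idx) :
    (Function.support fun i => lin a (T i)).Finite :=
  (h.ad (par a) (mulOp (coord a)) 1).subset fun i hi hc => hi (by
    show lin a (T i) = 0
    exact (congrArg toBase hc).trans (map_zero _))

theorem lin_psum {ι : Type} {T : ι → Op m n} (h : PFin T) (a : Idx) :
    lin a (psum T) = ∑ᶠ i, lin a (T i) := by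
  have h1 := h.ad (par a) (mulOp (coord a))
  rw [lin_apply, ad_psum h, psum_apply h1, map_finsum toBase (h1 1)]
  rfl

theorem eq_add_psum_lin {D : Op m n} (hD : D ∈ Fil 2) :
    D = mulOp (D 1) + psum fun a => sc (lin a D) * pd a := by
  have h := isCoordSystem_coord.eq_sum_taylor hD
  rw [Finset.sum_range_succ, Finset.sum_range_one] at h
  simp only [Nat.factorial, Nat.cast_one, inv_one, one_smul, mul_one] at h
  have h1 : ∀ a, taylor coord pd 0 (ad (par a) (mulOp (coord a)) D) = sc (lin a D) := fun a => by
    obtain ⟨r, hr⟩ := mem_fil_one.1 (isCoordSystem_coord.ad_mem hD a)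
    rw [lin_apply, hr, mulOp_apply, mul_one, toBase_ofBase]
    show mulOp (mulOp (ofBase r) 1) = mulOp (ofBase r)
    rw [mulOp_apply, mul_one]
  have h2 : taylor coord pd 1 D = psum fun a => sc (lin a D) * pd a :=
    psum_congr fun a => by rw [h1]
  rw [h2] at h
  exact h

theorem hasPar_sc {c : Bool} {r : Base m n} (h : HasParB c r) : HasPar c (sc r : Op m n) := by
  cases c
  · exact hasPar_sc_of_isEven (show parity r = r by simpa [HasParB] using h)
  · exact hasPar_sc_of_isOdd (show parity r = -r by simpa [HasParB] using h)

theorem hasParB_lin {c : Bool} {D : Op m n} (hD : HasPar c D) (a : Idx) :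
    HasParB (xor (par a) c) (lin a D) := by
  have hp : (parity.comp toBase : Pol m n →ₐ[ℂ] Base m n) = toBase.comp parity := by
    refine SuperPoly.algHom_ext ?_ ?_ <;> rintro (e | e) <;>
      simp only [AlgHom.comp_apply, parity_evenGen, parity_oddGen, map_neg] <;>
      simp only [toBase, SuperPoly.map_evenGen, SuperPoly.map_oddGen, MvPolynomial.aeval_X,
        ExteriorAlgebra.map_apply_ι, Finsupp.linearCombination_single, one_smul, Sum.elim_inl,
        Sum.elim_inr, map_zero]
    · exact parity_evenGen e
    · exact (congrArg parity (SuperPoly.zero_tmul _)).trans ((map_zero _).trans (SuperPoly.zero_tmul _).symm)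
    · exact parity_oddGen e
    · show parity (SuperPoly.tmul 1 0 : Base m n) = -SuperPoly.tmul 1 0
      rw [SuperPoly.tmul_zero, map_zero, neg_zero]
  have h1 := DFunLike.congr_fun (((hasPar_coord a).ad hD) true) 1
  rw [twist_apply, twistPol_true, map_one, LinearMap.smul_apply] at h1
  rw [HasParB, lin_apply, show parity (toBase _) = _ from DFunLike.congr_fun hp _, AlgHom.comp_apply, h1,
    map_smul, Bool.xor_comm]

/-- The label of a coordinate different from `θ⁰`. -/
def lab : Bool × ℕ+ → Idx
  | (false, a) => Sum.inl a
  | (true, a) => Sum.inr a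

theorem lab_injective : Function.Injective lab := by
  rintro ⟨b, a⟩ ⟨b', a'⟩ h
  cases b <;> cases b' <;> simp [lab] at h ⊢ <;> exact h

theorem lab_ne_theta0 (p : Bool × ℕ+) : lab p ≠ theta0 := by
  obtain ⟨b, a⟩ := p
  cases b <;> simp [lab, theta0]

theorem par_lab (p : Bool × ℕ+) : par (lab p) = p.1 := by
  obtain ⟨b, a⟩ := p
  cases b <;> rfl

theorem exists_lab {a : Idx} (h : a ≠ theta0) : ∃ p, lab p = a := by
  rcases a with a | a
  · exact ⟨(false, a), rfl⟩
  · exact ⟨(true, ⟨a, Nat.pos_of_ne_zero fun h0 => h (by rw [h0]; rfl)⟩), rfl⟩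

theorem md_eq_pd_lab (b : Bool) (a : ℕ+) : (md b a : Op m n) = pd (lab (b, a)) := by
  have ha : (0 : ℤ) < a := by exact_mod_cast a.pos
  cases b
  · simp only [md]
    rw [if_pos ha]
    congr 2
    exact PNat.coe_injective (by simp)
  · simp only [md]
    rw [if_pos ha]
    rfl

variable {t τ : ℤ → Base m n} {B V φ : ℕ → ℕ → Base m n} {s : ℤ}

/-- The coefficient of `ħ` in the members of the closed family. -/
def linPart (t τ : ℤ → Base m n) (B V φ : ℕ → ℕ → Base m n) (s : ℤ) (p : Bool × ℕ+) : Op m n :=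
  Ser.coeff 1 (hatGen t τ B V φ s p)

theorem linPart_of_isMode {b : Bool} {a : ℕ+} (h : IsMode b a) :
    linPart t τ B V φ s (b, a) = pd (lab (b, a)) := by
  rw [linPart, hatGen_of_isMode h, coeff_mono_same, md_eq_pd_lab]

theorem linPart_of_not_isMode {b : Bool} {a : ℕ+} (h : ¬IsMode b a) :
    linPart t τ B V φ s (b, a) = conjExp (polOp B V φ) (dilDer t τ (vop b (a - s))) := by
  rw [linPart, hatGen_of_not_isMode h, shiftConj, map_add, coeff_mono_same,
    coeff_mono_of_ne (by norm_num), zero_add]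
  rfl

theorem coeff_zero_hatGen (p : Bool × ℕ+) : Ser.coeff 0 (hatGen t τ B V φ s p) = 0 := by
  obtain ⟨b, a⟩ := p
  by_cases h : IsMode b a
  · rw [hatGen_of_isMode h, coeff_mono_of_ne (by norm_num)]
  · rw [hatGen_of_not_isMode h, shiftConj, map_add, coeff_mono_of_ne (by norm_num),
      coeff_mono_of_ne (by norm_num), add_zero]

theorem rowT_mem (h : IsAiryData t τ B V φ s) {i : ℤ} (hi : i < s) : rowT t i ∈ oddFilt m n 1 := by
  rw [rowT]
  split_ifs with ho
  · exact mem_oddFilt_of_body (h.body_t_eq_zero hi ho)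
  · exact Submodule.zero_mem _

theorem rowTau_mem (h : IsAiryData t τ B V φ s) (c : Bool) (k i : ℤ) :
    rowTau τ c k i ∈ oddFilt m n 1 := by
  rw [rowTau]
  split_ifs
  · exact Submodule.smul_mem _ _ (h.dil.odd_τ i).mem_oddFilt
  · exact Submodule.smul_mem _ _ (h.dil.odd_τ i).mem_oddFilt
  · exact Submodule.zero_mem _

open Classical in
/-- The linear part is triangular up to nilpotent elements. -/
theorem IsAiryData.lin_linPart (h : IsAiryData t τ B V φ s) {c : Bool} {a : ℕ+} (hm : ¬IsMode c a)
    {x : Idx} (hx : ∀ l : ℕ+, a < l → x ≠ lab (c, l)) :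
    lin x (linPart t τ B V φ s (c, a)) - (if x = lab (c, a) then t s else 0) ∈ oddFilt m n 1 := by
  have ha : (0 : ℤ) < a := by exact_mod_cast a.pos
  have hp := h.dil.pfin_rowTerm c (a - s)
  have hq := hp.conjExp (polOp B V φ)
  rw [linPart_of_not_isMode hm, h.dil.dilDer_vop (h.isLabel ha hm), conjExp_psum hp, lin_psum hq]
  set y : Base m n := if x = lab (c, a) then t s else 0 with hy
  have hfin2 : (Function.support fun i : ℤ => if i = s then y else 0).Finite :=
    (Set.finite_singleton s).subset fun i hi => by
      by_contra hc
      exact hi (if_neg hc)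
  -- The expected entry is written as a family supported at `i = s`, so that the difference can be
  -- estimated term by term.
  have h1 : y = ∑ᶠ i : ℤ, if i = s then y else 0 := by
    rw [finsum_eq_single _ s fun i hi => if_neg hi, if_pos rfl]
  rw [h1, ← finsum_sub_distrib (finite_lin hq x) hfin2]
  refine finsum_induction (· ∈ oddFilt m n 1) (Submodule.zero_mem _)
    (fun _ _ => Submodule.add_mem _) fun i => ?_
  rw [rowTerm, map_add, h.pol.conjExp_sc_mul, h.pol.conjExp_sc_mul, map_add, lin_sc_mul, lin_sc_mul,
    add_sub_right_comm]
  refine Submodule.add_mem _ ?_ (mul_mem_oddFilt_right (rowTau_mem h c _ i) _)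
  -- Below `s` the coefficient is nilpotent. From `s` on, the mode has index `i + a - s ≥ a > 0`, so
  -- it is a derivative and fixed by conjugation: `i = s` gives the diagonal entry and larger `i`
  -- give labels excluded by the hypothesis on `x`.
  rcases lt_or_ge i s with hi | hi
  · rw [if_neg hi.ne, sub_zero]
    exact mul_mem_oddFilt_right (rowT_mem h hi) _
  · obtain ⟨l, hl⟩ : ∃ l : ℕ+, (l : ℤ) = i + (a - s) :=
      ⟨⟨(i + (a - s)).toNat, by omega⟩, by
        show (((i + (a - s)).toNat : ℕ) : ℤ) = _
        omega⟩
    rw [← hl, h.pol.conjExp_md c (by exact_mod_cast l.pos), md_eq_pd_lab, lin_pd]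
    rcases hi.eq_or_lt with rfl | hi
    · have : l = a := pnat_cast_injective (by
        show (l : ℤ) = a
        omega)
      rw [if_pos rfl, this, hy, rowT, if_pos h.odd]
      by_cases hxa : x = lab (c, a)
      · rw [if_pos hxa, if_pos hxa.symm, mul_one, sub_self]
        exact Submodule.zero_mem _
      · rw [if_neg hxa, if_neg fun hc => hxa hc.symm, mul_zero, sub_zero]
        exact Submodule.zero_mem _
    · have hal : a < l := by
        have : (a : ℤ) < l := by omega
        exact_mod_cast this
      rw [if_neg fun hc => hx l hal hc.symm, if_neg hi.ne', mul_zero, sub_zero]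
      exact Submodule.zero_mem _

open Classical in
/-- The normalisation of the rows of the matrix of the linear part. -/
def nrm (u : Base m n) (p : Bool × ℕ+) : Base m n := if IsMode p.1 p.2 then 1 else u

theorem IsAiryData.pfin_linPart (h : IsAiryData t τ B V φ s) : PFin (linPart t τ B V φ s) :=
  h.isReesFamily_hatGen.hfin 1

/-- The columns of the matrix of the linear part. -/
def linCol (h : IsAiryData t τ B V φ s) (u : Base m n) (x : Idx) : Bool × ℕ+ →₀ Base m n :=
  Finsupp.ofSupportFinite (fun p => nrm u p * lin x (linPart t τ B V φ s p))
    ((finite_lin h.pfin_linPart x).subset fun p hp hc => hp (by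
      dsimp only at hc ⊢
      rw [hc, mul_zero]))

theorem linCol_apply (h : IsAiryData t τ B V φ s) (u : Base m n) (x : Idx) (p : Bool × ℕ+) :
    linCol h u x p = nrm u p * lin x (linPart t τ B V φ s p) := rfl

/-- Rows of modes are unit vectors. In the other rows multiplication by `u` turns the diagonal entry
`t_s` into one, and entries without a nilpotency bound occur only in columns of larger index. -/
theorem isUnitriangular_linCol (h : IsAiryData t τ B V φ s) {u : Base m n} (hu : u * t s = 1) :
    IsUnitriangular (fun p : Bool × ℕ+ => (p.2 : ℕ)) fun q => linCol h u (lab q) := by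
  classical
  rintro ⟨c, a⟩ q hw
  rw [linCol_apply, nrm]
  by_cases hm : IsMode c a
  · rw [if_pos hm, linPart_of_isMode hm, lin_pd, one_mul]
    simp only [lab_injective.eq_iff]
    split_ifs <;> rw [sub_self] <;> exact (oddFilt m n 1).zero_mem
  · rw [if_neg hm]
    have h1 := h.lin_linPart hm (x := lab q) fun l hl hc => hw (by
      rw [lab_injective hc]
      exact hl)
    have h2 := mul_mem_oddFilt_left u h1
    rw [mul_sub, mul_ite, hu, mul_zero] at h2
    simpa only [lab_injective.eq_iff, eq_comm] using h2

/-- The derivative `∂_{θ⁰}` never occurs among the positive modes, so its coefficients only come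
from nilpotent `t_i` or `τ_i`. This is why the distinguished coordinate moves by a nilpotent amount.
-/
theorem linCol_theta0_mem (h : IsAiryData t τ B V φ s) (u : Base m n) (p : Bool × ℕ+) :
    linCol h u theta0 p ∈ oddFilt m n 1 := by
  obtain ⟨c, a⟩ := p
  rw [linCol_apply]
  refine mul_mem_oddFilt_left _ ?_
  by_cases hm : IsMode c a
  · rw [linPart_of_isMode hm, lin_pd, if_neg (lab_ne_theta0 _)]
    exact Submodule.zero_mem _
  · have h1 := h.lin_linPart hm (x := theta0) fun l _ => (lab_ne_theta0 _).symm
    rwa [if_neg (lab_ne_theta0 _).symm, sub_zero] at h1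

theorem hasParB_nrm {u : Base m n} (hu : IsEven u) (p : Bool × ℕ+) : HasParB false (nrm u p) := by
  rw [HasParB, nrm, sgn_false_right, one_smul]
  split_ifs
  · exact map_one _
  · exact hu

theorem hasParCol_linCol (h : IsAiryData t τ B V φ s) {u : Base m n} (hu : IsEven u) (x : Idx) :
    HasParCol Prod.fst (par x) (linCol h u x) := fun p => by
  have := (hasParB_nrm hu p).mul (hasParB_lin (h.hasParH_hatGen p 1) x)
  rwa [Bool.false_xor] at this

end LinPart

/-! ### The normal form of the linear part -/

section NormalForm

variable {t τ : ℤ → Base m n} {B V φ : ℕ → ℕ → Base m n} {s : ℤ}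

theorem isRees_sc (r : Base m n) : IsRees (mono 0 (sc r)) := isRees_mono (d := 0) (sc_mem_fil r)

theorem exists_mul_nrm {u : Base m n} (hu : t s * u = 1) (p : Bool × ℕ+) :
    ∃ d, d * nrm u p = 1 := by
  rw [nrm]
  split_ifs
  · exact ⟨1, mul_one 1⟩
  · exact ⟨t s, hu⟩

/-- The entries of the matrix that brings the linear part into normal form. -/
def normMat (u : Base m n) (N : Bool × ℕ+ → Bool × ℕ+ →₀ Base m n) (p q : Bool × ℕ+) : Ser m n :=
  mono 0 (sc (N q p * nrm u q))

variable {u : Base m n} {N : Bool × ℕ+ → Bool × ℕ+ →₀ Base m n}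

theorem hfin_normMat (q : Bool × ℕ+) : HFin fun p => normMat u N p q :=
  HFin.of_finite ((N q).support.finite_toSet.subset fun p hp => by
    by_contra hc
    exact hp (by
      show mono 0 (sc (N q p * nrm u q)) = 0
      rw [Finsupp.notMem_support_iff.1 hc, zero_mul, map_zero, map_zero]))

/-- If `M` is the matrix of the linear part and `ν` the diagonal normalisation, then `N` inverts `ν
M`, and `M (N ν) = ν⁻¹ (ν M N) ν = 1`. -/
theorem summ_normMat_inverse (h : IsAiryData t τ B V φ s) (hu : t s * u = 1)
    (hN : ∀ v, colMap (fun q => linCol h u (lab q)) (colMap N v) = v) (i j : Bool × ℕ+) :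
    Summ 0 (fun k => mono 0 (sc (lin (lab k) (linPart t τ B V φ s i))) * normMat u N k j)
      (if j = i then 1 else 0) := by
  obtain ⟨d, hd⟩ := exists_mul_nrm (t := t) (s := s) hu i
  have hmul : ∀ k, mono 0 (sc (lin (lab k) (linPart t τ B V φ s i))) * normMat u N k j =
      mono 0 (sc (lin (lab k) (linPart t τ B V φ s i) * (N j k * nrm u j))) := fun k => by
    rw [normMat, mono_mul_mono, ← map_mul, add_zero]
  have h1 := DFunLike.congr_fun (hN (Finsupp.single j 1)) i
  rw [colMap_single, colMul_one, colMap_apply] at h1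
  have h2 : ∑ k ∈ (N j).support, lin (lab k) (linPart t τ B V φ s i) * (N j k * nrm u j) =
      if j = i then 1 else 0 := by
    have : ∀ k, lin (lab k) (linPart t τ B V φ s i) * (N j k * nrm u j) =
        d * (linCol h u (lab k) i * N j k) * nrm u j := fun k => by
      rw [linCol_apply, ← mul_assoc d, ← mul_assoc d, hd, one_mul, mul_assoc]
    simp only [this]
    rw [← Finset.sum_mul, ← Finset.mul_sum, h1, Finsupp.single_apply]
    split_ifs with hji
    · rw [mul_one, hji, hd]
    · rw [mul_zero, zero_mul]
  have h3 := summ_finset (N := 0) (N j).support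
    (T := fun k => mono 0 (sc (lin (lab k) (linPart t τ B V φ s i))) * normMat u N k j)
    (fun k hk => by
      rw [hmul, Finsupp.notMem_support_iff.1 hk, zero_mul, mul_zero, map_zero, map_zero])
    (fun k => by
      rw [hmul]
      exact lb_mono 0 _)
  simp only [hmul] at h3 ⊢
  rw [← map_sum, ← map_sum, h2] at h3
  convert h3 using 1
  split_ifs
  · rw [map_one, mono_one]
  · rw [map_zero, map_zero]

/-- The coefficient of `ħ` in the normal form. -/
theorem lin_normMat (h : IsAiryData t τ B V φ s) (x : Idx) (p : Bool × ℕ+) :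
    lin x (psum fun q => sc (N q p * nrm u q) * linPart t τ B V φ s q) =
      colMap N (linCol h u x) p := by
  rw [lin_psum (h.pfin_linPart.mul_left _), colMap_apply]
  simp only [lin_sc_mul, mul_assoc, ← linCol_apply h u x]
  refine finsum_eq_sum_of_support_subset _ fun q hq => ?_
  by_contra hc
  exact hq (by
    show N q p * linCol h u x q = 0
    rw [Finsupp.notMem_support_iff.1 hc, mul_zero])

theorem eq_normal_form {D : Op m n} (hD : D ∈ Fil 2) {p : Bool × ℕ+}
    (h : ∀ q, lin (lab q) D = if q = p then 1 else 0) :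
    D = pd (lab p) + sc (lin theta0 D) * pd theta0 + mulOp (D 1) := by
  classical
  conv_lhs => rw [eq_add_psum_lin hD, psum_eq_sum {lab p, theta0} fun a ha => by
    simp only [Finset.mem_insert, Finset.mem_singleton, not_or] at ha
    obtain ⟨q, rfl⟩ := exists_lab ha.2
    rw [h, if_neg fun hq => ha.1 (by rw [hq]), map_zero, zero_mul]]
  rw [Finset.sum_pair (lab_ne_theta0 p), h, if_pos rfl,
    show (sc (1 : Base m n) : Op m n) = 1 from map_one sc, one_mul, add_comm]

theorem lspan_of_normMat (h : IsAiryData t τ B V φ s) (hu : t s * u = 1)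
    (hN : ∀ v, colMap (fun q => linCol h u (lab q)) (colMap N v) = v) {H : Bool × ℕ+ → Ser m n}
    (hH : ∀ p, Summ 0 (fun q => normMat u N p q * hatGen t τ B V φ s q) (H p)) :
    lspan H = lspan (hatGen t τ B V φ s) := by
  have hR := h.isReesFamily_hatGen
  have hrees : ∀ p q, IsRees (normMat u N p q) := fun p q => isRees_sc _
  set M : Bool × ℕ+ → Bool × ℕ+ → Ser m n :=
    fun p q => mono 0 (sc (lin (lab q) (linPart t τ B V φ s p))) with hM
  have hMrees : ∀ p q, IsRees (M p q) := fun p q => isRees_sc _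
  have hMfin : ∀ q, HFin fun p => M p q := fun q =>
    HFin.of_finite ((finite_lin h.pfin_linPart (lab q)).subset fun p hp hp0 => hp (by
      show mono 0 (sc (lin (lab q) (linPart t τ B V φ s p))) = 0
      rw [show lin (lab q) (linPart t τ B V φ s p) = 0 from hp0, map_zero, map_zero]))
  have hMH : ∀ p, Summ 0 (fun q => M p q * H q) (hatGen t τ B V φ s p) := fun p =>
    hR.summ_of_inverse hrees hMrees hfin_normMat hH p fun q => by
      convert summ_normMat_inverse h hu hN p q
  exact (hR.lspan_le hrees hfin_normMat hH).antisymm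
    ((hR.of_combination hrees hfin_normMat hH).lspan_le hMrees hMfin hMH)

/-- The closed family can be replaced by a family in normal form. -/
theorem IsAiryData.exists_normal_form (h : IsAiryData t τ B V φ s) :
    ∃ (H : Bool × ℕ+ → Ser m n) (c : Bool × ℕ+ →₀ Base m n), IsReesFamily H ∧
      lspan H = lspan (hatGen t τ B V φ s) ∧ (∀ p, HasParH p.1 (H p)) ∧
      (∀ p, Ser.coeff 0 (H p) = 0) ∧
      (∀ p, ∃ f ∈ degLE (m := m) (n := n) 1,
        Ser.coeff 1 (H p) = pd (lab p) + sc (c p) * pd theta0 + mulOp f) ∧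
      (∀ p, IsNilpotent (c p)) ∧ HasParCol Prod.fst true c := by
  obtain ⟨⟨_, u, hu, hu'⟩, rfl⟩ := h.isUnit
  -- The parity involution maps an inverse of the even element `t s` to an inverse of it.
  have hev : IsEven u := by
    have h1 := h.dil.even_t s
    have h2 := congrArg parity hu
    rw [map_mul, map_one, show parity (t s) = t s from h1] at h2
    calc parity u = u * t s * parity u := by rw [hu', one_mul]
      _ = u := by rw [mul_assoc, h2, mul_one]
  have hC := isUnitriangular_linCol h hu'
  have hinj := hC.bijective.1
  obtain ⟨N, hN, hN'⟩ := hC.exists_inverse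
  have hCpar : ∀ q, HasParCol Prod.fst q.1 (linCol h u (lab q)) := fun q => by
    have := hasParCol_linCol h hev (lab q)
    rwa [par_lab] at this
  -- The columns of `N` are preimages of unit vectors under a matrix with homogeneous entries.
  have hNpar : ∀ q, HasParCol Prod.fst q.1 (N q) := fun q => by
    classical
    refine HasParCol.of_colMap hCpar hinj ?_
    have h1 := hN (Finsupp.single q 1)
    rw [colMap_single, colMul_one] at h1
    rw [h1]
    intro p
    rw [Finsupp.single_apply, HasParB]
    split_ifs with hqp
    · rw [hqp, Bool.xor_self, map_one, sgn_false_right, one_smul]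
    · rw [map_zero, smul_zero]
  -- After inversion of the block of the labels other than `θ⁰`, the column of `θ⁰` becomes the
  -- vector of coefficients of `∂_{θ⁰}`. It inherits nilpotency and parity from that column.
  set c := colMap N (linCol h u theta0) with hc
  have hcC : colMap (fun q => linCol h u (lab q)) c = linCol h u theta0 := hN _
  have hR := h.isReesFamily_hatGen
  have hrees : ∀ p q, IsRees (normMat u N p q) := fun p q => isRees_sc _
  choose H hH using fun p => hR.exists_summ (hrees p)
  have hcoeff : ∀ k p, Ser.coeff k (H p) =
      psum fun q => sc (N q p * nrm u q) * Ser.coeff k (hatGen t τ B V φ s q) := fun k p => by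
    rw [(hH p).coeff_eq]
    refine psum_congr fun q => ?_
    rw [normMat, coeff_mono_mul, sub_zero]
  have hR' := hR.of_combination hrees hfin_normMat hH
  have hlin : ∀ x p, lin x (Ser.coeff 1 (H p)) = colMap N (linCol h u x) p := fun x p => by
    rw [hcoeff]
    exact lin_normMat h x p
  refine ⟨H, c, hR', ?_, fun p => ?_, fun p => ?_, fun p => ?_, fun p => ?_, ?_⟩
  · exact lspan_of_normMat h hu hN hH
  · refine HasParH.summ (hH p) fun q => ?_
    have h1 := hasParH_mono (hasPar_sc ((hNpar q p).mul (hasParB_nrm hev q))) 0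
    have h2 := h1.mul (h.hasParH_hatGen q)
    have : xor (xor (xor q.1 p.1) false) q.1 = p.1 := by
      cases q.1 <;> cases p.1 <;> rfl
    rwa [this] at h2
  · rw [hcoeff, ← psum_zero]
    exact psum_congr fun q => by rw [coeff_zero_hatGen, mul_zero]
  · have hD : Ser.coeff 1 (H p) ∈ Fil 2 := (hR'.rees p).2 1
    refine ⟨_, apply_one_mem_degLE hD, ?_⟩
    have h1 := eq_normal_form hD (p := p) fun q => by
      have h2 := hN' (Finsupp.single q 1)
      rw [colMap_single, colMul_one] at h2
      rw [hlin, h2, Finsupp.single_apply]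
    rwa [hlin theta0 p] at h1
  · exact isNilpotent_of_mem_oddFilt (colMap_mem_oddFilt (linCol_theta0_mem h u) p)
  · refine HasParCol.of_colMap hCpar hinj ?_
    rw [hcC]
    exact hasParCol_linCol h hev theta0

/-- The labels of the coordinates different from `θ⁰`. -/
def labEquiv : {j : Idx // j ≠ theta0} ≃ Bool × ℕ+ :=
  (Equiv.ofBijective (fun p => (⟨lab p, lab_ne_theta0 p⟩ : {j : Idx // j ≠ theta0}))
    ⟨fun _ _ h => lab_injective (congrArg Subtype.val h), fun j =>
      (exists_lab j.2).imp fun _ h => Subtype.ext h⟩).symm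

theorem lab_labEquiv (j : {j : Idx // j ≠ theta0}) : lab (labEquiv j) = j :=
  congrArg Subtype.val (labEquiv.symm_apply_apply j)

theorem IsAiryData.isBounded_generators (h : IsAiryData t τ B V φ s) :
    IsBounded pd (generators t τ B V φ s) := by
  have h1 := (h.isReesFamily_gen.1.comp_equiv genEquiv).isBounded isCoordSystem_coord
  rwa [← funext h.generators_eq] at h1

theorem IsAiryData.leftSpan_generators (h : IsAiryData t τ B V φ s) :
    leftSpan (generators t τ B V φ s) = lspan (hatGen t τ B V φ s) := by
  rw [funext h.generators_eq, (h.isReesFamily_gen.1.comp_equiv genEquiv).leftSpan_eq,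
    lspan_comp_equiv, h.isReesFamily_gen.2]

/-- Three families generate the same left ideal: the given one, the closed one, which shows closure
under brackets, and the one in normal form, whose linear parts are the derivatives of the shifted
coordinates up to multiplications. -/
theorem IsAiryData.exists_isSuperAiryStructure (h : IsAiryData t τ B V φ s) :
    ∃ c : Idx →₀ Base m n, (∀ a, IsNilpotent (c a)) ∧
      (∀ k, IsOdd (c (Sum.inl k))) ∧ (∀ k, IsEven (c (Sum.inr k))) ∧
      IsSuperAiryStructure (shiftedPd c) theta0 (leftSpan (generators t τ B V φ s)) := by
  obtain ⟨H, cK, hR, hspan, hpar, h0, h1, hnil, hcpar⟩ := h.exists_normal_form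
  set c : Idx →₀ Base m n := Finsupp.embDomain ⟨lab, lab_injective⟩ cK with hc
  have hlab : ∀ p, c (lab p) = cK p := Finsupp.embDomain_apply_self _ _
  have htheta : c theta0 = 0 := Finsupp.embDomain_of_notMem_range _ _ _ (by
    rintro ⟨p, hp⟩
    exact lab_ne_theta0 p hp)
  have hodd : ∀ k, IsOdd (c (Sum.inl k)) := fun k => by
    have := hcpar (false, k)
    rw [show c (Sum.inl k) = _ from hlab (false, k)]
    show parity _ = _
    simpa [HasParB] using this
  have heven : ∀ k, IsEven (c (Sum.inr k)) := fun k => by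
    by_cases hk : Sum.inr k = theta0
    · rw [hk, htheta]
      exact map_zero _
    · obtain ⟨⟨b, a⟩, hp⟩ := exists_lab hk
      have := hcpar (b, a)
      rw [← hp, hlab]
      cases b
      · cases hp
      · show parity _ = _
        simpa [HasParB] using this
  refine ⟨c, fun a => ?_, hodd, heven, ?_⟩
  · by_cases ha : a = theta0
    · rw [ha, htheta]
      exact IsNilpotent.zero
    · obtain ⟨p, rfl⟩ := exists_lab ha
      rw [hlab]
      exact hnil p
  have hcl := h.isClosedFamily_hatGen
  have hRe := hR.comp_equiv labEquiv
  rw [h.leftSpan_generators]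
  exact
    { subset := fun X hX => mem_reesWeyl_iff.2 (hcl.isRees_of_mem hX)
      zero_mem := zero_mem_lspan _
      sum_mem := fun X hX Y hY => add_mem_lspan hX hY
      mul_mem := fun a ha X hX => mul_mem_lspan (mem_reesWeyl_iff.1 ha) hX
      exists_generators := by
        refine ⟨fun j => H (labEquiv j), fun j => (hpar _).isHomogeneous,
          hRe.isBounded (isCoordSystem_shifted hodd heven), ?_, fun j => ⟨h0 _, ?_⟩⟩
        · rw [hRe.leftSpan_eq, lspan_comp_equiv, hspan]
        · obtain ⟨f, hf, hD⟩ := h1 (labEquiv j)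
          refine ⟨f, hf, hD.trans ?_⟩
          rw [shiftedPd, if_neg j.2, ← hlab, lab_labEquiv, sc_apply]
      comm_mem := fun X hX Y hY => ⟨rbracket X Y, hcl.rbracket_mem hX hY, by
        exact (superComm_eq X Y).trans (mono_mul_rbracket X Y).symm⟩ }

end NormalForm

end SuperAiry
end

open SuperAiry in
theorem mainTheorem4 (m n : ℕ)
    (t τ : ℤ → Base m n) (B V φ : ℕ → ℕ → Base m n)
    (ht : ∀ k, IsEven (t k)) (hτ : ∀ k, IsOdd (τ k))
    (hB : ∀ k l, IsEven (B k l)) (hV : ∀ k l, IsEven (V k l)) (hφ : ∀ k l, IsOdd (φ k l))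
    (htτ : ∃ N : ℤ, ∀ k < N, t k = 0 ∧ τ k = 0)
    (ht0 : t 0 = 0)
    (hB0 : ∀ k, B k 0 = 0 ∧ B 0 k = 0) (hφ0 : ∀ k, φ 0 k = 0) (hV0 : V 0 0 = 0)
    (hBsymm : ∀ k l, B k l = B l k) (hVskew : ∀ k l, V k l = -V l k)
    (s : ℤ) (hs : IsLeast {k : ℤ | Odd k ∧ IsUnit (t k)} s) (hs13 : s = 1 ∨ s = 3)
    (hlinear : ((omega01 t τ).plus (omega01 t τ).pullSigma).IsBigO 1)
    (hquadratic : (twistedCasimir (boxTimes (omega01 t τ) (omega01 t τ))).IsBigO s) :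
    IsBounded pd (generators t τ B V φ s) ∧
      ∃ c : Idx →₀ Base m n,
        (∀ a, IsNilpotent (c a)) ∧
        (∀ k, IsOdd (c (Sum.inl k))) ∧ (∀ k, IsEven (c (Sum.inr k))) ∧
        IsSuperAiryStructure (shiftedPd c) theta0 (leftSpan (generators t τ B V φ s)) := by
  have h : IsAiryData t τ B V φ s :=
    { pol := ⟨hB, hV, hφ, hV0⟩
      dil := ⟨ht, hτ, htτ, ht0⟩
      hs := hs13
      linear := hlinear
      quadratic := hquadratic
      isUnit := hs.1.2 }
  exact ⟨h.isBounded_generators, h.exists_isSuperAiryStructure⟩
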